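/- Let $\mathbb K$ be a field, $\Gamma$ a finite set and $\mathbf k=\bigoplus_{v\in\Gamma}\mathbb K e_v$, with $e_v^2=e_v$ and $e_ve_w=0$ for $v\neq w$. Graded $\mathbf k$-bimodules are $\mathbb Z$-graded (cohomologically) with $\mathbb K$ acting centrally. Let $\mathscr C=\bigoplus_{i\le 0}\mathscr C^i$ be a graded $\mathbf k$-bimodule such that every $\mathscr C^i$ is a finitely generated $\mathbf k$-bimodule, $\mathscr C^0\cong\mathbf k$ and $\mathscr C^{-1}=0$ (that is, $\mathscr C$ is locally finite and simply connected). Suppose that $\mathscr C$ carries the structure of an $A_\infty$-coalgebra over $\mathbf k$, with operations $\Delta_i\colon\mathscr C\to\mathscr C^{\otimes_{\mathbf k} i}[2-i]$, $i\ge1$, of which for each $c\in\mathscr C$ only finitely many do not vanish on $c$ and which satisfy $$\sum_{i=1}^{d}\sum_{j=0}^{d-i}\big(\mathbf 1^{\otimes(d-i-j)}\otimes\Delta_i\otimes\mathbf 1^{\otimes j}\big)\Delta_{d-i+1}=0,\qquad d\ge 1,$$ where applying $\Delta_i$ to the factor $c_{j+1}$ of $c_{d-i+1}\otimes\cdots\otimes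 c_1$ produces the sign $(-1)^{|c_1|+\cdots+|c_j|-j}$. Suppose that it is strictly counital, with counit $\varepsilon\colon\mathscr C\to\mathbf k$ of degree $0$ (so that $(\mathbf 1\otimes\varepsilon)\Delta_2(c)=c$, $(\varepsilon\otimes\mathbf 1)\Delta_2(c)=(-1)^{|c|}c$, and $\varepsilon$ annihilates every tensor factor of $\Delta_i$ for $i\ne2$), and strictly coaugmented by the map $\eta\colon\mathbf k\cong\mathscr C^0\to\mathscr C$ (so that $\Delta_2\eta(e_v)=\eta(e_v)\otimes\eta(e_v)$, $\Delta_i\eta=0$ for $i\neq2$, and $\varepsilon\eta=\mathrm{id}$). Let $\mathscr A=\Omega\mathscr C=\mathbf k\oplus\bigoplus_{r\ge1}(\overline{\mathscr C}[-1])^{\otimes_{\mathbf k} r}$, with $\overline{\mathscr C}=\mathrm{coker}(\eta)$, be the cobar construction: its product is concatenation (up to the sign $\mathfrak m_2(x,y)=(-1)^{|y|}xy$), its differential $\mathfrak m_1$ is the derivation that extends $\sum_i\Delta_i$, and its augmentation is the projection to $\mathbf k$. Let $E(\mathscr A)=\mathrm{RHom}_{\mathscr A}(\mathbf k,\mathbf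 k)$, computed by $A_\infty$-module maps between left $\mathscr A$-modules, i.e. the graded dual $(\mathrm B\mathscr A)^\#$ of the reduced bar construction; and let $\mathscr C^\#$ be the graded dual of $\mathscr C$, with the dual operations $\mathfrak m_i(a_i,\dots,a_1)(c)=(-1)^{|c|}(a_i\otimes\cdots\otimes a_1)(\Delta_i c)$, where $(a_i\otimes\cdots\otimes a_1)(c_1\otimes\cdots\otimes c_i)=a_1(c_1\,a_2(c_2\cdots a_i(c_i)\cdots))$. Then: 1. $\mathscr A$ is an augmented DG-algebra over $\mathbf k$ and it is connected: $\mathscr A^i=0$ for $i>0$ and $\mathscr A^0=\mathbf k$. 2. $E(\mathscr A)\cong\mathscr C^\#$: there is a strictly unital, strictly augmented $A_\infty$-quasi-isomorphism $\mathscr C^\#\to E(\mathscr A)$. 3. $\mathscr A$ and $\mathscr C^\#$ are Koszul dual: the natural map $\Phi\colon\mathscr A\to\mathrm{RHom}_{E(\mathscr A)}(\mathbf k,\mathbf k)$ is a quasi-isomorphism. Here $\mathbf k$ is a right $E(\mathscr A)$-module through the augmentation of $E(\mathscr A)$, and $\Phi$ is given by viewing this module as $\mathrm{RHom}_{\mathscr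 A}(\mathscr A,\mathbf k)$, on which $\mathscr A$ acts from the left by $(a\cdot f)(b)=f(ba)$. Explicitly, let $y\colon\mathrm{RHom}_{\mathscr A}(\mathscr A,\mathbf k)\to\mathbf k$ be the map of right $E(\mathscr A)$-modules that evaluates the length-zero component of an $A_\infty$-module map at $1\in\mathscr A$. Then in $$\mathscr A\longrightarrow\mathrm{RHom}_{E(\mathscr A)}(\mathrm{RHom}_{\mathscr A}(\mathscr A,\mathbf k),\mathbf k)\longleftarrow\mathrm{RHom}_{E(\mathscr A)}(\mathbf k,\mathbf k),$$ where the left map is $a\mapsto(f\mapsto y(a\cdot f))$ and the right map is composition with $y$, both maps are quasi-isomorphisms, and $\Phi$ is the left map followed by the inverse of the right one. -/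

import Mathlib

/-!
Conventions.  `K` is a field, `Γ` a finite set and `k = ⨁_{v ∈ Γ} K e_v`.  A `k`-bimodule `M` (with
`K` acting centrally) is the same thing as the family of its Peirce components `e_v M e_w`;
bimodule maps are families of `K`-linear maps, and
`e_v (M ⊗_k N) e_w = ⨁_u (e_v M e_u) ⊗_K (e_u N e_w)`.  All graded `k`-bimodules below are written
in this way.  Gradings are cohomological and all signs are counted from the right.
-/

universe u

open scoped TensorProduct DirectSum

namespace Koszul

noncomputable section

open scoped Classical

/-- A `ℤ`-graded `k`-bimodule: `X n v w` is the component `e_v M^n e_w`. -/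
structure GBimod (K : Type u) [Field K] (Γ : Type u) where
  X : ℤ → Γ → Γ → Type u
  [acg : ∀ n v w, AddCommGroup (X n v w)]
  [mod : ∀ n v w, Module K (X n v w)]

attribute [instance] GBimod.acg GBimod.mod

/-- The sign `(-1)^n` as a scalar. -/
def sgn (K : Type u) [Field K] (n : ℤ) : K := (-1 : K) ^ n

/-! ### Graded pieces of a direct sum -/

section Piece

variable {K : Type u} [Field K] {ι : Type u} (V : ι → Type u) [∀ i, AddCommGroup (V i)]
  [∀ i, Module K (V i)] (deg : ι → ℤ)

/-- The degree `n` part of `⨁ i, V i`, where the summand `V i` is placed in degree `deg i`. -/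
abbrev Piece (n : ℤ) : Type u := ⨁ i : {i : ι // deg i = n}, V i.1

variable (K)

/-- Inclusion of the degree `n` part. -/
def Piece.incl (n : ℤ) : Piece V deg n →ₗ[K] ⨁ i, V i :=
  DirectSum.toModule K {i : ι // deg i = n} (⨁ i, V i) (fun i => DirectSum.lof K ι V i.1)

/-- Projection to the degree `n` part. -/
def Piece.proj (n : ℤ) : (⨁ i, V i) →ₗ[K] Piece V deg n :=
  DirectSum.toModule K ι (Piece V deg n) (fun i =>
    if h : deg i = n then
      DirectSum.lof K {i : ι // deg i = n} (fun i => V i.1) ⟨i, h⟩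
    else 0)

end Piece

/-! ### Words -/

/-- Shapes of words from `v` to `w`.  The shape of `x_r ⊗ ⋯ ⊗ x_1 ∈ M ⊗_k ⋯ ⊗_k M`, where the letter
`x_i` lies in `e_{v_i} M^{n_i} e_{v_{i-1}}`, is the list of the pairs `(v_i, n_i)` and of `v_0`;
`cons v n p` adds a leftmost letter of degree `n` from `v` to the start of `p`. -/
inductive Wd (Γ : Type u) : Γ → Γ → Type u
  | nil (v : Γ) : Wd Γ v v
  | cons (v : Γ) (n : ℤ) {u w : Γ} (p : Wd Γ u w) : Wd Γ v w

namespace Wd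

variable {Γ : Type u}

/-- The number of letters. -/
def length : {v w : Γ} → Wd Γ v w → ℕ
  | _, _, nil _ => 0
  | _, _, cons _ _ p => length p + 1

/-- The total degree when the degree of each letter is shifted by `c`. -/
def deg (c : ℤ) : {v w : Γ} → Wd Γ v w → ℤ
  | _, _, nil _ => 0
  | _, _, cons _ n p => (n + c) + deg c p

/-- Concatenation. -/
def append : {v u w : Γ} → Wd Γ v u → Wd Γ u w → Wd Γ v w
  | _, _, _, nil _, q => q
  | _, _, _, cons v n p, q => cons v n (append p q)

/-- `revAux p q` is the reversal of `p`, with the degrees negated, followed by `q`. -/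
def revAux : {v w z : Γ} → Wd Γ v w → Wd Γ v z → Wd Γ w z
  | _, _, _, nil _, q => q
  | _, _, _, cons v n (u := u) p, q => revAux p (cons u (-n) q)

/-- The shape of the words that pair with words of shape `p` of the dual. -/
abbrev rev {v w : Γ} (p : Wd Γ v w) : Wd Γ w v := revAux p (nil v)

/-- A one-letter shape. -/
abbrev one (v : Γ) (n : ℤ) (w : Γ) : Wd Γ v w := cons v n (nil w)

/-- A two-letter shape. -/
abbrev two (v : Γ) (n : ℤ) (u : Γ) (m : ℤ) (w : Γ) : Wd Γ v w := cons v n (one u m w)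

end Wd

section Words

variable {K : Type u} [Field K] {Γ : Type u}

/-- The tensor product over `K` of the components of `M` prescribed by a shape. -/
def tensAux (M : GBimod K Γ) : {v w : Γ} → Wd Γ v w → ModuleCat.{u} K
  | _, _, .nil _ => ModuleCat.of K K
  | _, _, .cons v n (u := u) p => ModuleCat.of K (M.X n v u ⊗[K] (tensAux M p))

/-- The words of shape `p` with letters in `M`. -/
def Tens (M : GBimod K Γ) {v w : Γ} (p : Wd Γ v w) : Type u := tensAux M p

instance (M : GBimod K Γ) {v w : Γ} (p : Wd Γ v w) : AddCommGroup (Tens M p) :=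
  inferInstanceAs (AddCommGroup (tensAux M p))

instance (M : GBimod K Γ) {v w : Γ} (p : Wd Γ v w) : Module K (Tens M p) :=
  inferInstanceAs (Module K (tensAux M p))

namespace Tens

variable (M : GBimod K Γ) {Q : Type u} [AddCommMonoid Q] [Module K Q]

/-- The words without letters form a copy of `K`. -/
def nilEquiv (v : Γ) : K ≃ₗ[K] Tens M (.nil v) := LinearEquiv.refl K K

/-- A word with at least one letter is a tensor of a letter and a word. -/
def consEquiv (v : Γ) (n : ℤ) {u w : Γ} (p : Wd Γ u w) :
    (M.X n v u ⊗[K] Tens M p) ≃ₗ[K] Tens M (.cons v n p) :=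
  LinearEquiv.refl K (M.X n v u ⊗[K] Tens M p)

/-- `x ⊗ t` as a word. -/
def cons (v : Γ) (n : ℤ) {u w : Γ} (p : Wd Γ u w) :
    M.X n v u →ₗ[K] Tens M p →ₗ[K] Tens M (.cons v n p) :=
  (TensorProduct.mk K (M.X n v u) (Tens M p)).compr₂ (consEquiv M v n p).toLinearMap

variable {M}

/-- Linear maps out of words with at least one letter. -/
def lift {v : Γ} {n : ℤ} {u w : Γ} {p : Wd Γ u w}
    (f : M.X n v u →ₗ[K] Tens M p →ₗ[K] Q) : Tens M (.cons v n p) →ₗ[K] Q :=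
  (TensorProduct.lift f).comp (consEquiv M v n p).symm.toLinearMap

/-- Linear maps out of words without letters. -/
def nilLift (v : Γ) (x : Q) : Tens M (.nil v) →ₗ[K] Q :=
  (LinearMap.toSpanSingleton K Q x).comp (nilEquiv M v).symm.toLinearMap

variable (M)

/-- The word with a single letter `x`. -/
def letter (v : Γ) (n : ℤ) (w : Γ) : M.X n v w →ₗ[K] Tens M (.one v n w) :=
  (cons M v n (.nil w)).flip (nilEquiv M w 1)

variable {M}

/-- The map induced on words by a map of graded bimodules. -/
def map {N : GBimod K Γ} (f : ∀ n v w, M.X n v w →ₗ[K] N.X n v w) :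
    {v w : Γ} → (p : Wd Γ v w) → Tens M p →ₗ[K] Tens N p
  | _, _, .nil v => nilLift v (nilEquiv N v 1)
  | _, _, .cons v n (u := u) p => lift ((cons N v n p).compl₁₂ (f n v u) (map f p))

variable (M)

/-- Concatenation of words of given shapes. -/
def concat : {v u w : Γ} → (p : Wd Γ v u) → (q : Wd Γ u w) →
    Tens M p →ₗ[K] Tens M q →ₗ[K] Tens M (p.append q)
  | _, _, _, .nil v, q => nilLift v (LinearMap.id : Tens M q →ₗ[K] Tens M q)
  | _, _, _, .cons v n p, q =>
      lift (((LinearMap.llcomp K (Tens M q) (Tens M (p.append q))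
        (Tens M (.cons v n (p.append q)))).comp (cons M v n (p.append q))).compl₂ (concat p q))

variable {M}

/-- The letter of a one-letter word. -/
def unletter (v : Γ) (n : ℤ) (w : Γ) : Tens M (.one v n w) →ₗ[K] M.X n v w :=
  lift ((LinearMap.lsmul K (M.X n v w)).flip.compl₂ (nilEquiv M w).symm.toLinearMap)

end Tens

/-- The component `e_v T_k(M) e_w` of the tensor algebra: the direct sum of all words from `v` to
`w`; the words with `r` letters form `e_v (M ⊗_k ⋯ ⊗_k M) e_w` (`r` factors). -/
abbrev Words (M : GBimod K Γ) (v w : Γ) : Type u := ⨁ p : Wd Γ v w, Tens M p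

namespace Words

variable (M : GBimod K Γ) {Q : Type u} [AddCommMonoid Q] [Module K Q]

/-- Words of shape `p` as elements of the tensor algebra. -/
def of {v w : Γ} (p : Wd Γ v w) : Tens M p →ₗ[K] Words M v w :=
  DirectSum.lof K (Wd Γ v w) (fun p => Tens M p) p

variable {M}

/-- Linear maps out of the tensor algebra. -/
def lift {v w : Γ} (f : ∀ p : Wd Γ v w, Tens M p →ₗ[K] Q) : Words M v w →ₗ[K] Q :=
  DirectSum.toModule K (Wd Γ v w) Q f

variable (M)

/-- The unit `e_v` of the tensor algebra if `v = w`, and `0` otherwise. -/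
def unit (v w : Γ) : Words M v w :=
  if h : v = w then h ▸ of M (.nil v) (Tens.nilEquiv M v 1) else 0

/-- The projection to words without letters. -/
def counit (v w : Γ) : Words M v w →ₗ[K] K :=
  lift (fun p => match p with
    | .nil v => (Tens.nilEquiv M v).symm.toLinearMap
    | .cons _ _ _ => 0)

/-- The projection to words with `r` letters. -/
def lenProj (r : ℕ) (v w : Γ) : Words M v w →ₗ[K] Words M v w :=
  lift (fun p => if p.length = r then of M p else 0)

/-- Multiplication of a word by a letter from the left. -/
def prepend (v : Γ) (n : ℤ) (u w : Γ) : M.X n v u →ₗ[K] Words M u w →ₗ[K] Words M v w :=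
  (lift (fun p => ((Tens.cons M v n p).compr₂ (of M (.cons v n p))).flip)).flip

/-- Concatenation. -/
def concat (v u w : Γ) : Words M v u →ₗ[K] Words M u w →ₗ[K] Words M v w :=
  lift (fun p => (lift (fun q => ((Tens.concat M p q).compr₂ (of M (p.append q))).flip)).flip)

/-- The map of tensor algebras induced by a map of graded bimodules. -/
def map {M N : GBimod K Γ} (f : ∀ n v w, M.X n v w →ₗ[K] N.X n v w) (v w : Γ) :
    Words M v w →ₗ[K] Words N v w :=
  lift (fun p => (of N p).comp (Tens.map f p))

end Words

/-- Positions at which words from `v` to `w` can be cut in two. -/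
abbrev Cut (Γ : Type u) (v w : Γ) : Type u := Σ u : Γ, Wd Γ v u × Wd Γ u w

/-- The target of deconcatenation. -/
abbrev Cuts (M : GBimod K Γ) (v w : Γ) : Type u :=
  ⨁ s : Cut Γ v w, (Tens M s.2.1 ⊗[K] Tens M s.2.2)

/-- A pair of words as an element of `Cuts`. -/
def Cuts.of (M : GBimod K Γ) {v u w : Γ} (p : Wd Γ v u) (q : Wd Γ u w) :
    (Tens M p ⊗[K] Tens M q) →ₗ[K] Cuts M v w :=
  DirectSum.lof K (Cut Γ v w) (fun s => Tens M s.2.1 ⊗[K] Tens M s.2.2) ⟨u, p, q⟩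

/-- Linear maps out of `Cuts`. -/
def Cuts.lift {M : GBimod K Γ} {v w : Γ} {Q : Type u} [AddCommMonoid Q] [Module K Q]
    (f : ∀ (u : Γ) (p : Wd Γ v u) (q : Wd Γ u w), (Tens M p ⊗[K] Tens M q) →ₗ[K] Q) :
    Cuts M v w →ₗ[K] Q :=
  DirectSum.toModule K (Cut Γ v w) Q (fun s => f s.1 s.2.1 s.2.2)

/-- Linear maps out of `Cuts` that only see the cuts at the vertex `u`. -/
def Cuts.liftAt {M : GBimod K Γ} {v w : Γ} (u : Γ) {Q : Type u} [AddCommMonoid Q] [Module K Q]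
    (f : ∀ (p : Wd Γ v u) (q : Wd Γ u w), (Tens M p ⊗[K] Tens M q) →ₗ[K] Q) :
    Cuts M v w →ₗ[K] Q :=
  Cuts.lift (fun z p q => if h : z = u then (by subst h; exact f p q) else 0)

/-- Deconcatenation: the sum of all `(x_r ⊗ ⋯ ⊗ x_{i+1}) ⊗ (x_i ⊗ ⋯ ⊗ x_1)` for `0 ≤ i ≤ r`,
without signs. -/
def split (M : GBimod K Γ) : {v w : Γ} → (p : Wd Γ v w) → Tens M p →ₗ[K] Cuts M v w
  | _, _, .nil v =>
      (Cuts.of M (.nil v) (.nil v)).comp (TensorProduct.mk K _ _ (Tens.nilEquiv M v 1))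
  | _, _, .cons v n p =>
      (Cuts.of M (.nil v) (.cons v n p)).comp (TensorProduct.mk K _ _ (Tens.nilEquiv M v 1)) +
      Tens.lift ((Cuts.lift (fun _ q r =>
        (TensorProduct.curry ((Cuts.of M (.cons v n q) r).comp
          ((LinearMap.rTensor (Tens M r) (Tens.consEquiv M v n q).toLinearMap).comp
            (TensorProduct.assoc K _ _ _).symm.toLinearMap))).flip)).flip.compl₂ (split M p))

/-- The derivation of the tensor algebra that extends `δ : M → T_k(M)`:
`[x_r|⋯|x_1] ↦ ∑_i (-1)^{(|x_1|+1) + ⋯ + (|x_{i-1}|+1)} [x_r|⋯|x_{i+1}|δ(x_i)|x_{i-1}|⋯|x_1]`. -/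
def cobarD (M : GBimod K Γ) (δ : ∀ n v w, M.X n v w →ₗ[K] Words M v w) :
    {v w : Γ} → (p : Wd Γ v w) → Tens M p →ₗ[K] Words M v w
  | _, _, .nil _ => 0
  | _, w, .cons v n (u := u) p =>
      Tens.lift ((Words.prepend M v n u w).compl₂ (cobarD M δ p) +
        sgn K (p.deg 1) • (Words.concat M v u w).compl₁₂ (δ n v u) (Words.of M p))

/-- The terms of the bar differential in which `μ` is applied to the left part `p` of a word that
is cut into `p` and `q`; only nonempty `p` contribute. -/
def barHead (M : GBimod K Γ) (μ : ∀ {v w} (p : Wd Γ v w) (n : ℤ), Tens M p →ₗ[K] M.X n v w)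
    {v u w : Γ} (p : Wd Γ v u) (q : Wd Γ u w) : (Tens M p ⊗[K] Tens M q) →ₗ[K] Words M v w :=
  if p.length = 0 then 0
  else sgn K (q.deg (-1)) • (Words.of M (.cons v (p.deg (-1) + 2) q)).comp
    ((Tens.consEquiv M v (p.deg (-1) + 2) q).toLinearMap.comp
      (LinearMap.rTensor (Tens M q) (μ p (p.deg (-1) + 2))))

/-- The coderivation with components `μ_i : M^{⊗ i} → M[2-i]`, `i ≥ 1`:
`[x_r|⋯|x_1] ↦ ∑_{i,j} (-1)^{|x_1|+⋯+|x_j|-j} [x_r|⋯|μ_i(x_{j+i},…,x_{j+1})|x_j|⋯|x_1]`. -/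
def barB (M : GBimod K Γ) (μ : ∀ {v w} (p : Wd Γ v w) (n : ℤ), Tens M p →ₗ[K] M.X n v w) :
    {v w : Γ} → (p : Wd Γ v w) → Tens M p →ₗ[K] Words M v w
  | _, _, .nil _ => 0
  | _, w, .cons v n (u := u) p =>
      Tens.lift ((Words.prepend M v n u w).compl₂ (barB M μ p)) +
        (Cuts.lift (fun _ q r => barHead M μ q r)).comp (split M (.cons v n p))

/-- The graded bimodule `T_k(M)` with the degree of every letter shifted by `c`. -/
abbrev wordsGr (M : GBimod K Γ) (c : ℤ) : GBimod K Γ where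
  X n v w := Piece (fun p : Wd Γ v w => Tens M p) (fun p => p.deg c) n

/-- Inclusion of the degree `n` words. -/
def wIncl (M : GBimod K Γ) (c n : ℤ) (v w : Γ) : (wordsGr M c).X n v w →ₗ[K] Words M v w :=
  Piece.incl K (fun p : Wd Γ v w => Tens M p) (fun p => p.deg c) n

/-- Projection to the degree `n` words. -/
def wProj (M : GBimod K Γ) (c n : ℤ) (v w : Γ) : Words M v w →ₗ[K] (wordsGr M c).X n v w :=
  Piece.proj K (fun p : Wd Γ v w => Tens M p) (fun p => p.deg c) n

/-- The kernel of a family of functionals, as a graded bimodule. -/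
abbrev GBimod.ker (M : GBimod K Γ) (ε : ∀ n v w, M.X n v w →ₗ[K] K) : GBimod K Γ where
  X n v w := LinearMap.ker (ε n v w)

/-- The inclusion of the kernel. -/
def GBimod.kerIncl (M : GBimod K Γ) (ε : ∀ n v w, M.X n v w →ₗ[K] K) (n : ℤ) (v w : Γ) :
    (M.ker ε).X n v w →ₗ[K] M.X n v w := (LinearMap.ker (ε n v w)).subtype

/-- The graded dual.  For both duals `M^#` (left `k`-linear maps to `k`) and `^#M` (right
`k`-linear maps to `k`) the component `e_v (-) e_w` in degree `n` is `Hom_K(e_w M^{-n} e_v, K)`. -/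
abbrev GBimod.dual (M : GBimod K Γ) : GBimod K Γ where
  X n v w := Module.Dual K (M.X (-n) w v)

theorem Words.lift_of (M : GBimod K Γ) {Q : Type u} [AddCommMonoid Q] [Module K Q] {v w : Γ}
    (f : ∀ p : Wd Γ v w, Tens M p →ₗ[K] Q) (p : Wd Γ v w) (t : Tens M p) :
    Words.lift f (Words.of M p t) = f p t := by
  simp [Words.lift, Words.of]

theorem Words.lift_comp (M : GBimod K Γ) {Q R : Type u} [AddCommMonoid Q] [Module K Q]
    [AddCommMonoid R] [Module K R] {v w : Γ} (f : ∀ p : Wd Γ v w, Tens M p →ₗ[K] Q)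
    (g : Q →ₗ[K] R) (x : Words M v w) :
    g (Words.lift f x) = Words.lift (fun p => g.comp (f p)) x := by
  have : g.comp (Words.lift f) = Words.lift (fun p => g.comp (f p)) := by
    apply DirectSum.linearMap_ext
    intro p
    ext t
    simp [Words.lift]
  exact LinearMap.congr_fun this x

theorem Words.unit_self (M : GBimod K Γ) (v : Γ) :
    Words.unit M v v = Words.of M (.nil v) (Tens.nilEquiv M v 1) := by
  simp [Words.unit]

theorem Words.unit_ne (M : GBimod K Γ) {v w : Γ} (h : v ≠ w) : Words.unit M v w = 0 := by
  simp [Words.unit, h]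

theorem wProj_of (M : GBimod K Γ) (c n : ℤ) {v w : Γ} (p : Wd Γ v w) (t : Tens M p) :
    wProj M c n v w (Words.of M p t) =
      if h : p.deg c = n then
        DirectSum.lof K {p : Wd Γ v w // p.deg c = n} (fun p => Tens M p.1) ⟨p, h⟩ t
      else 0 := by
  simp only [wProj, Piece.proj, Words.of, DirectSum.toModule_lof]
  split_ifs <;> rfl

theorem wIncl_wProj_of (M : GBimod K Γ) (c n : ℤ) {v w : Γ} (p : Wd Γ v w) (t : Tens M p) :
    wIncl M c n v w (wProj M c n v w (Words.of M p t)) =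
      if p.deg c = n then Words.of M p t else 0 := by
  rw [wProj_of]
  split_ifs with h
  · simp [wIncl, Piece.incl, Words.of]
  · simp

theorem wProj_unit (M : GBimod K Γ) (c n : ℤ) (v w : Γ) (h : ¬ (n = 0 ∧ v = w)) :
    wProj M c n v w (Words.unit M v w) = 0 := by
  by_cases hv : v = w
  · subst hv
    rw [Words.unit_self, wProj_of, dif_neg]
    rintro h'
    exact h ⟨h'.symm, rfl⟩
  · rw [Words.unit_ne M hv, map_zero]

/-- The projection to words without letters, on homogeneous elements. -/
theorem counit_wIncl_wProj (M : GBimod K Γ) (c n : ℤ) {v w : Γ} (x : Words M v w)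
    (hx : Words.counit M v w x = 0) :
    Words.counit M v w (wIncl M c n v w (wProj M c n v w x)) = 0 := by
  have key : (Words.counit M v w).comp ((wIncl M c n v w).comp (wProj M c n v w)) =
      (if n = 0 then (1 : K) else 0) • Words.counit M v w := by
    apply DirectSum.linearMap_ext
    intro p
    ext t
    have h1 := wIncl_wProj_of M c n p t
    simp only [LinearMap.comp_apply, LinearMap.smul_apply]
    change Words.counit M v w (wIncl M c n v w (wProj M c n v w (Words.of M p t))) =
      _ • Words.counit M v w (Words.of M p t)
    rw [h1]
    cases p with
    | nil =>
      by_cases h : n = 0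
      · subst h; simp [Wd.deg]
      · simp [Wd.deg, h, Ne.symm h]
    | cons v i p =>
      have : Words.counit M v w (Words.of M (.cons v i p) t) = 0 := by
        simp [Words.counit, Words.lift_of]
      split_ifs <;> simp [this]
  have := LinearMap.congr_fun key x
  rw [LinearMap.smul_apply, hx, smul_zero] at this
  exact this

theorem counit_of_cons (M : GBimod K Γ) {v u w : Γ} (n : ℤ) (p : Wd Γ u w)
    (t : Tens M (.cons v n p)) : Words.counit M v w (Words.of M (.cons v n p) t) = 0 := by
  simp [Words.counit, Words.lift_of]

theorem counit_of_nil (M : GBimod K Γ) (v : Γ) (t : Tens M (.nil v)) :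
    Words.counit M v v (Words.of M (.nil v) t) = (Tens.nilEquiv M v).symm t := by
  simp [Words.counit, Words.lift_of]

theorem Tens.nilLift_apply (M : GBimod K Γ) {Q : Type u} [AddCommMonoid Q] [Module K Q] (v : Γ)
    (x : Q) (t : Tens M (.nil v)) :
    Tens.nilLift v x t = (Tens.nilEquiv M v).symm t • x := by
  simp [Tens.nilLift]

theorem Tens.lift_cons (M : GBimod K Γ) {Q : Type u} [AddCommMonoid Q] [Module K Q] {v u w : Γ}
    {n : ℤ} {p : Wd Γ u w} (f : M.X n v u →ₗ[K] Tens M p →ₗ[K] Q) (x : M.X n v u)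
    (t : Tens M p) : Tens.lift f (Tens.cons M v n p x t) = f x t := by
  simp [Tens.lift, Tens.cons]

theorem Tens.map_cons {M N : GBimod K Γ} (f : ∀ n v w, M.X n v w →ₗ[K] N.X n v w) {v u w : Γ}
    {n : ℤ} {p : Wd Γ u w} (x : M.X n v u) (t : Tens M p) :
    Tens.map f (.cons v n p) (Tens.cons M v n p x t) =
      Tens.cons N v n p (f n v u x) (Tens.map f p t) := by
  rw [Tens.map, Tens.lift_cons]
  rfl

theorem Tens.cons_induction (M : GBimod K Γ) {v u w : Γ} {n : ℤ} {p : Wd Γ u w}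
    {P : Tens M (.cons v n p) → Prop} (h0 : P 0)
    (hc : ∀ x t, P (Tens.cons M v n p x t)) (ha : ∀ s t, P s → P t → P (s + t))
    (t : Tens M (.cons v n p)) : P t := by
  obtain ⟨t, rfl⟩ := (Tens.consEquiv M v n p).surjective t
  induction t using TensorProduct.induction_on with
  | zero => simpa using h0
  | tmul x y => exact hc x y
  | add x y hx hy => rw [map_add]; exact ha _ _ hx hy

theorem Tens.concat_nil (M : GBimod K Γ) {v w : Γ} (q : Wd Γ v w) (s : Tens M (.nil v))
    (t : Tens M q) :
    Tens.concat M (.nil v) q s t = (Tens.nilEquiv M v).symm s • t := by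
  change Tens.nilLift v (LinearMap.id : Tens M q →ₗ[K] Tens M q) s t = _
  rw [Tens.nilLift_apply]
  rfl

theorem Words.concat_of (M : GBimod K Γ) {v u w : Γ} (p : Wd Γ v u) (q : Wd Γ u w) (s : Tens M p)
    (t : Tens M q) : Words.concat M v u w (Words.of M p s) (Words.of M q t) =
      Words.of M (p.append q) (Tens.concat M p q s t) := by
  simp [Words.concat, Words.lift_of]

theorem counit_concat (M : GBimod K Γ) (v u w : Γ) (x : Words M v u) (y : Words M u w) :
    Words.counit M v w (Words.concat M v u w x y) =
      Words.counit M v u x * Words.counit M u w y := by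
  induction x using DirectSum.induction_on with
  | zero => simp
  | add x x' hx hx' => simp [hx, hx', add_mul]
  | of p s =>
    induction y using DirectSum.induction_on with
    | zero => simp
    | add y y' hy hy' => simp [hy, hy', mul_add]
    | of q t =>
      change Words.counit M v w (Words.concat M v u w (Words.of M p s) (Words.of M q t)) =
        Words.counit M v u (Words.of M p s) * Words.counit M u w (Words.of M q t)
      rw [Words.concat_of]
      cases p with
      | nil =>
        change Words.counit M v w (Words.of M q (Tens.concat M (.nil v) q s t)) = _
        rw [Tens.concat_nil, map_smul, map_smul, counit_of_nil, smul_eq_mul]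
      | cons v n p =>
        rw [counit_of_cons, zero_mul]
        exact counit_of_cons M n (p.append q) _

theorem counit_prepend (M : GBimod K Γ) (v : Γ) (n : ℤ) (u w : Γ) (x : M.X n v u)
    (y : Words M u w) : Words.counit M v w (Words.prepend M v n u w x y) = 0 := by
  induction y using DirectSum.induction_on with
  | zero => simp
  | add y y' hy hy' => simp [hy, hy']
  | of q t =>
    change Words.counit M v w (Words.prepend M v n u w x (Words.of M q t)) = 0
    have : Words.prepend M v n u w x (Words.of M q t) =
        Words.of M (.cons v n q) (Tens.cons M v n q x t) := by
      simp [Words.prepend, Words.lift_of]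
    rw [this, counit_of_cons]

theorem counit_cobarD (M : GBimod K Γ) (δ : ∀ n v w, M.X n v w →ₗ[K] Words M v w)
    (hδ : ∀ n v w x, Words.counit M v w (δ n v w x) = 0) {v w : Γ} (p : Wd Γ v w) (t : Tens M p) :
    Words.counit M v w (cobarD M δ p t) = 0 := by
  cases p with
  | nil => simp [cobarD]
  | cons v n p =>
    induction t using Tens.cons_induction with
    | h0 => simp
    | ha s t hs ht => simp [hs, ht]
    | hc x t =>
      rw [cobarD, Tens.lift_cons]
      simp [counit_prepend, counit_concat, hδ]

/-! ### Coaugmented `A_∞`-coalgebras -/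

/-- The operations of a strictly counital, strictly coaugmented `A_∞`-coalgebra.  `Δ` is the sum of
the `Δ_i : C → C^{⊗ i}` (its values lie in the direct sum over `i`); `η n v w` is the component of
the image of `1 ∈ k` in `e_v C^n e_w`. -/
structure CoOps (K : Type u) [Field K] (Γ : Type u) extends GBimod K Γ where
  Δ : ∀ n v w, X n v w →ₗ[K] Words toGBimod v w
  ε : ∀ n v w, X n v w →ₗ[K] K
  η : ∀ n v w, X n v w
  /-- The counit is a bimodule map of degree `0` to `k`. -/
  ε_zero : ∀ n v w, ¬ (n = 0 ∧ v = w) → ε n v w = 0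
  η_zero : ∀ n v w, ¬ (n = 0 ∧ v = w) → η n v w = 0
  /-- `η` is a strict comap from `k`, where `Δ_2 (e_v) = e_v ⊗ e_v` and `Δ_i = 0` for `i ≠ 2`. -/
  Δ_η : ∀ v, Δ 0 v v (η 0 v v) = Words.of toGBimod (.two v 0 v 0 v)
    (Tens.cons toGBimod v 0 (.one v 0 v) (η 0 v v) (Tens.letter toGBimod v 0 v (η 0 v v)))

/-- Apply a functional to the letter of a word in position `j`, counted from the left and starting
with `0`: this is `1^{⊗ j} ⊗ ε ⊗ 1 ⊗ ⋯ ⊗ 1` for a bimodule map `ε : M → k`. -/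
def contract (M : GBimod K Γ) (ε : ∀ n v w, M.X n v w →ₗ[K] K) :
    ℕ → {v w : Γ} → (p : Wd Γ v w) → Tens M p →ₗ[K] Words M v w
  | _, _, _, .nil _ => 0
  | 0, _, w, .cons v n (u := u) p =>
      Tens.lift ((LinearMap.lsmul K (Words M v w)).compl₁₂ (ε n v u)
        ((Words.concat M v u w (Words.unit M v u)).comp (Words.of M p)))
  | j + 1, _, w, .cons v n (u := u) p =>
      Tens.lift ((Words.prepend M v n u w).compl₂ (contract M ε j p))

/-- A strictly counital `A_∞`-coalgebra over `k` with a strict coaugmentation. -/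
structure AInfCoalg (K : Type u) [Field K] (Γ : Type u) extends CoOps K Γ where
  /-- There is no `Δ_0`. -/
  Δ_nil : ∀ n v w (x : X n v w), Words.lenProj toGBimod 0 v w (Δ n v w x) = 0
  /-- `Δ_i : C → C^{⊗ i}[2-i]` preserves degrees. -/
  Δ_deg : ∀ n v w (x : X n v w) (p : Wd Γ v w), p.deg 1 ≠ n + 2 → Δ n v w x p = 0
  /-- The co-`A_∞`-relations. -/
  Δ_rel : ∀ n v w (x : X n v w), Words.lift (cobarD toGBimod Δ) (Δ n v w x) = 0
  /-- `(ε ⊗ 1) Δ_2 (x) = (-1)^{|x|} x`. -/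
  ε_left : ∀ n v w (x : X n v w),
    Words.lift (contract toGBimod ε 0) (Words.lenProj toGBimod 2 v w (Δ n v w x)) =
      sgn K n • Words.of toGBimod (.one v n w) (Tens.letter toGBimod v n w x)
  /-- `(1 ⊗ ε) Δ_2 (x) = x`. -/
  ε_right : ∀ n v w (x : X n v w),
    Words.lift (contract toGBimod ε 1) (Words.lenProj toGBimod 2 v w (Δ n v w x)) =
      Words.of toGBimod (.one v n w) (Tens.letter toGBimod v n w x)
  /-- `ε` annihilates every factor of `Δ_i` for `i ≠ 2`. -/
  ε_other : ∀ n v w (x : X n v w) (i j : ℕ), i ≠ 2 →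
    Words.lift (contract toGBimod ε j) (Words.lenProj toGBimod i v w (Δ n v w x)) = 0
  ε_η : ∀ v, ε 0 v v (η 0 v v) = 1

/-! ### Augmented `A_∞`-algebras -/

/-- The operations of a strictly unital, strictly augmented `A_∞`-algebra: `m p n` is the operation
`m_i` (`i` the length of `p`) on words of shape `p`, followed by the projection to degree `n`;
`one n v w` is the component of the unit in degree `n` from `v` to `w`.  The augmentation ideal is
closed under the operations. -/
structure AugOps (K : Type u) [Field K] (Γ : Type u) extends GBimod K Γ where
  m : ∀ {v w} (p : Wd Γ v w) (n : ℤ), Tens toGBimod p →ₗ[K] X n v w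
  one : ∀ n v w, X n v w
  ε : ∀ n v w, X n v w →ₗ[K] K
  one_zero : ∀ n v w, ¬ (n = 0 ∧ v = w) → one n v w = 0
  ε_m : ∀ {v w} (p : Wd Γ v w) (n : ℤ), p.length ≠ 0 → ∀ t : Tens (toGBimod.ker ε) p,
    ε n v w (m p n (Tens.map (toGBimod.kerIncl ε) p t)) = 0

namespace AugOps

variable (A : AugOps K Γ)

/-- The augmentation ideal. -/
abbrev aug : GBimod K Γ := A.toGBimod.ker A.ε

/-- The operations restricted to the augmentation ideal. -/
def mAug {v w : Γ} (p : Wd Γ v w) (n : ℤ) : Tens A.aug p →ₗ[K] A.aug.X n v w :=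
  if h : p.length = 0 then 0
  else LinearMap.codRestrict (LinearMap.ker (A.ε n v w))
    ((A.m p n).comp (Tens.map (A.toGBimod.kerIncl A.ε) p))
    (fun t => LinearMap.mem_ker.mpr (A.ε_m p n h t))

/-- The component `A^i → A^j` of the operation `m_1`. -/
def d (i j : ℤ) (v w : Γ) : A.X i v w →ₗ[K] A.X j v w :=
  (A.m (.one v i w) j).comp (Tens.letter A.toGBimod v i w)

/-- The component `A^i ⊗ A^j → A^n` of the operation `m_2`. -/
def m2 (i j n : ℤ) (v u w : Γ) : A.X i v u →ₗ[K] A.X j u w →ₗ[K] A.X n v w :=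
  ((Tens.cons A.toGBimod v i (.one u j w)).compl₂ (Tens.letter A.toGBimod u j w)).compr₂
    (A.m (.two v i u j w) n)

/-- `A` is an augmented DG-algebra, in the sense of `A_∞`-algebras with `m_i = 0` for `i ≥ 3`.  The
differential and the product in the usual sense are `(-1)^{|a|} m_1(a)` and
`a₂ a₁ = (-1)^{|a₁|} m_2(a₂, a₁)`. -/
structure IsAugDGAlg : Prop where
  deg : ∀ {v w} (p : Wd Γ v w) (n : ℤ), p.deg (-1) + 2 ≠ n → A.m p n = 0
  m_zero : ∀ {v w} (p : Wd Γ v w) (n : ℤ), p.length = 0 → A.m p n = 0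
  m_three : ∀ {v w} (p : Wd Γ v w) (n : ℤ), 3 ≤ p.length → A.m p n = 0
  /-- The `A_∞`-relations. -/
  rel : ∀ {v w} (p : Wd Γ v w) (n : ℤ) (t : Tens A.toGBimod p),
    Words.lift (fun q => A.m q n) (barB A.toGBimod A.m p t) = 0
  m1_one : ∀ j v, A.d 0 j v v (A.one 0 v v) = 0
  m2_one : ∀ n v w (x : A.X n v w), A.m2 n 0 n v w w x (A.one 0 w w) = x
  one_m2 : ∀ n v w (x : A.X n v w), A.m2 0 n n v v w (A.one 0 v v) x = sgn K n • x
  ε_zero : ∀ n v w, ¬ (n = 0 ∧ v = w) → A.ε n v w = 0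
  ε_one : ∀ v, A.ε 0 v v (A.one 0 v v) = 1
  ε_d : ∀ i j v w (x : A.X i v w), A.ε j v w (A.d i j v w x) = 0
  ε_m2 : ∀ i j v u w (x : A.X i v u) (y : A.X j u w),
    A.ε (i + j) v w (A.m2 i j (i + j) v u w x y) = A.ε i v u x * A.ε j u w y

end AugOps

/-- `M` is connected and concentrated in degrees `≤ 0`: `M^n = 0` for `n > 0`, and `k → M^0`, the
map that sends the unit to the elements `one 0 v v`, is an isomorphism (it is injective when
an augmentation sends `one 0 v v` to `1`). -/
structure GBimod.IsConnected (M : GBimod K Γ) (one : ∀ n v w, M.X n v w) : Prop where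
  pos : ∀ n v w, 0 < n → Subsingleton (M.X n v w)
  zero : ∀ v w (x : M.X 0 v w), ∃ r : K, x = r • one 0 v w
  one_ne : ∀ v, one 0 v v ≠ 0
  one_eq : ∀ v w, v ≠ w → one 0 v w = 0

/-- Each graded piece is finitely generated. -/
def GBimod.IsLocallyFinite (M : GBimod K Γ) : Prop := ∀ n v w, Module.Finite K (M.X n v w)

/-! ### The cobar construction -/

namespace AInfCoalg

variable (C : AInfCoalg K Γ)

/-- `C̄`, the cokernel of the coaugmentation. -/
abbrev coaug : GBimod K Γ where
  X n v w := C.X n v w ⧸ Submodule.span K {C.η n v w}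

/-- The projection `C → C̄`. -/
def coaugProj (n : ℤ) (v w : Γ) : C.X n v w →ₗ[K] C.coaug.X n v w :=
  (Submodule.span K {C.η n v w}).mkQ

theorem coaugProj_η (n : ℤ) (v w : Γ) : C.coaugProj n v w (C.η n v w) = 0 := by
  have : C.η n v w ∈ Submodule.span K {C.η n v w} := Submodule.mem_span_singleton_self _
  exact (Submodule.Quotient.mk_eq_zero _).mpr this

theorem map_Δ_η (n : ℤ) (v w : Γ) :
    Words.map C.coaugProj v w (C.Δ n v w (C.η n v w)) = 0 := by
  by_cases h : n = 0 ∧ v = w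
  · obtain ⟨rfl, rfl⟩ := h
    rw [C.Δ_η]
    rw [Words.map, Words.lift_of, LinearMap.comp_apply, Tens.map_cons, coaugProj_η]
    simp
  · rw [C.η_zero n v w h]; simp

/-- The operations `C̄ → T_k(C̄)` induced by the `Δ_i`. -/
def coaugΔ (n : ℤ) (v w : Γ) : C.coaug.X n v w →ₗ[K] Words C.coaug v w :=
  Submodule.liftQ (Submodule.span K {C.η n v w})
    ((Words.map C.coaugProj v w).comp (C.Δ n v w))
    (by
      rw [Submodule.span_le]
      rintro x hx
      rw [Set.mem_singleton_iff] at hx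
      subst hx
      exact C.map_Δ_η n v w)


theorem counit_map_Δ (n : ℤ) (v w : Γ) (x : C.X n v w) :
    Words.counit C.coaug v w (Words.map C.coaugProj v w (C.Δ n v w x)) = 0 := by
  have key : (Words.counit C.coaug v w).comp (Words.map C.coaugProj v w) =
      (Words.counit C.toGBimod v w).comp (Words.lenProj C.toGBimod 0 v w) := by
    apply DirectSum.linearMap_ext
    intro p
    ext t
    change Words.counit C.coaug v w (Words.map C.coaugProj v w (Words.of C.toGBimod p t)) =
      Words.counit C.toGBimod v w (Words.lenProj C.toGBimod 0 v w (Words.of C.toGBimod p t))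
    simp only [Words.map, Words.lenProj, Words.lift_of, LinearMap.comp_apply]
    cases p with
    | nil =>
      rw [if_pos (by rfl), counit_of_nil, counit_of_nil]
      simp [Tens.map, Tens.nilLift_apply]
    | cons v n p =>
      rw [if_neg (by simp [Wd.length]), counit_of_cons]
      simp
  have := LinearMap.congr_fun key (C.Δ n v w x)
  simpa [C.Δ_nil] using this

theorem counit_coaugΔ (n : ℤ) (v w : Γ) (x : C.coaug.X n v w) :
    Words.counit C.coaug v w (C.coaugΔ n v w x) = 0 := by
  obtain ⟨x, rfl⟩ := Submodule.mkQ_surjective _ x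
  exact C.counit_map_Δ n v w x

/-- The operations of the cobar construction `ΩC = k ⊕ C̄[-1] ⊕ C̄[-1]^{⊗ 2} ⊕ ⋯`: `m_1` is the
derivation that extends the `Δ_i`, and `m_2(x, y) = (-1)^{|y|} x y` with the concatenation `x y`. -/
def cobarM (C : AInfCoalg K Γ) : {v w : Γ} → (p : Wd Γ v w) → (n : ℤ) →
    Tens (wordsGr C.coaug 1) p →ₗ[K] (wordsGr C.coaug 1).X n v w
  | _, _, .nil _, _ => 0
  | _, _, .cons v i (.nil w), n =>
      (wProj C.coaug 1 n v w).comp ((Words.lift (cobarD C.coaug C.coaugΔ)).comp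
        ((wIncl C.coaug 1 i v w).comp (Tens.unletter v i w)))
  | _, _, .cons v i (.cons u j (.nil w)), n =>
      sgn K j • Tens.lift ((((Words.concat C.coaug v u w).compl₁₂
        (wIncl C.coaug 1 i v u) (wIncl C.coaug 1 j u w)).compr₂
          (wProj C.coaug 1 n v w)).compl₂ (Tens.unletter u j w))
  | _, _, .cons _ _ (.cons _ _ (.cons _ _ _)), _ => 0

theorem counit_cobarM {v w : Γ} (p : Wd Γ v w) (n : ℤ)
    (t : Tens ((wordsGr C.coaug 1).ker
      (fun n v w => (Words.counit C.coaug v w).comp (wIncl C.coaug 1 n v w))) p) :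
    (Words.counit C.coaug v w).comp (wIncl C.coaug 1 n v w)
      (C.cobarM p n (Tens.map ((wordsGr C.coaug 1).kerIncl _) p t)) = 0 := by
  match p, t with
  | .nil _, _ => simp [cobarM]
  | .cons v i (.nil w), t =>
    simp only [cobarM, LinearMap.comp_apply]
    apply counit_wIncl_wProj
    rw [Words.lift_comp]
    have : (fun p : Wd Γ v w => (Words.counit C.coaug v w).comp
        (cobarD C.coaug C.coaugΔ p)) = fun _ => 0 := by
      funext p
      ext t
      exact counit_cobarD C.coaug C.coaugΔ C.counit_coaugΔ p t
    rw [this]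
    have h0 : (Words.lift (fun _ => 0) : Words C.coaug v w →ₗ[K] K) = 0 := by
      apply DirectSum.linearMap_ext
      intro p
      ext t
      simp [Words.lift]
    rw [h0]
    rfl
  | .cons v i (.cons u j (.nil w)), t =>
    induction t using Tens.cons_induction with
    | h0 => simp
    | ha s t hs ht => simp only [map_add, hs, ht, add_zero]
    | hc x t =>
      rw [Tens.map_cons]
      simp only [cobarM, LinearMap.smul_apply, map_smul, LinearMap.comp_apply]
      refine smul_eq_zero_of_right _ ?_
      erw [Tens.lift_cons]
      simp only [LinearMap.compl₂_apply, LinearMap.compr₂_apply, LinearMap.compl₁₂_apply]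
      have hx : Words.counit C.coaug v u (wIncl C.coaug 1 i v u x.1) = 0 := x.2
      apply counit_wIncl_wProj
      rw [counit_concat]
      exact mul_eq_zero_of_left hx _
  | .cons _ _ (.cons _ _ (.cons _ _ _)), t => simp [cobarM]

/-- The cobar construction, an augmented DG-algebra. -/
abbrev cobar (C : AInfCoalg K Γ) : AugOps K Γ where
  toGBimod := wordsGr C.coaug 1
  m := C.cobarM
  one n v w := wProj C.coaug 1 n v w (Words.unit C.coaug v w)
  ε n v w := (Words.counit C.coaug v w).comp (wIncl C.coaug 1 n v w)
  one_zero n v w h := wProj_unit C.coaug 1 n v w h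
  ε_m p n h t := C.counit_cobarM p n t

end AInfCoalg

/-! ### The bar construction -/

namespace AugOps

variable (A : AugOps K Γ)

/-- A word of shape `p` as a homogeneous element of the bar construction. -/
def barOf {v w : Γ} (p : Wd Γ v w) : Tens A.aug p →ₗ[K] (wordsGr A.aug (-1)).X (p.deg (-1)) v w :=
  DirectSum.lof K {q : Wd Γ v w // q.deg (-1) = p.deg (-1)} (fun q => Tens A.aug q.1) ⟨p, rfl⟩

/-- The coproduct of the bar construction:
`[a_r|⋯|a_1] ↦ ∑_i (-1)^{|a_1|+⋯+|a_i|-i} [a_r|⋯|a_{i+1}] ⊗ [a_i|⋯|a_1]`. -/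
def barΔ2 (n : ℤ) (v w : Γ) :
    (wordsGr A.aug (-1)).X n v w →ₗ[K] Words (wordsGr A.aug (-1)) v w :=
  (Cuts.lift (fun u p q => sgn K (q.deg (-1)) •
    (Words.of (wordsGr A.aug (-1)) (.two v (p.deg (-1)) u (q.deg (-1)) w)).comp
      (TensorProduct.lift ((Tens.cons (wordsGr A.aug (-1)) v (p.deg (-1))
        (.one u (q.deg (-1)) w)).compl₁₂ (A.barOf p)
          ((Tens.letter (wordsGr A.aug (-1)) u (q.deg (-1)) w).comp (A.barOf q)))))).comp
  ((Words.lift (split A.aug)).comp (wIncl A.aug (-1) n v w))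

/-- The differential of the bar construction, as an operation `Δ_1`. -/
def barΔ1 (n : ℤ) (v w : Γ) :
    (wordsGr A.aug (-1)).X n v w →ₗ[K] Words (wordsGr A.aug (-1)) v w :=
  (Words.of (wordsGr A.aug (-1)) (.one v (n + 1) w)).comp
    ((Tens.letter (wordsGr A.aug (-1)) v (n + 1) w).comp
      ((wProj A.aug (-1) (n + 1) v w).comp
        ((Words.lift (barB A.aug A.mAug)).comp (wIncl A.aug (-1) n v w))))

theorem bar_counit_zero (n : ℤ) (v w : Γ) (h : ¬ (n = 0 ∧ v = w)) :
    (Words.counit A.aug v w).comp (wIncl A.aug (-1) n v w) = 0 := by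
  apply DirectSum.linearMap_ext
  rintro ⟨p, hp⟩
  ext t
  have : wIncl A.aug (-1) n v w (DirectSum.lof K {p : Wd Γ v w // p.deg (-1) = n}
      (fun p => Tens A.aug p.1) ⟨p, hp⟩ t) = Words.of A.aug p t := by
    simp [wIncl, Piece.incl, Words.of]
  change Words.counit A.aug v w (wIncl A.aug (-1) n v w (DirectSum.lof K
    {p : Wd Γ v w // p.deg (-1) = n} (fun p => Tens A.aug p.1) ⟨p, hp⟩ t)) = 0
  rw [this]
  cases p with
  | nil => exact absurd ⟨hp.symm, rfl⟩ h
  | cons v i p => exact counit_of_cons A.aug i p t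

theorem bar_coaug (v : Γ) :
    (A.barΔ1 0 v v + A.barΔ2 0 v v) (wProj A.aug (-1) 0 v v (Words.unit A.aug v v)) =
      Words.of (wordsGr A.aug (-1)) (.two v 0 v 0 v)
        (Tens.cons (wordsGr A.aug (-1)) v 0 (.one v 0 v)
          (wProj A.aug (-1) 0 v v (Words.unit A.aug v v))
          (Tens.letter (wordsGr A.aug (-1)) v 0 v
            (wProj A.aug (-1) 0 v v (Words.unit A.aug v v)))) := by
  have h0 : (Wd.nil v).deg (-1) = 0 := rfl
  have h1 : wProj A.aug (-1) 0 v v (Words.unit A.aug v v) =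
      A.barOf (.nil v) (Tens.nilEquiv A.aug v 1) := by
    rw [Words.unit_self, wProj_of, dif_pos h0]
    rfl
  have h2 : wIncl A.aug (-1) 0 v v (wProj A.aug (-1) 0 v v (Words.unit A.aug v v)) =
      Words.of A.aug (.nil v) (Tens.nilEquiv A.aug v 1) := by
    rw [Words.unit_self, wIncl_wProj_of, if_pos h0]
  rw [LinearMap.add_apply, barΔ1, barΔ2]
  simp only [LinearMap.comp_apply]
  rw [h2, Words.lift_of, Words.lift_of, h1]
  have h3 : barB A.aug A.mAug (.nil v) (Tens.nilEquiv A.aug v 1) = 0 := by simp [barB]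
  rw [h3]
  simp only [map_zero, zero_add, split, LinearMap.comp_apply, Cuts.lift, Cuts.of,
    DirectSum.toModule_lof]
  simp [sgn, Wd.deg]
  rfl

/-- The reduced bar construction `BA = k ⊕ Ā[1] ⊕ Ā[1]^{⊗ 2} ⊕ ⋯`, a coaugmented DG-coalgebra, as
an `A_∞`-coalgebra with `Δ_i = 0` for `i ≥ 3`. -/
abbrev bar : CoOps K Γ where
  toGBimod := wordsGr A.aug (-1)
  Δ n v w := A.barΔ1 n v w + A.barΔ2 n v w
  ε n v w := (Words.counit A.aug v w).comp (wIncl A.aug (-1) n v w)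
  η n v w := wProj A.aug (-1) n v w (Words.unit A.aug v w)
  ε_zero n v w h := A.bar_counit_zero n v w h
  η_zero n v w h := wProj_unit A.aug (-1) n v w h
  Δ_η v := A.bar_coaug v

end AugOps

/-! ### The dual algebra -/

/-- `pairAux p q (a_r ⊗ ⋯ ⊗ a_1) φ` is the functional
`c_1 ⊗ ⋯ ⊗ c_r ⊗ t ↦ a_1(c_1) ⋯ a_r(c_r) φ(t)`. -/
def pairAux (M : GBimod K Γ) : {v w z : Γ} → (p : Wd Γ v w) → (q : Wd Γ v z) →
    Tens M.dual p →ₗ[K] Module.Dual K (Tens M q) →ₗ[K] Module.Dual K (Tens M (p.revAux q))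
  | _, _, _, .nil v, q =>
      Tens.nilLift v (LinearMap.id : Module.Dual K (Tens M q) →ₗ[K] Module.Dual K (Tens M q))
  | _, _, _, .cons v n (u := u) p, q =>
      Tens.lift (((LinearMap.llcomp K (Module.Dual K (Tens M q))
        (Module.Dual K (Tens M (.cons u (-n) q)))
        (Module.Dual K (Tens M (p.revAux (.cons u (-n) q))))).comp
          (pairAux M p (.cons u (-n) q))).flip.comp
            ((TensorProduct.curry (TensorProduct.dualDistrib K (M.X (-n) u v) (Tens M q))).compr₂
              (Module.Dual.transpose (R := K) (Tens.consEquiv M u (-n) q).symm.toLinearMap)))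

/-- The pairing `(a_r ⊗ ⋯ ⊗ a_1)(c_1 ⊗ ⋯ ⊗ c_r) = a_1(c_1) ⋯ a_r(c_r)`. -/
def pair (M : GBimod K Γ) {v w : Γ} (p : Wd Γ v w) :
    Tens M.dual p →ₗ[K] Module.Dual K (Words M w v) :=
  (Module.Dual.transpose (R := K)
    (DirectSum.component K (Wd Γ w v) (fun q => Tens M q) p.rev)).comp
      ((pairAux M p (.nil v)).flip (Tens.nilEquiv M v).symm.toLinearMap)

/-- The word of shape `p` all of whose letters are given by the family `x`. -/
def pureWord (M : GBimod K Γ) (x : ∀ n v w, M.X n v w) : {v w : Γ} → (p : Wd Γ v w) → Tens M p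
  | _, _, .nil v => Tens.nilEquiv M v 1
  | _, _, .cons v n (u := u) p => Tens.cons M v n p (x n v u) (pureWord M x p)

theorem pairAux_cons (M : GBimod K Γ) {v u w z : Γ} (n : ℤ) (p : Wd Γ u w) (q : Wd Γ v z)
    (a : M.dual.X n v u) (t : Tens M.dual p) (φ : Module.Dual K (Tens M q)) :
    pairAux M (.cons v n p) q (Tens.cons M.dual v n p a t) φ =
      pairAux M p (.cons u (-n) q) t
        ((TensorProduct.dualDistrib K (M.X (-n) u v) (Tens M q) (a ⊗ₜ φ)).comp
          (Tens.consEquiv M u (-n) q).symm.toLinearMap) := by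
  rw [pairAux]
  exact LinearMap.congr_fun (Tens.lift_cons M.dual _ a t) φ

theorem pairAux_pureWord (M : GBimod K Γ) (x : ∀ n v w, M.X n v w) {v w z : Γ} (p : Wd Γ v w)
    (q : Wd Γ v z) (φ : Module.Dual K (Tens M q)) (h : p.length ≠ 0 ∨ φ (pureWord M x q) = 0)
    (t : Tens (M.dual.ker (fun n v w => Module.Dual.eval K (M.X (-n) w v) (x (-n) w v))) p) :
    pairAux M p q (Tens.map (M.dual.kerIncl _) p t) φ (pureWord M x (p.revAux q)) = 0 := by
  induction p with
  | nil v =>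
    have h := h.resolve_left (by simp [Wd.length])
    refine (LinearMap.congr_fun (LinearMap.congr_fun (Tens.nilLift_apply M.dual v
      (LinearMap.id : Module.Dual K (Tens M q) →ₗ[K] Module.Dual K (Tens M q)) _) φ)
      (pureWord M x q)).trans ?_
    simp [h]
  | cons v n p ih =>
    induction t using Tens.cons_induction with
    | h0 => simp
    | ha s t hs ht => simp only [map_add, LinearMap.add_apply, hs, ht, add_zero]
    | hc a t =>
      rw [Tens.map, Tens.lift_cons]
      simp only [LinearMap.compl₁₂_apply]
      rw [pairAux_cons]
      apply ih
      right
      have ha : a.1 (x (-n) _ v) = 0 := a.2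
      simp only [pureWord, Tens.cons, LinearMap.compr₂_apply, LinearMap.comp_apply,
        LinearEquiv.coe_coe, LinearEquiv.symm_apply_apply, TensorProduct.mk_apply]
      rw [TensorProduct.dualDistrib_apply]
      exact mul_eq_zero_of_left ha _

theorem component_pureWord (M : GBimod K Γ) (x : ∀ n v w, M.X n v w) {v w : Γ} (p q : Wd Γ v w) :
    ∃ c : K, DirectSum.component K (Wd Γ v w) (fun q => Tens M q) p
      (Words.of M q (pureWord M x q)) = c • pureWord M x p := by
  by_cases h : q = p
  · subst h
    exact ⟨1, by simp [Words.of, DirectSum.component.lof_self]⟩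
  · exact ⟨0, by rw [Words.of, DirectSum.component.of, dif_neg h, zero_smul]⟩

theorem CoOps.pair_Δ_η (Q : CoOps K Γ) {v w : Γ} (p : Wd Γ v w) (n : ℤ) (hp : p.length ≠ 0)
    (t : Tens (Q.toGBimod.dual.ker
      (fun n v w => Module.Dual.eval K (Q.X (-n) w v) (Q.η (-n) w v))) p) :
    pair Q.toGBimod p (Tens.map (Q.toGBimod.dual.kerIncl _) p t)
      (Q.Δ (-n) w v (Q.η (-n) w v)) = 0 := by
  by_cases h : -n = 0 ∧ w = v
  · obtain ⟨hn, rfl⟩ := h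
    rw [hn, Q.Δ_η]
    change pairAux Q.toGBimod p (.nil w) _ _ (DirectSum.component K (Wd Γ w w)
      (fun q => Tens Q.toGBimod q) p.rev (Words.of Q.toGBimod (.two w 0 w 0 w)
        (pureWord Q.toGBimod Q.η (.two w 0 w 0 w)))) = 0
    obtain ⟨c, hc⟩ := component_pureWord Q.toGBimod Q.η p.rev (.two w 0 w 0 w)
    rw [hc, map_smul]
    exact smul_eq_zero_of_right _ (pairAux_pureWord Q.toGBimod Q.η p (.nil w) _ (.inl hp) t)
  · rw [Q.η_zero _ _ _ h]; simp

/-- The graded dual of a coaugmented `A_∞`-coalgebra, with the operations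
`m_i(a_i, …, a_1)(c) = (-1)^{|c|} (a_i ⊗ ⋯ ⊗ a_1)(Δ_i c)`. -/
abbrev CoOps.dual (Q : CoOps K Γ) : AugOps K Γ where
  toGBimod := Q.toGBimod.dual
  m {v w} p n := sgn K n •
    (Module.Dual.transpose (R := K) (Q.Δ (-n) w v)).comp (pair Q.toGBimod p)
  one n v w := Q.ε (-n) w v
  ε n v w := Module.Dual.eval K (Q.X (-n) w v) (Q.η (-n) w v)
  one_zero n v w h := Q.ε_zero (-n) w v (fun h' => h ⟨by omega, h'.2.symm⟩)
  ε_m p n h t := by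
    simp only [LinearMap.smul_apply, map_smul, LinearMap.comp_apply]
    exact smul_eq_zero_of_right _ (Q.pair_Δ_η p n h t)

namespace AugOps

/-- The Koszul dual `E(A) = RHom_A(k, k)` for the left `A`-module `k`, computed by `A_∞`-module maps:
this is `Hom_{k-}(BA, k) = (BA)^#` with the dual operations. -/
abbrev E (A : AugOps K Γ) : AugOps K Γ := A.bar.dual

/-! ### The right `E(A)`-module `RHom_A(A, k)` -/

section LeftBar

variable (A : AugOps K Γ)

/-- Index set of the summands of `e_v (BA ⊗_k A) e_w`. -/
abbrev ZIdx (Γ : Type u) (v : Γ) : Type u := Σ u : Γ, Wd Γ v u × ℤ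

/-- The summands of `e_v (BA ⊗_k A) e_w`; they consist of the words `[a_r|⋯|a_1] ⊗ a`. -/
abbrev ZSummand (v w : Γ) (s : ZIdx Γ v) : Type u :=
  Tens A.aug s.2.1 ⊗[K] A.X s.2.2 s.1 w

/-- The degree of a summand of `BA ⊗_k A`. -/
def zdeg (v : Γ) (s : ZIdx Γ v) : ℤ := s.2.1.deg (-1) + s.2.2

/-- `BA ⊗_k A`, without its grading. -/
abbrev ZTot (v w : Γ) : Type u := ⨁ s : ZIdx Γ v, A.ZSummand v w s

/-- A summand of `BA ⊗_k A`. -/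
def zOf {v u : Γ} (w : Γ) (p : Wd Γ v u) (j : ℤ) :
    (Tens A.aug p ⊗[K] A.X j u w) →ₗ[K] A.ZTot v w :=
  DirectSum.lof K (ZIdx Γ v) (A.ZSummand v w) ⟨u, p, j⟩

/-- The graded bimodule `BA ⊗_k A`. -/
abbrev Z : GBimod K Γ where
  X n v w := Piece (A.ZSummand v w) (zdeg v) n

/-- Inclusion of a graded piece of `BA ⊗_k A`. -/
def zIncl (n : ℤ) (v w : Γ) : A.Z.X n v w →ₗ[K] A.ZTot v w :=
  Piece.incl K (A.ZSummand v w) (zdeg v) n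

/-- Projection to a graded piece of `BA ⊗_k A`. -/
def zProj (n : ℤ) (v w : Γ) : A.ZTot v w →ₗ[K] A.Z.X n v w :=
  Piece.proj K (A.ZSummand v w) (zdeg v) n

/-- `([a_r|⋯|a_1], a) ↦ m_{r+1}(a_r, …, a_1, a)`. -/
def mLast {z u : Γ} (w : Γ) (r : Wd Γ z u) (j n : ℤ) :
    (Tens A.aug r ⊗[K] A.X j u w) →ₗ[K] A.X n z w :=
  (A.m (r.append (.one u j w)) n).comp (TensorProduct.lift
    ((Tens.concat A.toGBimod r (.one u j w)).compl₁₂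
      (Tens.map (A.toGBimod.kerIncl A.ε) r) (Tens.letter A.toGBimod u j w)))

/-- The differential of `BA ⊗_k A`, the bar resolution of the left `A`-module `A`:
`[a_r|⋯|a_1] ⊗ a ↦ (-1)^{|a|-1} b[a_r|⋯|a_1] ⊗ a + ∑_i [a_r|⋯|a_{i+1}] ⊗ m_{i+1}(a_i, …, a_1, a)`. -/
def zB {v u : Γ} (w : Γ) (p : Wd Γ v u) (j : ℤ) :
    (Tens A.aug p ⊗[K] A.X j u w) →ₗ[K] A.ZTot v w :=
  sgn K (j - 1) • TensorProduct.lift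
    ((Words.lift (fun q => TensorProduct.curry (A.zOf w q j))).comp (barB A.aug A.mAug p)) +
  TensorProduct.lift ((Cuts.lift (fun _ q r => TensorProduct.curry
    ((A.zOf w q (r.deg (-1) + j + 1)).comp
      ((LinearMap.lTensor (Tens A.aug q) (A.mLast w r j (r.deg (-1) + j + 1))).comp
        (TensorProduct.assoc K _ _ _).toLinearMap)))).comp (split A.aug p))

/-- The differential of `BA ⊗_k A` on all of it. -/
def zBTot (v w : Γ) : A.ZTot v w →ₗ[K] A.ZTot v w :=
  DirectSum.toModule K (ZIdx Γ v) (A.ZTot v w) (fun s => A.zB w s.2.1 s.2.2)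

/-- The coaction `[a_r|⋯|a_1] ⊗ a ↦ ∑_i ± [a_r|⋯|a_{i+1}] ⊗ ([a_i|⋯|a_1] ⊗ a)`, with sign
`(-1)^{|a|-1+|a_1|+⋯+|a_i|-i}`; only the part is kept where the two factors have degrees `j` and `i`
and meet in the vertex `u`. -/
def zCo (j i : ℤ) (v u w : Γ) :
    A.ZTot v w →ₗ[K] (A.bar.X j v u ⊗[K] A.Z.X i u w) :=
  DirectSum.toModule K (ZIdx Γ v) _ (fun s =>
    TensorProduct.lift ((Cuts.liftAt u (fun q r => sgn K (r.deg (-1) + s.2.2 - 1) •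
      TensorProduct.curry ((TensorProduct.map
        ((wProj A.aug (-1) j v u).comp (Words.of A.aug q))
        ((A.zProj i u w).comp (A.zOf w r s.2.2))).comp
          (TensorProduct.assoc K _ _ _).toLinearMap))).comp (split A.aug s.2.1)))

end LeftBar

/-- Right DG-modules (more generally, right `A_∞`-modules) over an augmented algebra: `μ v i p n`
takes an element of degree `i` and a word of shape `p` to an element of degree `n`.  The module
structure is strictly unital, so that only the operations with entries in the augmentation ideal
are recorded. -/
structure RMod (E : AugOps K Γ) extends GBimod K Γ where
  μ : ∀ {u w} (v : Γ) (i : ℤ) (p : Wd Γ u w) (n : ℤ),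
    X i v u →ₗ[K] Tens E.aug p →ₗ[K] X n v w

section RHom

variable {E : AugOps K Γ} (M : RMod E)

/-- Index set of the summands of `e_v (M ⊗_k BE) e_w`. -/
abbrev YIdx (Γ : Type u) (w : Γ) : Type u := Σ u : Γ, ℤ × Wd Γ u w

/-- The summands of `e_v (M ⊗_k BE) e_w`; they consist of the words `x ⊗ [x_r|⋯|x_1]`. -/
abbrev RMod.YSummand (v w : Γ) (s : YIdx Γ w) : Type u :=
  M.X s.2.1 v s.1 ⊗[K] Tens E.aug s.2.2

/-- The degree of a summand of `M ⊗_k BE`. -/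
def ydeg (w : Γ) (s : YIdx Γ w) : ℤ := s.2.1 + s.2.2.deg (-1)

/-- `M ⊗_k BE`, without its grading. -/
abbrev RMod.YTot (v w : Γ) : Type u := ⨁ s : YIdx Γ w, M.YSummand v w s

/-- A summand of `M ⊗_k BE`. -/
def RMod.yOf (v : Γ) {u w : Γ} (i : ℤ) (p : Wd Γ u w) :
    (M.X i v u ⊗[K] Tens E.aug p) →ₗ[K] M.YTot v w :=
  DirectSum.lof K (YIdx Γ w) (M.YSummand v w) ⟨u, i, p⟩

/-- The graded bimodule `M ⊗_k BE`. -/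
abbrev RMod.Y : GBimod K Γ where
  X n v w := Piece (M.YSummand v w) (ydeg w) n

/-- Inclusion of a graded piece of `M ⊗_k BE`. -/
def RMod.yIncl (n : ℤ) (v w : Γ) : M.Y.X n v w →ₗ[K] M.YTot v w :=
  Piece.incl K (M.YSummand v w) (ydeg w) n

/-- Projection to a graded piece of `M ⊗_k BE`. -/
def RMod.yProj (n : ℤ) (v w : Γ) : M.YTot v w →ₗ[K] M.Y.X n v w :=
  Piece.proj K (M.YSummand v w) (ydeg w) n

/-- The differential of `M ⊗_k BE`:
`x ⊗ [x_r|⋯|x_1] ↦ x ⊗ b[x_r|⋯|x_1] + ∑_i ± μ(x, x_r, …, x_{i+1}) ⊗ [x_i|⋯|x_1]`, with sign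
`(-1)^{|x_1|+⋯+|x_i|-i}`. -/
def RMod.yB (v : Γ) {u w : Γ} (i : ℤ) (p : Wd Γ u w) :
    (M.X i v u ⊗[K] Tens E.aug p) →ₗ[K] M.YTot v w :=
  TensorProduct.lift
    ((Words.lift (fun q => (TensorProduct.curry (M.yOf v i q)).flip)).flip.compl₂
        (barB E.aug E.mAug p) +
      (Cuts.lift (fun _ q r => (TensorProduct.curry (sgn K (r.deg (-1)) •
        (M.yOf v (i + q.deg (-1) + 1) r).comp
          ((LinearMap.rTensor (Tens E.aug r)
            (TensorProduct.lift (M.μ v i q (i + q.deg (-1) + 1)))).comp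
              (TensorProduct.assoc K _ _ _).symm.toLinearMap))).flip)).flip.compl₂
        (split E.aug p))

/-- The differential of `M ⊗_k BE` on all of it. -/
def RMod.yBTot (v w : Γ) : M.YTot v w →ₗ[K] M.YTot v w :=
  DirectSum.toModule K (YIdx Γ w) (M.YTot v w) (fun s => M.yB v s.2.1 s.2.2)

/-- `RHom_E(M, k)` for a right `E`-module `M`, computed by `A_∞`-module maps: as a graded bimodule
this is `Hom_{-k}(M ⊗_k BE, k)`, the graded dual of `M ⊗_k BE`. -/
abbrev RMod.RHomK : GBimod K Γ := M.Y.dual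

/-- The component from degree `i` to degree `j` of the differential of `RHom_E(M, k)`:
`(dφ)(y) = (-1)^{|y|} φ(dy)`. -/
def RMod.dRHomK (i j : ℤ) (v w : Γ) : M.RHomK.X i v w →ₗ[K] M.RHomK.X j v w :=
  sgn K j • Module.Dual.transpose (R := K)
    ((M.yProj (-i) w v).comp ((M.yBTot w v).comp (M.yIncl (-j) w v)))

/-- `k` as a right module over an augmented algebra. -/
abbrev kMod (E : AugOps K Γ) : RMod E where
  X n v w := ({ carrier := {x : K | ¬ (n = 0 ∧ v = w) → x = 0}
                add_mem' := fun ha hb h => by simp [ha h, hb h]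
                zero_mem' := fun _ => rfl
                smul_mem' := fun c x hx h => by simp [hx h] } : Submodule K K)
  μ _ _ _ _ := 0

end RHom

section Double

variable (A : AugOps K Γ)

/-- The component of the differential of `RHom_A(A, k) = Hom_{k-}(BA ⊗_k A, k)`. -/
def homAkD (i n : ℤ) (v w : Γ) : A.Z.dual.X i v w →ₗ[K] A.Z.dual.X n v w :=
  sgn K (n + 1) • Module.Dual.transpose (R := K)
    ((A.zProj (-i) w v).comp ((A.zBTot w v).comp (A.zIncl (-n) w v)))

/-- The action of `E(A)` on `RHom_A(A, k)` by composition of `A_∞`-module maps. -/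
def homAkAct (i j n : ℤ) (v u w : Γ) :
    A.Z.dual.X i v u →ₗ[K] A.E.aug.X j u w →ₗ[K] A.Z.dual.X n v w :=
  sgn K (n + 1) • (((TensorProduct.curry
    (TensorProduct.dualDistrib K (A.bar.X (-j) w u) (A.Z.X (-i) u v))).flip.compl₂
      (A.E.toGBimod.kerIncl A.E.ε j u w)).compr₂
        (Module.Dual.transpose (R := K) ((A.zCo (-j) (-i) w u v).comp (A.zIncl (-n) w v))))

/-- The operations of the right `E(A)`-module `RHom_A(A, k)`. -/
def homAkMu : {u w : Γ} → (v : Γ) → (i : ℤ) → (p : Wd Γ u w) → (n : ℤ) →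
    A.Z.dual.X i v u →ₗ[K] Tens A.E.aug p →ₗ[K] A.Z.dual.X n v w
  | _, _, v, i, .nil u, n =>
      (LinearMap.lsmul K (A.Z.dual.X n v u)).flip.compl₁₂ (A.homAkD i n v u)
        (Tens.nilEquiv A.E.aug u).symm.toLinearMap
  | _, _, v, i, .cons u j (.nil w), n => (A.homAkAct i j n v u w).compl₂ (Tens.unletter u j w)
  | _, _, _, _, .cons _ _ (.cons _ _ _), _ => 0

/-- `RHom_A(A, k)` for the left `A`-modules `A` and `k`, computed by `A_∞`-module maps, as a right
DG-module over `E(A)`. -/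
abbrev homAk : RMod A.E where
  toGBimod := A.Z.dual
  μ := A.homAkMu

/-- The Yoneda quasi-isomorphism `RHom_A(A, k) → k` of right `E(A)`-modules, `f ↦ f([ ] ⊗ 1)`. -/
def yoneda (n : ℤ) (v w : Γ) : A.homAk.X n v w →ₗ[K] (kMod A.E).X n v w :=
  LinearMap.codRestrict _
    (Module.Dual.eval K (A.Z.X (-n) w v) (A.zProj (-n) w v
      (A.zOf v (.nil w) (-n) (Tens.nilEquiv A.aug w 1 ⊗ₜ[K] A.one (-n) w v))))
    (fun f => by
      change ¬ (n = 0 ∧ v = w) → _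
      intro h
      rw [A.one_zero (-n) w v (fun h' => h ⟨by omega, h'.2.symm⟩)]
      simp)

/-- The map `RHom_{E(A)}(k, k) → RHom_{E(A)}(RHom_A(A, k), k)` induced by the Yoneda map. -/
def yonedaPull (n : ℤ) (v w : Γ) :
    (kMod A.E).RHomK.X n v w →ₗ[K] A.homAk.RHomK.X n v w :=
  Module.Dual.transpose (R := K) (((kMod A.E).yProj (-n) w v).comp
    ((DirectSum.toModule K (YIdx Γ v) ((kMod A.E).YTot w v) (fun s =>
      ((kMod A.E).yOf w s.2.1 s.2.2).comp
        (LinearMap.rTensor (Tens A.E.aug s.2.2) (A.yoneda s.2.1 w s.1)))).comp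
          (A.homAk.yIncl (-n) w v)))

/-- `f ⊗ [x_r|⋯|x_1] ↦ (a ↦ f([ ] ⊗ a))` if `r = 0`, and `0` if `r > 0`. -/
def actAux (w : Γ) (n i : ℤ) : {u v : Γ} → (p : Wd Γ u v) →
    (A.homAk.X i w u ⊗[K] Tens A.E.aug p) →ₗ[K] Module.Dual K (A.X n v w)
  | _, _, .nil v => TensorProduct.lift ((LinearMap.lsmul K (Module.Dual K (A.X n v w))).flip.compl₁₂
      (Module.Dual.transpose (R := K) ((A.zProj (-i) v w).comp
        ((A.zOf w (.nil v) n).comp (TensorProduct.mk K _ _ (Tens.nilEquiv A.aug v 1)))))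
      (Tens.nilEquiv A.E.aug v).symm.toLinearMap)
  | _, _, .cons _ _ _ => 0

/-- The left action of `A` on `RHom_A(A, k)`, `(a · f)(b) = f(b a)`, followed by the Yoneda map
`RHom_A(A, k) → k`: the map `A → RHom_{E(A)}(RHom_A(A, k), k)`, `a ↦ (f ↦ f(a))`. -/
def act (n : ℤ) (v w : Γ) : A.X n v w →ₗ[K] A.homAk.RHomK.X n v w :=
  ((DirectSum.toModule K (YIdx Γ v) _ (fun s => A.actAux w n s.2.1 s.2.2)).comp
    (A.homAk.yIncl (-n) w v)).flip

end Double

end AugOps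

/-! ### Quasi-isomorphisms -/

/-- `φ : M → N` is a quasi-isomorphism of complexes of graded bimodules; the families `dM` and `dN`
contain the components of the differentials. -/
structure IsQuasiIso {M N : GBimod K Γ} (dM : ∀ i j v w, M.X i v w →ₗ[K] M.X j v w)
    (dN : ∀ i j v w, N.X i v w →ₗ[K] N.X j v w) (φ : ∀ n v w, M.X n v w →ₗ[K] N.X n v w) :
    Prop where
  d_dM : ∀ n v w (x : M.X n v w), dM (n + 1) (n + 2) v w (dM n (n + 1) v w x) = 0
  d_dN : ∀ n v w (y : N.X n v w), dN (n + 1) (n + 2) v w (dN n (n + 1) v w y) = 0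
  comm : ∀ n v w (x : M.X n v w), φ (n + 1) v w (dM n (n + 1) v w x) = dN n (n + 1) v w (φ n v w x)
  inj : ∀ n v w (x : M.X n v w), dM n (n + 1) v w x = 0 →
    (∃ y : N.X (n - 1) v w, dN (n - 1) n v w y = φ n v w x) →
    ∃ z : M.X (n - 1) v w, dM (n - 1) n v w z = x
  surj : ∀ n v w (y : N.X n v w), dN n (n + 1) v w y = 0 →
    ∃ x : M.X n v w, dM n (n + 1) v w x = 0 ∧
      ∃ z : N.X (n - 1) v w, y = φ n v w x + dN (n - 1) n v w z

/-- The part of the map of bar constructions induced by `F_i : A^{⊗ i} → B[1-i]` that produces words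
with `r` letters: the sum of all `F(x_d, …) ⊗ ⋯ ⊗ F(…, x_1)` with `r` factors, each of which has
at least one argument. -/
def hat {M N : GBimod K Γ} (F : ∀ {v w} (p : Wd Γ v w) (n : ℤ), Tens M p →ₗ[K] N.X n v w) :
    ℕ → {v w : Γ} → (p : Wd Γ v w) → Tens M p →ₗ[K] Words N v w
  | 0, _, _, .nil v => Tens.nilLift v (Words.unit N v v)
  | 0, _, _, .cons _ _ _ => 0
  | r + 1, v, w, p => (Cuts.lift (fun u q s => if q.length = 0 then 0 else
      TensorProduct.lift ((Words.prepend N v (q.deg (-1) + 1) u w).compl₁₂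
        (F q (q.deg (-1) + 1)) (hat F r s)))).comp (split M p)

/-- `F` is a strictly unital, strictly augmented `A_∞`-quasi-isomorphism `A → B`. -/
structure IsAInfQuasiIso (A B : AugOps K Γ)
    (F : ∀ {v w} (p : Wd Γ v w) (n : ℤ), Tens A.toGBimod p →ₗ[K] B.X n v w) : Prop where
  /-- `F_i : A^{⊗ i} → B[1-i]` preserves degrees. -/
  deg : ∀ {v w} (p : Wd Γ v w) (n : ℤ), p.deg (-1) + 1 ≠ n → F p n = 0
  /-- The relations of an `A_∞`-map: `∑ n_r(F, …, F) = ∑ ± F(…, m_i, …)`. -/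
  rel : ∀ {v w} (p : Wd Γ v w) (t : Tens A.toGBimod p), p.length ≠ 0 →
    ∑ r ∈ Finset.range (p.length + 1),
      Words.lift (fun q => B.m q (p.deg (-1) + 2)) (hat F r p t) =
    Words.lift (fun q => F q (p.deg (-1) + 2)) (barB A.toGBimod A.m p t)
  unit : ∀ v, F (.one v 0 v) 0 (Tens.letter A.toGBimod v 0 v (A.one 0 v v)) = B.one 0 v v
  unit_zero : ∀ {v u w} (p : Wd Γ v u) (q : Wd Γ u w) (n : ℤ) (s : Tens A.toGBimod p)
    (t : Tens A.toGBimod q), 0 < p.length + q.length →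
    F (p.append (.cons u 0 q)) n (Tens.concat A.toGBimod p (.cons u 0 q) s
      (Tens.cons A.toGBimod u 0 q (A.one 0 u u) t)) = 0
  ε : ∀ n v w (x : A.X n v w), B.ε n v w (F (.one v n w) n (Tens.letter A.toGBimod v n w x)) =
    A.ε n v w x
  ε_zero : ∀ {v w} (p : Wd Γ v w) (n : ℤ) (t : Tens A.toGBimod p), 2 ≤ p.length →
    B.ε n v w (F p n t) = 0
  quasiIso : IsQuasiIso A.d B.d (fun n v w =>
    (F (.one v n w) n).comp (Tens.letter A.toGBimod v n w))

/-- `A` and `E(A)` are Koszul dual: the natural map `A → RHom_{E(A)}(k, k)` is a quasi-isomorphism.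
That map is given by the left action of `A` on `RHom_A(A, k)`, where the right `E(A)`-module `k` is
viewed as `RHom_A(A, k)`; hence it is the composition of `act`, with values in
`RHom_{E(A)}(RHom_A(A, k), k)`, and of the inverse of the identification
`yonedaPull : RHom_{E(A)}(k, k) → RHom_{E(A)}(RHom_A(A, k), k)`.  Both maps are quasi-isomorphisms. -/
structure AugOps.IsKoszulDual (A : AugOps K Γ) : Prop where
  act : IsQuasiIso A.d A.homAk.dRHomK A.act
  yoneda : IsQuasiIso (kMod A.E).dRHomK A.homAk.dRHomK A.yonedaPull

end Words

end

end Koszul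

namespace Koszul

noncomputable section

open scoped Classical
open LinearMap (comp_apply flip_apply compl₂_apply compr₂_apply compl₁₂_apply mem_ker id_apply
  add_comp smulRight_apply zero_comp comp_assoc smul_comp neg_comp comp_zero comp_id comp_add
  rTensor_tmul)
open LinearMap renaming congr_fun → lcongr_fun, ext → lext, add_apply → ladd_apply,
  smul_apply → lsmul_apply, zero_apply → lzero_apply, neg_apply → lneg_apply,
  sub_apply → lsub_apply,
  sum_apply → lsum_apply
open Module (Dual)

section Instances

/-! ### Shortcut instances -/

variable {K : Type u} [Field K] {Γ : Type u} {v w u z y : Γ}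

instance {V W : Type*} [AddCommMonoid V] [AddCommMonoid W] [Module K V] [Module K W] :
    AddMonoidHomClass (V →ₗ[K] W) V W := inferInstance
instance {V W : Type*} [AddCommMonoid V] [AddCommMonoid W] [Module K V] [Module K W] :
    ZeroHomClass (V →ₗ[K] W) V W := inferInstance

section

variable (M : GBimod K Γ) (v w : Γ)

instance : Module K (Words M v w) := inferInstance
instance : Zero (Words M v w) := inferInstance
instance : Add (Words M v w) := inferInstance
instance : AddZeroClass (Words M v w) := inferInstance
instance : SMul K (Words M v w) := inferInstance
instance : DistribSMul K (Words M v w) := inferInstance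
instance : SMulCommClass K K (Words M v w) := inferInstance
instance : IsScalarTower K K (Words M v w) := inferInstance

end

section

variable (A : AugOps K Γ) (v w : Γ)

instance : Module K (A.ZTot v w) := inferInstance
instance : Zero (A.ZTot v w) := inferInstance
instance : Add (A.ZTot v w) := inferInstance
instance : AddZeroClass (A.ZTot v w) := inferInstance
instance : SMul K (A.ZTot v w) := inferInstance
instance : DistribSMul K (A.ZTot v w) := inferInstance
instance : SMulCommClass K K (A.ZTot v w) := inferInstance
instance : IsScalarTower K K (A.ZTot v w) := inferInstance

end

section

variable {A : AugOps K Γ} (M : AugOps.RMod A) (v w : Γ)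

instance : Module K (M.YTot v w) := inferInstance
instance : Zero (M.YTot v w) := inferInstance
instance : Add (M.YTot v w) := inferInstance
instance : AddZeroClass (M.YTot v w) := inferInstance
instance : SMul K (M.YTot v w) := inferInstance
instance : DistribSMul K (M.YTot v w) := inferInstance
instance : SMulCommClass K K (M.YTot v w) := inferInstance
instance : IsScalarTower K K (M.YTot v w) := inferInstance

end

end Instances

/-- The operations of `A` vanish on words of length at least three. -/
abbrev AugOps.NoHigher {K : Type u} [Field K] {Γ : Type u} (A : AugOps K Γ) : Prop :=
  ∀ {v w} (p : Wd Γ v w) (n : ℤ), 3 ≤ p.length → A.m p n = 0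

lemma Tens.ind {K : Type u} [Field K] {Γ : Type u} {M : GBimod K Γ} {v u w : Γ} {n : ℤ}
    {p : Wd Γ u w} {P : Tens M (.cons v n p) → Prop} (ha : ∀ s t, P s → P t → P (s + t))
    (hc : ∀ x t, P (Tens.cons M v n p x t)) (t : Tens M (.cons v n p)) : P t :=
  cons_induction M (by simpa using hc 0 0) hc ha t

/-! ### Signs -/

section Sgn

variable (K : Type u) [Field K]

lemma sgn_add (a b : ℤ) : sgn K (a + b) = sgn K a * sgn K b := zpow_add₀ (by simp) a b

@[simp] lemma sgn_zero : sgn K 0 = 1 := zpow_zero _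

@[simp] lemma sgn_one : sgn K 1 = -1 := zpow_one _

lemma sgn_neg (a : ℤ) : sgn K (-a) = sgn K a := by
  rw [sgn, sgn, zpow_neg, ← inv_zpow, inv_neg, inv_one]

lemma sgn_mul_self (a : ℤ) : sgn K a * sgn K a = 1 := by
  rw [← sgn_add, sgn, ← two_mul, zpow_mul]
  norm_num

lemma sgn_sub (a b : ℤ) : sgn K (a - b) = sgn K a * sgn K b := by
  rw [sub_eq_add_neg, sgn_add, sgn_neg]

@[simp] lemma sgn_neg_one : sgn K (-1) = -1 := by rw [sgn_neg, sgn_one]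

@[simp] lemma sgn_two : sgn K 2 = 1 := by
  have := sgn_add K 1 1
  simpa using this

lemma sgn_smul_smul {Q : Type*} [AddCommGroup Q] [Module K Q] (a : ℤ) (x : Q) :
    sgn K a • sgn K a • x = x := by
  rw [smul_smul, sgn_mul_self, one_smul]

variable {K} in
lemma sgn_smul_eq_zero {Q : Type*} [AddCommGroup Q] [Module K Q] {a : ℤ} {x : Q}
    (h : sgn K a • x = 0) : x = 0 := by
  rw [← sgn_smul_smul K a x, h, smul_zero]

variable {Γ : Type u}

lemma sgn_deg_neg_one (p : Wd Γ v w) : sgn K (p.deg (-1)) = sgn K (p.deg 1) := by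
  induction p with
  | nil => rfl
  | cons v n p ih => simp only [Wd.deg, sgn_add, ih, sgn_one, sgn_neg_one]

end Sgn

section Words

variable {K : Type u} [Field K] {Γ : Type u} {v w u z y : Γ}

/-! ### Direct sums of graded pieces -/

section Piece

variable {ι : Type u} (V : ι → Type u) [∀ i, AddCommGroup (V i)] [∀ i, Module K (V i)] (deg : ι → ℤ)

lemma Piece.incl_lof (n : ℤ) (i : {i : ι // deg i = n}) (x : V i.1) :
    Piece.incl K V deg n (DirectSum.lof K _ (fun i : {i : ι // deg i = n} => V i.1) i x) =
      DirectSum.lof K ι V i.1 x := by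
  simp [Piece.incl]

lemma Piece.proj_lof (n : ℤ) (i : ι) (x : V i) : Piece.proj K V deg n (DirectSum.lof K ι V i x) =
      if h : deg i = n then
        DirectSum.lof K {i : ι // deg i = n} (fun i => V i.1) ⟨i, h⟩ x else 0 := by
  simp only [Piece.proj, DirectSum.toModule_lof]
  split_ifs <;> rfl

lemma Piece.incl_proj_lof (n : ℤ) (i : ι) (x : V i) :
    Piece.incl K V deg n (Piece.proj K V deg n (DirectSum.lof K ι V i x)) =
      if deg i = n then DirectSum.lof K ι V i x else 0 := by
  rw [Piece.proj_lof]
  split_ifs with h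
  · rw [Piece.incl_lof]
  · simp

@[simp] lemma Piece.proj_incl (n : ℤ) (x : Piece V deg n) :
    Piece.proj K V deg n (Piece.incl K V deg n x) = x := by
  have : (Piece.proj K V deg n).comp (Piece.incl K V deg n) = LinearMap.id := by
    apply DirectSum.linearMap_ext
    rintro ⟨i, h⟩
    ext1 x
    simp only [comp_apply]
    rw [Piece.incl_lof, Piece.proj_lof, dif_pos h]
    rfl
  exact lcongr_fun this x

lemma Piece.proj_incl_ne {m n : ℤ} (hmn : n ≠ m) (x : Piece V deg n) :
    Piece.proj K V deg m (Piece.incl K V deg n x) = 0 := by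
  have : (Piece.proj K V deg m).comp (Piece.incl K V deg n) = 0 := by
    apply DirectSum.linearMap_ext
    rintro ⟨i, h⟩
    ext1 x
    simp only [comp_apply]
    rw [Piece.incl_lof, Piece.proj_lof, dif_neg (fun h' => hmn (h.symm.trans h'))]
    rfl
  exact lcongr_fun this x

variable (K)

/-- The homogeneous elements of degree `n`. -/
def Piece.hom (n : ℤ) : Submodule K (⨁ i, V i) := LinearMap.range (Piece.incl K V deg n)

variable {K}

lemma Piece.incl_mem (n : ℤ) (x : Piece V deg n) :
    Piece.incl K V deg n x ∈ Piece.hom K V deg n := ⟨x, rfl⟩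

lemma Piece.lof_mem (i : ι) (x : V i) : DirectSum.lof K ι V i x ∈ Piece.hom K V deg (deg i) :=
  ⟨DirectSum.lof K {j : ι // deg j = deg i} (fun i => V i.1) ⟨i, rfl⟩ x, Piece.incl_lof _ _ _ _ _⟩

lemma Piece.incl_proj {n : ℤ} {x : ⨁ i, V i} (hx : x ∈ Piece.hom K V deg n) :
    Piece.incl K V deg n (Piece.proj K V deg n x) = x := by
  obtain ⟨x, rfl⟩ := hx
  rw [Piece.proj_incl]

lemma Piece.proj_ne {m n : ℤ} {x : ⨁ i, V i} (hx : x ∈ Piece.hom K V deg n) (h : n ≠ m) :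
    Piece.proj K V deg m x = 0 := by
  obtain ⟨x, rfl⟩ := hx
  exact Piece.proj_incl_ne V deg h x

lemma Piece.hom_induction {n : ℤ} {Q : Type*} [AddCommGroup Q] [Module K Q]
    (f : (⨁ i, V i) →ₗ[K] Q) (S : Submodule K Q)
    (h : ∀ i x, deg i = n → f (DirectSum.lof K ι V i x) ∈ S) {x : ⨁ i, V i}
    (hx : x ∈ Piece.hom K V deg n) : f x ∈ S := by
  obtain ⟨x, rfl⟩ := hx
  induction x using DirectSum.induction_on with
  | zero => simp
  | add x y hx hy => simpa using S.add_mem hx hy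
  | of i x =>
    have := Piece.incl_lof (K := K) V deg n i x
    change f (Piece.incl K V deg n (DirectSum.lof K _ (fun i : {i : ι // deg i = n} => V i.1) i x)) ∈ S
    rw [this]
    exact h i.1 x i.2

lemma Piece.exists_sum (x : ⨁ i, V i) (S : Submodule K (⨁ i, V i))
    (h : ∀ n, Piece.incl K V deg n (Piece.proj K V deg n x) ∈ S) : x ∈ S := by
  suffices ∃ s : Finset ℤ, x = ∑ n ∈ s, Piece.incl K V deg n (Piece.proj K V deg n x) by
    obtain ⟨s, hs⟩ := this
    rw [hs]
    exact S.sum_mem fun n _ => h n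
  suffices ∃ s : Finset ℤ, ∀ t, s ⊆ t →
      x = ∑ n ∈ t, Piece.incl K V deg n (Piece.proj K V deg n x) by
    obtain ⟨s, hs⟩ := this
    exact ⟨s, hs s subset_rfl⟩
  clear h
  induction x using DirectSum.induction_on with
  | zero => exact ⟨∅, fun t _ => by simp⟩
  | add x y hx hy =>
    obtain ⟨s, hs⟩ := hx
    obtain ⟨s', hs'⟩ := hy
    refine ⟨s ∪ s', fun t ht => ?_⟩
    simp only [map_add, Finset.sum_add_distrib]
    rw [← hs t (Finset.union_subset_left ht), ← hs' t (Finset.union_subset_right ht)]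
  | of i x =>
    refine ⟨{deg i}, fun t ht => ?_⟩
    change DirectSum.lof K ι V i x = ∑ n ∈ t, Piece.incl K V deg n
      (Piece.proj K V deg n (DirectSum.lof K ι V i x))
    simp only [Piece.incl_proj_lof]
    rw [Finset.sum_ite_eq, if_pos (ht (Finset.mem_singleton_self _))]

end Piece

/-! ### Letters -/

/-- All letters from `v` to `w`, of all degrees. -/
abbrev Lt (M : GBimod K Γ) (v w : Γ) : Type u := ⨁ n : ℤ, M.X n v w

section

variable (M : GBimod K Γ) (v w : Γ)

instance : Module K (Lt M v w) := inferInstance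
instance : Zero (Lt M v w) := inferInstance
instance : Add (Lt M v w) := inferInstance
instance : AddZeroClass (Lt M v w) := inferInstance
instance : SMul K (Lt M v w) := inferInstance
instance : DistribSMul K (Lt M v w) := inferInstance
instance : SMulCommClass K K (Lt M v w) := inferInstance
instance : IsScalarTower K K (Lt M v w) := inferInstance

end

namespace Lt

variable (M : GBimod K Γ) {Q : Type*} [AddCommMonoid Q] [Module K Q]

/-- A letter of degree `n`. -/
def of (n : ℤ) (v w : Γ) : M.X n v w →ₗ[K] Lt M v w := DirectSum.lof K ℤ (fun n => M.X n v w) n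

variable {M}

/-- Linear maps out of the letters. -/
def lift (f : ∀ n, M.X n v w →ₗ[K] Q) : Lt M v w →ₗ[K] Q := DirectSum.toModule K ℤ Q f

@[simp] lemma lift_of (f : ∀ n, M.X n v w →ₗ[K] Q) (n : ℤ) (x : M.X n v w) :
    lift f (of M n v w x) = f n x := by
  simp [lift, of]

@[elab_as_elim] lemma ind {P : Lt M v w → Prop}
    (ha : ∀ x y, P x → P y → P (x + y)) (ho : ∀ n x, P (of M n v w x)) (x : Lt M v w) : P x := by
  induction x using DirectSum.induction_on with
  | zero => simpa using ho 0 0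
  | add x y hx hy => exact ha x y hx hy
  | of n x => exact ho n x

lemma hom_ext {f g : Lt M v w →ₗ[K] Q}
    (h : ∀ n x, f (of M n v w x) = g (of M n v w x)) : f = g := by
  apply DirectSum.linearMap_ext
  intro n
  ext1 x
  exact h n x

variable (M)

/-- The component of degree `n`. -/
def comp (n : ℤ) (v w : Γ) : Lt M v w →ₗ[K] M.X n v w :=
  DirectSum.component K ℤ (fun n => M.X n v w) n

@[simp] lemma comp_of (n : ℤ) (v w : Γ) (x : M.X n v w) : comp M n v w (of M n v w x) = x :=
  DirectSum.component.lof_self K (M := fun n => M.X n v w) n x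

lemma comp_of_ne {m n : ℤ} (h : m ≠ n) (v w : Γ) (x : M.X m v w) :
    comp M n v w (of M m v w x) = 0 := by
  rw [comp, of, DirectSum.component.of, dif_neg h]

/-- The sign `(-1)^{|x|+1}`. -/
def eps (v w : Γ) : Lt M v w →ₗ[K] Lt M v w := lift (fun n => sgn K (n + 1) • of M n v w)

variable {M}

@[simp] lemma eps_of (n : ℤ) (v w : Γ) (x : M.X n v w) :
    eps M v w (of M n v w x) = sgn K (n + 1) • of M n v w x := by
  simp [eps]

@[simp] lemma eps_eps (x : Lt M v w) : eps M v w (eps M v w x) = x := by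
  induction x using Lt.ind with
  | ha x y hx hy => simp [hx, hy]
  | ho n x => simp [sgn_smul_smul]

end Lt

/-! ### Words as products of letters -/

namespace Words

variable (M : GBimod K Γ) {Q : Type*} [AddCommMonoid Q] [Module K Q]

/-- The empty word. -/
def nil (v : Γ) : Words M v v := of M (.nil v) (Tens.nilEquiv M v 1)

/-- Multiplication by a letter from the left. -/
def pre (v u w : Γ) : Lt M v u →ₗ[K] Words M u w →ₗ[K] Words M v w :=
  Lt.lift (fun n => prepend M v n u w)

variable {M}

lemma prepend_of (v : Γ) (n : ℤ) (p : Wd Γ u w) (x : M.X n v u) (t : Tens M p) :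
    prepend M v n u w x (of M p t) = of M (.cons v n p) (Tens.cons M v n p x t) := by
  simp [prepend, lift_of]

lemma pre_of (v : Γ) (n : ℤ) (x : M.X n v u) (s : Words M u w) :
    pre M v u w (Lt.of M n v u x) s = prepend M v n u w x s := by
  simp [pre]

lemma pre_of_of (v : Γ) (n : ℤ) (p : Wd Γ u w) (x : M.X n v u) (t : Tens M p) :
    pre M v u w (Lt.of M n v u x) (of M p t) = of M (.cons v n p) (Tens.cons M v n p x t) := by
  rw [pre_of, prepend_of]

lemma of_nil (v : Γ) (t : Tens M (.nil v)) :
    of M (.nil v) t = (Tens.nilEquiv M v).symm t • nil M v := by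
  rw [nil, ← map_smul, ← map_smul, smul_eq_mul, mul_one, LinearEquiv.apply_symm_apply]

@[simp] lemma unit_self' (v : Γ) : unit M v v = nil M v := unit_self M v

@[elab_as_elim] lemma ind {w : Γ} {P : ∀ v, Words M v w → Prop}
    (ha : ∀ v x y, P v x → P v y → P v (x + y)) (hs : ∀ v (c : K) x, P v x → P v (c • x))
    (hn : P w (nil M w))
    (hp : ∀ v u n (x : M.X n v u) s, P u s → P v (pre M v u w (Lt.of M n v u x) s))
    {v : Γ} (s : Words M v w) : P v s := by
  have h0 : ∀ v, P v 0 := fun v => by simpa using hp v w 0 0 (nil M w) hn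
  induction s using DirectSum.induction_on with
  | zero => exact h0 v
  | add x y hx hy => exact ha v x y hx hy
  | of p t =>
    change P v (of M p t)
    induction p with
    | nil v =>
      rw [of_nil]
      exact hs _ _ _ hn
    | cons v n p ih =>
      induction t using Tens.ind with
      | ha s t hs ht => simpa using ha _ _ _ hs ht
      | hc x t =>
        rw [← pre_of_of]
        exact hp _ _ _ _ _ (ih ha hs hn hp h0 t)

@[elab_as_elim] lemma ind' {P : ∀ v, Words M v w → Prop}
    (ha : ∀ v x y, P v x → P v y → P v (x + y)) (hs : ∀ v (c : K) x, P v x → P v (c • x))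
    (hn : P w (nil M w))
    (hp : ∀ v u (x : Lt M v u) s, P u s → P v (pre M v u w x s)) (s : Words M v w) : P v s :=
  ind ha hs hn (fun v u n x s h => hp v u (Lt.of M n v u x) s h) s

lemma ext_ind {Q : Γ → Type*} [∀ v, AddCommMonoid (Q v)] [∀ v, Module K (Q v)]
    (f g : ∀ v, Words M v w →ₗ[K] Q v) (hn : f w (nil M w) = g w (nil M w))
    (hp : ∀ v u (x : Lt M v u) s, f u s = g u s →
      f v (pre M v u w x s) = g v (pre M v u w x s)) (s : Words M v w) : f v s = g v s := by
  induction s using Words.ind with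
  | ha v x y hx hy => simp [hx, hy]
  | hs v c x hx => simp [hx]
  | hn => exact hn
  | hp v u n x s h => exact hp v u _ s h

lemma ext_cases {v w : Γ} {Q : Type*} [AddCommMonoid Q] [Module K Q]
    (f g : Words M v w →ₗ[K] Q) (hn : ∀ h : v = w, f (h ▸ nil M v) = g (h ▸ nil M v))
    (hp : ∀ u n (x : M.X n v u) s,
      f (pre M v u w (Lt.of M n v u x) s) = g (pre M v u w (Lt.of M n v u x) s)) : f = g := by
  apply DirectSum.linearMap_ext
  intro p
  ext1 t
  change f (of M p t) = g (of M p t)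
  cases p with
  | nil =>
    rw [of_nil]
    simp only [map_smul]
    rw [hn rfl]
  | cons v n p =>
    induction t using Tens.ind with
    | ha s t hs ht => simp [hs, ht]
    | hc x t =>
      rw [← pre_of_of]
      exact hp _ _ _ _

variable (M)

/-- The sign given by the degree with shifted letters. -/
def eps (v w : Γ) : Words M v w →ₗ[K] Words M v w := lift (fun p => sgn K (p.deg 1) • of M p)

variable {M}

lemma eps_of (p : Wd Γ v w) (t : Tens M p) :
    eps M v w (of M p t) = sgn K (p.deg 1) • of M p t := by
  simp [eps, lift_of]

@[simp] lemma eps_nil (v : Γ) : eps M v v (nil M v) = nil M v := by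
  rw [nil, eps_of]
  simp [Wd.deg]

@[simp] lemma eps_pre (x : Lt M v u) (s : Words M u w) :
    eps M v w (pre M v u w x s) = pre M v u w (Lt.eps M v u x) (eps M u w s) := by
  induction x using Lt.ind with
  | ha x y hx hy => simp [hx, hy]
  | ho n x =>
    induction s using DirectSum.induction_on with
    | zero => simp
    | add s t hs ht => simp [hs, ht]
    | of p t =>
      change eps M v w (pre M v u w _ (of M p t)) = pre M v u w _ (eps M u w (of M p t))
      rw [pre_of_of, eps_of, eps_of, Lt.eps_of]
      simp only [map_smul, lsmul_apply, pre_of_of, Wd.deg, sgn_add, smul_smul]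
      congr 1
      ring

@[simp] lemma eps_eps (s : Words M v w) : eps M v w (eps M v w s) = s := by
  refine ext_ind (fun v => (eps M v w).comp (eps M v w)) (fun _ => LinearMap.id) (by simp) ?_ s
  intro v u x s h
  simp only [comp_apply, id_apply] at h ⊢
  rw [eps_pre, eps_pre, Lt.eps_eps, h]

/-! #### Homogeneous words -/

variable (M)

/-- The homogeneous words of degree `n`, where the letters are shifted by `c`. -/
def hom (c n : ℤ) (v w : Γ) : Submodule K (Words M v w) :=
  Piece.hom K (fun p : Wd Γ v w => Tens M p) (fun p => p.deg c) n

variable {M}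

lemma of_mem_hom (c : ℤ) (p : Wd Γ v w) (t : Tens M p) : of M p t ∈ hom M c (p.deg c) v w :=
  Piece.lof_mem (fun p : Wd Γ v w => Tens M p) (fun p => p.deg c) p t

lemma of_mem_hom' {c n : ℤ} (p : Wd Γ v w) (h : p.deg c = n) (t : Tens M p) :
    of M p t ∈ hom M c n v w := h ▸ of_mem_hom c p t

lemma nil_mem_hom (c : ℤ) (v : Γ) : nil M v ∈ hom M c 0 v v := of_mem_hom' (.nil v) rfl _

lemma hom_induction {c n : ℤ} {Q : Type*} [AddCommGroup Q] [Module K Q]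
    (f : Words M v w →ₗ[K] Q) (S : Submodule K Q)
    (h : ∀ p t, p.deg c = n → f (of M p t) ∈ S) {x : Words M v w}
    (hx : x ∈ hom M c n v w) : f x ∈ S :=
  Piece.hom_induction (fun p : Wd Γ v w => Tens M p) (fun p => p.deg c) f S h hx

lemma pre_mem_hom {c m : ℤ} (n k : ℤ) (x : M.X n v u) {s : Words M u w}
    (hs : s ∈ hom M c m u w) (hk : n + c + m = k) :
    pre M v u w (Lt.of M n v u x) s ∈ hom M c k v w := by
  refine hom_induction (pre M v u w (Lt.of M n v u x)) _ (fun p t hp => ?_) hs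
  rw [pre_of_of]
  exact of_mem_hom' _ (by simp only [Wd.deg]; omega) _

lemma eps_hom {c n : ℤ} (hc : sgn K c = -1) {x : Words M v w} (hx : x ∈ hom M c n v w) :
    eps M v w x = sgn K n • x := by
  have hd : ∀ {v w : Γ} (p : Wd Γ v w), sgn K (p.deg c) = sgn K (p.deg 1) := by
    intro v w p
    induction p with
    | nil => rfl
    | cons v n p ih => simp only [Wd.deg, sgn_add, ih, sgn_one, hc]
  have := hom_induction (eps M v w - sgn K n • LinearMap.id) ⊥ (fun p t hp => ?_) hx
  · simpa [sub_eq_zero] using this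
  · simp [eps_of, ← hd, hp]

/-! #### Concatenation -/

@[simp] lemma nil_concat (s : Words M v w) : concat M v v w (nil M v) s = s := by
  induction s using DirectSum.induction_on with
  | zero => simp
  | add s t hs ht => simp [hs, ht]
  | of p t =>
    change concat M v v w (of M _ _) (of M p t) = of M p t
    rw [concat_of, Tens.concat_nil]
    simp
    rfl

lemma _root_.Koszul.Tens.concat_cons (n : ℤ) (p : Wd Γ u w) (q : Wd Γ w z)
    (x : M.X n v u) (s : Tens M p) (t : Tens M q) :
    Tens.concat M (.cons v n p) q (Tens.cons M v n p x s) t =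
      Tens.cons M v n (p.append q) x (Tens.concat M p q s t) := by
  rw [Tens.concat]
  exact lcongr_fun (Tens.lift_cons M _ x s) t

@[simp] lemma pre_concat (x : Lt M v u) (s : Words M u w) (t : Words M w z) :
    concat M v w z (pre M v u w x s) t = pre M v u z x (concat M u w z s t) := by
  induction x using Lt.ind with
  | ha x y hx hy => simp [hx, hy]
  | ho n x =>
    induction s using DirectSum.induction_on with
    | zero => simp
    | add s t hs ht => simp [hs, ht]
    | of p s =>
      induction t using DirectSum.induction_on with
      | zero => simp
      | add s t hs ht => simp only [map_add, hs, ht]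
      | of q t =>
        change concat M v w z (pre M v u w _ (of M p s)) (of M q t) =
          pre M v u z _ (concat M u w z (of M p s) (of M q t))
        rw [pre_of_of, concat_of, Tens.concat_cons, concat_of, pre_of_of]
        rfl

@[simp] lemma concat_nil (s : Words M v w) : concat M v w w s (nil M w) = s := by
  refine ext_ind (fun v => (concat M v w w).flip (nil M w)) (fun _ => LinearMap.id) (by simp) ?_ s
  intro v u x s h
  simp only [flip_apply, id_apply] at h ⊢
  rw [pre_concat, h]

lemma concat_assoc (s : Words M v u) (t : Words M u w) (r : Words M w z) :
    concat M v w z (concat M v u w s t) r = concat M v u z s (concat M u w z t r) := by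
  induction s using Words.ind with
  | ha v x y hx hy => simp [hx, hy]
  | hs v c x hx => simp [hx]
  | hn => simp
  | hp v u n x s h => simp [h]

@[simp] lemma eps_concat (s : Words M v u) (t : Words M u w) :
    eps M v w (concat M v u w s t) = concat M v u w (eps M v u s) (eps M u w t) := by
  induction s using Words.ind with
  | ha v x y hx hy => simp [hx, hy]
  | hs v c x hx => simp [hx]
  | hn => simp
  | hp v u n x s h => simp [h]

lemma concat_mem_hom {c m n k : ℤ} {s : Words M v u} {t : Words M u w}
    (hs : s ∈ hom M c m v u) (ht : t ∈ hom M c n u w) (hk : m + n = k) :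
    concat M v u w s t ∈ hom M c k v w := by
  refine hom_induction ((concat M v u w).flip t) _ (fun p s hp => ?_) hs
  refine hom_induction (concat M v u w (of M p s)) _ (fun q t hq => ?_) ht
  rw [concat_of]
  refine of_mem_hom' _ ?_ _
  have : ∀ {v u : Γ} (p : Wd Γ v u) (q : Wd Γ u w), (p.append q).deg c = p.deg c + q.deg c := by
    intro v u p q
    induction p with
    | nil => simp [Wd.append, Wd.deg]
    | cons v n p ih => simp only [Wd.append, Wd.deg, ih]; ring
  rw [this]
  omega

@[simp] lemma counit_nil (v : Γ) : counit M v v (nil M v) = 1 := by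
  rw [nil, counit_of_nil]
  simp

@[simp] lemma counit_pre (x : Lt M v u) (s : Words M u w) :
    counit M v w (pre M v u w x s) = 0 := by
  induction x using Lt.ind with
  | ha x y hx hy => simp [hx, hy]
  | ho n x => rw [pre_of, counit_prepend]

end Words

end Words

/-! ### Acyclicity and duality -/

section Acyclic

variable {K : Type u} [Field K]

lemma exists_comp_eq_of_ker_le_ker {V W U : Type*} [AddCommGroup V] [Module K V] [AddCommGroup W]
    [Module K W] [AddCommGroup U] [Module K U] (f : V →ₗ[K] W) (g : V →ₗ[K] U)
    (h : LinearMap.ker f ≤ LinearMap.ker g) : ∃ φ : W →ₗ[K] U, φ.comp f = g := by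
  obtain ⟨φ, hφ⟩ := LinearMap.exists_extend
    (((LinearMap.ker f).liftQ g h).comp f.quotKerEquivRange.symm.toLinearMap)
  refine ⟨φ, ?_⟩
  ext x
  have := lcongr_fun hφ ⟨f x, x, rfl⟩
  simp only [comp_apply, Submodule.subtype_apply] at this
  rw [comp_apply, this]
  have h2 : f.quotKerEquivRange.symm ⟨f x, x, rfl⟩ = (LinearMap.ker f).mkQ x := by
    rw [LinearEquiv.symm_apply_eq]
    rfl
  simp [h2]

lemma exists_primitive {T : Type*} [AddCommGroup T] [Module K T] (D : T →ₗ[K] T)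
    (hD : ∀ x, D (D x) = 0) (S : Submodule K T) (hS : ∀ x ∈ S, D x ∈ S) (F : ℕ → Submodule K T)
    (h0 : ∀ x ∈ S, x ∈ F 0 → x = 0)
    (hF : ∀ k, ∀ x ∈ S, x ∈ F (k + 1) → D x = 0 → ∃ y ∈ S, x - D y ∈ F k)
    (hex : ∀ x ∈ S, ∃ k, x ∈ F k) (x : T) (hx : x ∈ S) (hDx : D x = 0) : ∃ y ∈ S, D y = x := by
  obtain ⟨k, hk⟩ := hex x hx
  induction k generalizing x with
  | zero => exact ⟨0, S.zero_mem, by rw [h0 x hx hk, map_zero]⟩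
  | succ k ih =>
    obtain ⟨y, hy, hxy⟩ := hF k x hx hk hDx
    obtain ⟨z, hz, hDz⟩ := ih (x - D y) (S.sub_mem hx (hS y hy)) (by rw [map_sub, hDx, hD, sub_zero])
      hxy
    exact ⟨y + z, S.add_mem hy hz, by rw [map_add, hDz]; abel⟩

lemma exists_primitive_piece {ι : Type u} (V : ι → Type u) [∀ i, AddCommGroup (V i)]
    [∀ i, Module K (V i)] (deg : ι → ℤ) (D : (⨁ i, V i) →ₗ[K] ⨁ i, V i)
    (hD : ∀ n x, x ∈ Piece.hom K V deg n → D x ∈ Piece.hom K V deg (n + 1))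
    (S : Submodule K (⨁ i, V i))
    (hS : ∀ n x, x ∈ S → Piece.incl K V deg n (Piece.proj K V deg n x) ∈ S)
    (hac : ∀ x ∈ S, D x = 0 → ∃ y ∈ S, D y = x) (i j k : ℤ) (hij : i + 1 = j) (hjk : j + 1 = k)
    (x : Piece V deg j) (hx : Piece.incl K V deg j x ∈ S)
    (hdx : Piece.proj K V deg k (D (Piece.incl K V deg j x)) = 0) :
    ∃ y : Piece V deg i, Piece.incl K V deg i y ∈ S ∧
      Piece.proj K V deg j (D (Piece.incl K V deg i y)) = x := by
  subst hij hjk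
  have h1 : D (Piece.incl K V deg (i + 1) x) = 0 := by
    rw [← Piece.incl_proj V deg (hD _ _ (Piece.incl_mem V deg _ x)), hdx, map_zero]
  obtain ⟨y, hy, hDy⟩ := hac _ hx h1
  refine ⟨Piece.proj K V deg i y, hS i y hy, ?_⟩
  have h2 : ∀ y, Piece.proj K V deg (i + 1) (D y) =
      Piece.proj K V deg (i + 1) (D (Piece.incl K V deg i (Piece.proj K V deg i y))) := by
    intro y
    have : y - Piece.incl K V deg i (Piece.proj K V deg i y) ∈
        LinearMap.ker ((Piece.proj K V deg (i + 1)).comp D) := by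
      apply Piece.exists_sum V deg
      intro n
      by_cases hn : n = i
      · subst hn
        simp
      · rw [map_sub, Piece.proj_incl_ne V deg (Ne.symm hn), sub_zero, mem_ker, comp_apply]
        exact Piece.proj_ne V deg (hD _ _ (Piece.incl_mem V deg _ _)) (by omega)
    rw [mem_ker, comp_apply, map_sub, map_sub, sub_eq_zero] at this
    exact this
  rw [← h2, hDy, Piece.proj_incl]

variable {Γ : Type u}

/-- The dual of a family of maps between the pieces of a graded bimodule, with the sign of
the target degree. -/
def dualD {M : GBimod K Γ} (δ : ∀ i j v w, M.X i v w →ₗ[K] M.X j v w) (i j : ℤ) (v w : Γ) :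
    M.dual.X i v w →ₗ[K] M.dual.X j v w :=
  sgn K j • Module.Dual.transpose (R := K) (δ (-j) (-i) w v)

lemma dualD_apply {M : GBimod K Γ} (δ : ∀ i j v w, M.X i v w →ₗ[K] M.X j v w) (i j : ℤ)
    (v w : Γ) (f : M.dual.X i v w) (x : M.X (-j) w v) :
    dualD δ i j v w f x = sgn K j • f (δ (-j) (-i) w v x) := rfl

lemma isQuasiIso_dual {M N : GBimod K Γ} (δM : ∀ i j v w, M.X i v w →ₗ[K] M.X j v w)
    (δN : ∀ i j v w, N.X i v w →ₗ[K] N.X j v w) (f : ∀ n v w, M.X n v w →ₗ[K] N.X n v w)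
    (hM : ∀ i j k v w x, i + 1 = j → j + 1 = k → δM j k v w (δM i j v w x) = 0)
    (hN : ∀ i j k v w x, i + 1 = j → j + 1 = k → δN j k v w (δN i j v w x) = 0)
    (hf : ∀ i j v w x, i + 1 = j → f j v w (δM i j v w x) = δN i j v w (f i v w x))
    (hs : ∀ n v w, Function.Surjective (f n v w))
    (hac : ∀ i j k v w x, i + 1 = j → j + 1 = k → f j v w x = 0 → δM j k v w x = 0 →
      ∃ y, f i v w y = 0 ∧ δM i j v w y = x) :
    IsQuasiIso (M := N.dual) (N := M.dual) (dualD δN) (dualD δM)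
      (fun n v w => Module.Dual.transpose (R := K) (f (-n) w v)) where
  d_dM n v w x := by
    ext y
    rw [dualD_apply, dualD_apply, hN _ _ _ _ _ _ (by omega) (by omega)]
    simp
  d_dN n v w x := by
    ext y
    rw [dualD_apply, dualD_apply, hM _ _ _ _ _ _ (by omega) (by omega)]
    simp
  comm n v w x := by
    ext y
    change dualD δN _ _ _ _ x (f _ _ _ y) = dualD δM _ _ v w _ y
    rw [dualD_apply, dualD_apply, ← hf _ _ _ _ _ (by omega)]
    rfl
  inj n v w ψ hψ hχ := by
    obtain ⟨χ, hχ⟩ := hχ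
    have hψ' : ∀ y, ψ (δN (-(n + 1)) (-n) w v y) = 0 := fun y => by
      have := lcongr_fun hψ y
      rw [dualD_apply] at this
      exact sgn_smul_eq_zero this
    have hχ' : ∀ y, sgn K n • χ (δM (-n) (-(n - 1)) w v y) = ψ (f (-n) w v y) := fun y =>
      lcongr_fun hχ y
    have hker : LinearMap.ker (δN (-n) (-(n - 1)) w v) ≤ LinearMap.ker ψ := by
      intro y hy
      obtain ⟨x, rfl⟩ := hs _ _ _ y
      obtain ⟨z, hz, hxz⟩ := hac (-n) (-(n - 1)) (-(n - 1) + 1) w v (δM (-n) (-(n - 1)) w v x)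
        (by omega) rfl (by rw [hf _ _ _ _ _ (by omega)]; exact hy) (hM _ _ _ _ _ _ (by omega) rfl)
      have h1 : f (-n) w v x = f (-n) w v (x - z) := by rw [map_sub, hz, sub_zero]
      rw [mem_ker, h1, ← hχ', map_sub, hxz, sub_self, map_zero, smul_zero]
    obtain ⟨φ, hφ⟩ := exists_comp_eq_of_ker_le_ker _ _ hker
    refine ⟨sgn K n • φ, ?_⟩
    ext y
    rw [dualD_apply]
    change sgn K n • sgn K n • φ _ = _
    rw [sgn_smul_smul, ← hφ]
    rfl
  surj n v w χ hχ := by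
    have hχ' : ∀ y, χ (δM (-(n + 1)) (-n) w v y) = 0 := fun y => by
      have := lcongr_fun hχ y
      rw [dualD_apply] at this
      exact sgn_smul_eq_zero this
    set S := LinearMap.ker (f (-n) w v)
    have hker : LinearMap.ker ((δM (-n) (-(n - 1)) w v).comp S.subtype) ≤
        LinearMap.ker (χ.comp S.subtype) := by
      rintro ⟨y, hy⟩ hdy
      obtain ⟨z, -, rfl⟩ := hac (-(n + 1)) (-n) (-(n - 1)) w v y (by omega) (by omega) hy hdy
      exact hχ' z
    obtain ⟨ω, hω⟩ := exists_comp_eq_of_ker_le_ker _ _ hker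
    have hker2 : LinearMap.ker (f (-n) w v) ≤
        LinearMap.ker (χ - ω.comp (δM (-n) (-(n - 1)) w v)) := by
      intro y hy
      have := lcongr_fun hω ⟨y, hy⟩
      simp only [comp_apply, Submodule.subtype_apply] at this
      rw [mem_ker, lsub_apply, comp_apply, this, sub_self]
    obtain ⟨ψ, hψ⟩ := exists_comp_eq_of_ker_le_ker _ _ hker2
    refine ⟨ψ, ?_, sgn K n • ω, ?_⟩
    · ext y
      obtain ⟨x, rfl⟩ := hs _ _ _ y
      rw [dualD_apply, ← hf _ _ _ _ _ (by omega)]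
      have := lcongr_fun hψ (δM (-(n + 1)) (-n) w v x)
      simp only [comp_apply, lsub_apply] at this
      rw [hχ', hM _ _ _ _ _ _ (by omega) (by omega), map_zero, sub_zero] at this
      rw [this, smul_zero]
      rfl
    · ext y
      have := lcongr_fun hψ y
      simp only [comp_apply, lsub_apply] at this
      change χ y = ψ (f _ _ _ y) + dualD δM _ _ v w _ y
      rw [this, dualD_apply]
      change _ = _ + sgn K n • sgn K n • ω _
      rw [sgn_smul_smul]
      abel

lemma IsQuasiIso.comp_equiv {M M' N : GBimod K Γ} {dM : ∀ i j v w, M.X i v w →ₗ[K] M.X j v w}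
    {dM' : ∀ i j v w, M'.X i v w →ₗ[K] M'.X j v w}
    {dN : ∀ i j v w, N.X i v w →ₗ[K] N.X j v w} {φ : ∀ n v w, M.X n v w →ₗ[K] N.X n v w}
    (h : IsQuasiIso dM dN φ) (e : ∀ n v w, M'.X n v w ≃ₗ[K] M.X n v w)
    (he : ∀ i j v w x, i + 1 = j → e j v w (dM' i j v w x) = dM i j v w (e i v w x)) :
    IsQuasiIso dM' dN (fun n v w => (φ n v w).comp (e n v w).toLinearMap) where
  d_dM n v w x := by
    apply (e _ v w).injective
    rw [he _ _ _ _ _ (by omega), he _ _ _ _ _ (by omega), h.d_dM, map_zero]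
  d_dN := h.d_dN
  comm n v w x := by
    simp only [comp_apply, LinearEquiv.coe_coe]
    rw [he _ _ _ _ _ rfl, h.comm]
  inj n v w x hx hy := by
    obtain ⟨z, hz⟩ := h.inj n v w (e n v w x) (by rw [← he _ _ _ _ _ rfl, hx, map_zero]) hy
    refine ⟨(e _ v w).symm z, (e n v w).injective ?_⟩
    rw [he _ _ _ _ _ (by omega), LinearEquiv.apply_symm_apply, hz]
  surj n v w y hy := by
    obtain ⟨x, hx, z, hz⟩ := h.surj n v w y hy
    refine ⟨(e n v w).symm x, (e _ v w).injective ?_, z, ?_⟩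
    · rw [he _ _ _ _ _ rfl, LinearEquiv.apply_symm_apply, hx, map_zero]
    · rw [hz]
      simp

end Acyclic

open Words

section Words

variable {K : Type u} [Field K] {Γ : Type u} {v w u z y : Γ}

/-! ### Cutting words -/

section Cut

variable (M : GBimod K Γ) {Q : Type u} [AddCommGroup Q] [Module K Q]

lemma Cuts.lift_of' {Q : Type u} [AddCommMonoid Q] [Module K Q]
    (G : ∀ (u : Γ) (p : Wd Γ v u) (q : Wd Γ u w), (Tens M p ⊗[K] Tens M q) →ₗ[K] Q)
    (p : Wd Γ v u) (q : Wd Γ u w) (x : Tens M p ⊗[K] Tens M q) :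
    Cuts.lift G (Cuts.of M p q x) = G u p q x := by
  simp [Cuts.lift, Cuts.of]

lemma Cuts.hom_ext {f g : Cuts M v w →ₗ[K] Q} (h : ∀ u (p : Wd Γ v u) (q : Wd Γ u w) x y,
      f (Cuts.of M p q (x ⊗ₜ y)) = g (Cuts.of M p q (x ⊗ₜ y))) : f = g := by
  apply DirectSum.linearMap_ext
  rintro ⟨u, p, q⟩
  apply TensorProduct.ext'
  intro x y
  exact h u p q x y

variable {M}

@[elab_as_elim] lemma Cuts.ind {P : Cuts M v w → Prop}
    (ha : ∀ x y, P x → P y → P (x + y))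
    (ho : ∀ u (p : Wd Γ v u) (q : Wd Γ u w) x y, P (Cuts.of M p q (x ⊗ₜ y))) (c : Cuts M v w) :
    P c := by
  have h0 : P 0 := by simpa using ho v (.nil v) (.cons v 0 (.nil w)) 0 0
  induction c using DirectSum.induction_on with
  | zero => exact h0
  | add x y hx hy => exact ha x y hx hy
  | of s x =>
    obtain ⟨u, p, q⟩ := s
    induction x using TensorProduct.induction_on with
    | zero => rw [map_zero]; exact h0
    | tmul x y => exact ho u p q x y
    | add x y hx hy => rw [map_add]; exact ha _ _ hx hy

lemma lift_split_nil
    (G : ∀ (u : Γ) (p : Wd Γ v u) (q : Wd Γ u v), (Tens M p ⊗[K] Tens M q) →ₗ[K] Q)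
    (t : Tens M (.nil v)) :
    Cuts.lift G (split M (.nil v) t) = G v (.nil v) (.nil v) (Tens.nilEquiv M v 1 ⊗ₜ t) := by
  rw [split, comp_apply, Cuts.lift_of']
  rfl

lemma lift_split_cons {n : ℤ} {p : Wd Γ u w}
    (G : ∀ (z : Γ) (p : Wd Γ v z) (q : Wd Γ z w), (Tens M p ⊗[K] Tens M q) →ₗ[K] Q)
    (x : M.X n v u) (t : Tens M p) : Cuts.lift G (split M (.cons v n p) (Tens.cons M v n p x t)) =
      G v (.nil v) (.cons v n p) (Tens.nilEquiv M v 1 ⊗ₜ Tens.cons M v n p x t) +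
      Cuts.lift (fun z q r => (G z (.cons v n q) r).comp
        (LinearMap.rTensor (Tens M r) (Tens.cons M v n q x))) (split M p t) := by
  rw [split, ladd_apply, map_add, comp_apply, Cuts.lift_of', Tens.lift_cons]
  congr 1
  simp only [compl₂_apply]
  rw [flip_apply]
  generalize split M p t = c
  induction c using Cuts.ind with
  | ha c d hc hd => simp only [map_add, ladd_apply, hc, hd]
  | ho z q r y s =>
    rw [Cuts.lift_of', Cuts.lift_of']
    exact Cuts.lift_of' M G (.cons v n q) r _

lemma lift_split_of_cons_eq_zero (p : Wd Γ v w)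
    (G : ∀ (z : Γ) (p : Wd Γ v z) (q : Wd Γ z w), (Tens M p ⊗[K] Tens M q) →ₗ[K] Q)
    (hG : ∀ z u n (q : Wd Γ u z) (r : Wd Γ z w), G z (.cons v n q) r = 0) (t : Tens M p) :
    Cuts.lift G (split M p t) = G v (.nil v) p (Tens.nilEquiv M v 1 ⊗ₜ t) := by
  cases p with
  | nil => exact lift_split_nil G t
  | cons v n p =>
    induction t using Tens.ind with
    | ha s t hs ht => simp only [map_add, hs, ht, TensorProduct.tmul_add]
    | hc x t =>
      rw [lift_split_cons]
      simp only [hG, zero_comp]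
      generalize split M p t = c
      induction c using Cuts.ind with
      | ha c d hc hd => 
        rw [map_add, ← add_assoc, hc, hd]
      | ho z q r y s => rw [Cuts.lift_of']; simp

namespace Words

/-- The sum of `F` over all ways to cut a word in two. -/
def cut (F : ∀ u, Words M v u →ₗ[K] Words M u w →ₗ[K] Q) : Words M v w →ₗ[K] Q :=
  (Cuts.lift (fun u p q => TensorProduct.lift ((F u).compl₁₂ (of M p) (of M q)))).comp
    (lift (split M))

lemma cut_of (F : ∀ u, Words M v u →ₗ[K] Words M u w →ₗ[K] Q) (p : Wd Γ v w)
    (t : Tens M p) : cut F (of M p t) =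
      Cuts.lift (fun u p q => TensorProduct.lift ((F u).compl₁₂ (of M p) (of M q)))
        (split M p t) := by
  rw [cut, comp_apply, lift_of]

lemma cut_congr {F G : ∀ u, Words M v u →ₗ[K] Words M u w →ₗ[K] Q}
    (h : ∀ u s t, F u s t = G u s t) (s : Words M v w) : cut F s = cut G s := by
  have : F = G := by
    funext u
    exact lext fun s => lext fun t => h u s t
  rw [this]

lemma cut_add (F G : ∀ u, Words M v u →ₗ[K] Words M u w →ₗ[K] Q) (s : Words M v w) :
    cut (fun u => F u + G u) s = cut F s + cut G s := by
  simp only [cut, comp_apply]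
  generalize lift (split M) s = c
  induction c using Cuts.ind with
  | ha c d hc hd => simp only [map_add, hc, hd]; abel
  | ho z q r y s => simp only [Cuts.lift_of']; rfl

lemma map_cut {R : Type u} [AddCommGroup R] [Module K R] (g : Q →ₗ[K] R)
    (F : ∀ u, Words M v u →ₗ[K] Words M u w →ₗ[K] Q) (s : Words M v w) :
    g (cut F s) = cut (fun u => (F u).compr₂ g) s := by
  simp only [cut, comp_apply]
  generalize lift (split M) s = c
  induction c using Cuts.ind with
  | ha c d hc hd => simp only [map_add, hc, hd]
  | ho z q r y s => simp only [Cuts.lift_of']; rfl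

lemma cut_smul (c : K) (F : ∀ u, Words M v u →ₗ[K] Words M u w →ₗ[K] Q)
    (s : Words M v w) : cut (fun u => c • F u) s = c • cut F s := by
  have := map_cut (c • (LinearMap.id : Q →ₗ[K] Q)) F s
  simp only [lsmul_apply, id_apply] at this
  rw [this]
  rfl

lemma cut_zero (s : Words M v w) :
    cut (fun _ => (0 : Words M v _ →ₗ[K] Words M _ w →ₗ[K] Q)) s = 0 := by
  have := cut_smul (0 : K) (fun _ => (0 : Words M v _ →ₗ[K] Words M _ w →ₗ[K] Q)) s
  simpa using this

@[simp] lemma cut_nil (F : ∀ u, Words M v u →ₗ[K] Words M u v →ₗ[K] Q) :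
    cut F (nil M v) = F v (nil M v) (nil M v) := by
  rw [nil, cut_of, lift_split_nil]
  rfl

lemma cut_pre (F : ∀ u, Words M v u →ₗ[K] Words M u w →ₗ[K] Q) (x : Lt M v u)
    (s : Words M u w) : cut F (pre M v u w x s) = F v (nil M v) (pre M v u w x s) +
      cut (fun z => (F z).comp (pre M v u z x)) s := by
  induction x using Lt.ind with
  | ha x y hx hy =>
    simp only [map_add, ladd_apply, comp_add, hx, hy, cut_add]
    abel
  | ho n x =>
    induction s using DirectSum.induction_on with
    | zero => simp
    | add s t hs ht => simp only [map_add, hs, ht]; abel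
    | of p t =>
      change cut F (pre M v u w _ (of M p t)) = F v (nil M v) (pre M v u w _ (of M p t)) +
        cut _ (of M p t)
      rw [pre_of_of, cut_of, lift_split_cons, cut_of]
      congr 1
      generalize split M p t = c
      induction c using Cuts.ind with
      | ha c d hc hd => simp only [map_add, hc, hd]
      | ho z q r y s =>
        rw [Cuts.lift_of', Cuts.lift_of']
        simp only [comp_apply, rTensor_tmul, TensorProduct.lift.tmul, compl₁₂_apply, pre_of_of]

/-- Eliminate the first letter; the empty word goes to `0`. -/
def elim (g : ∀ u, Lt M v u →ₗ[K] Words M u w →ₗ[K] Q) : Words M v w →ₗ[K] Q :=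
  lift (fun p => match p with
    | .nil _ => 0
    | .cons v n (u := u) p => Tens.lift ((g u).compl₁₂ (Lt.of M n v u) (of M p)))

@[simp] lemma elim_nil (g : ∀ u, Lt M v u →ₗ[K] Words M u v →ₗ[K] Q) :
    elim g (nil M v) = 0 := by
  simp [elim, nil, lift_of]

@[simp] lemma elim_pre (g : ∀ u, Lt M v u →ₗ[K] Words M u w →ₗ[K] Q) (x : Lt M v u)
    (s : Words M u w) : elim g (pre M v u w x s) = g u x s := by
  induction x using Lt.ind with
  | ha x y hx hy => simp [hx, hy]
  | ho n x =>
    induction s using DirectSum.induction_on with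
    | zero => simp
    | add s t hs ht => simp only [map_add, hs, ht]
    | of p t =>
      change elim g (pre M v u w _ (of M p t)) = g u _ (of M p t)
      rw [pre_of_of, elim, lift_of, Tens.lift_cons]
      rfl

/-- The terms `(x y) ⊗ ± t` of `x ⊗ (y ⊗ t)`, where `P` consists of elements `x` with a right
action of the letters. -/
def circ {P : Type u} [AddCommGroup P] [Module K P]
    (g : ∀ u, P →ₗ[K] Lt M v u →ₗ[K] Words M u w →ₗ[K] Q) : P →ₗ[K] Words M v w →ₗ[K] Q :=
  (elim (fun u => LinearMap.lflip.comp (g u).flip)).flip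

section

variable {P : Type u} [AddCommGroup P] [Module K P] {v w : Γ}

@[simp] lemma circ_nil (g : ∀ u, P →ₗ[K] Lt M v u →ₗ[K] Words M u v →ₗ[K] Q) (x : P) :
    circ g x (nil M v) = 0 := by
  simp [circ]

@[simp] lemma circ_pre (g : ∀ u, P →ₗ[K] Lt M v u →ₗ[K] Words M u w →ₗ[K] Q) (x : P)
    (y : Lt M v u) (t : Words M u w) : circ g x (pre M v u w y t) = g u x y t := by
  simp [circ]

end

end Words

end Cut

/-! ### Derivations and coderivations -/

section Bar

variable (M : GBimod K Γ)

/-- The bar differential on all words. -/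
def barT (μ : ∀ {v w} (p : Wd Γ v w) (n : ℤ), Tens M p →ₗ[K] M.X n v w) (v w : Γ) :
    Words M v w →ₗ[K] Words M v w := lift (barB M μ)

/-- The operation `μ_1` on all letters. -/
def opD (μ : ∀ {v w} (p : Wd Γ v w) (n : ℤ), Tens M p →ₗ[K] M.X n v w) (v w : Γ) :
    Lt M v w →ₗ[K] Lt M v w :=
  Lt.lift (fun n => (Lt.of M _ v w).comp ((μ (.one v n w) ((Wd.one v n w).deg (-1) + 2)).comp
    (Tens.letter M v n w)))

/-- The operation `μ_2` on all letters. -/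
def opM (μ : ∀ {v w} (p : Wd Γ v w) (n : ℤ), Tens M p →ₗ[K] M.X n v w) (v u w : Γ) :
    Lt M v u →ₗ[K] Lt M u w →ₗ[K] Lt M v w :=
  Lt.lift (fun i => (Lt.lift (fun j => (((Tens.cons M v i (.one u j w)).compl₂
    (Tens.letter M u j w)).compr₂ ((Lt.of M _ v w).comp
      (μ (.two v i u j w) ((Wd.two v i u j w).deg (-1) + 2)))).flip)).flip)

variable {M}
variable (μ : ∀ {v w} (p : Wd Γ v w) (n : ℤ), Tens M p →ₗ[K] M.X n v w)

lemma opD_of (n : ℤ) (x : M.X n v w) :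
    opD M μ v w (Lt.of M n v w x) = Lt.of M ((Wd.one v n w).deg (-1) + 2) v w
      (μ (.one v n w) _ (Tens.letter M v n w x)) := by
  simp [opD]

lemma opM_of (i j : ℤ) (x : M.X i v u) (y : M.X j u w) :
    opM M μ v u w (Lt.of M i v u x) (Lt.of M j u w y) =
      Lt.of M ((Wd.two v i u j w).deg (-1) + 2) v w
        (μ (.two v i u j w) _ (Tens.cons M v i _ x (Tens.letter M u j w y))) := by
  simp [opM]

/-- The terms of the bar differential with `μ_2` applied to the two leftmost letters. -/
abbrev barCirc (v u w : Γ) : Lt M v u →ₗ[K] Words M u w →ₗ[K] Words M v w :=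
  circ (fun z => (opM M μ v u z).compr₂ ((pre M v z w).compl₂ (eps M z w)))

@[simp] lemma barT_nil (v : Γ) : barT M μ v v (nil M v) = 0 := by
  simp [barT, nil, lift_of, barB]

lemma barT_of (p : Wd Γ v w) (t : Tens M p) : barT M μ v w (of M p t) = barB M μ p t := by
  simp [barT, lift_of]

lemma barHead_tmul (n : ℤ) (p : Wd Γ u z) (q : Wd Γ z w)
    (s : Tens M (.cons v n p)) (t : Tens M q) : barHead M μ (.cons v n p) q (s ⊗ₜ t) =
      pre M v z w (Lt.of M _ v z (μ (.cons v n p) ((Wd.cons v n p).deg (-1) + 2) s))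
        (eps M z w (of M q t)) := by
  rw [barHead, if_neg (by simp [Wd.length]), eps_of, map_smul, pre_of_of, sgn_deg_neg_one]
  rfl

lemma lift_barHead_split {n : ℤ} {p : Wd Γ u w} (x : M.X n v u) (t : Tens M p) :
    Cuts.lift (fun _ q r => barHead M μ q r) (split M (.cons v n p) (Tens.cons M v n p x t)) =
      Cuts.lift (fun z q r => (barHead M μ (.cons v n q) r).comp
        (LinearMap.rTensor (Tens M r) (Tens.cons M v n q x))) (split M p t) := by
  rw [lift_split_cons]
  simp only [barHead, Wd.length, if_true, lzero_apply, zero_add]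

variable (hμ : ∀ {v w} (p : Wd Γ v w) (n : ℤ), 3 ≤ p.length → μ p n = 0)

include hμ in
lemma barT_pre (x : Lt M v u) (s : Words M u w) :
    barT M μ v w (pre M v u w x s) = pre M v u w x (barT M μ u w s) +
      pre M v u w (opD M μ v u x) (eps M u w s) + barCirc μ v u w x s := by
  have hz : ∀ {v w} (p : Wd Γ v w) (n : ℤ) (t : Tens M p), 3 ≤ p.length → μ p n t = 0 :=
    fun p n t h => by rw [hμ p n h, lzero_apply]
  induction x using Lt.ind with
  | ha x y hx hy => simp only [map_add, ladd_apply, hx, hy]; abel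
  | ho n x =>
    induction s using DirectSum.induction_on with
    | zero => simp
    | add s t hs ht => simp only [map_add, hs, ht]; abel
    | of p t =>
      change barT M μ v w (pre M v u w _ (of M p t)) = pre M v u w _ (barT M μ u w (of M p t)) +
        pre M v u w (opD M μ v u _) (eps M u w (of M p t)) + barCirc μ v u w _ (of M p t)
      rw [pre_of_of, barT_of, barB, ladd_apply, Tens.lift_cons, comp_apply, lift_barHead_split,
        barT_of, pre_of, add_assoc]
      congr 1
      cases p with
      | nil v =>
        rw [lift_split_nil, of_nil]
        simp only [comp_apply, rTensor_tmul, barHead_tmul, map_smul, circ_nil, smul_zero, add_zero,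
          eps_nil, of_nil, opD_of]
        rfl
      | cons u m p =>
        induction t using Tens.ind with
        | ha s t hs ht => simp only [map_add, hs, ht]; abel
        | hc y t =>
          rw [lift_split_cons, lift_split_of_cons_eq_zero]
          · simp only [comp_apply, rTensor_tmul, barHead_tmul, opD_of]
            congr 1
            rw [← pre_of_of, circ_pre]
            simp only [compr₂_apply, compl₂_apply, opM_of]
            rfl
          · intro z u' n' q r
            apply TensorProduct.ext'
            intro a b
            simp only [comp_apply, rTensor_tmul, barHead_tmul]
            rw [hz _ _ _ (by simp only [Wd.length]; omega)]
            simp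

end Bar

/-- Operations `d` and `m` on letters that satisfy the `A_∞`-relations, when all the others
vanish. -/
structure IsDGOps (M : GBimod K Γ) (d : ∀ v w, Lt M v w →ₗ[K] Lt M v w)
    (m : ∀ v u w, Lt M v u →ₗ[K] Lt M u w →ₗ[K] Lt M v w) : Prop where
  d_d : ∀ {v w} (x : Lt M v w), d v w (d v w x) = 0
  eps_d : ∀ {v w} (x : Lt M v w), Lt.eps M v w (d v w x) = - d v w (Lt.eps M v w x)
  eps_m : ∀ {v u w} (x : Lt M v u) (y : Lt M u w),
    Lt.eps M v w (m v u w x y) = - m v u w (Lt.eps M v u x) (Lt.eps M u w y)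
  leibniz : ∀ {v u w} (x : Lt M v u) (y : Lt M u w),
    d v w (m v u w x y) + m v u w x (d u w y) + m v u w (d v u x) (Lt.eps M u w y) = 0
  assoc : ∀ {v u w z} (x : Lt M v u) (y : Lt M u w) (a : Lt M w z),
    m v u z x (m u w z y a) + m v w z (m v u w x y) (Lt.eps M w z a) = 0

section BarSquare

variable {M : GBimod K Γ} (μ : ∀ {v w} (p : Wd Γ v w) (n : ℤ), Tens M p →ₗ[K] M.X n v w)
  (hμ : ∀ {v w} (p : Wd Γ v w) (n : ℤ), 3 ≤ p.length → μ p n = 0)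
  (H : IsDGOps M (opD M μ) (opM M μ))

include hμ H

lemma eps_barT (s : Words M v w) : eps M v w (barT M μ v w s) = - barT M μ v w (eps M v w s) := by
  have hc : ∀ {v u w : Γ} (x : Lt M v u) (s : Words M u w), eps M v w (barCirc μ v u w x s) =
        - barCirc μ v u w (Lt.eps M v u x) (eps M u w s) := by
    intro v u w x s
    induction s using ind' with
    | ha v s t hs ht => simp only [map_add, hs x, ht x, neg_add]
    | hs v c s hs => simp only [map_smul, hs x, smul_neg]
    | hn => simp
    | hp z u' y s _ => simp [H.eps_m]
  induction s using ind' with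
  | ha v x y hx hy => simp only [map_add, hx, hy, neg_add]
  | hs v c x hx => simp [hx]
  | hn => simp
  | hp v u x s h =>
    rw [barT_pre μ hμ, eps_pre, barT_pre μ hμ]
    simp only [map_add, eps_pre, h, hc, H.eps_d, map_neg, lneg_apply]
    abel

lemma barCirc_barCirc (x : Lt M v z) (y : Lt M z u) (t : Words M u w) :
    barCirc μ v z w x (barCirc μ z u w y t) =
      - barCirc μ v u w (opM M μ v z u x y) (eps M u w t) := by
  induction t using ind' with
  | ha v s t hs ht => simp only [map_add, hs y, ht y, neg_add]
  | hs v c s hs => simp only [map_smul, hs y, smul_neg]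
  | hn => simp
  | hp a b c r _ =>
    simp only [circ_pre, compr₂_apply, compl₂_apply, eps_pre, eps_eps]
    rw [eq_neg_iff_add_eq_zero, ← ladd_apply, ← map_add, H.assoc]
    simp

lemma barT_barCirc (x : Lt M v u) (s : Words M u w) :
    barT M μ v w (barCirc μ v u w x s) = - barCirc μ v u w x (barT M μ u w s) -
        barCirc μ v u w (opD M μ v u x) (eps M u w s) := by
  induction s using ind' with
  | ha v s t hs ht => simp only [map_add, hs x, ht x]; abel
  | hs v c s hs => simp only [map_smul, hs x, smul_sub, smul_neg]
  | hn => simp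
  | hp z u' y t _ =>
    simp only [map_add, circ_pre, eps_pre, compr₂_apply, compl₂_apply, eps_eps, barT_pre μ hμ,
      eps_barT μ hμ H, map_neg, barCirc_barCirc μ hμ H]
    have h2 : pre M v u' w (opD M μ v u' (opM M μ v z u' x y)) t =
        - (pre M v u' w (opM M μ v z u' x (opD M μ z u' y)) t +
          pre M v u' w (opM M μ v z u' (opD M μ v z x) (Lt.eps M z u' y)) t) := by
      rw [eq_neg_iff_add_eq_zero, ← add_assoc, ← ladd_apply, ← map_add, ← ladd_apply, ← map_add,
        H.leibniz x y]
      simp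
    rw [h2]
    abel

lemma barT_barT (s : Words M v w) : barT M μ v w (barT M μ v w s) = 0 := by
  induction s using ind' with
  | ha v x y hx hy => simp [hx, hy]
  | hs v c x hx => simp [hx]
  | hn => simp
  | hp v u x s h =>
    rw [barT_pre μ hμ, map_add, map_add, barT_pre μ hμ, barT_pre μ hμ, h, H.d_d, eps_barT μ hμ H,
      barT_barCirc μ hμ H]
    simp only [map_zero, map_neg, eps_eps, lzero_apply, add_zero, zero_add]
    abel

end BarSquare

/-! ### Letters under maps of bimodules -/

namespace Lt

variable {M N : GBimod K Γ}

/-- The map of letters induced by a map of graded bimodules. -/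
def map (f : ∀ n v w, M.X n v w →ₗ[K] N.X n v w) (v w : Γ) : Lt M v w →ₗ[K] Lt N v w :=
  lift (fun n => (of N n v w).comp (f n v w))

@[simp] lemma map_of (f : ∀ n v w, M.X n v w →ₗ[K] N.X n v w) (n : ℤ) (v w : Γ)
    (x : M.X n v w) : map f v w (of M n v w x) = of N n v w (f n v w x) := by
  simp [map]

lemma ext_comp {x y : Lt M v w} (h : ∀ n, comp M n v w x = comp M n v w y) : x = y :=
  DirectSum.ext_component K h

lemma comp_map (f : ∀ n v w, M.X n v w →ₗ[K] N.X n v w) (n : ℤ) (x : Lt M v w) :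
    comp N n v w (map f v w x) = f n v w (comp M n v w x) := by
  induction x using Lt.ind with
  | ha x y hx hy => simp [hx, hy]
  | ho m x =>
    by_cases h : m = n
    · subst h
      simp
    · simp [comp_of_ne _ h]

lemma map_injective (f : ∀ n v w, M.X n v w →ₗ[K] N.X n v w)
    (hf : ∀ n v w, Function.Injective (f n v w)) (v w : Γ) : Function.Injective (map f v w) := by
  intro x y h
  apply ext_comp
  intro n
  apply hf
  rw [← comp_map, h, comp_map]

lemma map_eps (f : ∀ n v w, M.X n v w →ₗ[K] N.X n v w) (x : Lt M v w) :
    map f v w (eps M v w x) = eps N v w (map f v w x) := by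
  induction x using Lt.ind with
  | ha x y hx hy => simp [hx, hy]
  | ho m x => simp

end Lt

lemma eps_opD {M : GBimod K Γ} (μ : ∀ {v w} (p : Wd Γ v w) (n : ℤ), Tens M p →ₗ[K] M.X n v w) (x : Lt M v w) :
    Lt.eps M v w (opD M μ v w x) = - opD M μ v w (Lt.eps M v w x) := by
  induction x using Lt.ind with
  | ha x y hx hy => simp only [map_add, hx, hy, neg_add]
  | ho n x =>
    rw [Lt.eps_of, map_smul, opD_of, Lt.eps_of, ← neg_smul]
    congr 1
    simp [Wd.deg, sgn_add]

lemma eps_opM {M : GBimod K Γ} (μ : ∀ {v w} (p : Wd Γ v w) (n : ℤ), Tens M p →ₗ[K] M.X n v w) (x : Lt M v u) (y : Lt M u w) :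
    Lt.eps M v w (opM M μ v u w x y) = - opM M μ v u w (Lt.eps M v u x) (Lt.eps M u w y) := by
  induction x using Lt.ind with
  | ha x x' hx hy => simp only [map_add, hx, hy, neg_add, ladd_apply]
  | ho n x =>
    induction y using Lt.ind with
    | ha y y' hx hy => simp only [map_add, hx, hy, neg_add]
    | ho m y =>
      rw [Lt.eps_of, Lt.eps_of, map_smul, map_smul, lsmul_apply, opM_of, Lt.eps_of, smul_smul,
        ← neg_smul]
      congr 1
      simp [Wd.deg, sgn_add]
      ring

namespace Words

variable {M N : GBimod K Γ}

@[simp] lemma map_nil (f : ∀ n v w, M.X n v w →ₗ[K] N.X n v w) (v : Γ) :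
    map f v v (nil M v) = nil N v := by
  rw [map, nil, lift_of, comp_apply, Tens.map, Tens.nilLift_apply]
  simp [nil]

@[simp] lemma map_pre (f : ∀ n v w, M.X n v w →ₗ[K] N.X n v w) (x : Lt M v u)
    (s : Words M u w) :
    map f v w (pre M v u w x s) = pre N v u w (Lt.map f v u x) (map f u w s) := by
  induction x using Lt.ind with
  | ha x y hx hy => simp [hx, hy]
  | ho n x =>
    induction s using DirectSum.induction_on with
    | zero => simp
    | add s t hs ht => simp only [map_add, hs, ht]
    | of p t =>
      change map f v w (pre M v u w _ (of M p t)) = pre N v u w _ (map f u w (of M p t))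
      rw [pre_of_of, map, lift_of, comp_apply, Tens.map_cons, ← pre_of_of, map, lift_of, Lt.map_of]
      rfl

@[simp] lemma map_concat (f : ∀ n v w, M.X n v w →ₗ[K] N.X n v w)
    (s : Words M v u) (t : Words M u w) :
    map f v w (concat M v u w s t) = concat N v u w (map f v u s) (map f u w t) := by
  induction s using ind' with
  | ha v x y hx hy => simp [hx, hy]
  | hs v c x hx => simp [hx]
  | hn => simp
  | hp v u x s h => simp [h]

lemma map_eps (f : ∀ n v w, M.X n v w →ₗ[K] N.X n v w)
    (s : Words M v w) : map f v w (eps M v w s) = eps N v w (map f v w s) := by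
  induction s using ind' with
  | ha v x y hx hy => simp [hx, hy]
  | hs v c x hx => simp [hx]
  | hn => simp
  | hp v u x s h => simp [h, Lt.map_eps]

end Words

/-! ### Differential graded algebras -/

namespace AugOps

variable (A : AugOps K Γ)

/-- All operations on all words. -/
def mTot (v w : Γ) : Words A.1 v w →ₗ[K] Lt A.1 v w :=
  lift (fun q => (Lt.of _ (q.deg (-1) + 2) v w).comp (A.m q (q.deg (-1) + 2)))

/-- The differential on all letters. -/
abbrev D (v w : Γ) : Lt A.1 v w →ₗ[K] Lt A.1 v w := opD A.1 A.m v w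

/-- The product on all letters. -/
abbrev P (v u w : Γ) : Lt A.1 v u →ₗ[K] Lt A.1 u w →ₗ[K] Lt A.1 v w := opM A.1 A.m v u w

lemma mTot_of (p : Wd Γ v w) (t : Tens A.1 p) :
    A.mTot v w (of _ p t) = Lt.of _ _ v w (A.m p (p.deg (-1) + 2) t) := by
  simp [mTot, lift_of]

lemma mTot_one (x : Lt A.1 v w) : A.mTot v w (pre _ v w w x (nil _ w)) = A.D v w x := by
  induction x using Lt.ind with
  | ha x y hx hy => simp only [map_add, ladd_apply, hx, hy]
  | ho n x =>
    rw [nil, pre_of_of, mTot_of, opD_of]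
    rfl

lemma mTot_two (x : Lt A.1 v u) (y : Lt A.1 u w) : A.mTot v w (pre _ v u w x
      (pre _ u w w y (nil _ w))) = A.P v u w x y := by
  induction x using Lt.ind with
  | ha x y hx hy => simp only [map_add, ladd_apply, hx, hy]
  | ho n x =>
    induction y using Lt.ind with
    | ha x y hx hy => simp only [map_add, ladd_apply, hx, hy]
    | ho m y =>
      rw [nil, pre_of_of, pre_of_of, mTot_of, opM_of]
      rfl

/-- Only the operations `m_1` and `m_2` do not vanish, and they have the right degrees. -/
structure IsShort : Prop where
  deg : ∀ {v w} (p : Wd Γ v w) (n : ℤ), p.deg (-1) + 2 ≠ n → A.m p n = 0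
  m_zero : ∀ {v w} (p : Wd Γ v w) (n : ℤ), p.length = 0 → A.m p n = 0
  m_three : A.NoHigher

variable {A}

lemma IsAugDGAlg.isShort (h : A.IsAugDGAlg) : A.IsShort := ⟨h.deg, h.m_zero, h.m_three⟩

namespace IsShort

variable (h : A.IsShort)

include h

lemma mTot_three (a : Lt A.1 v u) (b : Lt A.1 u z) (c : Lt A.1 z y) (s : Words A.1 y w) :
    A.mTot v w (pre _ v u w a (pre _ u z w b (pre _ z y w c s))) = 0 := by
  induction a using Lt.ind with
  | ha x y hx hy => simp only [map_add, ladd_apply, hx, hy, add_zero]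
  | ho i a =>
    induction b using Lt.ind with
    | ha x y hx hy => simp only [map_add, ladd_apply, hx, hy, add_zero]
    | ho j b =>
      induction c using Lt.ind with
      | ha x y hx hy => simp only [map_add, ladd_apply, hx, hy, add_zero]
      | ho k c =>
        induction s using DirectSum.induction_on with
        | zero => simp
        | add s t hs ht => simp only [map_add, hs, ht, add_zero]
        | of p t =>
          change A.mTot v w (pre _ v u w _ (pre _ u z w _ (pre _ z y w _ (of _ p t)))) = 0
          rw [pre_of_of, pre_of_of, pre_of_of, mTot_of, h.m_three _ _ (by
            simp only [Wd.length]; omega)]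
          simp

lemma comp_mTot (n : ℤ) (s : Words A.1 v w) :
    Lt.comp A.1 n v w (A.mTot v w s) = lift (fun q => A.m q n) s := by
  induction s using DirectSum.induction_on with
  | zero => simp
  | add s t hs ht => simp only [map_add, hs, ht]
  | of p t =>
    change Lt.comp A.1 n v w (A.mTot v w (of _ p t)) = lift _ (of _ p t)
    rw [mTot_of, lift_of]
    by_cases hn : p.deg (-1) + 2 = n
    · subst hn
      simp
    · rw [Lt.comp_of_ne _ hn, h.deg _ _ hn]
      simp

lemma barT_pre (x : Lt A.1 v u) (s : Words A.1 u w) : barT A.1 A.m v w (pre _ v u w x s) =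
      pre _ v u w x (barT A.1 A.m u w s) + pre _ v u w (A.D v u x) (eps _ u w s) +
      barCirc A.m v u w x s := Koszul.barT_pre A.m (fun p n hp => h.m_three p n hp) x s

lemma isDGOps (H : ∀ {v w} (s : Words A.1 v w),
    A.mTot v w (barT A.1 A.m v w s) = 0) : IsDGOps A.1 A.D A.P where
  eps_d x := eps_opD A.m x
  eps_m x y := eps_opM A.m x y
  d_d {v w} x := by
    have := H (pre _ v w w x (nil _ w))
    rw [h.barT_pre] at this
    simpa [mTot_one] using this
  leibniz {v u w} x y := by
    have := H (pre _ v u w x (pre _ u w w y (nil _ w)))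
    simp only [h.barT_pre, barT_nil, map_add, circ_pre, circ_nil, eps_pre, eps_nil, map_zero,
      zero_add, add_zero, compr₂_apply, compl₂_apply, mTot_one, mTot_two] at this
    rw [← this]
    abel
  assoc {v u w z} x y a := by
    have := H (pre _ v u z x (pre _ u w z y (pre _ w z z a (nil _ z))))
    simp only [h.barT_pre, barT_nil, map_add, circ_pre, circ_nil, eps_pre, eps_nil, map_zero,
      zero_add, add_zero, compr₂_apply, compl₂_apply, mTot_two, h.mTot_three] at this
    exact this

lemma mTot_barT (H : IsDGOps A.1 A.D A.P) (s : Words A.1 v w) :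
    A.mTot v w (barT A.1 A.m v w s) = 0 := by
  have h4 : ∀ {v u z y r w : Γ} (a : Lt A.1 v u) (b : Lt A.1 u z)
      (c : Lt A.1 z y) (d : Lt A.1 y r) (s : Words A.1 r w),
      A.mTot v w (barT A.1 A.m v w (pre _ v u w a (pre _ u z w b (pre _ z y w c
          (pre _ y r w d s))))) = 0 := by
    intro v u z y r w a b c d s
    simp only [h.barT_pre, map_add, circ_pre, eps_pre, add_zero, compr₂_apply, compl₂_apply,
      h.mTot_three]
  have h3 : ∀ {v u z w : Γ} (a : Lt A.1 v u) (b : Lt A.1 u z)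
      (s : Words A.1 z w) (c : Γ) (x : Lt A.1 c v), A.mTot c w (barT A.1 A.m c w (pre _ c v w x
        (pre _ v u w a (pre _ u z w b s)))) = 0 := by
    intro v u z w a b s
    induction s using ind' with
    | ha v s t hs ht => intro c x; simp only [map_add, hs b c x, ht b c x, add_zero]
    | hs v k s hs => intro c x; simp only [map_smul, hs b c x, smul_zero]
    | hp => intro c x; exact h4 _ _ _ _ _
    | hn =>
      intro c x
      simp only [h.barT_pre, barT_nil, map_add, circ_pre, circ_nil, eps_pre, eps_nil, map_zero,
        zero_add, add_zero, compr₂_apply, compl₂_apply, mTot_two, h.mTot_three]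
      exact H.assoc x a b
  have h2 : ∀ {v u w : Γ} (a : Lt A.1 v u) (s : Words A.1 u w) (c : Γ)
      (x : Lt A.1 c v), A.mTot c w (barT A.1 A.m c w (pre _ c v w x (pre _ v u w a s))) = 0 := by
    intro v u w a s
    induction s using ind' with
    | ha v s t hs ht => intro c x; simp only [map_add, hs a c x, ht a c x, add_zero]
    | hs v k s hs => intro c x; simp only [map_smul, hs a c x, smul_zero]
    | hp => intro c x; exact h3 _ _ _ _ _
    | hn =>
      intro c x
      simp only [h.barT_pre, barT_nil, map_add, circ_pre, circ_nil, eps_pre, eps_nil, map_zero,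
        zero_add, add_zero, compr₂_apply, compl₂_apply, mTot_one, mTot_two]
      rw [← H.leibniz x a]
      abel
  have h1 : ∀ {v w : Γ} (s : Words A.1 v w) (c : Γ) (x : Lt A.1 c v),
      A.mTot c w (barT A.1 A.m c w (pre _ c v w x s)) = 0 := by
    intro v w s
    induction s using ind' with
    | ha v s t hs ht => intro c x; simp only [map_add, hs c x, ht c x, add_zero]
    | hs v k s hs => intro c x; simp only [map_smul, hs c x, smul_zero]
    | hp => intro c x; exact h2 _ _ _ _
    | hn =>
      intro c x
      simp only [h.barT_pre, barT_nil, map_add, circ_nil, eps_nil, map_zero, zero_add, add_zero,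
        mTot_one]
      exact H.d_d x
  induction s using ind' with
  | ha v s t hs ht => simp only [map_add, hs, ht, add_zero]
  | hs v k s hs => simp only [map_smul, hs, smul_zero]
  | hp => exact h1 _ _ _
  | hn => simp

lemma rel (H : IsDGOps A.1 A.D A.P) (p : Wd Γ v w) (n : ℤ)
    (t : Tens A.1 p) : lift (fun q => A.m q n) (barB A.1 A.m p t) = 0 := by
  rw [← barT_of A.m p t, ← h.comp_mTot, h.mTot_barT H, map_zero]

end IsShort

lemma IsAugDGAlg.isDGOps (h : A.IsAugDGAlg) : IsDGOps A.1 A.D A.P := by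
  refine h.isShort.isDGOps (fun {v w} s => ?_)
  apply Lt.ext_comp
  intro n
  rw [h.isShort.comp_mTot, map_zero]
  induction s using DirectSum.induction_on with
  | zero => simp
  | add s t hs ht => simp only [map_add, hs, ht, add_zero]
  | of p t =>
    change lift _ (barT A.1 A.m v w (of _ p t)) = 0
    rw [barT_of]
    exact h.rel p n t

/-! #### The augmentation ideal -/

variable (A)

/-- The inclusion of the augmentation ideal. -/
abbrev augIncl (v w : Γ) : Lt A.aug v w →ₗ[K] Lt A.1 v w := Lt.map (A.1.kerIncl A.ε) v w

lemma augIncl_injective (v w : Γ) : Function.Injective (A.augIncl v w) :=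
  Lt.map_injective _ (fun n v w => Submodule.subtype_injective _) v w

/-- The differential on the augmentation ideal. -/
abbrev DAug (v w : Γ) : Lt A.aug v w →ₗ[K] Lt A.aug v w := opD A.aug A.mAug v w

/-- The product on the augmentation ideal. -/
abbrev PAug (v u w : Γ) : Lt A.aug v u →ₗ[K] Lt A.aug u w →ₗ[K] Lt A.aug v w :=
  opM A.aug A.mAug v u w

lemma kerIncl_mAug (p : Wd Γ v w) (n : ℤ) (hp : p.length ≠ 0) (t : Tens A.aug p) :
    A.1.kerIncl A.ε n v w (A.mAug p n t) = A.m p n (Tens.map (A.1.kerIncl A.ε) p t) := by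
  rw [mAug, dif_neg hp]
  rfl

lemma tensMap_letter {M N : GBimod K Γ} (f : ∀ n v w, M.X n v w →ₗ[K] N.X n v w) (n : ℤ) (x : M.X n v w) : Tens.map f (.one v n w) (Tens.letter M v n w x) =
      Tens.letter N v n w (f n v w x) := by
  rw [Tens.letter, flip_apply, Tens.map_cons, Tens.map, Tens.nilLift_apply]
  simp [Tens.letter]

@[simp] lemma augIncl_D (x : Lt A.aug v w) :
    A.augIncl v w (A.DAug v w x) = A.D v w (A.augIncl v w x) := by
  induction x using Lt.ind with
  | ha x y hx hy => simp only [map_add, hx, hy]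
  | ho n x =>
    rw [opD_of, Lt.map_of, Lt.map_of, opD_of, kerIncl_mAug _ _ _ (by simp [Wd.length]),
      tensMap_letter]

@[simp] lemma augIncl_P (x : Lt A.aug v u) (y : Lt A.aug u w) :
    A.augIncl v w (A.PAug v u w x y) = A.P v u w (A.augIncl v u x) (A.augIncl u w y) := by
  induction x using Lt.ind with
  | ha x y hx hy => simp only [map_add, hx, hy, ladd_apply]
  | ho n x =>
    induction y using Lt.ind with
    | ha x y hx hy => simp only [map_add, hx, hy]
    | ho m y =>
      rw [opM_of, Lt.map_of, Lt.map_of, Lt.map_of, opM_of, kerIncl_mAug _ _ _ (by simp [Wd.length]),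
        Tens.map_cons, tensMap_letter]

lemma mAug_three (h : A.NoHigher)
    (p : Wd Γ v w) (n : ℤ) (hp : 3 ≤ p.length) : A.mAug p n = 0 := by
  ext1 t
  apply Subtype.ext
  change A.1.kerIncl A.ε n v w (A.mAug p n t) = 0
  rw [kerIncl_mAug _ _ _ (by omega), h _ _ hp, lzero_apply]

variable {A}

lemma isDGOps_aug (H : IsDGOps A.1 A.D A.P) : IsDGOps A.aug A.DAug A.PAug where
  eps_d x := eps_opD A.mAug x
  eps_m x y := eps_opM A.mAug x y
  d_d {v w} x := by
    apply A.augIncl_injective v w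
    rw [augIncl_D, augIncl_D, H.d_d, map_zero]
  leibniz {v u w} x y := by
    apply A.augIncl_injective v w
    simp only [map_add, augIncl_D, augIncl_P, map_zero, Lt.map_eps]
    exact H.leibniz _ _
  assoc {v u w z} x y a := by
    apply A.augIncl_injective v z
    simp only [map_add, augIncl_P, map_zero, Lt.map_eps]
    exact H.assoc _ _ _

end AugOps

lemma Piece.mem_hom {ι : Type u} (V : ι → Type u) [∀ i, AddCommGroup (V i)]
    [∀ i, Module K (V i)] (deg : ι → ℤ) {n : ℤ} {x : ⨁ i, V i}
    (h : ∀ i, deg i ≠ n → x i = 0) : x ∈ Piece.hom K V deg n := by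
  rw [← DirectSum.sum_support_of x]
  refine Submodule.sum_mem _ fun i _ => ?_
  by_cases hi : deg i = n
  · exact hi ▸ Piece.lof_mem V deg i (x i)
  · rw [h i hi, map_zero]
    exact Submodule.zero_mem _

lemma Tens.subsingleton_or {M : GBimod K Γ} {b : ℤ} (hM : ∀ n v w, b < n → Subsingleton (M.X n v w))
    (c : ℤ) (p : Wd Γ v w) : Subsingleton (Tens M p) ∨ p.deg c ≤ (b + c) * p.length := by
  induction p with
  | nil => right; simp [Wd.deg, Wd.length]
  | cons v n p ih =>
    rename_i u w
    by_cases hn : b < n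
    · left
      have := hM n v u hn
      refine ⟨fun s t => ?_⟩
      have h0 : ∀ s : Tens M (.cons v n p), s = 0 := by
        intro s
        induction s using Tens.ind with
        | ha s t hs ht => rw [hs, ht, add_zero]
        | hc x t => rw [Subsingleton.elim x 0, map_zero, lzero_apply]
      rw [h0 s, h0 t]
    · rcases ih with h | h
      · left
        refine ⟨fun s t => ?_⟩
        have h0 : ∀ s : Tens M (.cons v n p), s = 0 := by
          intro s
          induction s using Tens.ind with
          | ha s t hs ht => rw [hs, ht, add_zero]
          | hc x t => rw [Subsingleton.elim t 0, map_zero]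
        rw [h0 s, h0 t]
      · right
        simp only [Wd.deg, Wd.length]
        push_cast
        linarith

namespace Words

variable {M N : GBimod K Γ}

lemma map_mem_hom (f : ∀ n v w, M.X n v w →ₗ[K] N.X n v w) {c n : ℤ}
    {x : Words M v w} (hx : x ∈ hom M c n v w) : map f v w x ∈ hom N c n v w := by
  refine hom_induction (map f v w) _ (fun p t hp => ?_) hx
  rw [map, lift_of]
  exact of_mem_hom' p hp _

lemma hom_eq_zero {c n : ℤ} {Q : Type*} [AddCommGroup Q] [Module K Q]
    (f : Words M v w →ₗ[K] Q) (h : ∀ p t, p.deg c = n → f (of M p t) = 0) {x : Words M v w}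
    (hx : x ∈ hom M c n v w) : f x = 0 := by
  have := hom_induction f ⊥ (fun p t hp => by rw [h p t hp]; exact Submodule.zero_mem _) hx
  simpa using this

lemma counit_hom {c n : ℤ} {x : Words M v w} (hx : x ∈ hom M c n v w)
    (h : ¬ (n = 0 ∧ v = w)) : counit M v w x = 0 := by
  refine hom_eq_zero _ (fun p t hp => ?_) hx
  cases p with
  | nil => exact absurd ⟨hp.symm, rfl⟩ h
  | cons v n p => exact counit_of_cons M n p t

@[simp] lemma counit_unit (v : Γ) : counit M v v (unit M v v) = 1 := by simp

lemma counit_eps (s : Words M v w) : counit M v w (eps M v w s) = counit M v w s := by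
  induction s using ind' with
  | ha v x y hx hy => simp [hx, hy]
  | hs v c x hx => simp [hx]
  | hn => simp
  | hp v u x s h => simp

end Words

/-! ### The letters of a graded bimodule of words -/

section WordLetters

variable (M : GBimod K Γ) (c : ℤ)

/-- The letters of the bimodule of words are words. -/
def wordsEquiv (v w : Γ) : Lt (wordsGr M c) v w ≃ₗ[K] Words M v w :=
  LinearEquiv.ofLinearMap (Lt.lift (fun n => wIncl M c n v w))
    (lift (fun p => (Lt.of (wordsGr M c) (p.deg c) v w).comp
      (DirectSum.lof K {q : Wd Γ v w // q.deg c = p.deg c} (fun q => Tens M q.1) ⟨p, rfl⟩))) (by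
      apply DirectSum.linearMap_ext
      intro p
      ext1 t
      rw [comp_apply, comp_apply, comp_apply]
      refine (congrArg _ (lift_of M _ p t)).trans ?_
      rw [comp_apply, Lt.lift_of]
      exact Piece.incl_lof _ _ _ _ _)
    (by
      apply Lt.hom_ext
      intro n x
      rw [comp_apply, Lt.lift_of]
      induction x using DirectSum.induction_on with
      | zero => simp
      | add x y hx hy => simp only [map_add, hx, hy]
      | of p t =>
        obtain ⟨p, rfl⟩ := p
        have : wIncl M c (p.deg c) v w (DirectSum.lof K {q : Wd Γ v w // q.deg c = p.deg c}
            (fun q => Tens M q.1) ⟨p, rfl⟩ t) = of M p t := Piece.incl_lof _ _ _ _ _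
        change lift _ (wIncl M c (p.deg c) v w (DirectSum.lof K
          {q : Wd Γ v w // q.deg c = p.deg c} (fun q => Tens M q.1) ⟨p, rfl⟩ t)) = _
        rw [this, lift_of]
        rfl)

variable {M c}

@[simp] lemma wordsEquiv_of (n : ℤ) (x : (wordsGr M c).X n v w) :
    wordsEquiv M c v w (Lt.of _ n v w x) = wIncl M c n v w x :=
  Lt.lift_of _ n x

lemma wIncl_mem (n : ℤ) (x : (wordsGr M c).X n v w) :
    wIncl M c n v w x ∈ hom M c n v w := Piece.incl_mem _ _ n x

@[simp] lemma wProj_wIncl (n : ℤ) (x : (wordsGr M c).X n v w) :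
    wProj M c n v w (wIncl M c n v w x) = x := Piece.proj_incl _ _ n x

lemma wIncl_wProj {n : ℤ} {x : Words M v w} (hx : x ∈ hom M c n v w) :
    wIncl M c n v w (wProj M c n v w x) = x := Piece.incl_proj _ _ hx

lemma wProj_ne {m n : ℤ} {x : Words M v w} (hx : x ∈ hom M c n v w)
    (h : n ≠ m) : wProj M c m v w x = 0 := Piece.proj_ne _ _ hx h

lemma wordsEquiv_eps (hc : sgn K c = -1) (x : Lt (wordsGr M c) v w) :
    wordsEquiv M c v w (Lt.eps _ v w x) = - eps M v w (wordsEquiv M c v w x) := by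
  induction x using Lt.ind with
  | ha x y hx hy => simp only [map_add, hx, hy, neg_add]
  | ho n x =>
    rw [Lt.eps_of, map_smul, wordsEquiv_of, eps_hom hc (wIncl_mem n x), sgn_add, sgn_one]
    simp

end WordLetters

/-! ### Derivations of the tensor algebra -/

section Cobar

variable {M : GBimod K Γ}

variable (δ : ∀ n v w, M.X n v w →ₗ[K] Words M v w)

/-- The derivation that extends `δ`, on all words. -/
def cobarT (v w : Γ) : Words M v w →ₗ[K] Words M v w := lift (cobarD M δ)

/-- `δ` on all letters. -/
abbrev cobarδ (v w : Γ) : Lt M v w →ₗ[K] Words M v w := Lt.lift (fun n => δ n v w)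

@[simp] lemma cobarT_nil (v : Γ) : cobarT δ v v (nil M v) = 0 := by
  simp [cobarT, nil, lift_of, cobarD]

@[simp] lemma cobarT_pre (x : Lt M v u) (s : Words M u w) :
    cobarT δ v w (pre M v u w x s) = pre M v u w x (cobarT δ u w s) +
      concat M v u w (cobarδ δ v u x) (eps M u w s) := by
  induction x using Lt.ind with
  | ha x y hx hy => simp only [map_add, ladd_apply, hx, hy]; abel
  | ho n x =>
    induction s using DirectSum.induction_on with
    | zero => simp
    | add s t hs ht => simp only [map_add, hs, ht]; abel
    | of p t =>
      change cobarT δ v w (pre M v u w _ (of M p t)) = pre M v u w _ (cobarT δ u w (of M p t)) +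
        concat M v u w _ (eps M u w (of M p t))
      rw [pre_of_of, cobarT, lift_of, cobarD, Tens.lift_cons, cobarT, lift_of, pre_of, eps_of,
        Lt.lift_of, map_smul]
      rfl

lemma cobarT_concat (s : Words M v u) (t : Words M u w) :
    cobarT δ v w (concat M v u w s t) = concat M v u w s (cobarT δ u w t) +
      concat M v u w (cobarT δ v u s) (eps M u w t) := by
  induction s using ind' with
  | ha v x y hx hy => simp only [map_add, ladd_apply, hx, hy]; abel
  | hs v c x hx => simp [hx]
  | hn => simp
  | hp v u x s h =>
    simp only [pre_concat, cobarT_pre, h, map_add, ladd_apply, concat_assoc, eps_concat, add_assoc]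

variable (hδ : ∀ {v w : Γ} (x : Lt M v w),
  eps M v w (cobarδ δ v w x) = - cobarδ δ v w (Lt.eps M v w x))

include hδ in
lemma eps_cobarT (s : Words M v w) :
    eps M v w (cobarT δ v w s) = - cobarT δ v w (eps M v w s) := by
  induction s using ind' with
  | ha v x y hx hy => simp only [map_add, hx, hy]; abel
  | hs v c x hx => simp [hx]
  | hn => simp
  | hp v u x s h =>
    simp only [eps_pre, cobarT_pre, map_add, eps_concat, h, hδ, map_neg, lneg_apply, neg_add]

include hδ in
lemma cobarT_cobarT (hδ2 : ∀ {v w : Γ} (x : Lt M v w), cobarT δ v w (cobarδ δ v w x) = 0) (s : Words M v w) : cobarT δ v w (cobarT δ v w s) = 0 := by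
  induction s using ind' with
  | ha v x y hx hy => simp only [map_add, hx, hy, add_zero]
  | hs v c x hx => simp [hx]
  | hn => simp
  | hp v u x s h =>
    simp only [cobarT_pre, map_add, h, cobarT_concat, hδ2, eps_cobarT δ hδ, map_neg, map_zero,
      lzero_apply]
    abel

lemma cobarT_map {N : GBimod K Γ} (f : ∀ n v w, M.X n v w →ₗ[K] N.X n v w)
    (δ' : ∀ n v w, N.X n v w →ₗ[K] Words N v w)
    (hf : ∀ n v w x, map f v w (δ n v w x) = δ' n v w (f n v w x))
    (s : Words M v w) : map f v w (cobarT δ v w s) = cobarT δ' v w (map f v w s) := by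
  have hf' : ∀ {v w : Γ} (x : Lt M v w),
      map f v w (cobarδ δ v w x) = cobarδ δ' v w (Lt.map f v w x) := by
    intro v w x
    induction x using Lt.ind with
    | ha x y hx hy => simp only [map_add, hx, hy]
    | ho n x => simp [hf]
  induction s using ind' with
  | ha v x y hx hy => simp only [map_add, hx, hy]
  | hs v c x hx => simp [hx]
  | hn => simp
  | hp v u x s h => simp [h, hf', map_eps]

lemma cobarT_mem_hom (hδ : ∀ n v w x, δ n v w x ∈ hom M 1 (n + 2) v w) {n k : ℤ}
    (hk : n + 1 = k) {x : Words M v w} (hx : x ∈ hom M 1 n v w) :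
    cobarT δ v w x ∈ hom M 1 k v w := by
  have : ∀ {v w : Γ} (p : Wd Γ v w) (t : Tens M p) (k : ℤ), p.deg 1 + 1 = k →
      cobarT δ v w (of M p t) ∈ hom M 1 k v w := by
    intro v w p
    induction p with
    | nil v => intro t k _; rw [of_nil]; simp
    | cons v n p ih =>
      intro t k hk
      induction t using Tens.ind with
      | ha s t hs ht => simpa only [map_add] using Submodule.add_mem _ hs ht
      | hc x t =>
        rw [← pre_of_of, cobarT_pre]
        simp only [Wd.deg] at hk
        refine Submodule.add_mem _ (pre_mem_hom n _ x (ih t _ rfl) (by omega)) ?_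
        rw [eps_of, map_smul, Lt.lift_of]
        exact Submodule.smul_mem _ _ (concat_mem_hom (hδ n _ _ x) (of_mem_hom 1 p t) (by omega))
  exact hom_induction _ _ (fun p t hp => this p t k (by omega)) hx

lemma eps_cobarδ (hδ : ∀ n v w x, δ n v w x ∈ hom M 1 (n + 2) v w)
    (x : Lt M v w) : eps M v w (cobarδ δ v w x) = - cobarδ δ v w (Lt.eps M v w x) := by
  induction x using Lt.ind with
  | ha x y hx hy => simp only [map_add, hx, hy, neg_add]
  | ho n x =>
    rw [Lt.eps_of, map_smul, Lt.lift_of, eps_hom (by simp) (hδ n v w x), sgn_add, sgn_add, sgn_two,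
      sgn_one]
    simp

end Cobar

/-! ### The cobar construction is an augmented algebra -/

namespace AInfCoalg

variable (C : AInfCoalg K Γ)

lemma Δ_mem_hom (n : ℤ) (v w : Γ) (x : C.X n v w) : C.Δ n v w x ∈ hom C.toGBimod 1 (n + 2) v w :=
  Piece.mem_hom _ _ (fun p hp => C.Δ_deg n v w x p hp)

lemma coaugΔ_proj (n : ℤ) (v w : Γ) (x : C.X n v w) :
    C.coaugΔ n v w (C.coaugProj n v w x) = map C.coaugProj v w (C.Δ n v w x) := rfl

lemma coaugProj_surjective (n : ℤ) (v w : Γ) : Function.Surjective (C.coaugProj n v w) :=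
  Submodule.mkQ_surjective _

lemma coaugΔ_mem_hom (n : ℤ) (v w : Γ) (x : C.coaug.X n v w) :
    C.coaugΔ n v w x ∈ hom C.coaug 1 (n + 2) v w := by
  obtain ⟨x, rfl⟩ := C.coaugProj_surjective n v w x
  rw [coaugΔ_proj]
  exact map_mem_hom _ (C.Δ_mem_hom n v w x)

/-- The differential of the cobar construction, on all words. -/
abbrev DΩ (v w : Γ) : Words C.coaug v w →ₗ[K] Words C.coaug v w := cobarT C.coaugΔ v w

lemma DΩ_δ (x : Lt C.coaug v w) : C.DΩ v w (cobarδ C.coaugΔ v w x) = 0 := by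
  induction x using Lt.ind with
  | ha x y hx hy => simp only [map_add, hx, hy, add_zero]
  | ho n x =>
    obtain ⟨x, rfl⟩ := C.coaugProj_surjective n v w x
    rw [Lt.lift_of, coaugΔ_proj, ← cobarT_map C.Δ C.coaugProj _ (fun _ _ _ _ => rfl)]
    have := C.Δ_rel n v w x
    rw [cobarT, this, map_zero]

lemma eps_DΩ (s : Words C.coaug v w) : eps _ v w (C.DΩ v w s) = - C.DΩ v w (eps _ v w s) :=
  eps_cobarT _ (eps_cobarδ _ C.coaugΔ_mem_hom) s

lemma DΩ_DΩ (s : Words C.coaug v w) : C.DΩ v w (C.DΩ v w s) = 0 :=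
  cobarT_cobarT _ (eps_cobarδ _ C.coaugΔ_mem_hom) C.DΩ_δ s

lemma DΩ_mem_hom {n k : ℤ} (hk : n + 1 = k) {x : Words C.coaug v w}
    (hx : x ∈ hom C.coaug 1 n v w) : C.DΩ v w x ∈ hom C.coaug 1 k v w :=
  cobarT_mem_hom _ C.coaugΔ_mem_hom hk hx

lemma unletter_letter {M : GBimod K Γ} (n : ℤ) (x : M.X n v w) :
    Tens.unletter v n w (Tens.letter M v n w x) = x := by
  rw [Tens.letter, flip_apply, Tens.unletter, Tens.lift_cons]
  simp

lemma cobarM_one (i n : ℤ) (x : (wordsGr C.coaug 1).X i v w) :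
    C.cobarM (.one v i w) n (Tens.letter _ v i w x) =
      wProj C.coaug 1 n v w (C.DΩ v w (wIncl C.coaug 1 i v w x)) := by
  change wProj C.coaug 1 n v w (C.DΩ v w (wIncl C.coaug 1 i v w
    (Tens.unletter v i w (Tens.letter _ v i w x)))) = _
  rw [unletter_letter]

lemma cobarM_two (i j n : ℤ) (x : (wordsGr C.coaug 1).X i v u) (y : (wordsGr C.coaug 1).X j u w) :
    C.cobarM (.two v i u j w) n (Tens.cons _ v i _ x (Tens.letter _ u j w y)) =
      sgn K j • wProj C.coaug 1 n v w (concat _ v u w (wIncl C.coaug 1 i v u x)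
        (wIncl C.coaug 1 j u w y)) := by
  rw [cobarM, lsmul_apply]
  congr 1
  refine (Tens.lift_cons _ _ x _).trans ?_
  simp only [compl₂_apply]
  erw [unletter_letter]
  rfl

lemma cobar_isShort : C.cobar.IsShort where
  deg {v w} p n hp := by
    match p with
    | .nil _ => rfl
    | .cons v i (.nil w) =>
      ext1 t
      obtain ⟨x, rfl⟩ : ∃ x, Tens.letter _ v i w x = t := by
        induction t using Tens.ind with
        | ha s t hs ht =>
          obtain ⟨x, hx⟩ := hs
          obtain ⟨y, hy⟩ := ht
          exact ⟨x + y, by rw [map_add, hx, hy]⟩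
        | hc x t =>
          refine ⟨(Tens.nilEquiv _ w).symm t • x, ?_⟩
          rw [map_smul, Tens.letter, flip_apply, ← map_smul, ← map_smul, smul_eq_mul, mul_one,
            LinearEquiv.apply_symm_apply]
      refine (C.cobarM_one i n x).trans ?_
      rw [wProj_ne (C.DΩ_mem_hom rfl (wIncl_mem i x)) (by simp only [Wd.deg] at hp; omega)]
      rfl
    | .cons v i (.cons u j (.nil w)) =>
      ext1 t
      induction t using Tens.ind with
      | ha s t hs ht => simp only [map_add, hs, ht]
      | hc x t =>
        simp only [Wd.deg] at hp
        refine (congrArg (fun z : (wordsGr C.coaug 1).X n v w => sgn K j • z) (Tens.lift_cons _ _ x t)).trans ?_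
        simp only [compl₂_apply, compr₂_apply, compl₁₂_apply]
        rw [wProj_ne (concat_mem_hom (wIncl_mem i x) (wIncl_mem j _) rfl) (by omega)]
        simp
    | .cons _ _ (.cons _ _ (.cons _ _ _)) => rfl
  m_zero {v w} p n hp := by
    match p with
    | .nil _ => rfl
    | .cons v i q => simp [Wd.length] at hp
  m_three {v w} p n hp := by
    match p with
    | .nil _ => rfl
    | .cons v i (.nil w) => simp [Wd.length] at hp
    | .cons v i (.cons u j (.nil w)) => simp [Wd.length] at hp
    | .cons _ _ (.cons _ _ (.cons _ _ _)) => rfl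

/-- The elements of the cobar construction are words. -/
abbrev Ω (v w : Γ) : Lt C.cobar.1 v w ≃ₗ[K] Words C.coaug v w := wordsEquiv C.coaug 1 v w

lemma Ω_eps (x : Lt (wordsGr C.coaug 1) v w) :
    C.Ω v w (Lt.eps (wordsGr C.coaug 1) v w x) = - eps _ v w (C.Ω v w x) :=
  wordsEquiv_eps (by simp) x

lemma Ω_D (x : Lt C.cobar.1 v w) : C.Ω v w (C.cobar.D v w x) = C.DΩ v w (C.Ω v w x) := by
  induction x using Lt.ind with
  | ha x y hx hy => simp only [map_add, hx, hy]
  | ho n x =>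
    rw [opD_of, wordsEquiv_of, wordsEquiv_of]
    refine (congrArg _ (C.cobarM_one n _ x)).trans ?_
    rw [wIncl_wProj (C.DΩ_mem_hom (by simp only [Wd.deg]; omega) (wIncl_mem n x))]

lemma Ω_P (x : Lt C.cobar.1 v u) (y : Lt C.cobar.1 u w) : C.Ω v w (C.cobar.P v u w x y) =
      concat _ v u w (C.Ω v u x) (eps _ u w (C.Ω u w y)) := by
  induction x using Lt.ind with
  | ha x y hx hy => simp only [map_add, ladd_apply, hx, hy]
  | ho n x =>
    induction y using Lt.ind with
    | ha x y hx hy => simp only [map_add, hx, hy]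
    | ho m y =>
      rw [opM_of, wordsEquiv_of, wordsEquiv_of, wordsEquiv_of]
      refine (congrArg _ (C.cobarM_two n m _ x y)).trans ?_
      rw [map_smul, wIncl_wProj (concat_mem_hom (wIncl_mem n x) (wIncl_mem m y)
        (by simp only [Wd.deg]; omega)), eps_hom (by simp) (wIncl_mem m y), map_smul]

lemma cobar_isDGOps : IsDGOps C.cobar.1 C.cobar.D C.cobar.P where
  eps_d x := eps_opD C.cobar.m x
  eps_m x y := eps_opM C.cobar.m x y
  d_d {v w} x := by
    apply (C.Ω v w).injective
    rw [Ω_D, Ω_D, DΩ_DΩ, map_zero]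
  leibniz {v u w} x y := by
    apply (C.Ω v w).injective
    simp only [map_add, Ω_D, Ω_P, Ω_eps, cobarT_concat, eps_DΩ, map_neg, eps_eps, map_zero]
    abel
  assoc {v u w z} x y a := by
    apply (C.Ω v z).injective
    simp only [map_add, Ω_P, Ω_eps, eps_concat, eps_eps, map_neg, map_zero, concat_assoc]
    abel

lemma cobar_isAugDGAlg : C.cobar.IsAugDGAlg where
  deg := C.cobar_isShort.deg
  m_zero := C.cobar_isShort.m_zero
  m_three := C.cobar_isShort.m_three
  rel p n t := C.cobar_isShort.rel C.cobar_isDGOps p n t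
  m1_one j v := by
    refine (C.cobarM_one 0 j (wProj C.coaug 1 0 v v (unit _ v v))).trans ?_
    rw [wIncl_wProj (by rw [unit_self']; exact nil_mem_hom 1 v), unit_self', cobarT_nil, map_zero]
  m2_one n v w x := by
    refine (C.cobarM_two n 0 n x _).trans ?_
    rw [wIncl_wProj (by rw [unit_self']; exact nil_mem_hom 1 w), unit_self', concat_nil,
      wProj_wIncl, sgn_zero, one_smul]
  one_m2 n v w x := by
    refine (C.cobarM_two 0 n n _ x).trans ?_
    rw [wIncl_wProj (by rw [unit_self']; exact nil_mem_hom 1 v), unit_self', nil_concat,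
      wProj_wIncl]
  ε_zero n v w h := by
    refine lext fun x => ?_
    exact counit_hom (wIncl_mem n x) h
  ε_one v := by
    change counit _ v v (wIncl _ _ _ _ _ (wProj _ _ _ _ _ (unit _ v v))) = 1
    rw [wIncl_wProj (by rw [unit_self']; exact nil_mem_hom 1 v), counit_unit]
  ε_d i j v w x := by
    change counit _ v w (wIncl _ _ _ _ _ (C.cobarM (.one v i w) j (Tens.letter _ v i w x))) = 0
    rw [cobarM_one]
    apply counit_wIncl_wProj
    generalize wIncl C.coaug 1 i v w x = s
    induction s using DirectSum.induction_on with
    | zero => simp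
    | add s t hs ht => simp only [map_add, hs, ht, add_zero]
    | of p t =>
      change counit _ _ _ (cobarT C.coaugΔ v w (of _ p t)) = 0
      rw [cobarT, lift_of]
      exact counit_cobarD _ _ C.counit_coaugΔ p t
  ε_m2 i j v u w x y := by
    change counit _ v w (wIncl _ _ _ _ _ (C.cobarM (.two v i u j w) (i + j)
      (Tens.cons _ v i _ x (Tens.letter _ u j w y)))) =
      counit _ v u (wIncl _ _ _ _ _ x) * counit _ u w (wIncl _ _ _ _ _ y)
    rw [cobarM_two, map_smul, map_smul,
      wIncl_wProj (concat_mem_hom (wIncl_mem i x) (wIncl_mem j y) rfl), counit_concat]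
    by_cases hj : j = 0
    · subst hj
      simp
    · rw [counit_hom (wIncl_mem j y) (fun h => hj h.1)]
      simp

variable (hconn : C.toGBimod.IsConnected C.η) (hsc : ∀ v w, Subsingleton (C.X (-1) v w))

include hconn hsc

lemma coaug_subsingleton (n : ℤ) (v w : Γ) (hn : -2 < n) : Subsingleton (C.coaug.X n v w) := by
  refine ⟨fun x y => ?_⟩
  obtain ⟨x, rfl⟩ := C.coaugProj_surjective n v w x
  obtain ⟨y, rfl⟩ := C.coaugProj_surjective n v w y
  rcases lt_trichotomy n 0 with h | rfl | h
  · obtain rfl : n = -1 := by omega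
    have := hsc v w
    rw [Subsingleton.elim x y]
  · obtain ⟨r, rfl⟩ := hconn.zero v w x
    obtain ⟨s, rfl⟩ := hconn.zero v w y
    rw [map_smul, map_smul, coaugProj_η, smul_zero, smul_zero]
  · have := hconn.pos n v w h
    rw [Subsingleton.elim x y]

lemma coaug_tens (p : Wd Γ v w) : Subsingleton (Tens C.coaug p) ∨ p.deg 1 ≤ - p.length := by
  have := Tens.subsingleton_or (C.coaug_subsingleton hconn hsc) 1 p
  simpa using this

lemma cobar_isConnected : C.cobar.1.IsConnected C.cobar.one where
  pos n v w hn := by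
    refine ⟨fun x y => ?_⟩
    have h0 : ∀ x : C.cobar.X n v w, x = 0 := by
      intro x
      have := hom_eq_zero LinearMap.id (fun p t hp => ?_) (wIncl_mem n x)
      · rw [← wProj_wIncl n x]
        rw [id_apply] at this
        rw [this, map_zero]
      · rcases C.coaug_tens hconn hsc p with h | h
        · rw [Subsingleton.elim t 0, map_zero, map_zero]
        · omega
    rw [h0 x, h0 y]
  zero v w x := by
    refine ⟨counit _ v w (wIncl C.coaug 1 0 v w x), ?_⟩
    have := hom_eq_zero (LinearMap.id - (LinearMap.toSpanSingleton K _
      (unit _ v w)).comp (counit _ v w)) (fun p t hp => ?_) (wIncl_mem 0 x)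
    · simp only [lsub_apply, id_apply, sub_eq_zero, comp_apply,
        LinearMap.toSpanSingleton_apply] at this
      have h2 := congrArg (wProj C.coaug 1 0 v w) this
      rw [wProj_wIncl, map_smul] at h2
      exact h2
    · rcases C.coaug_tens hconn hsc p with h | h
      · rw [Subsingleton.elim t 0, map_zero, map_zero]
      · cases p with
        | nil =>
          rw [of_nil]
          simp
        | cons v n p => simp only [Wd.length] at h; omega
  one_ne v h := by
    have h1 := C.cobar_isAugDGAlg.ε_one v
    rw [h, map_zero] at h1
    exact zero_ne_one h1
  one_eq v w h := wProj_unit _ _ _ _ _ (fun h' => h h'.2)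

end AInfCoalg

namespace Words

variable {M : GBimod K Γ} {Q : Type u} [AddCommGroup Q] [Module K Q]

/-! ### Coassociativity and convolution -/

lemma cut_eps (F : ∀ u, Words M v u →ₗ[K] Words M u w →ₗ[K] Q) (s : Words M v w) :
    cut F (eps M v w s) = cut (fun u => (F u).compl₁₂ (eps M v u) (eps M u w)) s := by
  induction s using ind' with
  | ha v s t hs ht => simp only [map_add, hs, ht]
  | hs v c s hs => simp only [map_smul, hs]
  | hn => simp
  | hp v z x s ih =>
    rw [eps_pre, cut_pre, cut_pre, ih]
    congr 1
    · simp
    · refine cut_congr (fun u s t => ?_) s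
      simp

/-- The convolution of a row and a column of functionals. -/
def conv (f : ∀ u, Dual K (Words M v u)) (g : ∀ u, Dual K (Words M u w)) : Dual K (Words M v w) :=
  cut (fun u => (LinearMap.lsmul K K).compl₁₂ (f u) (g u))

lemma conv_congr {f f' : ∀ u, Dual K (Words M v u)}
    {g g' : ∀ u, Dual K (Words M u w)} (h : ∀ u s t, f u s * g u t = f' u s * g' u t)
    (s : Words M v w) : conv f g s = conv f' g' s :=
  cut_congr (fun u s t => h u s t) s

@[simp] lemma conv_nil (f : ∀ u, Dual K (Words M v u))
    (g : ∀ u, Dual K (Words M u v)) :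
    conv f g (nil M v) = f v (nil M v) * g v (nil M v) := by
  simp [conv]

lemma conv_pre (f : ∀ u, Dual K (Words M v u))
    (g : ∀ u, Dual K (Words M u w)) (x : Lt M v u) (s : Words M u w) :
    conv f g (pre M v u w x s) = f v (nil M v) * g v (pre M v u w x s) +
      conv (fun z => (f z).comp (pre M v u z x)) g s := cut_pre _ x s

lemma conv_add_left (f f' : ∀ u, Dual K (Words M v u))
    (g : ∀ u, Dual K (Words M u w)) (s : Words M v w) :
    conv (fun u => f u + f' u) g s = conv f g s + conv f' g s := by
  rw [conv, conv, conv, ← cut_add]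
  exact cut_congr (fun u s t => by simp [add_mul]) s

lemma conv_add_right (f : ∀ u, Dual K (Words M v u))
    (g g' : ∀ u, Dual K (Words M u w)) (s : Words M v w) :
    conv f (fun u => g u + g' u) s = conv f g s + conv f g' s := by
  rw [conv, conv, conv, ← cut_add]
  exact cut_congr (fun u s t => by simp [mul_add]) s

lemma conv_zero_left (g : ∀ u, Dual K (Words M u w)) (s : Words M v w) :
    conv (fun _ => 0) g s = 0 := by
  rw [← cut_zero (Q := K) s, conv]
  exact cut_congr (fun u s t => by simp) s

lemma conv_zero_right (f : ∀ u, Dual K (Words M v u)) (s : Words M v w) :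
    conv f (fun _ => 0) s = 0 := by
  rw [← cut_zero (Q := K) s, conv]
  exact cut_congr (fun u s t => by simp) s

lemma conv_eps (f : ∀ u, Dual K (Words M v u)) (g : ∀ u, Dual K (Words M u w)) (s : Words M v w) :
    conv f g (eps M v w s) =
      conv (fun u => (f u).comp (eps M v u)) (fun u => (g u).comp (eps M u w)) s := cut_eps _ s

lemma conv_smul_left (c : K) (f : ∀ u, Dual K (Words M v u))
    (g : ∀ u, Dual K (Words M u w)) (s : Words M v w) :
    conv (fun u => c • f u) g s = c * conv f g s := by
  rw [conv, conv, ← smul_eq_mul, ← cut_smul]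
  exact cut_congr (fun u s t => by simp [mul_assoc]) s

lemma conv_assoc (f : ∀ u, Dual K (Words M v u))
    (g : ∀ u z, Dual K (Words M u z)) (h : ∀ u, Dual K (Words M u w)) (s : Words M v w) :
    conv (fun z => conv f (fun u => g u z)) h s = conv f (fun u => conv (g u) h) s := by
  induction s using ind' with
  | ha v s t hs ht => simp only [map_add, hs, ht]
  | hs v c s hs => simp only [map_smul, hs]
  | hn => simp [mul_assoc]
  | hp v u x s ih =>
    have h1 : ∀ z, (conv f (fun u => g u z)).comp (pre M v u z x) =
        f v (nil M v) • (g v z).comp (pre M v u z x) +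
          conv (fun y => (f y).comp (pre M v u y x)) (fun u => g u z) := by
      intro z
      refine lext fun t => ?_
      simp [conv_pre]
    rw [conv_pre, conv_pre, conv_nil, conv_pre]
    simp only [h1]
    rw [conv_add_left, conv_smul_left, ih]
    ring

/-- The convolution of two functionals. -/
def mulDual (a : Dual K (Words M v u)) (b : Dual K (Words M u w)) : Dual K (Words M v w) :=
  conv (Pi.single u a) (Pi.single u b)

lemma conv_single_right (f : ∀ u, Dual K (Words M v u))
    (b : Dual K (Words M u w)) (s : Words M v w) :
    conv f (Pi.single u b) s = mulDual (f u) b s := by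
  refine conv_congr (fun z s t => ?_) s
  by_cases h : z = u
  · subst h; simp
  · simp [h]

lemma conv_single_left (a : Dual K (Words M v u))
    (g : ∀ u, Dual K (Words M u w)) (s : Words M v w) :
    conv (Pi.single u a) g s = mulDual a (g u) s := by
  refine conv_congr (fun z s t => ?_) s
  by_cases h : z = u
  · subst h; simp
  · simp [h]

lemma mulDual_assoc (a : Dual K (Words M v u))
    (b : Dual K (Words M u z)) (c : Dual K (Words M z w)) :
    mulDual (mulDual a b) c = mulDual a (mulDual b c) := by
  refine lext fun s => ?_
  have h := conv_assoc (Pi.single u a) (Pi.single u (Pi.single z b) :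
    ∀ x y, Dual K (Words M x y)) (Pi.single z c) s
  rw [conv_single_right, conv_single_left] at h
  rw [show conv (Pi.single u a) (fun x => (Pi.single u (Pi.single z b) :
    ∀ x y, Dual K (Words M x y)) x z) = mulDual a b from ?_,
    show conv ((Pi.single u (Pi.single z b) : ∀ x y, Dual K (Words M x y)) u)
      (Pi.single z c) = mulDual b c from ?_] at h
  · exact h
  · rw [Pi.single_eq_same]
    rfl
  · refine lext fun s => ?_
    rw [conv_single_left, Pi.single_eq_same, Pi.single_eq_same]

lemma mulDual_eps (a : Dual K (Words M v u)) (b : Dual K (Words M u w)) :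
    (mulDual a b).comp (eps M v w) = mulDual (a.comp (eps M v u)) (b.comp (eps M u w)) := by
  refine lext fun s => ?_
  rw [comp_apply, mulDual, conv_eps]
  refine conv_congr (fun z s t => ?_) s
  by_cases h : z = u
  · subst h; simp
  · simp [h]

lemma mulDual_add_left (a a' : Dual K (Words M v u))
    (b : Dual K (Words M u w)) : mulDual (a + a') b = mulDual a b + mulDual a' b := by
  refine lext fun s => ?_
  rw [ladd_apply, mulDual, Pi.single_add]
  exact conv_add_left _ _ _ s

lemma mulDual_add_right (a : Dual K (Words M v u))
    (b b' : Dual K (Words M u w)) : mulDual a (b + b') = mulDual a b + mulDual a b' := by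
  refine lext fun s => ?_
  rw [ladd_apply, mulDual, Pi.single_add]
  exact conv_add_right _ _ _ s

lemma mulDual_smul_left (c : K) (a : Dual K (Words M v u))
    (b : Dual K (Words M u w)) : mulDual (c • a) b = c • mulDual a b := by
  refine lext fun s => ?_
  rw [lsmul_apply, mulDual, Pi.single_smul]
  exact conv_smul_left _ _ _ s

lemma mulDual_smul_right (c : K) (a : Dual K (Words M v u))
    (b : Dual K (Words M u w)) : mulDual a (c • b) = c • mulDual a b := by
  refine lext fun s => ?_
  rw [lsmul_apply, smul_eq_mul, mulDual, mulDual, ← conv_smul_left]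
  refine conv_congr (fun z s t => ?_) s
  by_cases h : z = u
  · subst h; simp; ring
  · simp [h]

/-- Convolution as a bilinear map. -/
def mulDualₗ (v u w : Γ) : Dual K (Words M v u) →ₗ[K] Dual K (Words M u w) →ₗ[K]
    Dual K (Words M v w) :=
  LinearMap.mk₂ K mulDual mulDual_add_left mulDual_smul_left mulDual_add_right mulDual_smul_right

@[simp] lemma mulDualₗ_apply (a : Dual K (Words M v u))
    (b : Dual K (Words M u w)) : mulDualₗ v u w a b = mulDual a b := rfl

lemma conv_counit_left (g : ∀ u, Dual K (Words M u w)) (s : Words M v w) :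
    conv (fun u => counit M v u) g s = g v s := by
  induction s using ind' with
  | ha v s t hs ht => simp only [map_add, hs, ht]
  | hs v c s hs => simp only [map_smul, hs]
  | hn => simp
  | hp v u x s ih =>
    have : ∀ z, (counit M v z).comp (pre M v u z x) = 0 := fun z => lext fun t => by simp
    simp [conv_pre, this, conv_zero_left]

lemma conv_counit_right (f : ∀ u, Dual K (Words M v u)) (s : Words M v w) :
    conv f (fun u => counit M u w) s = f w s := by
  induction s using ind' with
  | ha v s t hs ht => simp only [map_add, hs, ht]
  | hs v c s hs => simp only [map_smul, hs]
  | hn => simp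
  | hp v u x s ih => simp [conv_pre, ih]

lemma counit_ne (h : v ≠ w) : counit M v w = 0 := by
  refine ext_cases _ _ (fun h' => absurd h' h) (fun u n x s => by simp)

lemma single_counit_right (v : Γ) :
    (Pi.single v (counit M v v) : ∀ u, Dual K (Words M v u)) = fun u => counit M v u := by
  funext u
  by_cases h : u = v
  · subst h; simp
  · rw [Pi.single_eq_of_ne h, counit_ne (Ne.symm h)]

lemma single_counit_left (v : Γ) :
    (Pi.single v (counit M v v) : ∀ u, Dual K (Words M u v)) = fun u => counit M u v := by
  funext u
  by_cases h : u = v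
  · subst h; simp
  · rw [Pi.single_eq_of_ne h, counit_ne h]

@[simp] lemma counit_mulDual (b : Dual K (Words M v w)) :
    mulDual (counit M v v) b = b := by
  refine lext fun s => ?_
  rw [mulDual, single_counit_right, conv_counit_left, Pi.single_eq_same]

@[simp] lemma mulDual_counit (a : Dual K (Words M v w)) :
    mulDual a (counit M w w) = a := by
  refine lext fun s => ?_
  rw [mulDual, single_counit_left, conv_counit_right, Pi.single_eq_same]

/-! ### Convolution and coderivations -/

section Coder

variable (μ : ∀ {v w} (p : Wd Γ v w) (n : ℤ), Tens M p →ₗ[K] M.X n v w)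
  (hμ : ∀ {v w} (p : Wd Γ v w) (n : ℤ), 3 ≤ p.length → μ p n = 0)

lemma conv_barCirc (f : ∀ u, Dual K (Words M v u))
    (g : ∀ u, Dual K (Words M u w)) (x : Lt M v u) (s : Words M u w) :
    conv f g (barCirc μ v u w x s) = f v (nil M v) * g v (barCirc μ v u w x s) +
      conv (fun z => (f z).comp (barCirc μ v u z x)) (fun z => (g z).comp (eps M z w)) s := by
  induction s using ind' with
  | ha v s t hs ht => simp only [map_add, hs x, ht x]; ring
  | hs v c s hs => simp only [map_smul, hs x, smul_eq_mul]; ring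
  | hn => simp
  | hp u z y s _ =>
    rw [circ_pre, conv_pre]
    simp only [compr₂_apply, compl₂_apply, comp_apply, circ_nil, map_zero, zero_mul, zero_add,
      conv_pre, conv_eps]
    congr 1
    refine conv_congr (fun r s t => ?_) s
    simp

include hμ in
lemma conv_barT (f : ∀ u, Dual K (Words M v u))
    (g : ∀ u, Dual K (Words M u w)) (s : Words M v w) : conv f g (barT M μ v w s) =
      conv (fun u => (f u).comp (barT M μ v u)) (fun u => (g u).comp (eps M u w)) s +
      conv f (fun u => (g u).comp (barT M μ u w)) s := by
  induction s using ind' with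
  | ha v s t hs ht => simp only [map_add, hs, ht]; ring
  | hs v c s hs => simp only [map_smul, hs, smul_eq_mul]; ring
  | hn => simp
  | hp v u x s ih =>
    have h1 : ∀ z, ((f z).comp (barT M μ v z)).comp (pre M v u z x) =
        (((f z).comp (pre M v u z x)).comp (barT M μ u z) +
          ((f z).comp (pre M v u z (opD M μ v u x))).comp (eps M u z)) +
          (f z).comp (barCirc μ v u z x) := fun z => lext fun t => by
      simp [barT_pre μ hμ]
    rw [barT_pre μ hμ, map_add, map_add, conv_pre, conv_pre, conv_pre, conv_pre, conv_barCirc, ih,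
      conv_eps]
    simp only [h1, conv_add_left, comp_apply, barT_nil, map_zero, zero_mul, zero_add, barT_pre μ hμ,
      map_add]
    ring

include hμ in
lemma mulDual_barT (a : Dual K (Words M v u)) (b : Dual K (Words M u w)) :
    (mulDual a b).comp (barT M μ v w) =
      mulDual (a.comp (barT M μ v u)) (b.comp (eps M u w)) + mulDual a (b.comp (barT M μ u w)) := by
  refine lext fun s => ?_
  rw [comp_apply, mulDual, conv_barT μ hμ, ladd_apply]
  congr 1
  · refine conv_congr (fun z s t => ?_) s
    by_cases h : z = u
    · subst h; simp
    · simp [h]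
  · refine conv_congr (fun z s t => ?_) s
    by_cases h : z = u
    · subst h; simp
    · simp [h]

end Coder

/-! ### Pairing -/

variable (M)

/-- The part of length one. -/
def letterProj (v w : Γ) : Words M v w →ₗ[K] Lt M v w :=
  lift (fun p => match p with
    | .nil _ => 0
    | .cons v n (.nil w) => (Lt.of M n v w).comp (Tens.unletter v n w)
    | .cons _ _ (.cons _ _ _) => 0)

variable {M}

@[simp] lemma letterProj_nil (v : Γ) : letterProj M v v (nil M v) = 0 := by
  simp [letterProj, nil, lift_of]

@[simp] lemma letterProj_one (x : Lt M v w) :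
    letterProj M v w (pre M v w w x (nil M w)) = x := by
  induction x using Lt.ind with
  | ha x y hx hy => simp only [map_add, ladd_apply, hx, hy]
  | ho n x =>
    rw [nil, pre_of_of, letterProj, lift_of]
    change Lt.of M n v w (Tens.unletter v n w (Tens.letter M v n w x)) = _
    rw [AInfCoalg.unletter_letter]

@[simp] lemma letterProj_two (x : Lt M v u) (y : Lt M u z) (s : Words M z w) :
    letterProj M v w (pre M v u w x (pre M u z w y s)) = 0 := by
  induction x using Lt.ind with
  | ha x y hx hy => simp only [map_add, ladd_apply, hx, hy, add_zero]
  | ho n x =>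
    induction y using Lt.ind with
    | ha x y hx hy => simp only [map_add, ladd_apply, hx, hy, add_zero]
    | ho m y =>
      induction s using DirectSum.induction_on with
      | zero => simp
      | add s t hs ht => simp only [map_add, hs, ht, add_zero]
      | of p t =>
        change letterProj M v w (pre M v u w _ (pre M u z w _ (of M p t))) = 0
        rw [pre_of_of, pre_of_of, letterProj, lift_of]
        rfl

/-- Letters of the dual as functionals on letters. -/
def _root_.Koszul.Lt.ev (M : GBimod K Γ) (v w : Γ) : Lt M.dual v w →ₗ[K] Dual K (Lt M w v) :=
  Lt.lift (fun n => Module.Dual.transpose (R := K) (Lt.comp M (-n) w v))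

lemma _root_.Koszul.Lt.ev_of (n : ℤ) (a : M.dual.X n v w) (x : Lt M w v) :
    Lt.ev M v w (Lt.of _ n v w a) x = a (Lt.comp M (-n) w v x) := by
  rw [Lt.ev, Lt.lift_of]
  rfl

lemma _root_.Koszul.Lt.ev_comp (n : ℤ) (a : Lt M.dual v w) (x : M.X (-n) w v) :
    Lt.ev M v w a (Lt.of M (-n) w v x) = Lt.comp M.dual n v w a x := by
  induction a using Lt.ind with
  | ha a b ha hb => simp only [map_add, ladd_apply, ha, hb]
  | ho m a =>
    rw [Lt.ev_of]
    by_cases h : m = n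
    · subst h
      rw [Lt.comp_of, Lt.comp_of]
    · rw [Lt.comp_of_ne M (by omega), Lt.comp_of_ne M.dual h]
      simp

lemma _root_.Koszul.Lt.ev_injective (v w : Γ) : Function.Injective (Lt.ev M v w) := by
  intro a b h
  apply Lt.ext_comp
  intro n
  refine lext fun x => ?_
  rw [← Lt.ev_comp, ← Lt.ev_comp, h]

/-- Letters of the dual as functionals on words. -/
def evLetter (v w : Γ) (a : Lt M.dual v w) : Dual K (Words M w v) :=
  (Lt.ev M v w a).comp (letterProj M w v)

end Words

namespace Words

variable {M : GBimod K Γ}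

lemma hom_ext {Q : Type*} [AddCommMonoid Q] [Module K Q] {f g : Words M v w →ₗ[K] Q}
    (h : ∀ p t, f (of M p t) = g (of M p t)) : f = g :=
  DirectSum.linearMap_ext _ fun p => lext fun t => h p t

@[simp] lemma evLetter_nil (a : Lt M.dual v v) : evLetter v v a (nil M v) = 0 := by
  simp [evLetter]

lemma evLetter_pre (a : Lt M.dual v w) (x : Lt M w v) :
    (evLetter v w a).comp (pre M w v v x) = Lt.ev M v w a x • counit M v v := by
  refine ext_cases _ _ (fun _ => ?_) (fun u n y s => ?_)
  · simp [evLetter]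
  · simp [evLetter]

lemma evLetter_pre_ne (h : u ≠ v) (a : Lt M.dual v w) (x : Lt M w u) :
    (evLetter v w a).comp (pre M w u v x) = 0 := by
  refine ext_cases _ _ (fun h' => absurd h' h) (fun u n y s => ?_)
  simp [evLetter]

lemma mulDual_evLetter_nil (a : Lt M.dual v w)
    (b : Dual K (Words M v w)) : mulDual (evLetter v w a) b (nil M w) = 0 := by
  rw [mulDual, conv_nil]
  by_cases h : w = v
  · subst h; simp
  · simp [h]

lemma mulDual_evLetter_pre (a : Lt M.dual v w) (b : Dual K (Words M v z))
    (x : Lt M w v) (s : Words M v z) :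
    mulDual (evLetter v w a) b (pre M w v z x s) = Lt.ev M v w a x * b s := by
  have h1 : (fun y => ((Pi.single v (evLetter v w a) : ∀ u, Dual K (Words M w u)) y).comp
      (pre M w v y x)) = Pi.single v (Lt.ev M v w a x • counit M v v) := by
    funext y
    by_cases h : y = v
    · subst h; simp [evLetter_pre]
    · simp [h]
  have h2 : (Pi.single v (evLetter v w a) : ∀ u, Dual K (Words M w u)) w (nil M w) = 0 := by
    by_cases h : w = v
    · subst h; simp
    · simp [h]
  rw [mulDual, conv_pre, h1, h2, zero_mul, zero_add]
  change mulDual _ b s = _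
  rw [mulDual_smul_left, counit_mulDual]
  rfl

lemma mulDual_evLetter_pre_ne (h : u ≠ v) (a : Lt M.dual v w)
    (b : Dual K (Words M v z)) (x : Lt M w u) (s : Words M u z) :
    mulDual (evLetter v w a) b (pre M w u z x s) = 0 := by
  have h1 : (fun y => ((Pi.single v (evLetter v w a) : ∀ u, Dual K (Words M w u)) y).comp
      (pre M w u y x)) = fun _ => 0 := by
    funext y
    by_cases h : y = v
    · subst h; simp [evLetter_pre_ne (by assumption)]
    · simp [h]
  have h2 : (Pi.single v (evLetter v w a) : ∀ u, Dual K (Words M w u)) w (nil M w) = 0 := by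
    by_cases h : w = v
    · subst h; simp
    · simp [h]
  rw [mulDual, conv_pre, h1, h2, zero_mul, zero_add, conv_zero_left]

variable (M)

/-- A functional on words of a given shape as a functional on all words. -/
def extendDual (q : Wd Γ v w) (φ : Dual K (Tens M q)) : Dual K (Words M v w) :=
  φ.comp (DirectSum.component K (Wd Γ v w) (fun q => Tens M q) q)

variable {M}

lemma extendDual_of (q : Wd Γ v w) (φ : Dual K (Tens M q)) (t : Tens M q) :
    extendDual M q φ (of M q t) = φ t := by
  rw [extendDual, comp_apply, of, DirectSum.component.lof_self]

lemma extendDual_of_ne {p q : Wd Γ v w} (h : p ≠ q) (φ : Dual K (Tens M q))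
    (t : Tens M p) : extendDual M q φ (of M p t) = 0 := by
  rw [extendDual, comp_apply, of, DirectSum.component.of, dif_neg h, map_zero]

lemma extendDual_nil (v : Γ) :
    extendDual M (.nil v) (Tens.nilEquiv M v).symm.toLinearMap = counit M v v := by
  refine hom_ext fun p t => ?_
  cases p with
  | nil => rw [extendDual_of, counit_of_nil]; rfl
  | cons v n p => rw [extendDual_of_ne (by simp), counit_of_cons]

lemma extendDual_cons (n : ℤ) (q : Wd Γ v z) (a : M.dual.X n v u) (φ : Dual K (Tens M q)) :
    extendDual M (.cons u (-n) q) ((TensorProduct.dualDistrib K (M.X (-n) u v) (Tens M q)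
      (a ⊗ₜ φ)).comp (Tens.consEquiv M u (-n) q).symm.toLinearMap) =
      mulDual (evLetter v u (Lt.of _ n v u a)) (extendDual M q φ) := by
  refine hom_ext fun p t => ?_
  cases p with
  | nil =>
    rw [extendDual_of_ne (by simp), of_nil, map_smul, mulDual_evLetter_nil, smul_zero]
  | cons u m r =>
    rename_i y
    induction t using Tens.ind with
    | ha s t hs ht => simp only [map_add, hs, ht]
    | hc x t =>
      by_cases hy : y = v
      · subst hy
        by_cases hm : m = -n
        · subst hm
          by_cases hr : r = q
          · subst hr
            rw [extendDual_of, ← pre_of_of, mulDual_evLetter_pre, extendDual_of, Lt.ev_of,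
              Lt.comp_of]
            simp [Tens.cons]
          · rw [extendDual_of_ne (by simp [hr]), ← pre_of_of, mulDual_evLetter_pre,
              extendDual_of_ne hr, mul_zero]
        · rw [extendDual_of_ne (by simp [hm]), ← pre_of_of, mulDual_evLetter_pre, Lt.ev_of,
            Lt.comp_of_ne _ hm, map_zero, zero_mul]
      · rw [extendDual_of_ne (by simp [hy]), ← pre_of_of, mulDual_evLetter_pre_ne hy]

variable (M)

/-- The pairing of words with letters in the dual with words. -/
def pairT (v w : Γ) : Words M.dual v w →ₗ[K] Dual K (Words M w v) := lift (fun p => pair M p)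

variable {M}

lemma pairT_of (p : Wd Γ v w) (t : Tens M.dual p) : pairT M v w (of _ p t) =
      extendDual M p.rev (pairAux M p (.nil v) t (Tens.nilEquiv M v).symm.toLinearMap) := by
  rw [pairT, lift_of]
  rfl

lemma extendDual_pairAux (p : Wd Γ v w) (q : Wd Γ v z) (t : Tens M.dual p)
    (φ : Dual K (Tens M q)) : extendDual M (p.revAux q) (pairAux M p q t φ) =
      mulDual (pairT M v w (of _ p t)) (extendDual M q φ) := by
  induction p generalizing z with
  | nil v =>
    have h : pairAux M (.nil v) q t φ = (Tens.nilEquiv M.dual v).symm t • φ :=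
      lcongr_fun (Tens.nilLift_apply M.dual v
        (LinearMap.id : Dual K (Tens M q) →ₗ[K] Dual K (Tens M q)) t) φ
    have h' : pairAux M (.nil v) (.nil v) t (Tens.nilEquiv M v).symm.toLinearMap =
        (Tens.nilEquiv M.dual v).symm t • (Tens.nilEquiv M v).symm.toLinearMap :=
      lcongr_fun (Tens.nilLift_apply M.dual v (LinearMap.id :
        Dual K (Tens M (.nil v)) →ₗ[K] Dual K (Tens M (.nil v))) t) _
    have h'' : pairT M v v (of _ (.nil v) t) = (Tens.nilEquiv M.dual v).symm t • counit M v v :=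
      (pairT_of _ t).trans ((congrArg (extendDual M (.nil v)) h').trans ((smul_comp _ _ _).trans
          (congrArg (fun y => (Tens.nilEquiv M.dual v).symm t • y) (extendDual_nil v))))
    rw [h'', mulDual_smul_left, counit_mulDual]
    exact congrArg (extendDual M q) h
  | cons v n p ih =>
    induction t using Tens.ind with
    | ha s t hs ht =>
      simp only [map_add, ladd_apply, mulDual_add_left, ← hs, ← ht]
      exact add_comp _ _ _
    | hc a t =>
      rw [pairT_of, pairAux_cons, pairAux_cons]
      refine (ih _ t _).trans ?_
      refine Eq.trans ?_ (congrArg (fun y => mulDual y (extendDual M q φ)) (ih _ t _).symm)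
      rw [extendDual_cons, extendDual_cons, extendDual_nil, mulDual_counit, mulDual_assoc]

@[simp] lemma pairT_nil (v : Γ) : pairT M v v (nil _ v) = counit M v v := by
  rw [nil, pairT_of]
  refine (congrArg (extendDual M (.nil v)) ?_).trans (extendDual_nil v)
  exact (lcongr_fun (Tens.nilLift_apply M.dual v (LinearMap.id :
    Dual K (Tens M (.nil v)) →ₗ[K] Dual K (Tens M (.nil v))) _) _).trans (by simp)

@[simp] lemma pairT_pre (a : Lt M.dual v u) (t : Words M.dual u w) :
    pairT M v w (pre _ v u w a t) = mulDual (pairT M u w t) (evLetter v u a) := by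
  induction a using Lt.ind with
  | ha x y hx hy =>
    simp only [map_add, ladd_apply, hx, hy, evLetter, add_comp, mulDual_add_right]
  | ho n a =>
    induction t using DirectSum.induction_on with
    | zero =>
      simp only [map_zero]
      exact (lcongr_fun (map_zero (mulDualₗ w u v)) _).symm
    | add s t hs ht => simp only [map_add, hs, ht, mulDual_add_left]
    | of p t =>
      change pairT M v w (pre _ v u w _ (of _ p t)) = mulDual (pairT M u w (of _ p t)) _
      rw [pre_of_of, pairT_of, pairAux_cons]
      erw [extendDual_pairAux]
      rw [extendDual_cons, extendDual_nil, mulDual_counit]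

end Words

/-! ### The operations of the dual of a coalgebra -/

lemma Wd.revAux_deg (p : Wd Γ v w) (q : Wd Γ v z) (c : ℤ) :
    (p.revAux q).deg c = - p.deg (-c) + q.deg c := by
  induction p generalizing z with
  | nil => simp [Wd.revAux, Wd.deg]
  | cons v n p ih => simp only [Wd.revAux, ih, Wd.deg]; ring

lemma Wd.revAux_length (p : Wd Γ v w) (q : Wd Γ v z) :
    (p.revAux q).length = p.length + q.length := by
  induction p generalizing z with
  | nil => simp [Wd.revAux, Wd.length]
  | cons v n p ih => simp only [Wd.revAux, ih, Wd.length]; ring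

namespace Words

variable {M : GBimod K Γ}

lemma extendDual_hom {c n : ℤ} (q : Wd Γ v w) (hq : q.deg c ≠ n)
    (φ : Dual K (Tens M q)) {s : Words M v w} (hs : s ∈ hom M c n v w) : extendDual M q φ s = 0 :=
  hom_eq_zero _ (fun p t hp => extendDual_of_ne (fun h => hq (by rw [← h, hp])) φ t) hs

lemma pairT_hom {n : ℤ} (p : Wd Γ v w) (t : Tens M.dual p) (hp : p.deg (-1) + n ≠ 0)
    {s : Words M w v} (hs : s ∈ hom M 1 n w v) : pairT M v w (of _ p t) s = 0 := by
  rw [pairT_of]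
  refine extendDual_hom _ ?_ _ hs
  rw [Wd.revAux_deg]
  simp only [Wd.deg]
  omega

end Words

namespace Words

variable {M : GBimod K Γ}

lemma neg_mulDual (f : Dual K (Words M v u))
    (g : Dual K (Words M u w)) : mulDual (-f) g = - mulDual f g :=
  LinearMap.map_neg₂ (mulDualₗ v u w) f g

variable {Q : Type u} [AddCommGroup Q] [Module K Q]

lemma cut_of_mem (c : ℤ) (p : Wd Γ v w) (t : Tens M p)
    (F : ∀ u, Words M v u →ₗ[K] Words M u w →ₗ[K] Q) (S : Submodule K Q)
    (h : ∀ u (q : Wd Γ v u) (r : Wd Γ u w) x y, q.deg c + r.deg c = p.deg c →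
      F u (of M q x) (of M r y) ∈ S) : cut F (of M p t) ∈ S := by
  induction p with
  | nil v =>
    rw [of_nil, map_smul, cut_nil]
    exact S.smul_mem _ (h _ _ _ _ _ (by simp [Wd.deg]))
  | cons v n p ih =>
    induction t using Tens.ind with
    | ha s t hs ht => simpa only [map_add] using S.add_mem hs ht
    | hc x t =>
      rw [← pre_of_of, cut_pre]
      refine S.add_mem ?_ (ih _ _ fun u q r y z hqr => ?_)
      · rw [pre_of_of]
        exact h _ _ _ _ _ (by simp [Wd.deg])
      · rw [comp_apply, pre_of_of]
        exact h _ _ _ _ _ (by simp only [Wd.deg]; omega)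

end Words

namespace CoOps

variable (Q : CoOps K Γ)

/-- The operations of a coalgebra on all elements. -/
abbrev ΔT (v w : Γ) : Lt Q.1 v w →ₗ[K] Words Q.1 v w := cobarδ Q.Δ v w

lemma dual_m_apply (p : Wd Γ v w) (n : ℤ) (t : Tens Q.dual.1 p) (c : Q.X (-n) w v) :
    Q.dual.m p n t c = sgn K n * pairT Q.1 v w (of Q.dual.1 p t) (Q.Δ (-n) w v c) := by
  rw [pairT, lift_of]
  rfl

variable {Q}

lemma ev_dual_mTot (hΔ : ∀ n v w x, Q.Δ n v w x ∈ hom Q.1 1 (n + 2) v w)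
    (s : Words Q.dual.1 v w) (x : Lt Q.1 w v) : Lt.ev Q.1 v w (Q.dual.mTot v w s) x =
      - pairT Q.1 v w s (Q.ΔT w v (Lt.eps Q.1 w v x)) := by
  induction s using DirectSum.induction_on with
  | zero => simp
  | add s t hs ht =>
    rw [map_add, map_add, map_add, ladd_apply, ladd_apply, hs, ht, neg_add]
  | of p t =>
    change Lt.ev Q.1 v w (Q.dual.mTot v w (of Q.dual.1 p t)) x = - pairT Q.1 v w (of Q.dual.1 p t) _
    rw [AugOps.mTot_of]
    induction x using Lt.ind with
    | ha x y hx hy => simp only [map_add, hx, hy, neg_add]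
    | ho n c =>
      rw [Lt.eps_of, map_smul, map_smul, Lt.lift_of]
      refine (Lt.ev_of _ _ _).trans ?_
      by_cases h : n = -(p.deg (-1) + 2)
      · subst h
        rw [Lt.comp_of]
        refine (dual_m_apply Q p _ t c).trans ?_
        rw [sgn_add K (-_) 1, sgn_neg]
        simp
      · rw [Lt.comp_of_ne _ h, map_zero, pairT_hom p t (by omega) (hΔ n w v c)]
        simp

end CoOps

/-! ### The Koszul dual of a differential graded algebra -/

namespace Words

variable {M : GBimod K Γ} {μ : ∀ {v w} (p : Wd Γ v w) (n : ℤ), Tens M p →ₗ[K] M.X n v w}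

lemma barT_mem_hom (hμ : ∀ {v w} (p : Wd Γ v w) (n : ℤ), 3 ≤ p.length → μ p n = 0) {n k : ℤ}
    (hk : n + 1 = k) {x : Words M v w} (hx : x ∈ hom M (-1) n v w) :
    barT M μ v w x ∈ hom M (-1) k v w := by
  have : ∀ {v w : Γ} (p : Wd Γ v w) (t : Tens M p) (k : ℤ), p.deg (-1) + 1 = k →
      barT M μ v w (of M p t) ∈ hom M (-1) k v w := by
    intro v w p
    induction p with
    | nil v => intro t k _; rw [of_nil]; simp
    | cons v n p ih =>
      intro t k hk
      induction t using Tens.ind with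
      | ha s t hs ht => simpa only [map_add] using Submodule.add_mem _ hs ht
      | hc x t =>
        rw [← pre_of_of, barT_pre μ hμ]
        simp only [Wd.deg] at hk
        refine Submodule.add_mem _ (Submodule.add_mem _ (pre_mem_hom n _ x (ih t _ rfl) (by omega))
          ?_) ?_
        · rw [eps_of, map_smul, opD_of]
          exact Submodule.smul_mem _ _ (pre_mem_hom _ _ _ (of_mem_hom (-1) p t)
            (by simp only [Wd.deg]; omega))
        · cases p with
          | nil => rw [of_nil]; simp
          | cons u m p =>
            induction t using Tens.ind with
            | ha s t hs ht => simpa only [map_add] using Submodule.add_mem _ hs ht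
            | hc y t =>
              rw [← pre_of_of, circ_pre]
              simp only [compr₂_apply, compl₂_apply, opM_of, eps_of, map_smul]
              exact Submodule.smul_mem _ _ (pre_mem_hom _ _ _ (of_mem_hom (-1) p t)
                (by simp only [Wd.deg] at hk ⊢; omega))
  exact hom_induction _ _ (fun p t hp => this p t k (by omega)) hx

end Words

namespace AugOps

variable (A : AugOps K Γ)

/-- The bar differential. -/
abbrev bT (v w : Γ) : Words A.aug v w →ₗ[K] Words A.aug v w := barT A.aug A.mAug v w

/-- The elements of `E(A)` as functionals on the bar construction. -/
def evE (v w : Γ) : Lt A.E.1 v w →ₗ[K] Dual K (Words A.aug w v) :=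
  Lt.lift (fun n => Module.Dual.transpose (R := K) (wProj A.aug (-1) (-n) w v))

lemma evE_of (n : ℤ) (a : A.E.X n v w) (s : Words A.aug w v) :
    A.evE v w (Lt.of _ n v w a) s = a (wProj A.aug (-1) (-n) w v s) := by
  rw [evE, Lt.lift_of]
  rfl

lemma evE_eq_ev (a : Lt A.E.1 v w) (x : Lt (wordsGr A.aug (-1)) w v) :
    A.evE v w a (wordsEquiv A.aug (-1) w v x) = Lt.ev (wordsGr A.aug (-1)) v w a x := by
  induction a using Lt.ind with
  | ha a b ha hb => simp only [map_add, ladd_apply, ha, hb]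
  | ho n a =>
    rw [evE_of]
    refine Eq.trans ?_ (Lt.ev_of n a x).symm
    congr 1
    induction x using Lt.ind with
    | ha x y hx hy => simp only [map_add, hx, hy]
    | ho m x =>
      rw [wordsEquiv_of]
      by_cases h : m = -n
      · subst h
        rw [Lt.comp_of, wProj_wIncl]
      · rw [Lt.comp_of_ne _ h, wProj_ne (wIncl_mem m x) h]

lemma evE_injective (v w : Γ) : Function.Injective (A.evE v w) := by
  intro a b h
  apply Lt.ev_injective (M := wordsGr A.aug (-1)) v w
  refine lext fun x => ?_
  rw [← evE_eq_ev, ← evE_eq_ev, h]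

lemma evE_eps (a : Lt (wordsGr A.aug (-1)).dual v w) :
    A.evE v w (Lt.eps (wordsGr A.aug (-1)).dual v w a) = - (A.evE v w a).comp (eps _ w v) := by
  refine lext fun s => ?_
  induction a using Lt.ind with
  | ha a b ha hb =>
    simp only [map_add, ladd_apply, ha, hb, lneg_apply, comp_apply, neg_add]
  | ho n a =>
    have h : ∀ s, wProj A.aug (-1) (-n) w v (eps _ w v s) =
        sgn K n • wProj A.aug (-1) (-n) w v s := by
      intro s
      induction s using DirectSum.induction_on with
      | zero => simp
      | add s t hs ht => simp only [map_add, hs, ht, smul_add]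
      | of p t =>
        change wProj A.aug (-1) (-n) w v (eps _ w v (of _ p t)) =
          _ • wProj A.aug (-1) (-n) w v (of _ p t)
        rw [eps_of, map_smul]
        by_cases hp : p.deg (-1) = -n
        · rw [← sgn_deg_neg_one, hp, sgn_neg]
        · rw [wProj_ne (of_mem_hom (-1) p t) hp, smul_zero, smul_zero]
    rw [Lt.eps_of, map_smul, lsmul_apply, evE_of, lneg_apply, comp_apply, evE_of, h, map_smul,
      sgn_add]
    simp

/-! #### The coproduct of the bar construction -/

lemma barOf_eq (p : Wd Γ v w) (t : Tens A.aug p) :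
    Lt.of (wordsGr A.aug (-1)) _ v w (A.barOf p t) =
      (wordsEquiv A.aug (-1) v w).symm (of _ p t) := by
  rw [LinearEquiv.eq_symm_apply, wordsEquiv_of]
  exact Piece.incl_lof _ _ _ _ _

lemma barΔ1_eq (n : ℤ) (hA : A.NoHigher) (c : (wordsGr A.aug (-1)).X n v w) :
    A.barΔ1 n v w c = pre (wordsGr A.aug (-1)) v w w
      ((wordsEquiv A.aug (-1) v w).symm (A.bT v w (wIncl A.aug (-1) n v w c)))
      (nil (wordsGr A.aug (-1)) w) := by
  have h : (wordsEquiv A.aug (-1) v w).symm (A.bT v w (wIncl A.aug (-1) n v w c)) =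
      Lt.of (wordsGr A.aug (-1)) (n + 1) v w
        (wProj A.aug (-1) (n + 1) v w (A.bT v w (wIncl A.aug (-1) n v w c))) := by
    rw [LinearEquiv.symm_apply_eq, wordsEquiv_of,
      wIncl_wProj (barT_mem_hom (fun p n hp => A.mAug_three hA p n hp) rfl (wIncl_mem n c))]
  rw [h, nil, pre_of_of]
  rfl

lemma barΔ2_eq (n : ℤ) (c : (wordsGr A.aug (-1)).X n v w) :
    A.barΔ2 n v w c = cut (fun u => (((pre (wordsGr A.aug (-1)) v u w).compl₂
      ((pre (wordsGr A.aug (-1)) u w w).flip (nil (wordsGr A.aug (-1)) w))).compl₁₂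
        (wordsEquiv A.aug (-1) v u).symm.toLinearMap
        ((wordsEquiv A.aug (-1) u w).symm.toLinearMap.comp (eps _ u w))))
      (wIncl A.aug (-1) n v w c) := by
  rw [barΔ2, comp_apply, comp_apply, cut, comp_apply]
  generalize lift (split A.aug) (wIncl A.aug (-1) n v w c) = d
  induction d using Cuts.ind with
  | ha x y hx hy => simp only [map_add, hx, hy]
  | ho u p q s t =>
    rw [Cuts.lift_of', Cuts.lift_of']
    simp only [lsmul_apply, comp_apply, TensorProduct.lift.tmul, compl₁₂_apply, compl₂_apply,
      LinearEquiv.coe_coe, eps_of, map_smul, flip_apply]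
    rw [sgn_deg_neg_one, ← barOf_eq, ← barOf_eq, nil, pre_of_of, pre_of_of]
    rfl

lemma bar_Δ_mem_hom (n : ℤ) (v w : Γ) (c : (wordsGr A.aug (-1)).X n v w) :
    A.bar.Δ n v w c ∈ hom (wordsGr A.aug (-1)) 1 (n + 2) v w := by
  change A.barΔ1 n v w c + A.barΔ2 n v w c ∈ _
  refine Submodule.add_mem _ ?_ ?_
  · exact of_mem_hom' _ (by simp only [Wd.deg]; omega) _
  · rw [barΔ2_eq]
    refine hom_induction _ _ (fun p t hp => ?_) (wIncl_mem n c)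
    refine cut_of_mem (-1) p t _ _ fun u q r x y hqr => ?_
    simp only [compl₁₂_apply, compl₂_apply, comp_apply, LinearEquiv.coe_coe, eps_of, map_smul,
      flip_apply]
    rw [← barOf_eq, ← barOf_eq, nil, pre_of_of, pre_of_of]
    exact Submodule.smul_mem _ _ (of_mem_hom' _ (by simp only [Wd.deg]; omega) _)

/-! #### The operations of `E(A)` -/

variable {A}
variable (hA : A.NoHigher)

include hA in
lemma ΔT_eq (x : Lt (wordsGr A.aug (-1)) v w) : A.bar.ΔT v w x = pre (wordsGr A.aug (-1)) v w w
      ((wordsEquiv A.aug (-1) v w).symm (A.bT v w (wordsEquiv A.aug (-1) v w x)))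
      (nil (wordsGr A.aug (-1)) w) + cut (fun u => (((pre (wordsGr A.aug (-1)) v u w).compl₂
      ((pre (wordsGr A.aug (-1)) u w w).flip (nil (wordsGr A.aug (-1)) w))).compl₁₂
        (wordsEquiv A.aug (-1) v u).symm.toLinearMap
        ((wordsEquiv A.aug (-1) u w).symm.toLinearMap.comp (eps _ u w))))
      (wordsEquiv A.aug (-1) v w x) := by
  induction x using Lt.ind with
  | ha x y hx hy =>
    simp only [map_add, ladd_apply, hx, hy]
    abel
  | ho n c =>
    rw [Lt.lift_of, wordsEquiv_of, ← barΔ1_eq A n hA, ← barΔ2_eq]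
    rfl

include hA in
lemma evE_D (a : Lt A.E.1 v w) :
    A.evE v w (A.E.D v w a) = ((A.evE v w a).comp (A.bT w v)).comp (eps _ w v) := by
  refine lext fun s => ?_
  obtain ⟨x, rfl⟩ := (wordsEquiv A.aug (-1) w v).surjective s
  rw [evE_eq_ev, ← mTot_one]
  refine (CoOps.ev_dual_mTot (Q := A.bar) (bar_Δ_mem_hom A) _ x).trans ?_
  rw [pairT_pre, pairT_nil, counit_mulDual, ΔT_eq hA, map_add, map_cut]
  rw [evLetter, comp_apply, letterProj_one, wordsEquiv_eps (by simp), ← evE_eq_ev,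
    LinearEquiv.apply_symm_apply]
  rw [cut_congr (G := fun _ => 0), cut_zero]
  · simp
  · intro u s t
    simp

include hA in
lemma evE_P (a : Lt A.E.1 v u) (b : Lt A.E.1 u w) : A.evE v w (A.E.P v u w a b) =
      mulDual ((A.evE u w b).comp (eps _ w u)) (A.evE v u a) := by
  refine lext fun s => ?_
  obtain ⟨x, rfl⟩ := (wordsEquiv A.aug (-1) w v).surjective s
  rw [evE_eq_ev, ← mTot_two]
  refine (CoOps.ev_dual_mTot (Q := A.bar) (bar_Δ_mem_hom A) _ x).trans ?_
  rw [pairT_pre, pairT_pre, pairT_nil, counit_mulDual, ΔT_eq hA, map_add, map_cut,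
    wordsEquiv_eps (by simp)]
  have h1 : ∀ x : Lt (wordsGr A.aug (-1)) w v, mulDual (evLetter u w b)
      (evLetter v u a) (pre (wordsGr A.aug (-1)) w v v x (nil _ v)) = 0 := by
    intro x
    by_cases h : v = u
    · subst h
      rw [mulDual_evLetter_pre, evLetter_nil, mul_zero]
    · rw [mulDual_evLetter_pre_ne h]
  rw [h1, zero_add, map_neg, neg_neg, cut_eps]
  refine (cut_congr (fun z s t => ?_) _ : _ = cut (fun z => (LinearMap.lsmul K K).compl₁₂
    ((Pi.single u ((A.evE u w b).comp (eps _ w u)) : ∀ z, Dual K (Words A.aug w z)) z)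
    ((Pi.single u (A.evE v u a) : ∀ z, Dual K (Words A.aug z v)) z)) _)
  simp only [compl₁₂_apply, compr₂_apply, compl₂_apply, comp_apply, LinearEquiv.coe_coe, flip_apply,
    eps_eps]
  by_cases h : z = u
  · subst h
    rw [mulDual_evLetter_pre, ← evE_eq_ev, evLetter, comp_apply, letterProj_one, ← evE_eq_ev]
    simp
  · rw [mulDual_evLetter_pre_ne h]
    simp [h]

include hA in
lemma E_m_three (p : Wd Γ v w) (n : ℤ) (hp : 3 ≤ p.length) : A.E.m p n = 0 := by
  refine lext fun t => lext fun c => ?_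
  refine (CoOps.dual_m_apply A.bar p n t c).trans ?_
  have h1 : A.bar.Δ (-n) w v c = A.bar.ΔT w v (Lt.of _ (-n) w v c) := by rw [Lt.lift_of]
  have h2 : p.rev.length = p.length := by rw [Wd.revAux_length]; rfl
  rw [h1, ΔT_eq hA, map_add, map_cut, pairT_of, cut_congr (G := fun _ => 0), cut_zero]
  · rw [add_zero]
    refine mul_eq_zero_of_right _ ?_
    generalize (wordsEquiv A.aug (-1) w v).symm _ = y
    induction y using Lt.ind with
    | ha x y hx hy => simp only [map_add, ladd_apply, hx, hy, add_zero]
    | ho m y =>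
      rw [nil, pre_of_of, extendDual_of_ne]
      intro h
      rw [← h] at h2
      simp only [Wd.length] at h2
      omega
  · intro u s t
    simp only [compl₁₂_apply, compr₂_apply, compl₂_apply, comp_apply, LinearEquiv.coe_coe,
      flip_apply, lzero_apply]
    generalize (wordsEquiv A.aug (-1) w u).symm s = y
    generalize (wordsEquiv A.aug (-1) u v).symm _ = z
    induction y using Lt.ind with
    | ha x y hx hy => simp only [map_add, ladd_apply, hx, hy, add_zero]
    | ho m y =>
      induction z using Lt.ind with
      | ha x y hx hy => simp only [map_add, ladd_apply, hx, hy, add_zero]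
      | ho k z =>
        rw [nil, pre_of_of, pre_of_of, extendDual_of_ne]
        intro h
        rw [← h] at h2
        simp only [Wd.length] at h2
        omega

include hA in
lemma E_isDGOps (H : IsDGOps A.aug A.DAug A.PAug) : IsDGOps A.E.1 A.E.D A.E.P where
  eps_d x := eps_opD A.E.m x
  eps_m x y := eps_opM A.E.m x y
  d_d {v w} a := by
    apply A.evE_injective v w
    refine lext fun s => ?_
    simp only [evE_D hA, comp_apply, map_zero, lzero_apply]
    rw [eps_barT _ (fun p n hp => A.mAug_three hA p n hp) H, eps_eps, map_neg,
      barT_barT _ (fun p n hp => A.mAug_three hA p n hp) H]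
    simp
  leibniz {v u w} a b := by
    apply A.evE_injective v w
    have h : ∀ x y : Γ, (eps A.aug x y).comp ((A.bT x y).comp (eps A.aug x y)) =
        - A.bT x y := fun x y => lext fun s => by
      simp only [comp_apply, lneg_apply]
      rw [eps_barT _ (fun p n hp => A.mAug_three hA p n hp) H, eps_eps]
    have h2 : ∀ x y : Γ, (eps A.aug x y).comp (eps A.aug x y) = LinearMap.id :=
      fun x y => lext fun s => by simp
    simp only [map_add, evE_D hA, evE_P hA, evE_eps, map_zero, comp_assoc, neg_comp, h2, comp_id]
    rw [← comp_assoc, mulDual_barT _ (fun p n hp => A.mAug_three hA p n hp), add_comp, mulDual_eps,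
      mulDual_eps]
    simp only [comp_assoc, h, h2, comp_id, LinearMap.comp_neg]
    simp only [neg_mulDual]
    abel
  assoc {v u w z} a b c := by
    apply A.evE_injective v z
    have h2 : ∀ x y : Γ, (eps A.aug x y).comp (eps A.aug x y) = LinearMap.id :=
      fun x y => lext fun s => by simp
    simp only [map_add, evE_P hA, evE_eps, map_zero, mulDual_eps, comp_assoc, neg_comp, h2, comp_id,
      mulDual_assoc, neg_mulDual]
    abel

end AugOps

/-! ### The resolution `BA ⊗ A` -/

namespace AugOps

variable (A : AugOps K Γ) {Q : Type u} [AddCommMonoid Q] [Module K Q]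

/-- `c ⊗ a` as an element of `BA ⊗ A`. -/
def zt (v u w : Γ) : Words A.aug v u →ₗ[K] Lt A.1 u w →ₗ[K] A.ZTot v w :=
  lift (fun p => (Lt.lift (fun j => (TensorProduct.curry (A.zOf w p j)).flip)).flip)

variable {A}

lemma zt_of (p : Wd Γ v u) (j : ℤ) (t : Tens A.aug p) (a : A.X j u w) :
    A.zt v u w (of _ p t) (Lt.of _ j u w a) = A.zOf w p j (t ⊗ₜ a) := by
  rw [zt, lift_of, flip_apply, Lt.lift_of]
  rfl

/-- Linear maps out of `BA ⊗ A`. -/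
def zelim (F : ∀ u, Words A.aug v u →ₗ[K] Lt A.1 u w →ₗ[K] Q) : A.ZTot v w →ₗ[K] Q :=
  DirectSum.toModule K (ZIdx Γ v) Q (fun s => TensorProduct.lift
    ((F s.1).compl₁₂ (of _ s.2.1) (Lt.of _ s.2.2 s.1 w)))

lemma toModule_zOf {R : Type*} [AddCommMonoid R] [Module K R]
    (f : ∀ s : ZIdx Γ v, A.ZSummand v w s →ₗ[K] R) (p : Wd Γ v u) (j : ℤ)
    (x : Tens A.aug p ⊗[K] A.X j u w) :
    DirectSum.toModule K (ZIdx Γ v) R f (A.zOf w p j x) = f ⟨u, p, j⟩ x := by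
  simp [zOf]

lemma zelim_zOf (F : ∀ u, Words A.aug v u →ₗ[K] Lt A.1 u w →ₗ[K] Q)
    (p : Wd Γ v u) (j : ℤ) (t : Tens A.aug p) (a : A.X j u w) :
    zelim F (A.zOf w p j (t ⊗ₜ a)) = F u (of _ p t) (Lt.of _ j u w a) := by
  rw [zelim, toModule_zOf]
  rfl

@[elab_as_elim] lemma zind_of {P : A.ZTot v w → Prop}
    (ha : ∀ x y, P x → P y → P (x + y))
    (ho : ∀ u (p : Wd Γ v u) j t (a : A.X j u w),
      P (A.zt v u w (of _ p t) (Lt.of _ j u w a))) (z : A.ZTot v w) : P z := by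
  have h0 : P 0 := by simpa using ho v (.nil v) 0 0 0
  induction z using DirectSum.induction_on with
  | zero => exact h0
  | add x y hx hy => exact ha x y hx hy
  | of s x =>
    obtain ⟨u, p, j⟩ := s
    change P (A.zOf w p j x)
    induction x using TensorProduct.induction_on with
    | zero => rw [map_zero]; exact h0
    | tmul x y => rw [← zt_of]; exact ho u p j x y
    | add x y hx hy => rw [map_add]; exact ha _ _ hx hy

lemma bilin_ext_of {M N : GBimod K Γ}
    {f g : Words M v u →ₗ[K] Lt N z w →ₗ[K] Q}
    (h : ∀ p t j a, f (of M p t) (Lt.of N j z w a) = g (of M p t) (Lt.of N j z w a)) :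
    f = g :=
  hom_ext fun p t => Lt.hom_ext fun j a => h p t j a

@[simp] lemma zelim_zt (F : ∀ u, Words A.aug v u →ₗ[K] Lt A.1 u w →ₗ[K] Q)
    (c : Words A.aug v u) (a : Lt A.1 u w) : zelim F (A.zt v u w c a) = F u c a := by
  have : (A.zt v u w).compr₂ (zelim F) = F u := bilin_ext_of fun p t j a => by
    rw [compr₂_apply, zt_of, zelim_zOf]
  exact lcongr_fun (lcongr_fun this c) a

lemma zt_ext {f g : A.ZTot v w →ₗ[K] Q}
    (h : ∀ u c a, f (A.zt v u w c a) = g (A.zt v u w c a)) : f = g := by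
  refine lext fun z => ?_
  induction z using zind_of with
  | ha x y hx hy => simp [hx, hy]
  | ho u p j t a => exact h _ _ _

variable (A)

/-- `[] ⊗ a`. -/
def znil (v w : Γ) : Lt A.1 v w →ₗ[K] A.ZTot v w := A.zt v v w (nil _ v)

/-- Multiplication by a letter from the left. -/
def zpre (v u w : Γ) : Lt A.aug v u →ₗ[K] A.ZTot u w →ₗ[K] A.ZTot v w :=
  (zelim (fun y => LinearMap.lflip.comp ((pre _ v u y).compr₂ (A.zt v y w)).flip)).flip

/-- The sign given by the degree plus one. -/
def zeps (v w : Γ) : A.ZTot v w →ₗ[K] A.ZTot v w :=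
  zelim (fun u => (A.zt v u w).compl₁₂ (eps _ v u) (Lt.eps _ u w))

variable {A}

@[simp] lemma zpre_zt (x : Lt A.aug v u) (c : Words A.aug u y)
    (a : Lt A.1 y w) :
    A.zpre v u w x (A.zt u y w c a) = A.zt v y w (pre _ v u y x c) a := by
  simp [zpre]

@[simp] lemma zeps_zt (c : Words A.aug v u) (a : Lt A.1 u w) :
    A.zeps v w (A.zt v u w c a) = A.zt v u w (eps _ v u c) (Lt.eps _ u w a) := by
  simp [zeps]

@[simp] lemma zeps_znil (a : Lt A.1 v w) :
    A.zeps v w (A.znil v w a) = A.znil v w (Lt.eps _ v w a) := by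
  simp [znil]

@[simp] lemma zeps_zpre (x : Lt A.aug v u) (z : A.ZTot u w) :
    A.zeps v w (A.zpre v u w x z) = A.zpre v u w (Lt.eps _ v u x) (A.zeps u w z) := by
  induction z using zind_of with
  | ha x y hx hy => simp [hx, hy]
  | ho u p j t a =>
    rw [zpre_zt, zeps_zt, zeps_zt, zpre_zt, eps_pre]

@[elab_as_elim] lemma zind {P : ∀ v, A.ZTot v w → Prop}
    (ha : ∀ v x y, P v x → P v y → P v (x + y)) (hs : ∀ v (c : K) x, P v x → P v (c • x))
    (hn : ∀ v a, P v (A.znil v w a))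
    (hp : ∀ v u (x : Lt A.aug v u) z, P u z → P v (A.zpre v u w x z)) (z : A.ZTot v w) : P v z := by
  induction z using zind_of with
  | ha x y hx hy => exact ha v x y hx hy
  | ho u p j t a =>
    generalize of _ p t = c
    clear p t
    induction c using ind' with
    | ha v x y hx hy => rw [map_add, ladd_apply]; exact ha _ _ _ hx hy
    | hs v c x hx => rw [map_smul, lsmul_apply]; exact hs _ _ _ hx
    | hn => exact hn _ _
    | hp v u x s h => rw [← zpre_zt]; exact hp _ _ _ _ h

@[simp] lemma zeps_zeps (z : A.ZTot v w) : A.zeps v w (A.zeps v w z) = z := by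
  induction z using zind_of with
  | ha x y hx hy => simp [hx, hy]
  | ho u p j t a => rw [zeps_zt, zeps_zt, eps_eps, Lt.eps_eps]

/-! #### The differential -/

variable (A)

/-- `([a_r|⋯|a_1], a) ↦ m_{r+1}(a_r, …, a_1, a)`. -/
def mEnd (v u w : Γ) : Words A.aug v u →ₗ[K] Lt A.1 u w →ₗ[K] Lt A.1 v w :=
  ((concat _ v u w).compl₁₂ (map (A.1.kerIncl A.ε) v u)
    ((pre _ u w w).flip (nil _ w))).compr₂ (A.mTot v w)

variable {A}

lemma mEnd_of (p : Wd Γ v u) (t : Tens A.aug p) (j : ℤ) (a : A.X j u w) :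
    A.mEnd v u w (of _ p t) (Lt.of _ j u w a) =
      Lt.of _ (p.deg (-1) + j + 1) v w (A.mLast w p j _ (t ⊗ₜ a)) := by
  simp only [mEnd, compr₂_apply, compl₁₂_apply, flip_apply]
  rw [nil, pre_of_of, map, lift_of, comp_apply, concat_of, mTot_of]
  have h : ∀ {v u : Γ} (p : Wd Γ v u), (p.append (.one u j w)).deg (-1) + 2 =
      p.deg (-1) + j + 1 := by
    intro v u p
    induction p with
    | nil => simp only [Wd.append, Wd.deg]; ring
    | cons v n p ih =>
      simp only [Wd.append, Wd.deg]
      omega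
  have h2 : ∀ {m n : ℤ} (q : Wd Γ v w) (s : Tens A.1 q), m = n →
      Lt.of _ m v w (A.m q m s) = Lt.of _ n v w (A.m q n s) := by
    rintro m n q s rfl
    rfl
  exact h2 _ _ (h p)

lemma toModule_zt (p : Wd Γ v u) (j : ℤ) (t : Tens A.aug p) (a : A.X j u w)
    {R : Type*} [AddCommMonoid R] [Module K R] (f : ∀ s : ZIdx Γ v, A.ZSummand v w s →ₗ[K] R) :
    DirectSum.toModule K (ZIdx Γ v) R f
      (A.zt v u w (of _ p t) (Lt.of _ j u w a)) = f ⟨u, p, j⟩ (t ⊗ₜ a) := by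
  rw [zt_of, toModule_zOf]

lemma zBTot_zt (c : Words A.aug v u) (a : Lt A.1 u w) :
    A.zBTot v w (A.zt v u w c a) = A.zt v u w (A.bT v u c) (Lt.eps _ u w a) +
      cut (fun y => (A.zt v y w).compl₂ ((A.mEnd y u w).flip a)) c := by
  induction a using Lt.ind with
  | ha x y hx hy =>
    rw [cut_congr (G := fun z => (A.zt v z w).compl₂ ((A.mEnd z u w).flip x) +
      (A.zt v z w).compl₂ ((A.mEnd z u w).flip y)) (fun _ _ _ => by simp), cut_add]
    simp only [map_add, hx, hy]
    abel
  | ho j a =>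
    induction c using DirectSum.induction_on with
    | zero => simp
    | add s t hs ht => simp only [map_add, ladd_apply, hs, ht]; abel
    | of p t =>
      change A.zBTot v w (A.zt v u w (of _ p t) _) =
        A.zt v u w (A.bT v u (of _ p t)) _ + cut _ (of _ p t)
      rw [zBTot, toModule_zt, zB, ladd_apply, barT_of, cut_of, lsmul_apply, TensorProduct.lift.tmul,
        TensorProduct.lift.tmul, Lt.eps_of, map_smul]
      congr 1
      · rw [comp_apply]
        have h : sgn K (j - 1) = sgn K (j + 1) := by rw [sgn_sub, sgn_add]; 
        rw [h]
        congr 1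
        generalize barB A.aug A.mAug p t = d
        induction d using DirectSum.induction_on with
        | zero => simp
        | add s t hs ht => simp only [map_add, ladd_apply, hs, ht]
        | of q s =>
          change lift (fun q => TensorProduct.curry (A.zOf w q j)) (of _ q s) a = A.zt v u w (of _ q s) _
          rw [lift_of, zt_of]
          rfl
      · rw [comp_apply]
        generalize split A.aug p t = d
        induction d using Cuts.ind with
        | ha x y hx hy => simp only [map_add, ladd_apply, hx, hy]
        | ho y q r s t =>
          rw [Cuts.lift_of', Cuts.lift_of']
          simp only [TensorProduct.lift.tmul, compl₁₂_apply, compl₂_apply, flip_apply, mEnd_of,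
            zt_of]
          rfl

@[simp] lemma mEnd_nil (a : Lt A.1 u w) :
    A.mEnd u u w (nil _ u) a = A.D u w a := by
  simp [mEnd, mTot_one]

@[simp] lemma mEnd_one (x : Lt A.aug v u) (a : Lt A.1 u w) :
    A.mEnd v u w (pre _ v u u x (nil _ u)) a = A.P v u w (A.augIncl v u x) a := by
  simp [mEnd, mTot_two]

lemma mEnd_two (h : A.IsShort) (x : Lt A.aug v u) (x' : Lt A.aug u z)
    (s : Words A.aug z y) (a : Lt A.1 y w) :
    A.mEnd v y w (pre _ v u y x (pre _ u z y x' s)) a = 0 := by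
  induction s using ind' with
  | ha v s t hs ht => simp only [map_add, ladd_apply, hs x', ht x', add_zero]
  | hs v c s hs => simp only [map_smul, lsmul_apply, hs x', smul_zero]
  | hn => simp [mEnd, h.mTot_three]
  | hp v u y s _ => simp [mEnd, h.mTot_three]

variable (A)

/-- The terms of the differential of `BA ⊗ A` that multiply the two leftmost factors. -/
def zcirc (v u w : Γ) : Lt A.aug v u →ₗ[K] A.ZTot u w →ₗ[K] A.ZTot v w :=
  (A.zpre v u w).compr₂ (A.zBTot v w) + (-1 : K) • ((A.zpre v u w).compl₂ (A.zBTot u w) +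
    (A.zpre v u w).compl₁₂ (A.DAug v u) (A.zeps u w))

variable {A}

@[simp] lemma zBTot_znil (a : Lt A.1 v w) :
    A.zBTot v w (A.znil v w a) = A.znil v w (A.D v w a) := by
  simp [znil, zBTot_zt]

lemma zBTot_zpre (x : Lt A.aug v u) (z : A.ZTot u w) :
    A.zBTot v w (A.zpre v u w x z) = A.zpre v u w x (A.zBTot u w z) +
      A.zpre v u w (A.DAug v u x) (A.zeps u w z) + A.zcirc v u w x z := by
  simp only [zcirc, ladd_apply, lsmul_apply, neg_smul, one_smul, compr₂_apply, compl₂_apply,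
    compl₁₂_apply]
  abel

lemma zcirc_zt (h : A.IsShort) (x : Lt A.aug v u) (c : Words A.aug u y)
    (a : Lt A.1 y w) : A.zcirc v u w x (A.zt u y w c a) =
      A.zt v y w (barCirc A.mAug v u y x c) (Lt.eps _ y w a) +
        A.znil v w (A.mEnd v y w (pre _ v u y x c) a) := by
  have h1 : cut (fun z => (A.zt v z w).compl₂ ((A.mEnd z y w).flip a) ∘ₗ
      pre _ v u z x) c = A.zpre v u w x
        (cut (fun z => (A.zt u z w).compl₂ ((A.mEnd z y w).flip a)) c) := by
    rw [map_cut]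
    refine cut_congr (fun z s t => ?_) c
    simp
  simp only [zcirc, ladd_apply, lsmul_apply, neg_smul, one_smul, compr₂_apply, compl₂_apply,
    compl₁₂_apply, zpre_zt, zBTot_zt, zeps_zt, map_add, ← h1]
  rw [barT_pre _ (fun p n hp => A.mAug_three h.m_three p n hp), cut_pre]
  simp only [map_add, ladd_apply, compl₂_apply, flip_apply, znil]
  abel

@[simp] lemma zcirc_znil (h : A.IsShort) (x : Lt A.aug v u) (a : Lt A.1 u w) :
    A.zcirc v u w x (A.znil u w a) = A.znil v w (A.P v u w (A.augIncl v u x) a) := by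
  rw [znil, zcirc_zt h, mEnd_one]
  simp

lemma zcirc_zpre (h : A.IsShort) (x : Lt A.aug v u) (x' : Lt A.aug u y)
    (z : A.ZTot y w) : A.zcirc v u w x (A.zpre u y w x' z) =
      A.zpre v y w (A.PAug v u y x x') (A.zeps y w z) := by
  induction z using zind_of with
  | ha x y hx hy => simp only [map_add, hx, hy]
  | ho r p j t a =>
    rw [zpre_zt, zcirc_zt h, mEnd_two h, zeps_zt, zpre_zt]
    simp

section DG

variable (h : A.IsShort) (H : IsDGOps A.1 A.D A.P)

include h H

lemma zeps_zcirc (x : Lt A.aug v u) (z : A.ZTot u w) :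
    A.zeps v w (A.zcirc v u w x z) = - A.zcirc v u w (Lt.eps _ v u x) (A.zeps u w z) := by
  induction z using zind with
  | ha v s t hs ht => simp only [map_add, hs x, ht x, neg_add]
  | hs v c s hs => simp only [map_smul, hs x, smul_neg]
  | hn v a => 
    rw [zcirc_znil h, zeps_znil, zeps_znil, zcirc_znil h, H.eps_m, Lt.map_eps, map_neg]
  | hp v u y z _ =>
    rw [zcirc_zpre h, zeps_zpre, zeps_zpre, zcirc_zpre h, (isDGOps_aug H).eps_m, map_neg,
      lneg_apply]

lemma zeps_zBTot (z : A.ZTot v w) :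
    A.zeps v w (A.zBTot v w z) = - A.zBTot v w (A.zeps v w z) := by
  induction z using zind with
  | ha v s t hs ht => simp only [map_add, hs, ht, neg_add]
  | hs v c s hs => simp only [map_smul, hs, smul_neg]
  | hn v a => rw [zBTot_znil, zeps_znil, zeps_znil, zBTot_znil, H.eps_d, map_neg]
  | hp v u y z ih =>
    rw [zBTot_zpre, zeps_zpre, zBTot_zpre]
    simp only [map_add, zeps_zpre, ih, zeps_zcirc h H, (isDGOps_aug H).eps_d, map_neg, lneg_apply]
    abel

lemma zcirc_zcirc (x : Lt A.aug v u) (x' : Lt A.aug u y) (z : A.ZTot y w) :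
    A.zcirc v u w x (A.zcirc u y w x' z) = - A.zcirc v y w (A.PAug v u y x x') (A.zeps y w z) := by
  induction z using zind with
  | ha v s t hs ht => simp only [map_add, hs x', ht x', neg_add]
  | hs v c s hs => simp only [map_smul, hs x', smul_neg]
  | hn v a =>
    rw [zcirc_znil h, zcirc_znil h, zeps_znil, zcirc_znil h, augIncl_P, eq_neg_iff_add_eq_zero,
      ← map_add, H.assoc, map_zero]
  | hp v u y z _ =>
    rw [zcirc_zpre h, zcirc_zpre h, zeps_zpre, zcirc_zpre h, zeps_zeps, eq_neg_iff_add_eq_zero,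
      ← ladd_apply, ← map_add, (isDGOps_aug H).assoc]
    simp

lemma zBTot_zcirc (x : Lt A.aug v u) (z : A.ZTot u w) :
    A.zBTot v w (A.zcirc v u w x z) = - A.zcirc v u w x (A.zBTot u w z) -
      A.zcirc v u w (A.DAug v u x) (A.zeps u w z) := by
  induction z using zind with
  | ha v s t hs ht => simp only [map_add, hs x, ht x]; abel
  | hs v c s hs => simp only [map_smul, hs x, smul_sub, smul_neg]
  | hn v a =>
    simp only [zcirc_znil h, zBTot_znil, zeps_znil, augIncl_D]
    rw [eq_sub_iff_add_eq, eq_neg_iff_add_eq_zero, ← map_add, ← map_add, add_right_comm, H.leibniz,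
      map_zero]
  | hp v u y z _ =>
    have h2 : A.zpre _ u w (A.DAug _ u (A.PAug _ v u x y)) z =
        - (A.zpre _ u w (A.PAug _ v u x (A.DAug v u y)) z +
          A.zpre _ u w (A.PAug _ v u (A.DAug _ v x) (Lt.eps _ v u y)) z) := by
      rw [eq_neg_iff_add_eq_zero, ← add_assoc, ← ladd_apply, ← map_add, ← ladd_apply, ← map_add,
        (isDGOps_aug H).leibniz x y]
      simp
    simp only [map_add, zcirc_zpre h, zeps_zpre, zeps_zeps, zBTot_zpre, zeps_zBTot h H, map_neg,
      zcirc_zcirc h H, h2]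
    abel

lemma zBTot_zBTot (z : A.ZTot v w) : A.zBTot v w (A.zBTot v w z) = 0 := by
  induction z using zind with
  | ha v s t hs ht => simp only [map_add, hs, ht, add_zero]
  | hs v c s hs => simp only [map_smul, hs, smul_zero]
  | hn v a => rw [zBTot_znil, zBTot_znil, H.d_d, map_zero]
  | hp v u y z ih =>
    simp only [zBTot_zpre, map_add, ih, (isDGOps_aug H).d_d, zeps_zBTot h H, zBTot_zcirc h H,
      map_zero, map_neg, zeps_zeps, lzero_apply]
    abel

end DG

end AugOps

lemma Words.cut_of_eq_zero {M : GBimod K Γ} {Q : Type u} [AddCommGroup Q] [Module K Q] (c : ℤ) (p : Wd Γ v w) (t : Tens M p) (F : ∀ u, Words M v u →ₗ[K] Words M u w →ₗ[K] Q)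
    (h : ∀ u (q : Wd Γ v u) (r : Wd Γ u w) x y, q.deg c + r.deg c = p.deg c →
      F u (of M q x) (of M r y) = 0) : cut F (of M p t) = 0 := by
  have := cut_of_mem c p t F ⊥ (fun u q r x y hqr => by
    rw [h u q r x y hqr]; exact Submodule.zero_mem _)
  simpa using this

namespace AugOps

variable {A : AugOps K Γ}

/-! #### Homogeneity -/

variable (A)

/-- The elements of degree `n`. -/
def zHom (n : ℤ) (v w : Γ) : Submodule K (A.ZTot v w) := Piece.hom K (A.ZSummand v w) (zdeg v) n

variable {A}

lemma zHom_induction {Q : Type*} [AddCommGroup Q] [Module K Q] {n : ℤ}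
    (f : A.ZTot v w →ₗ[K] Q) (S : Submodule K Q)
    (h : ∀ u (p : Wd Γ v u) j t (a : A.X j u w), p.deg (-1) + j = n →
      f (A.zt v u w (of _ p t) (Lt.of _ j u w a)) ∈ S) {z : A.ZTot v w}
    (hz : z ∈ A.zHom n v w) : f z ∈ S := by
  refine Piece.hom_induction _ _ f S (fun s x hs => ?_) hz
  obtain ⟨u, p, j⟩ := s
  rw [show f _ = f (A.zOf w p j x) by unfold zOf; congr!]
  induction x using TensorProduct.induction_on with
  | zero => rw [map_zero, map_zero]; exact Submodule.zero_mem _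
  | add x y hx hy => rw [map_add, map_add]; exact Submodule.add_mem _ hx hy
  | tmul t a =>
    rw [← zt_of]
    exact h u p j t a hs

lemma zHom_eq_zero {Q : Type*} [AddCommGroup Q] [Module K Q] {n : ℤ} (f : A.ZTot v w →ₗ[K] Q)
    (h : ∀ u (p : Wd Γ v u) j t (a : A.X j u w), p.deg (-1) + j = n →
      f (A.zt v u w (of _ p t) (Lt.of _ j u w a)) = 0) {z : A.ZTot v w}
    (hz : z ∈ A.zHom n v w) : f z = 0 := by
  have := zHom_induction f ⊥ (fun u p j t a hn => by
    rw [h u p j t a hn]; exact Submodule.zero_mem _) hz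
  simpa using this

lemma zt_mem {n k m : ℤ} (hm : n + k = m) {c : Words A.aug v u}
    (hc : c ∈ hom A.aug (-1) n v u) (a : A.X k u w) :
    A.zt v u w c (Lt.of _ k u w a) ∈ A.zHom m v w := by
  subst hm
  refine hom_induction ((A.zt v u w).flip (Lt.of _ k u w a)) _ (fun p t hp => ?_) hc
  rw [flip_apply, zt_of, ← hp]
  have := Piece.lof_mem (K := K) (A.ZSummand v w) (zdeg v) ⟨u, p, k⟩ (t ⊗ₜ[K] a)
  refine Eq.mp (congrArg (· ∈ A.zHom (p.deg (-1) + k) v w) ?_) this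
  unfold zOf
  congr!

lemma zBTot_mem (h : A.IsShort) {n m : ℤ} (hm : n + 1 = m) {z : A.ZTot v w}
    (hz : z ∈ A.zHom n v w) : A.zBTot v w z ∈ A.zHom m v w := by
  subst hm
  refine zHom_induction (A.zBTot v w) _ (fun u p j t a hs => ?_) hz
  rw [zBTot_zt]
  refine Submodule.add_mem _ ?_ ?_
  · rw [Lt.eps_of, map_smul]
    exact Submodule.smul_mem _ _ (zt_mem (by omega) (barT_mem_hom
      (fun p n hp => A.mAug_three h.m_three p n hp) rfl (of_mem_hom (-1) p t)) a)
  · refine cut_of_mem (-1) p t _ _ fun u q r x y hqr => ?_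
    rw [compl₂_apply, flip_apply, mEnd_of]
    exact zt_mem (by omega) (of_mem_hom (-1) q x) _

lemma zeps_hom {n : ℤ} {z : A.ZTot v w}
    (hz : z ∈ A.zHom n v w) : A.zeps v w z = sgn K (n + 1) • z := by
  have := zHom_eq_zero (A.zeps v w + (- sgn K (n + 1)) • LinearMap.id) (fun u p j t a hs => ?_) hz
  · simpa [add_neg_eq_zero] using this
  · rw [ladd_apply, zeps_zt, eps_of, Lt.eps_of, ← sgn_deg_neg_one, lsmul_apply, id_apply]
    simp only [map_smul, lsmul_apply, smul_smul]
    rw [← sgn_add, ← hs, show j + 1 + p.deg (-1) = p.deg (-1) + j + 1 by ring, neg_smul,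
      add_neg_cancel]

lemma zProj_zIncl (n : ℤ) (x : A.Z.X n v w) :
    A.zProj n v w (A.zIncl n v w x) = x := Piece.proj_incl _ _ n x

lemma zIncl_mem (n : ℤ) (x : A.Z.X n v w) : A.zIncl n v w x ∈ A.zHom n v w :=
  Piece.incl_mem _ _ n x

lemma zIncl_zProj {n : ℤ} {z : A.ZTot v w} (hz : z ∈ A.zHom n v w) :
    A.zIncl n v w (A.zProj n v w z) = z := Piece.incl_proj _ _ hz

lemma zProj_ne {m n : ℤ} {z : A.ZTot v w} (hz : z ∈ A.zHom n v w) (h : n ≠ m) :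
    A.zProj m v w z = 0 := Piece.proj_ne _ _ hz h

lemma zext_hom {Q : Type*} [AddCommMonoid Q] [Module K Q] {f g : A.ZTot v w →ₗ[K] Q}
    (h : ∀ n z, z ∈ A.zHom n v w → f z = g z) : f = g := by
  refine lext fun z => ?_
  induction z using zind_of with
  | ha x y hx hy => simp [hx, hy]
  | ho u p j t a => exact h _ _ (zt_mem rfl (of_mem_hom (-1) p t) a)

/-! #### Convolution -/

/-- The convolution of functionals on `BA` and on `BA ⊗ A`. -/
def convZ (f : ∀ u, Dual K (Words A.aug v u))
    (g : ∀ u, Dual K (A.ZTot u w)) : Dual K (A.ZTot v w) :=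
  zelim (fun y => cut (fun u => (LinearMap.lsmul K (Dual K (Lt A.1 y w))).compl₁₂
    (f u) ((A.zt u y w).compr₂ (g u))))

lemma convZ_zt (f : ∀ u, Dual K (Words A.aug v u))
    (g : ∀ u, Dual K (A.ZTot u w)) (c : Words A.aug v y) (a : Lt A.1 y w) :
    convZ f g (A.zt v y w c a) = conv f (fun u => (g u).comp ((A.zt u y w).flip a)) c := by
  rw [convZ, zelim_zt]
  refine (map_cut (LinearMap.applyₗ a) _ c).trans ?_
  exact cut_congr (fun u s t => by simp) c

@[simp] lemma convZ_znil (f : ∀ u, Dual K (Words A.aug v u))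
    (g : ∀ u, Dual K (A.ZTot u w)) (a : Lt A.1 v w) :
    convZ f g (A.znil v w a) = f v (nil _ v) * g v (A.znil v w a) := by
  rw [znil, convZ_zt, conv_nil]
  rfl

lemma convZ_zpre (f : ∀ u, Dual K (Words A.aug v u))
    (g : ∀ u, Dual K (A.ZTot u w)) (x : Lt A.aug v u) (z : A.ZTot u w) :
    convZ f g (A.zpre v u w x z) = f v (nil _ v) * g v (A.zpre v u w x z) +
      convZ (fun y => (f y).comp (pre _ v u y x)) g z := by
  induction z using zind_of with
  | ha x y hx hy => simp only [map_add, hx, hy]; ring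
  | ho u p j t a =>
    rw [zpre_zt, convZ_zt, convZ_zt, conv_pre]
    rfl

lemma convZ_congr {f f' : ∀ u, Dual K (Words A.aug v u)}
    {g g' : ∀ u, Dual K (A.ZTot u w)} (h : ∀ u c z, f u c * g u z = f' u c * g' u z)
    (z : A.ZTot v w) : convZ f g z = convZ f' g' z := by
  induction z using zind_of with
  | ha x y hx hy => simp only [map_add, hx, hy]
  | ho u p j t a =>
    rw [convZ_zt, convZ_zt]
    exact conv_congr (fun u s t => h u s _) _

lemma convZ_add_left (f f' : ∀ u, Dual K (Words A.aug v u))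
    (g : ∀ u, Dual K (A.ZTot u w)) (z : A.ZTot v w) :
    convZ (fun u => f u + f' u) g z = convZ f g z + convZ f' g z := by
  induction z using zind_of with
  | ha x y hx hy => simp only [map_add, hx, hy]; ring
  | ho u p j t a => rw [convZ_zt, convZ_zt, convZ_zt, conv_add_left]

lemma convZ_zeps (f : ∀ u, Dual K (Words A.aug v u))
    (g : ∀ u, Dual K (A.ZTot u w)) (z : A.ZTot v w) : convZ f g (A.zeps v w z) =
      convZ (fun u => (f u).comp (eps _ v u)) (fun u => (g u).comp (A.zeps u w)) z := by
  induction z using zind_of with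
  | ha x y hx hy => simp only [map_add, hx, hy]
  | ho u p j t a =>
    rw [zeps_zt, convZ_zt, convZ_zt, conv_eps]
    refine conv_congr (fun u s t => ?_) _
    simp

section Coder

variable (h : A.IsShort)

include h

lemma convZ_zcirc (f : ∀ u, Dual K (Words A.aug v u))
    (g : ∀ u, Dual K (A.ZTot u w)) (x : Lt A.aug v u) (z : A.ZTot u w) :
    convZ f g (A.zcirc v u w x z) = f v (nil _ v) * g v (A.zcirc v u w x z) +
      convZ (fun y => (f y).comp (barCirc A.mAug v u y x)) (fun y => (g y).comp (A.zeps y w)) z := by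
  induction z using zind with
  | ha v s t hs ht => simp only [map_add, hs x, ht x]; ring
  | hs v c s hs => simp only [map_smul, hs x, smul_eq_mul]; ring
  | hn v a => rw [zcirc_znil h]; simp
  | hp v y x' z _ =>
    rw [zcirc_zpre h, convZ_zpre, convZ_zpre, convZ_zeps]
    rw [comp_apply, circ_nil, map_zero, zero_mul, zero_add]
    refine congrArg₂ (· + ·) rfl (convZ_congr (fun u c z => ?_) z)
    rw [comp_apply, comp_apply, comp_apply, comp_apply, comp_apply, circ_pre]
    rfl

lemma convZ_zBTot (f : ∀ u, Dual K (Words A.aug v u))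
    (g : ∀ u, Dual K (A.ZTot u w)) (z : A.ZTot v w) : convZ f g (A.zBTot v w z) =
      convZ (fun u => (f u).comp (A.bT v u)) (fun u => (g u).comp (A.zeps u w)) z +
      convZ f (fun u => (g u).comp (A.zBTot u w)) z := by
  induction z using zind with
  | ha v s t hs ht => simp only [map_add, hs, ht]; ring
  | hs v c s hs => simp only [map_smul, hs, smul_eq_mul]; ring
  | hn v a => simp
  | hp v u x z ih =>
    have h1 : ∀ y, ((f y).comp (A.bT v y)).comp (pre _ v u y x) =
        (((f y).comp (pre _ v u y x)).comp (A.bT u y) +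
          ((f y).comp (pre _ v u y (A.DAug v u x))).comp (eps _ u y)) +
          (f y).comp (barCirc A.mAug v u y x) := fun y => lext fun t => by
      simp [barT_pre _ (fun p n hp => A.mAug_three h.m_three p n hp)]
    rw [zBTot_zpre, map_add, map_add, convZ_zpre, convZ_zpre, convZ_zpre, convZ_zpre, convZ_zcirc h,
      ih, convZ_zeps]
    simp only [h1, convZ_add_left, comp_apply, barT_nil, map_zero, zero_mul, zero_add, zBTot_zpre,
      map_add]
    ring

end Coder

/-- The convolution of two functionals. -/
def mulZ (f : Dual K (Words A.aug v u)) (φ : Dual K (A.ZTot u w)) : Dual K (A.ZTot v w) :=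
  convZ (Pi.single u f) (Pi.single u φ)

lemma mulZ_zt (f : Dual K (Words A.aug v u)) (φ : Dual K (A.ZTot u w))
    (c : Words A.aug v y) (a : Lt A.1 y w) :
    mulZ f φ (A.zt v y w c a) = mulDual f (φ.comp ((A.zt u y w).flip a)) c := by
  rw [mulZ, convZ_zt]
  refine conv_congr (fun z s t => ?_) c
  by_cases h : z = u
  · subst h; simp
  · simp [h]

lemma mulZ_assoc (f : Dual K (Words A.aug v u))
    (g : Dual K (Words A.aug u y)) (φ : Dual K (A.ZTot y w)) :
    mulZ (mulDual f g) φ = mulZ f (mulZ g φ) := by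
  refine zt_ext fun z c a => ?_
  rw [mulZ_zt, mulZ_zt, mulDual_assoc]
  congr 2
  refine lext fun s => ?_
  simp [mulZ_zt]

lemma mulZ_zeps (f : Dual K (Words A.aug v u))
    (φ : Dual K (A.ZTot u w)) : (mulZ f φ).comp (A.zeps v w) =
      mulZ (f.comp (eps _ v u)) (φ.comp (A.zeps u w)) := by
  refine zt_ext fun z c a => ?_
  rw [comp_apply, zeps_zt, mulZ_zt, mulZ_zt]
  refine (lcongr_fun (mulDual_eps _ _) c).trans ?_
  congr 2
  refine lext fun s => ?_
  simp

lemma mulZ_zBTot (h : A.IsShort) (f : Dual K (Words A.aug v u))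
    (φ : Dual K (A.ZTot u w)) : (mulZ f φ).comp (A.zBTot v w) =
      mulZ (f.comp (A.bT v u)) (φ.comp (A.zeps u w)) + mulZ f (φ.comp (A.zBTot u w)) := by
  refine lext fun z => ?_
  refine (convZ_zBTot h _ _ z).trans (congrArg₂ (· + ·) ?_ ?_)
  · refine convZ_congr (fun y c z => ?_) z
    by_cases hy : y = u
    · subst hy
      rw [Pi.single_eq_same, Pi.single_eq_same, Pi.single_eq_same, Pi.single_eq_same]
    · rw [Pi.single_eq_of_ne hy, Pi.single_eq_of_ne hy, zero_comp, lzero_apply, zero_mul,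
        Pi.single_eq_of_ne hy, lzero_apply, zero_mul]
  · refine convZ_congr (fun y c z => ?_) z
    by_cases hy : y = u
    · subst hy
      rw [Pi.single_eq_same, Pi.single_eq_same, Pi.single_eq_same]
    · rw [Pi.single_eq_of_ne hy]
      simp

lemma mulZ_add_left (f f' : Dual K (Words A.aug v u))
    (φ : Dual K (A.ZTot u w)) : mulZ (f + f') φ = mulZ f φ + mulZ f' φ := zt_ext fun z c a => by
    rw [ladd_apply, mulZ_zt, mulZ_zt, mulZ_zt, mulDual_add_left, ladd_apply]

lemma mulZ_add_right (f : Dual K (Words A.aug v u))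
    (φ ψ : Dual K (A.ZTot u w)) : mulZ f (φ + ψ) = mulZ f φ + mulZ f ψ := zt_ext fun z c a => by
    rw [ladd_apply, mulZ_zt, mulZ_zt, mulZ_zt, add_comp, mulDual_add_right, ladd_apply]

lemma mulZ_neg_left (f : Dual K (Words A.aug v u))
    (φ : Dual K (A.ZTot u w)) : mulZ (-f) φ = - mulZ f φ := zt_ext fun z c a => by
    rw [lneg_apply, mulZ_zt, mulZ_zt, neg_mulDual, lneg_apply]

/-! #### The right module `RHom_A(A, k)` -/

variable (A)

/-- The elements of `RHom_A(A, k)` as functionals on `BA ⊗ A`. -/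
def evZ (v w : Γ) : Lt A.Z.dual v w →ₗ[K] Dual K (A.ZTot w v) :=
  Lt.lift (fun n => Module.Dual.transpose (R := K) (A.zProj (-n) w v))

variable {A}

lemma evZ_of (n : ℤ) (φ : A.Z.dual.X n v w) (z : A.ZTot w v) :
    A.evZ v w (Lt.of _ n v w φ) z = φ (A.zProj (-n) w v z) := by
  rw [evZ, Lt.lift_of]
  rfl

lemma evZ_zIncl (n : ℤ) (φ : Lt A.Z.dual v w) (z : A.Z.X (-n) w v) :
    A.evZ v w φ (A.zIncl (-n) w v z) = Lt.comp A.Z.dual n v w φ z := by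
  induction φ using Lt.ind with
  | ha a b ha hb => simp only [map_add, ladd_apply, ha, hb]
  | ho m φ =>
    rw [evZ_of]
    by_cases h : m = n
    · subst h
      rw [zProj_zIncl, Lt.comp_of]
    · rw [zProj_ne (zIncl_mem (-n) z) (by omega), Lt.comp_of_ne _ h]
      simp

lemma evZ_injective (v w : Γ) : Function.Injective (A.evZ v w) := by
  intro a b h
  apply Lt.ext_comp
  intro n
  refine lext fun x => ?_
  rw [← evZ_zIncl, ← evZ_zIncl, h]

lemma evZ_homAkD (hA : A.IsShort) {i n : ℤ} (hn : i + 1 = n) (φ : A.Z.dual.X i v w) :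
    A.evZ v w (Lt.of _ n v w (A.homAkD i n v w φ)) =
      ((A.evZ v w (Lt.of _ i v w φ)).comp (A.zBTot w v)).comp (A.zeps w v) := by
  refine zext_hom fun k z hz => ?_
  rw [comp_apply, comp_apply, evZ_of, evZ_of]
  change sgn K (n + 1) • φ (A.zProj (-i) w v (A.zBTot w v (A.zIncl (-n) w v _))) = _
  rw [zeps_hom hz]
  by_cases h : k = -n
  · subst h
    rw [zIncl_zProj hz, map_smul, map_smul, map_smul, sgn_add, sgn_add, sgn_neg]
  · rw [zProj_ne hz h, map_smul, map_smul, zProj_ne (zBTot_mem hA rfl hz) (by omega)]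
    simp

lemma dualDistrib_zCo (j i : ℤ) (f : Dual K (A.bar.X j v u))
    (φ : Dual K (A.Z.X i u w)) (z : A.ZTot v w) :
    TensorProduct.dualDistrib K (A.bar.X j v u) (A.Z.X i u w) (f ⊗ₜ φ) (A.zCo j i v u w z) =
      mulZ (f.comp (wProj A.aug (-1) j v u)) ((φ.comp (A.zProj i u w)).comp (A.zeps u w)) z := by
  induction z using zind_of with
  | ha x y hx hy => simp only [map_add, hx, hy]
  | ho y p k t a =>
    rw [zCo, toModule_zt, mulZ_zt, TensorProduct.lift.tmul, comp_apply, mulDual, conv, cut_of]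
    generalize split A.aug p t = d
    induction d using Cuts.ind with
    | ha x y hx hy => simp only [map_add, ladd_apply, hx, hy]
    | ho z q r s t =>
      rw [Cuts.liftAt, Cuts.lift_of', Cuts.lift_of']
      by_cases h : z = u
      · subst h
        rw [dif_pos rfl]
        simp only [TensorProduct.lift.tmul, compl₁₂_apply, comp_apply, Pi.single_eq_same,
          flip_apply, zeps_zt, eps_of, Lt.eps_of, map_smul, lsmul_apply]
        simp only [zt_of]
        erw [TensorProduct.curry_apply]
        simp only [comp_apply, LinearEquiv.coe_coe, TensorProduct.assoc_tmul,
          TensorProduct.map_tmul, TensorProduct.dualDistrib_apply, LinearMap.lsmul_apply,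
          smul_eq_mul]
        rw [sgn_sub, sgn_add, sgn_deg_neg_one, sgn_add, sgn_one]
        ring
      · rw [dif_neg h]
        simp [h]

lemma evZ_homAkAct {i j n : ℤ} (hn : i + j = n) (φ : A.Z.dual.X i v u) (f : A.E.aug.X j u w) :
    A.evZ v w (Lt.of _ n v w (A.homAkAct i j n v u w φ f)) =
      mulZ ((A.evE u w (Lt.of _ j u w f.1)).comp (eps _ w u)) (A.evZ v u (Lt.of _ i v u φ)) := by
  have h2 : (A.zeps u v).comp (A.zeps u v) = LinearMap.id := lext fun z => by simp
  have h3 : mulZ ((A.evE u w (Lt.of _ j u w f.1)).comp (eps _ w u)) (A.evZ v u (Lt.of _ i v u φ)) =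
      (mulZ (A.evE u w (Lt.of _ j u w f.1))
        ((A.evZ v u (Lt.of _ i v u φ)).comp (A.zeps u v))).comp (A.zeps w v) := by
    rw [mulZ_zeps, comp_assoc, h2, comp_id]
  rw [h3]
  refine zext_hom fun k z hz => ?_
  rw [evZ_of, comp_apply, zeps_hom hz]
  change sgn K (n + 1) • TensorProduct.dualDistrib K (A.bar.X (-j) w u) (A.Z.X (-i) u v)
    (f.1 ⊗ₜ φ) (A.zCo (-j) (-i) w u v (A.zIncl (-n) w v _)) = _
  have h4 : (f.1.comp (wProj A.aug (-1) (-j) w u) : Dual K (Words A.aug w u)) =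
    A.evE u w (Lt.of _ j u w f.1) := by
      refine lext fun s => ?_
      rw [evE_of]
      rfl
  have h5 : φ.comp (A.zProj (-i) u v) = A.evZ v u (Lt.of _ i v u φ) :=
    lext fun s => by rw [evZ_of]; rfl
  rw [dualDistrib_zCo, h4, h5, map_smul]
  by_cases h : k = -n
  · subst h
    rw [zIncl_zProj hz, sgn_add, sgn_add, sgn_neg]
  · rw [zProj_ne hz h, map_zero, map_zero]
    have : mulZ (A.evE u w (Lt.of _ j u w f.1))
        ((A.evZ v u (Lt.of _ i v u φ)).comp (A.zeps u v)) z = 0 := by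
      refine zHom_eq_zero _ (fun y' p m t a hs => ?_) hz
      rw [mulZ_zt]
      refine cut_of_eq_zero (-1) p t _ fun z q r x y hqr => ?_
      by_cases hzu : z = u
      · subst hzu
        simp only [compl₁₂_apply, Pi.single_eq_same, LinearMap.lsmul_apply, smul_eq_mul, comp_apply,
          flip_apply]
        by_cases hq : q.deg (-1) = -j
        · have hr := zt_mem (A := A) rfl (of_mem_hom (-1) r y) a
          have e : A.evZ v z (Lt.of _ i v z φ) (A.zt z y' v (of _ r y) (Lt.of _ m y' v a)) = 0 := by
            rw [evZ_of, zProj_ne hr (by omega), map_zero]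
          rw [zeps_hom hr, map_smul, e, smul_zero, mul_zero]
        · have e : A.evE z w (Lt.of _ j z w f.1) (of _ q x) = 0 := by
            rw [evE_of, wProj_ne (of_mem_hom (-1) q x) hq, map_zero]
          exact mul_eq_zero_of_left e _
      · simp [hzu]
    rw [this]
    simp

end AugOps

/-! ### The complex `M ⊗ BE` -/

namespace AugOps

namespace RMod

variable {E : AugOps K Γ} (M : RMod E) {Q : Type u} [AddCommMonoid Q] [Module K Q]

/-- `m ⊗ s` as an element of `M ⊗ BE`. -/
def yt (v u w : Γ) : Lt M.1 v u →ₗ[K] Words E.aug u w →ₗ[K] M.YTot v w :=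
  Lt.lift (fun i => (lift (fun p => (TensorProduct.curry (M.yOf v i p)).flip)).flip)

variable {M}

lemma yt_of (i : ℤ) (p : Wd Γ u w) (m : M.X i v u) (t : Tens E.aug p) :
    M.yt v u w (Lt.of _ i v u m) (of _ p t) = M.yOf v i p (m ⊗ₜ t) := by
  rw [yt, Lt.lift_of, flip_apply, lift_of]
  rfl

/-- Linear maps out of `M ⊗ BE`. -/
def yelim (F : ∀ u, Lt M.1 v u →ₗ[K] Words E.aug u w →ₗ[K] Q) : M.YTot v w →ₗ[K] Q :=
  DirectSum.toModule K (YIdx Γ w) Q (fun s => TensorProduct.lift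
    ((F s.1).compl₁₂ (Lt.of _ s.2.1 v s.1) (of _ s.2.2)))

lemma toModule_yOf {R : Type*} [AddCommMonoid R] [Module K R]
    (f : ∀ s : YIdx Γ w, M.YSummand v w s →ₗ[K] R) (i : ℤ) (p : Wd Γ u w)
    (x : M.X i v u ⊗[K] Tens E.aug p) :
    DirectSum.toModule K (YIdx Γ w) R f (M.yOf v i p x) = f ⟨u, i, p⟩ x := by
  simp [yOf]

lemma toModule_yt {R : Type*} [AddCommMonoid R] [Module K R]
    (f : ∀ s : YIdx Γ w, M.YSummand v w s →ₗ[K] R) (i : ℤ) (p : Wd Γ u w)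
    (m : M.X i v u) (t : Tens E.aug p) : DirectSum.toModule K (YIdx Γ w) R f
      (M.yt v u w (Lt.of _ i v u m) (of _ p t)) = f ⟨u, i, p⟩ (m ⊗ₜ t) := by
  rw [yt_of, toModule_yOf]

@[elab_as_elim] lemma yind_of {P : M.YTot v w → Prop}
    (ha : ∀ x y, P x → P y → P (x + y))
    (ho : ∀ u i (m : M.X i v u) (p : Wd Γ u w) t,
      P (M.yt v u w (Lt.of _ i v u m) (of _ p t))) (y : M.YTot v w) : P y := by
  have h0 : P 0 := by simpa using ho w 0 0 (.nil w) 0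
  induction y using DirectSum.induction_on with
  | zero => exact h0
  | add x y hx hy => exact ha x y hx hy
  | of s x =>
    obtain ⟨u, i, p⟩ := s
    change P (M.yOf v i p x)
    induction x using TensorProduct.induction_on with
    | zero => rw [map_zero]; exact h0
    | tmul x y => rw [← yt_of]; exact ho u i x p y
    | add x y hx hy => rw [map_add]; exact ha _ _ hx hy

lemma bilin_ext {M N : GBimod K Γ}
    {f g : Lt M v u →ₗ[K] Words N z w →ₗ[K] Q}
    (h : ∀ i m p t, f (Lt.of M i v u m) (of N p t) = g (Lt.of M i v u m) (of N p t)) :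
    f = g :=
  Lt.hom_ext fun i m => hom_ext fun p t => h i m p t

@[simp] lemma yelim_yt (F : ∀ u, Lt M.1 v u →ₗ[K] Words E.aug u w →ₗ[K] Q)
    (m : Lt M.1 v u) (s : Words E.aug u w) : yelim F (M.yt v u w m s) = F u m s := by
  have : (M.yt v u w).compr₂ (yelim F) = F u := bilin_ext fun i m p t => by
    rw [compr₂_apply, yelim, toModule_yt]
    rfl
  exact lcongr_fun (lcongr_fun this m) s

lemma yt_ext {f g : M.YTot v w →ₗ[K] Q}
    (h : ∀ u m s, f (M.yt v u w m s) = g (M.yt v u w m s)) : f = g := by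
  refine lext fun z => ?_
  induction z using yind_of with
  | ha x y hx hy => simp [hx, hy]
  | ho u i m p t => exact h _ _ _

/-! #### Homogeneity -/

variable (M)

/-- The elements of degree `n`. -/
def yHom (n : ℤ) (v w : Γ) : Submodule K (M.YTot v w) := Piece.hom K (M.YSummand v w) (ydeg w) n

variable {M}

lemma yHom_induction {Q : Type*} [AddCommGroup Q] [Module K Q] {n : ℤ}
    (f : M.YTot v w →ₗ[K] Q) (S : Submodule K Q)
    (h : ∀ u i (m : M.X i v u) (p : Wd Γ u w) t, i + p.deg (-1) = n →
      f (M.yt v u w (Lt.of _ i v u m) (of _ p t)) ∈ S) {z : M.YTot v w}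
    (hz : z ∈ M.yHom n v w) : f z ∈ S := by
  refine Piece.hom_induction _ _ f S (fun s x hs => ?_) hz
  obtain ⟨u, i, p⟩ := s
  rw [show f _ = f (M.yOf v i p x) by unfold yOf; congr!]
  induction x using TensorProduct.induction_on with
  | zero => rw [map_zero, map_zero]; exact Submodule.zero_mem _
  | add x y hx hy => rw [map_add, map_add]; exact Submodule.add_mem _ hx hy
  | tmul m t =>
    rw [← yt_of]
    exact h u i m p t hs

lemma yt_mem {n k l : ℤ} (hl : n + k = l) (m : M.X n v u) {s : Words E.aug u w}
    (hs : s ∈ hom E.aug (-1) k u w) : M.yt v u w (Lt.of _ n v u m) s ∈ M.yHom l v w := by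
  subst hl
  refine hom_induction (M.yt v u w (Lt.of _ n v u m)) _ (fun p t hp => ?_) hs
  rw [yt_of, ← hp]
  have := Piece.lof_mem (K := K) (M.YSummand v w) (ydeg w) ⟨u, n, p⟩ (m ⊗ₜ[K] t)
  refine Eq.mp (congrArg (· ∈ M.yHom (n + p.deg (-1)) v w) ?_) this
  unfold yOf
  congr!

lemma yProj_yIncl (n : ℤ) (x : M.Y.X n v w) :
    M.yProj n v w (M.yIncl n v w x) = x := Piece.proj_incl _ _ n x

lemma yIncl_yProj {n : ℤ} {z : M.YTot v w} (hz : z ∈ M.yHom n v w) :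
    M.yIncl n v w (M.yProj n v w z) = z := Piece.incl_proj _ _ hz

lemma yProj_ne {m n : ℤ} {z : M.YTot v w} (hz : z ∈ M.yHom n v w) (h : n ≠ m) :
    M.yProj m v w z = 0 := Piece.proj_ne _ _ hz h

/-! #### The differential -/

variable (M)

/-- The differential of `M` on all elements. -/
def dY (v u : Γ) : Lt M.1 v u →ₗ[K] Lt M.1 v u :=
  Lt.lift (fun i => (Lt.of _ (i + (Wd.nil u).deg (-1) + 1) v u).comp
    ((M.μ v i (.nil u) (i + (Wd.nil u).deg (-1) + 1)).flip (Tens.nilEquiv E.aug u 1)))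

/-- The action of `E` on `M` on all elements. -/
def aY (v u w : Γ) : Lt M.1 v u →ₗ[K] Lt E.aug u w →ₗ[K] Lt M.1 v w :=
  Lt.lift (fun i => (Lt.lift (fun j => (((M.μ v i (.one u j w)
    (i + (Wd.one u j w).deg (-1) + 1)).compl₂ (Tens.letter E.aug u j w)).compr₂
      (Lt.of _ (i + (Wd.one u j w).deg (-1) + 1) v w)).flip)).flip)

/-- The terms of the differential of `M ⊗ BE` that multiply the two leftmost factors. -/
abbrev ycirc (v u w : Γ) : Lt M.1 v u →ₗ[K] Words E.aug u w →ₗ[K] M.YTot v w :=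
  circ (fun z => (M.aY v u z).compr₂ ((M.yt v z w).compl₂ (eps _ z w)))

/-- `M` is a differential graded module: the operations with at least two entries in the algebra
vanish. -/
structure IsDG : Prop where
  μ_two : ∀ {u w} (v : Γ) (i : ℤ) (p : Wd Γ u w) (n : ℤ), 2 ≤ p.length → M.μ v i p n = 0
  d_d : ∀ {v u} (m : Lt M.1 v u), M.dY v u (M.dY v u m) = 0
  leibniz : ∀ {v u w} (m : Lt M.1 v u) (x : Lt E.aug u w),
    M.dY v w (M.aY v u w m x) + M.aY v u w m (E.DAug u w x) +
      M.aY v u w (M.dY v u m) (Lt.eps _ u w x) = 0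
  assoc : ∀ {v u z w} (m : Lt M.1 v u) (x : Lt E.aug u z) (y : Lt E.aug z w),
    M.aY v u w m (E.PAug u z w x y) + M.aY v z w (M.aY v u z m x) (Lt.eps _ z w y) = 0

variable {M}

lemma dY_of (i : ℤ) (m : M.X i v u) :
    M.dY v u (Lt.of _ i v u m) = Lt.of _ (i + (Wd.nil u).deg (-1) + 1) v u
      (M.μ v i (.nil u) _ m (Tens.nilEquiv E.aug u 1)) := by
  simp [dY]

lemma aY_of (i j : ℤ) (m : M.X i v u) (x : E.aug.X j u w) :
    M.aY v u w (Lt.of _ i v u m) (Lt.of _ j u w x) = Lt.of _ (i + (Wd.one u j w).deg (-1) + 1) v w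
        (M.μ v i (.one u j w) _ m (Tens.letter E.aug u j w x)) := by
  rw [aY, Lt.lift_of, flip_apply, Lt.lift_of]
  rfl

lemma _root_.Koszul.Cuts.lift_apply {N : GBimod K Γ} {P : Type u} [AddCommMonoid P]
    [Module K P] (G : ∀ (u : Γ) (p : Wd Γ v u) (q : Wd Γ u w), (Tens N p ⊗[K] Tens N q) →ₗ[K]
      P →ₗ[K] Q) (d : Cuts N v w) (m : P) :
    Cuts.lift G d m = Cuts.lift (fun u p q => (LinearMap.applyₗ m).comp (G u p q)) d := by
  induction d using Cuts.ind with
  | ha x y hx hy => simp only [map_add, ladd_apply, hx, hy]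
  | ho u p q x y =>
    rw [Cuts.lift_of', Cuts.lift_of']
    rfl

section

variable (hμ : ∀ {u w} (v : Γ) (i : ℤ) (p : Wd Γ u w) (n : ℤ), 2 ≤ p.length → M.μ v i p n = 0)

include hμ

lemma yBTot_yt {v u w : Γ} (m : Lt M.toGBimod v u) (s : Words E.aug u w) :
    M.yBTot v w (M.yt v u w m s) = M.yt v u w m (E.bT u w s) +
      M.yt v u w (M.dY v u m) (eps E.aug u w s) + M.ycirc v u w m s := by
  induction m using Lt.ind with
  | ha x y hx hy => simp only [map_add, ladd_apply, hx, hy]; abel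
  | ho i m =>
    induction s using DirectSum.induction_on with
    | zero => simp
    | add s t hs ht => simp only [map_add, hs, ht]; abel
    | of p t =>
      change M.yBTot v w (M.yt v u w _ (of E.aug p t)) =
        M.yt v u w _ (E.bT u w (of E.aug p t)) +
        M.yt v u w _ (eps E.aug u w (of E.aug p t)) +
        M.ycirc v u w _ (of E.aug p t)
      rw [yBTot, toModule_yt, yB, TensorProduct.lift.tmul, ladd_apply,
        ladd_apply, add_assoc, barT_of, compl₂_apply, compl₂_apply,
        flip_apply, flip_apply]
      congr 1
      · generalize barB E.aug E.mAug p t = d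
        induction d using DirectSum.induction_on with
        | zero => simp
        | add s t hs ht => simp only [map_add, ladd_apply, hs, ht]
        | of q s =>
          change lift (fun q => (TensorProduct.curry (M.yOf v i q)).flip)
            (of E.aug q s) m = M.yt v u w _ (of E.aug q s)
          rw [lift_of, yt_of]
          rfl
      · cases p with
        | nil v =>
          dsimp only
          rw [Cuts.lift_apply, lift_split_nil]
          rw [of_nil, map_smul, map_smul, map_smul, circ_nil, smul_zero,
            add_zero, eps_nil, ← map_smul, ← of_nil, dY_of, yt_of]
          simp only [LinearMap.applyₗ_apply_apply, flip_apply, TensorProduct.curry_apply, lsmul_apply,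
            comp_apply, LinearEquiv.coe_coe, TensorProduct.assoc_symm_tmul,
            rTensor_tmul, TensorProduct.lift.tmul]
          rw [show (Wd.nil u).deg (-1) = 0 from rfl, sgn_zero, one_smul]
        | cons u j p =>
          induction t using Tens.ind with
          | ha s t hs ht => simp only [map_add, ladd_apply, hs, ht]; abel
          | hc x t =>
            dsimp only
            rw [Cuts.lift_apply, lift_split_cons, lift_split_of_cons_eq_zero]
            · rw [← pre_of_of, circ_pre, compr₂_apply, compl₂_apply, aY_of, dY_of,
              pre_of_of, eps_of, eps_of, map_smul, map_smul, yt_of, yt_of]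
              simp only [LinearMap.applyₗ_apply_apply, flip_apply,
                TensorProduct.curry_apply, lsmul_apply,
                comp_apply, LinearEquiv.coe_coe, TensorProduct.assoc_symm_tmul,
                rTensor_tmul, TensorProduct.lift.tmul, sgn_deg_neg_one]
              rfl
            · intro z u' n q r
              refine TensorProduct.ext' fun a b => ?_
              simp only [LinearMap.applyₗ_apply_apply, flip_apply,
                TensorProduct.curry_apply, lsmul_apply,
                comp_apply, LinearEquiv.coe_coe, TensorProduct.assoc_symm_tmul,
                rTensor_tmul, TensorProduct.lift.tmul]
              rw [hμ _ _ _ _ (by simp only [Wd.length]; omega)]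
              simp

end

lemma yBTot_mem (hM : M.IsDG) (hE : ∀ {v w} (p : Wd Γ v w) (n : ℤ), 3 ≤ p.length → E.mAug p n = 0)
    {n k : ℤ} (hk : n + 1 = k) {z : M.YTot v w}
    (hz : z ∈ M.yHom n v w) : M.yBTot v w z ∈ M.yHom k v w := by
  subst hk
  refine yHom_induction (M.yBTot v w) _ (fun u i m p t hs => ?_) hz
  rw [yBTot_yt hM.μ_two]
  refine Submodule.add_mem _ (Submodule.add_mem _ ?_ ?_) ?_
  · exact yt_mem (by omega) m (barT_mem_hom hE rfl (of_mem_hom (-1) p t))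
  · rw [dY_of, eps_of, map_smul]
    exact Submodule.smul_mem _ _ (yt_mem (by simp only [Wd.deg]; omega) _ (of_mem_hom (-1) p t))
  · cases p with
    | nil =>
      rw [of_nil, map_smul, circ_nil, smul_zero]
      exact Submodule.zero_mem _
    | cons u j p =>
      induction t using Tens.ind with
      | ha s t hs ht => rw [map_add, map_add]; exact Submodule.add_mem _ hs ht
      | hc x t =>
        rw [← pre_of_of, circ_pre, compr₂_apply, compl₂_apply, aY_of, eps_of, map_smul]
        refine Submodule.smul_mem _ _ (yt_mem ?_ _ (of_mem_hom (-1) p t))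
        simp only [Wd.deg] at hs ⊢
        omega

section

variable (hM : M.IsDG) (hE : ∀ {v w} (p : Wd Γ v w) (n : ℤ), 3 ≤ p.length → E.mAug p n = 0)
  (H : IsDGOps E.aug E.DAug E.PAug)

include hM hE H

lemma ycirc_ycirc (m : Lt M.1 v z) (y : Lt E.aug z u) (t : Words E.aug u w) :
    M.ycirc v z w m (barCirc E.mAug z u w y t) =
      - M.ycirc v u w (M.aY v z u m y) (eps _ u w t) := by
  induction t using ind' with
  | ha v s t hs ht => simp only [map_add, hs y, ht y, neg_add]
  | hs v c s hs => simp only [map_smul, hs y, smul_neg]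
  | hn => simp
  | hp v u x s _ =>
    rw [circ_pre, eps_pre, circ_pre]
    simp only [compr₂_apply, compl₂_apply]
    rw [circ_pre, compr₂_apply, compl₂_apply, eq_neg_iff_add_eq_zero]
    refine (ladd_apply _ _ _).symm.trans ?_
    rw [← map_add]
    erw [hM.assoc]
    simp

lemma yBTot_ycirc (m : Lt M.1 v u) (s : Words E.aug u w) :
    M.yBTot v w (M.ycirc v u w m s) = - M.ycirc v u w m (E.bT u w s) -
        M.ycirc v u w (M.dY v u m) (eps _ u w s) := by
  induction s using ind' with
  | ha v s t hs ht => simp only [map_add, hs m, ht m]; abel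
  | hs v c s hs => simp only [map_smul, hs m, smul_sub, smul_neg]
  | hn => simp
  | hp u' z y t _ =>
    have h1 : M.yt v z w (M.dY v z (M.aY v u' z m y)) t =
        - (M.yt v z w (M.aY v u' z m (E.DAug u' z y)) t +
          M.yt v z w (M.aY v u' z (M.dY v u' m) (Lt.eps _ u' z y)) t) := by
      rw [eq_neg_iff_add_eq_zero, ← add_assoc, ← ladd_apply, ← map_add, ← ladd_apply, ← map_add,
        hM.leibniz, map_zero, lzero_apply]
    rw [circ_pre, Koszul.barT_pre _ hE, eps_pre, map_add, map_add, circ_pre, circ_pre, circ_pre,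
      ycirc_ycirc hM hE H]
    simp only [compr₂_apply, compl₂_apply]
    rw [yBTot_yt hM.μ_two, eps_eps, h1, eps_barT _ hE H]
    simp only [map_neg]
    abel

lemma yBTot_yBTot (y : M.YTot v w) : M.yBTot v w (M.yBTot v w y) = 0 := by
  induction y using yind_of with
  | ha x y hx hy => simp [hx, hy]
  | ho u i m p t =>
    generalize Lt.of _ i v u m = m
    generalize of _ p t = s
    rw [yBTot_yt hM.μ_two, map_add, map_add, yBTot_yt hM.μ_two, yBTot_yt hM.μ_two,
      yBTot_ycirc hM hE H, barT_barT _ hE H, eps_barT _ hE H, hM.d_d, eps_eps]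
    simp only [map_zero, map_neg, lzero_apply, add_zero, zero_add]
    abel

end

end RMod

end AugOps

namespace AugOps

variable {A : AugOps K Γ}

/-! ### `RHom_A(A, k)` and `k` as differential graded modules -/

variable (A)

/-- The elements of the augmentation ideal of `E(A)` as functionals on the bar construction. -/
def evA (v w : Γ) : Lt A.E.aug v w →ₗ[K] Dual K (Words A.aug w v) :=
  (A.evE v w).comp (A.E.augIncl v w)

variable {A}

lemma evA_of (n : ℤ) (x : A.E.aug.X n v w) :
    A.evA v w (Lt.of _ n v w x) = A.evE v w (Lt.of _ n v w x.1) := by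
  rw [evA, comp_apply, Lt.map_of]
  rfl

lemma evA_injective (v w : Γ) : Function.Injective (A.evA v w) :=
  (A.evE_injective v w).comp (A.E.augIncl_injective v w)

lemma evA_eps (x : Lt A.E.aug v w) :
    A.evA v w (Lt.eps _ v w x) = - (A.evA v w x).comp (eps _ w v) := by
  rw [evA, comp_apply, Lt.map_eps]
  exact A.evE_eps _

section

variable (hA : A.NoHigher)

include hA

lemma evA_D (x : Lt A.E.aug v w) : A.evA v w (A.E.DAug v w x) =
    ((A.evA v w x).comp (A.bT w v)).comp (eps _ w v) := by
  rw [evA, comp_apply, augIncl_D, evE_D hA]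
  rfl

lemma evA_P (x : Lt A.E.aug v u) (y : Lt A.E.aug u w) : A.evA v w (A.E.PAug v u w x y) =
      mulDual ((A.evA u w y).comp (eps _ w u)) (A.evA v u x) := by
  rw [evA, comp_apply, augIncl_P, evE_P hA]
  rfl

end

lemma homAk_μ_two (v : Γ) (i : ℤ) (p : Wd Γ u w) (n : ℤ) (hp : 2 ≤ p.length) :
    A.homAk.μ v i p n = 0 := by
  match p, hp with
  | .cons _ _ (.cons _ _ _), _ => rfl

lemma evZ_dY (h : A.IsShort) (φ : Lt A.Z.dual v u) :
    A.evZ v u (A.homAk.dY v u φ) = ((A.evZ v u φ).comp (A.zBTot u v)).comp (A.zeps u v) := by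
  induction φ using Lt.ind with
  | ha x y hx hy => simp only [map_add, add_comp, hx, hy]
  | ho i φ =>
    rw [← evZ_homAkD h (n := i + (Wd.nil u).deg (-1) + 1) (by simp [Wd.deg])]
    refine congrArg (A.evZ v u) ((RMod.dY_of (M := A.homAk) i φ).trans (congrArg _ ?_))
    change (LinearMap.lsmul K _).flip.compl₁₂ _ _ φ (Tens.nilEquiv A.E.aug u 1) = _
    simp

lemma evZ_aY (φ : Lt A.Z.dual v u) (x : Lt A.E.aug u w) : A.evZ v w (A.homAk.aY v u w φ x) =
      mulZ ((A.evA u w x).comp (eps _ w u)) (A.evZ v u φ) := by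
  have h0 : ∀ f : Dual K (Words A.aug w u), mulZ f (0 : Dual K (A.ZTot u v)) = 0 := fun f => by
    have := mulZ_add_right f (0 : Dual K (A.ZTot u v)) 0
    simpa using this
  have h1 : ∀ φ : Dual K (A.ZTot u v), mulZ (0 : Dual K (Words A.aug w u)) φ = 0 := fun φ => by
    have := mulZ_add_left (0 : Dual K (Words A.aug w u)) 0 φ
    simpa using this
  induction φ using Lt.ind with
  | ha a b ha hb => simp only [map_add, ladd_apply, mulZ_add_right, ha, hb]
  | ho i φ =>
    induction x using Lt.ind with
    | ha a b ha hb => simp only [map_add, mulZ_add_left, add_comp, ha, hb]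
    | ho j x =>
      rw [evA_of, ← evZ_homAkAct (n := i + (Wd.one u j w).deg (-1) + 1)
        (by simp only [Wd.deg]; ring)]
      refine congrArg (A.evZ v w) ((RMod.aY_of (M := A.homAk) i j φ x).trans (congrArg _ ?_))
      change (A.homAkAct i j _ v u w).compl₂ _ φ (Tens.letter A.E.aug u j w x) = _
      rw [compl₂_apply, AInfCoalg.unletter_letter]

lemma homAk_isDG (h : A.IsShort) (H : IsDGOps A.1 A.D A.P) : A.homAk.IsDG where
  μ_two v i p n hp := homAk_μ_two v i p n hp
  d_d {v u} m := by
    apply A.evZ_injective v u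
    refine lext fun z => ?_
    rw [evZ_dY h, evZ_dY h]
    simp only [comp_apply]
    rw [zeps_zBTot h H, zeps_zeps, map_neg, zBTot_zBTot h H]
    simp
  leibniz {v u w} m x := by
    have hA : A.NoHigher := h.m_three
    apply A.evZ_injective v w
    rw [map_add, map_add, evZ_dY h, evZ_aY, evZ_aY, evZ_aY, evZ_dY h, evA_D hA, evA_eps, mulZ_zBTot h]
    have h1 : ((A.evZ v u m).comp (A.zeps u v)).comp (A.zeps u v) = A.evZ v u m :=
      lext fun z => by simp
    have h2 : ((A.evA u w x).comp (eps _ w u)).comp (eps _ w u) =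
        A.evA u w x := lext fun z => by simp
    have h3 : (((A.evA u w x).comp (eps _ w u)).comp (A.bT w u)).comp
        (eps _ w u) = - (A.evA u w x).comp (A.bT w u) := lext fun z => by
      simp only [comp_apply, lneg_apply]
      rw [eps_barT _ (fun p n hp => A.mAug_three hA p n hp) (isDGOps_aug H), eps_eps, map_neg]
    have h4 : (((A.evA u w x).comp (A.bT w u)).comp (eps _ w u)).comp
        (eps _ w u) = (A.evA u w x).comp (A.bT w u) := lext fun z => by simp
    rw [add_comp, mulZ_zeps, mulZ_zeps, h1, h2, h3, h4, neg_comp, h2, mulZ_neg_left, mulZ_neg_left,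
      map_zero]
    abel
  assoc {v u z w} m x y := by
    have hA : A.NoHigher := h.m_three
    apply A.evZ_injective v w
    rw [map_add, evZ_aY, evZ_aY, evZ_aY, evA_P hA, evA_eps, mulDual_eps, mulZ_assoc]
    have h2 : ∀ {a b : Γ} (f : Dual K (Words A.aug a b)),
        (f.comp (eps _ a b)).comp (eps _ a b) = f := fun f => lext fun z => by simp
    rw [h2, neg_comp, h2, mulZ_neg_left, map_zero, add_neg_cancel]

lemma kMod_dY (E : AugOps K Γ) (m : Lt (kMod E).toGBimod v u) : (kMod E).dY v u m = 0 := by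
  induction m using Lt.ind with
  | ha x y hx hy => rw [map_add, hx, hy, add_zero]
  | ho i m => rw [RMod.dY_of]; simp

lemma kMod_aY (E : AugOps K Γ) (m : Lt (kMod E).toGBimod v u) (x : Lt E.aug u w) :
    (kMod E).aY v u w m x = 0 := by
  induction m using Lt.ind with
  | ha a b ha hb => rw [map_add, ladd_apply, ha, hb, add_zero]
  | ho i m =>
    induction x using Lt.ind with
    | ha a b ha hb => rw [map_add, ha, hb, add_zero]
    | ho j x => rw [RMod.aY_of]; simp

lemma kMod_isDG (E : AugOps K Γ) : (kMod E).IsDG where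
  μ_two _ _ _ _ _ := rfl
  d_d m := by rw [kMod_dY]
  leibniz m x := by rw [kMod_dY, kMod_dY, kMod_aY, kMod_aY, add_zero, add_zero]
  assoc m x y := by rw [kMod_aY, kMod_aY, add_zero]

lemma kMod_yBTot (E : AugOps K Γ) (m : Lt (kMod E).toGBimod v u)
    (s : Words E.aug u w) : (kMod E).yBTot v w ((kMod E).yt v u w m s) =
      (kMod E).yt v u w m (E.bT u w s) := by
  have : (kMod E).ycirc v u w m s = 0 := by
    induction s using ind' with
    | ha v s t hs ht => rw [map_add, hs, ht, add_zero]
    | hs v c s hs => rw [map_smul, hs, smul_zero]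
    | hn => simp
    | hp v u x s _ => rw [circ_pre, compr₂_apply, kMod_aY, map_zero,
      lzero_apply]
  rw [RMod.yBTot_yt (kMod_isDG E).μ_two, kMod_dY, this, map_zero, lzero_apply, add_zero, add_zero]

end AugOps

end Words

section Predual

variable {K : Type u} [Field K] {Γ : Type u} {v w u z y : Γ}

/-- A family of direct sums as a graded bimodule. -/
abbrev pieceGr {ι : Γ → Γ → Type u} (V : ∀ v w, ι v w → Type u) [∀ v w i, AddCommGroup (V v w i)]
    [∀ v w i, Module K (V v w i)] (deg : ∀ v w, ι v w → ℤ) : GBimod K Γ where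
  X n v w := Piece (V v w) (deg v w) n

lemma Piece.eq_zero_of_proj {ι : Type u} (V : ι → Type u) [∀ i, AddCommGroup (V i)]
    [∀ i, Module K (V i)] (deg : ι → ℤ) {x : ⨁ i, V i}
    (h : ∀ n, Piece.proj K V deg n x = 0) : x = 0 := by
  have := Piece.exists_sum (K := K) V deg x ⊥ (fun n => by rw [h n, map_zero]; exact zero_mem _)
  simpa using this

lemma isQuasiIso_dual_of_piece {ι : Γ → Γ → Type u} (V : ∀ v w, ι v w → Type u)
    [∀ v w i, AddCommGroup (V v w i)] [∀ v w i, Module K (V v w i)] (deg : ∀ v w, ι v w → ℤ)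
    {N : GBimod K Γ} (D : ∀ v w, (⨁ i, V v w i) →ₗ[K] ⨁ i, V v w i)
    (hD : ∀ n v w x, x ∈ Piece.hom K (V v w) (deg v w) n →
      D v w x ∈ Piece.hom K (V v w) (deg v w) (n + 1)) (hDD : ∀ v w x, D v w (D v w x) = 0)
    (δN : ∀ i j v w, N.X i v w →ₗ[K] N.X j v w) (f : ∀ n v w, (⨁ i, V v w i) →ₗ[K] N.X n v w)
    (hf0 : ∀ m n v w x, x ∈ Piece.hom K (V v w) (deg v w) m → m ≠ n → f n v w x = 0)
    (hf : ∀ i j v w x, i + 1 = j → x ∈ Piece.hom K (V v w) (deg v w) i →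
      f j v w (D v w x) = δN i j v w (f i v w x))
    (hs : ∀ n v w, Function.Surjective (f n v w))
    (hac : ∀ v w x, (∀ n, f n v w x = 0) → D v w x = 0 → ∃ y, (∀ n, f n v w y = 0) ∧ D v w y = x) :
    IsQuasiIso (M := N.dual) (N := (pieceGr V deg).dual) (dualD δN)
      (dualD (M := pieceGr V deg) (fun i j v w => (Piece.proj K (V v w) (deg v w) j).comp
        ((D v w).comp (Piece.incl K (V v w) (deg v w) i))))
      (fun n v w => Module.Dual.transpose (R := K)
        ((f (-n) w v).comp (Piece.incl K (V w v) (deg w v) (-n)))) := by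
  have hf1 : ∀ n v w x, f n v w (Piece.incl K (V v w) (deg v w) n
      (Piece.proj K (V v w) (deg v w) n x)) = f n v w x := by
    intro n v w x
    have : x ∈ LinearMap.ker ((f n v w).comp ((Piece.incl K (V v w) (deg v w) n).comp
        (Piece.proj K (V v w) (deg v w) n)) - f n v w) := by
      refine Piece.exists_sum (V v w) (deg v w) x _ fun m => ?_
      rw [mem_ker, lsub_apply, comp_apply, comp_apply]
      by_cases h : m = n
      · subst h
        rw [Piece.proj_incl, sub_self]
      · rw [Piece.proj_incl_ne _ _ h, map_zero, map_zero, hf0 m n v w _ (Piece.incl_mem _ _ _ _) h,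
          sub_zero]
    rw [mem_ker, lsub_apply, sub_eq_zero] at this
    exact this
  have hfD : ∀ i j v w x, i + 1 = j → x ∈ Piece.hom K (V v w) (deg v w) i →
      Piece.incl K (V v w) (deg v w) j (Piece.proj K (V v w) (deg v w) j (D v w x)) = D v w x := by
    rintro i j v w x rfl hx
    exact Piece.incl_proj _ _ (hD _ _ _ _ hx)
  refine isQuasiIso_dual (M := pieceGr V deg) _ δN
    (fun n v w => (f n v w).comp (Piece.incl K (V v w) (deg v w) n)) ?_ ?_ ?_ ?_ ?_
  · intro i j k v w x hij hjk
    simp only [comp_apply]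
    rw [hfD _ _ _ _ _ hij (Piece.incl_mem _ _ _ _), hDD, map_zero]
  · intro i j k v w x hij hjk
    obtain ⟨x, rfl⟩ := hs i v w x
    rw [← hf1, ← hf _ _ _ _ _ hij (Piece.incl_mem _ _ _ _), ← hf _ _ _ _ _ hjk, hDD, map_zero]
    rw [← hij]
    exact hD _ _ _ _ (Piece.incl_mem _ _ _ _)
  · intro i j v w x hij
    simp only [comp_apply]
    rw [hfD _ _ _ _ _ hij (Piece.incl_mem _ _ _ _), hf _ _ _ _ _ hij (Piece.incl_mem _ _ _ _)]
  · intro n v w x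
    obtain ⟨x, rfl⟩ := hs n v w x
    exact ⟨_, hf1 n v w x⟩
  · intro i j k v w x hij hjk hfx hdx
    have h0 : ∀ n, f n v w (Piece.incl K (V v w) (deg v w) j x) = 0 := fun n => by
      by_cases h : j = n
      · subst h
        exact hfx
      · exact hf0 _ _ _ _ _ (Piece.incl_mem _ _ _ _) h
    obtain ⟨y, hy, hyx⟩ := exists_primitive_piece (V v w) (deg v w) (D v w)
      (fun n x hx => hD n v w x hx) (⨅ n, LinearMap.ker (f n v w)) (fun n x hx => by
        simp only [Submodule.mem_iInf, mem_ker] at hx ⊢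
        intro m
        by_cases h : n = m
        · subst h
          rw [hf1, hx]
        · exact hf0 _ _ _ _ _ (Piece.incl_mem _ _ _ _) h) (fun x hx hdx => by
        simp only [Submodule.mem_iInf, mem_ker] at hx
        obtain ⟨y, hy, hyx⟩ := hac v w x hx hdx
        exact ⟨y, by simpa only [Submodule.mem_iInf, mem_ker] using hy, hyx⟩)
      i j k hij hjk x (by simpa only [Submodule.mem_iInf, mem_ker] using h0) hdx
    simp only [Submodule.mem_iInf, mem_ker] at hy
    exact ⟨y, hy i, hyx⟩

end Predual

section Words

variable {K : Type u} [Field K] {Γ : Type u} {v w u z y : Γ}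

namespace AugOps

variable (A : AugOps K Γ)

/-! ### Functionals as elements of `RHom_A(A, k)` -/

/-- The degree `n` part of a functional on `BA ⊗ A`. -/
def mkZ (n : ℤ) (v w : Γ) : Dual K (A.ZTot w v) →ₗ[K] Lt A.Z.dual v w :=
  (Lt.of _ n v w).comp (Module.Dual.transpose (R := K) (A.zIncl (-n) w v))

variable {A}

lemma evZ_mkZ {n : ℤ} {f : Dual K (A.ZTot w v)}
    (hf : ∀ m z, z ∈ A.zHom m w v → m ≠ -n → f z = 0) : A.evZ v w (A.mkZ n v w f) = f := by
  refine zext_hom fun m z hz => ?_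
  rw [mkZ, comp_apply, evZ_of]
  change f (A.zIncl (-n) w v (A.zProj (-n) w v z)) = f z
  by_cases h : m = -n
  · subst h
    rw [zIncl_zProj hz]
  · rw [zProj_ne hz h, map_zero, map_zero, hf m z hz h]

lemma evZ_of_eq_zero {i m : ℤ} (φ : A.Z.dual.X i v w) {z : A.ZTot w v}
    (hz : z ∈ A.zHom m w v) (h : m ≠ -i) : A.evZ v w (Lt.of _ i v w φ) z = 0 := by
  rw [evZ_of, zProj_ne hz h, map_zero]

variable (A)

/-- The transpose of an operator of degree `k` on `BA ⊗ A`. -/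
def zOp (k : ℤ) (v w : Γ) (T : A.ZTot w v →ₗ[K] A.ZTot w v) :
    Lt A.Z.dual v w →ₗ[K] Lt A.Z.dual v w :=
  Lt.lift (fun i => (A.mkZ (i + k) v w).comp ((Module.Dual.transpose (R := K) T).comp
    ((A.evZ v w).comp (Lt.of _ i v w))))

variable {A}

lemma evZ_zOp {k : ℤ} {T : A.ZTot w v →ₗ[K] A.ZTot w v}
    (hT : ∀ n z, z ∈ A.zHom n w v → T z ∈ A.zHom (n + k) w v) (φ : Lt A.Z.dual v w) :
    A.evZ v w (A.zOp k v w T φ) = (A.evZ v w φ).comp T := by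
  induction φ using Lt.ind with
  | ha a b ha hb => simp only [map_add, add_comp, ha, hb]
  | ho i φ =>
    rw [zOp, Lt.lift_of]
    exact evZ_mkZ fun m z hz hm => evZ_of_eq_zero φ (hT m z hz) (by omega)

/-! ### The contraction of `BA ⊗ A` -/

variable (A)

/-- The unit. -/
def unitL (v w : Γ) : Lt A.1 v w := Lt.of _ 0 v w (A.one 0 v w)

/-- The augmentation. -/
def epsTot (v w : Γ) : Lt A.1 v w →ₗ[K] K := Lt.lift (fun n => A.ε n v w)

namespace IsAugDGAlg

variable {A} (h : A.IsAugDGAlg)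

include h

lemma ε_one_mul (n : ℤ) (v w : Γ) (a : A.X n v w) :
    A.ε n v w a * A.ε n v w (A.one n v w) = A.ε n v w a := by
  by_cases hn : n = 0 ∧ v = w
  · obtain ⟨rfl, rfl⟩ := hn
    rw [h.ε_one, mul_one]
  · rw [h.ε_zero n v w hn]
    simp

/-- The projection to the augmentation ideal. -/
def augProj (v w : Γ) : Lt A.1 v w →ₗ[K] Lt A.aug v w :=
  Lt.lift (fun n => (Lt.of _ n v w).comp (LinearMap.codRestrict (LinearMap.ker (A.ε n v w))
    (LinearMap.id + (-1 : K) • (A.ε n v w).smulRight (A.one n v w)) (fun a => by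
      rw [mem_ker]
      simp [h.ε_one_mul])))

lemma augIncl_augProj (a : Lt A.1 v w) :
    A.augIncl v w (h.augProj v w a) = a + (-A.epsTot v w a) • A.unitL v w := by
  induction a using Lt.ind with
  | ha x y hx hy => simp only [map_add, hx, hy, neg_add, add_smul]; abel
  | ho n a =>
    rw [augProj, Lt.lift_of, comp_apply, Lt.map_of, epsTot, Lt.lift_of, unitL]
    change Lt.of _ n v w (a + (-1 : K) • A.ε n v w a • A.one n v w) = _
    rw [map_add, neg_smul, neg_smul, one_smul, map_neg, map_smul]
    by_cases hn : n = 0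
    · subst hn
      rfl
    · rw [h.ε_zero n v w (fun h' => hn h'.1)]
      simp

lemma augProj_eps (a : Lt A.1 v w) :
    h.augProj v w (Lt.eps _ v w a) = Lt.eps _ v w (h.augProj v w a) := by
  induction a using Lt.ind with
  | ha x y hx hy => simp only [map_add, hx, hy]
  | ho n a => rw [Lt.eps_of, map_smul, augProj, Lt.lift_of, comp_apply, Lt.eps_of]

lemma augProj_unitL (v w : Γ) : h.augProj v w (A.unitL v w) = 0 := by
  apply A.augIncl_injective
  rw [augIncl_augProj, map_zero, unitL, epsTot, Lt.lift_of]
  by_cases hv : v = w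
  · subst hv
    rw [h.ε_one]
    simp
  · rw [A.one_zero 0 v w (fun h' => hv h'.2)]
    simp

lemma D_unitL (v w : Γ) : A.D v w (A.unitL v w) = 0 := by
  rw [unitL, opD_of]
  by_cases hv : v = w
  · subst hv
    have := h.m1_one ((Wd.one v 0 v).deg (-1) + 2) v
    rw [AugOps.d, comp_apply] at this
    rw [this, map_zero]
  · rw [A.one_zero 0 v w (fun h' => hv h'.2)]
    simp

lemma P_unitL (x : Lt A.1 v w) : A.P v w w x (A.unitL w w) = x := by
  induction x using Lt.ind with
  | ha x y hx hy => simp only [map_add, ladd_apply, hx, hy]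
  | ho n x =>
    rw [unitL, opM_of]
    have := h.m2_one n v w x
    have h2 : ∀ m, n = m → Lt.of _ m v w (A.m (.two v n w 0 w) m
        (Tens.cons A.1 v n _ x (Tens.letter A.1 w 0 w (A.one 0 w w)))) = Lt.of _ n v w x := by
      rintro m rfl
      exact congrArg _ this
    exact h2 _ (by simp only [Wd.deg]; ring)

lemma epsTot_D (a : Lt A.1 v w) : A.epsTot v w (A.D v w a) = 0 := by
  induction a using Lt.ind with
  | ha x y hx hy => simp only [map_add, hx, hy, add_zero]
  | ho n a =>
    rw [opD_of, epsTot, Lt.lift_of]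
    exact h.ε_d n _ v w a

lemma epsTot_of_ne (hv : v ≠ w) (a : Lt A.1 v w) : A.epsTot v w a = 0 := by
  induction a using Lt.ind with
  | ha x y hx hy => simp only [map_add, hx, hy, add_zero]
  | ho n a =>
    rw [epsTot, Lt.lift_of, h.ε_zero n v w (fun h' => hv h'.2), lzero_apply]

lemma epsTot_P (x : Lt A.1 v u) (y : Lt A.1 u w) :
    A.epsTot v w (A.P v u w x y) = A.epsTot v u x * A.epsTot u w y := by
  induction x using Lt.ind with
  | ha a b ha hb => simp only [map_add, ladd_apply, ha, hb, add_mul]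
  | ho i x =>
    induction y using Lt.ind with
    | ha a b ha hb => simp only [map_add, ha, hb, mul_add]
    | ho j y =>
      rw [opM_of, epsTot, epsTot, epsTot, Lt.lift_of, Lt.lift_of, Lt.lift_of, ← h.ε_m2]
      have h2 : ∀ m, i + j = m → A.ε m v w (A.m (.two v i u j w) m
          (Tens.cons A.1 v i _ x (Tens.letter A.1 u j w y))) =
          A.ε (i + j) v w (A.m2 i j (i + j) v u w x y) := by
        rintro m rfl
        rfl
      exact h2 _ (by simp only [Wd.deg]; ring)

lemma epsTot_augIncl (x : Lt A.aug v w) : A.epsTot v w (A.augIncl v w x) = 0 := by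
  induction x using Lt.ind with
  | ha a b ha hb => simp only [map_add, ha, hb, add_zero]
  | ho n x =>
    rw [Lt.map_of, epsTot, Lt.lift_of]
    exact x.2

/-- The contracting homotopy of `BA ⊗ A`. -/
def zs (v w : Γ) : A.ZTot v w →ₗ[K] A.ZTot v w :=
  zelim (fun y => ((concat _ v y w).compl₂ (((pre _ y w w).flip
    (nil _ w)).comp (h.augProj y w))).compr₂ ((A.zt v w w).flip (A.unitL w w)))

omit h in
variable (A) in
/-- The augmentation of `BA ⊗ A`. -/
def _root_.Koszul.AugOps.zp (v w : Γ) : A.ZTot v w →ₗ[K] K :=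
  zelim (fun y => (LinearMap.lsmul K K).compl₁₂ (counit _ v y) (A.epsTot y w))

end IsAugDGAlg

end AugOps

end Words

section Words

variable {K : Type u} [Field K] {Γ : Type u} {v w u z y : Γ}

namespace AugOps

variable {A : AugOps K Γ}

@[simp] lemma zp_zt (c : Words A.aug v y) (a : Lt A.1 y w) :
    A.zp v w (A.zt v y w c a) = counit _ v y c * A.epsTot y w a := by
  rw [zp, zelim_zt]
  rfl

@[simp] lemma zp_znil (a : Lt A.1 v w) :
    A.zp v w (A.znil v w a) = A.epsTot v w a := by
  rw [znil, zp_zt, counit_nil, one_mul]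

@[simp] lemma zp_zpre (x : Lt A.aug v u) (z : A.ZTot u w) :
    A.zp v w (A.zpre v u w x z) = 0 := by
  have : (A.zp v w).comp (A.zpre v u w x) = 0 := zt_ext fun y c a => by
    rw [comp_apply, zpre_zt, zp_zt, counit_pre, zero_mul, lzero_apply]
  exact lcongr_fun this z

lemma zneg_smul (c : K) (z : A.ZTot v w) : -c • z = -(c • z) := neg_smul c z

lemma unitL_ne (hv : v ≠ w) : A.unitL v w = 0 := by
  rw [unitL, A.one_zero 0 v w (fun h => hv h.2), map_zero]

lemma eps_unitL (v w : Γ) : Lt.eps _ v w (A.unitL v w) = - A.unitL v w := by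
  rw [unitL, Lt.eps_of]
  simp

namespace IsAugDGAlg

variable (h : A.IsAugDGAlg)

include h

lemma augProj_D (a : Lt A.1 v w) : h.augProj v w (A.D v w a) = A.DAug v w (h.augProj v w a) := by
  apply A.augIncl_injective
  rw [h.augIncl_augProj, augIncl_D, h.augIncl_augProj, h.epsTot_D, map_add, map_smul, h.D_unitL]
  simp

lemma zs_zt (c : Words A.aug v y) (a : Lt A.1 y w) :
    h.zs v w (A.zt v y w c a) = A.zt v w w (concat _ v y w c
      (pre _ y w w (h.augProj y w a) (nil _ w))) (A.unitL w w) := by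
  rw [zs, zelim_zt]
  rfl

lemma zs_znil (a : Lt A.1 v w) : h.zs v w (A.znil v w a) =
    A.zpre v w w (h.augProj v w a) (A.znil w w (A.unitL w w)) := by
  rw [znil, zs_zt, nil_concat, znil, zpre_zt]

lemma zs_zpre (x : Lt A.aug v u) (z : A.ZTot u w) :
    h.zs v w (A.zpre v u w x z) = A.zpre v u w x (h.zs u w z) := by
  have : (h.zs v w).comp (A.zpre v u w x) = (A.zpre v u w x).comp (h.zs u w) :=
    zt_ext fun y c a => by
      rw [comp_apply, comp_apply, zpre_zt, zs_zt, zs_zt, zpre_zt, pre_concat]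
  exact lcongr_fun this z

lemma zs_zeps (z : A.ZTot v w) : h.zs v w (A.zeps v w z) = - A.zeps v w (h.zs v w z) := by
  have : (h.zs v w).comp (A.zeps v w) = - (A.zeps v w).comp (h.zs v w) := zt_ext fun y c a => by
      rw [lneg_apply, comp_apply, comp_apply, zeps_zt, zs_zt, zs_zt, zeps_zt, eps_concat, eps_pre,
        eps_nil, h.augProj_eps, eps_unitL, map_neg, neg_neg]
  exact lcongr_fun this z

lemma augProj_of (j : ℤ) (a : A.X j v w) :
    ∃ b : A.aug.X j v w, h.augProj v w (Lt.of _ j v w a) = Lt.of _ j v w b := by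
  rw [augProj, Lt.lift_of, comp_apply]
  exact ⟨_, rfl⟩

lemma zs_mem {n : ℤ} {z : A.ZTot v w} (hz : z ∈ A.zHom n v w) :
    h.zs v w z ∈ A.zHom (n + -1) v w := by
  refine zHom_induction (h.zs v w) _ (fun y p j t a hp => ?_) hz
  rw [zs_zt]
  obtain ⟨b, hb⟩ := h.augProj_of j a
  rw [hb]
  have h2 : concat _ v y w (of _ p t) (pre _ y w w
      (Lt.of _ j y w b) (nil _ w)) ∈ hom A.aug (-1) (n + -1) v w :=
    concat_mem_hom (of_mem_hom' p rfl t)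
      (pre_mem_hom j (j + -1) b (nil_mem_hom _ _) (by ring)) (by rw [← hp]; ring)
  exact zt_mem (k := 0) (add_zero _) h2 (A.one 0 w w)

lemma zs_zcirc (x : Lt A.aug v u) (z : A.ZTot u w) :
    h.zs v w (A.zcirc v u w x z) + A.zcirc v u w x (h.zs u w z) =
      A.zp u w z • A.zpre v u w x (A.znil u w (A.unitL u w)) := by
  have hs := h.isShort
  induction z using zind with
  | ha v s t hs ht =>
    simp only [map_add, add_smul]
    rw [← hs x, ← ht x]
    abel
  | hs v c s hs =>
    simp only [map_smul, smul_assoc]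
    rw [← hs x, smul_add]
  | hn u a =>
    have : h.augProj v w (A.P v u w (A.augIncl v u x) a) = A.PAug v u w x (h.augProj u w a) +
        A.epsTot u w a • (if e : u = w then e ▸ x else 0) := by
      apply A.augIncl_injective
      rw [map_add, map_smul, h.augIncl_augProj, augIncl_P, h.augIncl_augProj, h.epsTot_P,
        h.epsTot_augIncl, map_add, map_smul]
      by_cases e : u = w
      · subst e
        rw [h.P_unitL]
        simp
      · rw [unitL_ne e, dif_neg e]
        simp
    rw [zcirc_znil hs, zs_znil, zs_znil, zcirc_zpre hs, zp_znil, zeps_znil, eps_unitL, map_neg,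
      map_neg, this, map_add, map_smul, ladd_apply, lsmul_apply, add_neg_cancel_comm]
    by_cases e : u = w
    · subst e
      rw [dif_pos rfl]
    · rw [h.epsTot_of_ne e, zero_smul, zero_smul]
  | hp u y x' z ih =>
    rw [zs_zpre, zcirc_zpre hs, zcirc_zpre hs, zs_zpre, zp_zpre, h.zs_zeps, zero_smul, map_neg,
      neg_add_cancel]

lemma zBTot_zs (z : A.ZTot v w) : A.zBTot v w (h.zs v w z) + h.zs v w (A.zBTot v w z) =
      z - A.zp v w z • A.znil v w (A.unitL v w) := by
  have hs := h.isShort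
  induction z using zind with
  | ha v s t hs ht =>
    simp only [map_add, add_smul]
    rw [add_add_add_comm, hs, ht]
    abel
  | hs v c s hs =>
    simp only [map_smul]
    rw [← smul_add, hs, smul_sub, ← mul_smul, smul_eq_mul]
  | hn v a =>
    rw [zs_znil, zBTot_zpre, zcirc_znil hs, zBTot_znil, zBTot_znil, zs_znil, h.D_unitL, h.P_unitL,
      zeps_znil, eps_unitL, h.augProj_D, h.augIncl_augProj, zp_znil, map_zero, map_zero, map_neg,
      map_neg, map_add, map_smul, zneg_smul, zero_add, sub_eq_add_neg]
    abel
  | hp v u x z ih =>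
    have h1 := h.zs_zcirc x z
    have h2 := congrArg (A.zpre v u w x) ih
    rw [map_add, map_sub, map_smul, ← h1] at h2
    rw [zBTot_zpre, map_add, map_add, zs_zpre, zs_zpre, zs_zpre, zBTot_zpre, zp_zpre, h.zs_zeps,
      map_neg, zero_smul, sub_zero]
    rw [eq_sub_iff_add_eq] at h2
    rw [← h2]
    abel

end IsAugDGAlg

end AugOps

namespace AugOps

namespace RMod

variable {E : AugOps K Γ}

section

variable (M : RMod E)

/-- The part of `M ⊗ BE` with words of length less than `k`. -/
def lenLt (k : ℕ) (v w : Γ) : Submodule K (M.YTot v w) :=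
  Submodule.span K {y | ∃ (u : Γ) (i : ℤ) (m : M.X i v u) (p : Wd Γ u w) (t : Tens E.aug p),
    p.length < k ∧ y = M.yt v u w (Lt.of _ i v u m) (of _ p t)}

variable {M}

lemma lenLt_induction {Q : Type*} [AddCommGroup Q] [Module K Q] {k : ℕ}
    (f : M.YTot v w →ₗ[K] Q) (S : Submodule K Q)
    (h : ∀ u i (m : M.X i v u) (p : Wd Γ u w) t, p.length < k →
      f (M.yt v u w (Lt.of _ i v u m) (of _ p t)) ∈ S) {y : M.YTot v w}
    (hy : y ∈ M.lenLt k v w) : f y ∈ S := by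
  have : M.lenLt k v w ≤ S.comap f := by
    refine Submodule.span_le.2 ?_
    rintro _ ⟨u, i, m, p, t, hp, rfl⟩
    exact h u i m p t hp
  exact this hy

lemma yt_mem_lenLt {k : ℕ} (m : Lt M.1 v u) (p : Wd Γ u w) (t : Tens E.aug p)
    (hp : p.length < k) : M.yt v u w m (of _ p t) ∈ M.lenLt k v w := by
  induction m using Lt.ind with
  | ha x y hx hy => rw [map_add, ladd_apply]; exact add_mem hx hy
  | ho i m => exact Submodule.subset_span ⟨u, i, m, p, t, hp, rfl⟩

lemma lenLt_mono {k l : ℕ} (hkl : k ≤ l) (v w : Γ) : M.lenLt k v w ≤ M.lenLt l v w :=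
  Submodule.span_mono fun _ ⟨u, i, m, p, t, hp, e⟩ => ⟨u, i, m, p, t, hp.trans_le hkl, e⟩

lemma exists_mem_lenLt (y : M.YTot v w) : ∃ k, y ∈ M.lenLt k v w := by
  induction y using yind_of with
  | ha x y hx hy =>
    obtain ⟨k, hk⟩ := hx
    obtain ⟨l, hl⟩ := hy
    exact ⟨max k l, add_mem (lenLt_mono (le_max_left _ _) v w hk)
      (lenLt_mono (le_max_right _ _) v w hl)⟩
  | ho u i m p t => exact ⟨p.length + 1, yt_mem_lenLt _ p t (Nat.lt_succ_self _)⟩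

lemma lenLt_zero {y : M.YTot v w} (hy : y ∈ M.lenLt 0 v w) : y = 0 := by
  have : M.lenLt 0 v w ≤ ⊥ := by
    refine Submodule.span_le.2 ?_
    rintro _ ⟨u, i, m, p, t, hp, rfl⟩
    exact absurd hp (Nat.not_lt_zero _)
  exact (Submodule.mem_bot K).1 (this hy)

lemma lenLt_of_pre {k : ℕ} (R : M.YTot v w →ₗ[K] M.YTot v w)
    (hn : ∀ m : Lt M.1 v w, R (M.yt v w w m (nil _ w)) = 0)
    (hp : ∀ (u z : Γ) (m : Lt M.1 v u) (n : ℤ) (x : E.aug.X n u z) (p : Wd Γ z w)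
      (t : Tens E.aug p), p.length < k → R (M.yt v u w m
        (pre _ u z w (Lt.of _ n u z x) (of _ p t))) ∈ M.lenLt k v w)
    {y : M.YTot v w} (hy : y ∈ M.lenLt (k + 1) v w) : R y ∈ M.lenLt k v w := by
  refine lenLt_induction R _ (fun u i m p t hpk => ?_) hy
  cases p with
  | nil =>
    rw [of_nil, map_smul, map_smul, hn, smul_zero]
    exact zero_mem _
  | cons _ n q =>
    obtain ⟨t, rfl⟩ := (Tens.consEquiv E.aug u n q).surjective t
    induction t using TensorProduct.induction_on with
    | zero => simp
    | add s t hs ht => rw [map_add, map_add, map_add, map_add]; exact add_mem hs ht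
    | tmul x t =>
      have := hp u _ (Lt.of _ i v u m) n x q t (Nat.lt_of_succ_lt_succ hpk)
      rwa [pre_of_of] at this

end

variable {M N : RMod E}

/-- The map `M ⊗ BE → N ⊗ BE` induced by `g : M → N`. -/
def ymap (g : ∀ u, Lt M.1 v u →ₗ[K] Lt N.1 v u) (w : Γ) : M.YTot v w →ₗ[K] N.YTot v w :=
  yelim (fun u => (N.yt v u w).comp (g u))

@[simp] lemma ymap_yt (g : ∀ u, Lt M.1 v u →ₗ[K] Lt N.1 v u)
    (m : Lt M.1 v u) (s : Words E.aug u w) :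
    ymap g w (M.yt v u w m s) = N.yt v u w (g u m) s := by
  rw [ymap, yelim_yt]
  rfl

end RMod

variable (A : AugOps K Γ)

/-- The elements of the module `k` as scalars. -/
def kval (E : AugOps K Γ) (v w : Γ) : Lt (kMod E).toGBimod v w →ₗ[K] K :=
  Lt.lift (fun _ => Submodule.subtype _)

lemma kval_of_ne (E : AugOps K Γ) (hv : v ≠ w) (x : Lt (kMod E).toGBimod v w) :
    kval E v w x = 0 := by
  induction x using Lt.ind with
  | ha x y hx hy => rw [map_add, hx, hy, add_zero]
  | ho n x =>
    rw [kval, Lt.lift_of]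
    exact x.2 (fun h => hv h.2)

lemma kval_injective (E : AugOps K Γ) (v w : Γ) : Function.Injective (kval E v w) := by
  rw [injective_iff_map_eq_zero]
  intro x hx
  have h0 : ∀ (n : ℤ) (y : (kMod E).X n v w), n ≠ 0 → y = 0 := fun n y hn =>
    Subtype.ext (y.2 (fun h => hn h.1))
  have h1 : ∀ x : Lt (kMod E).toGBimod v w, kval E v w x = (Lt.comp (kMod E).toGBimod 0 v w x).1 := by
    intro x
    induction x using Lt.ind with
    | ha x y hx hy => rw [map_add, hx, hy, map_add]; rfl
    | ho n x =>
      by_cases hn : n = 0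
      · subst hn
        rw [Lt.comp_of, kval, Lt.lift_of]
        rfl
      · rw [h0 n x hn]
        simp
  refine Lt.ext_comp fun n => ?_
  by_cases hn : n = 0
  · subst hn
    rw [map_zero]
    exact Subtype.ext ((h1 x).symm.trans hx)
  · exact (h0 n _ hn).trans (h0 n _ hn).symm

/-- The Yoneda map on all elements. -/
def yon (v w : Γ) : Lt A.homAk.1 v w →ₗ[K] Lt (kMod A.E).toGBimod v w := Lt.map A.yoneda v w

variable {A}

lemma kval_yon (φ : Lt A.Z.dual v w) :
    kval A.E v w (A.yon v w φ) = A.evZ v w φ (A.znil w v (A.unitL w v)) := by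
  induction φ using Lt.ind with
  | ha x y hx hy => simp only [map_add, ladd_apply, hx, hy]
  | ho n φ =>
    refine (congrArg (kval A.E v w) (Lt.map_of A.yoneda n v w φ)).trans ?_
    rw [evZ_of, kval, Lt.lift_of]
    change φ (A.zProj (-n) w v (A.zOf v (.nil w) (-n)
      (Tens.nilEquiv A.aug w 1 ⊗ₜ[K] A.one (-n) w v))) = _
    have h1 : ∀ m : ℤ, A.zt w w v (nil A.aug w) (Lt.of A.1 m w v (A.one m w v)) =
        A.zOf v (.nil w) m (Tens.nilEquiv A.aug w 1 ⊗ₜ[K] A.one m w v) := fun m =>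
      zt_of (.nil w) m _ _
    rw [← h1]
    have h3 : ∀ m (ψ : Dual K (A.Z.X m w v)), m = 0 → ψ (A.zProj m w v (A.zt w w v (nil A.aug w)
          (Lt.of A.1 m w v (A.one m w v)))) = ψ (A.zProj m w v (A.znil w v (A.unitL w v))) := by
      rintro m ψ rfl
      rfl
    by_cases hn : -n = 0
    · exact h3 _ φ hn
    · have h2 : A.znil w v (A.unitL w v) ∈ A.zHom 0 w v := zt_mem (add_zero _) (nil_mem_hom _ _) _
      rw [A.one_zero (-n) w v (fun h => hn h.1), map_zero, map_zero, map_zero,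
        zProj_ne h2 (Ne.symm hn)]

/-- Inclusion of `k` in `RHom_A(A, k)` by the augmentation of `BA ⊗ A`. -/
def kIncl (A : AugOps K Γ) (v w : Γ) : Lt (kMod A.E).toGBimod v w →ₗ[K] Lt A.homAk.1 v w :=
  (A.mkZ 0 v w).comp ((kval A.E v w).smulRight (A.zp w v))

namespace IsAugDGAlg

variable (h : A.IsAugDGAlg)

include h

lemma zp_hom {n : ℤ} {z : A.ZTot v w} (hz : z ∈ A.zHom n v w) (hn : n ≠ 0) : A.zp v w z = 0 := by
  refine zHom_eq_zero (A.zp v w) (fun u p j t a hp => ?_) hz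
  rw [zp_zt, epsTot, Lt.lift_of]
  by_cases hj : j = 0
  · subst hj
    rw [counit_hom (of_mem_hom (-1) p t) (by omega), zero_mul]
  · rw [h.ε_zero j u w (fun h' => hj h'.1), lzero_apply, mul_zero]

lemma evZ_kIncl (x : Lt (kMod A.E).toGBimod v w) :
    A.evZ v w (A.kIncl v w x) = kval A.E v w x • A.zp w v :=
  evZ_mkZ (n := 0) (f := kval A.E v w x • A.zp w v) fun m z hz hm => by
    rw [lsmul_apply, h.zp_hom hz (by simpa using hm), smul_zero]

lemma yon_kIncl (x : Lt (kMod A.E).toGBimod v w) : A.yon v w (A.kIncl v w x) = x := by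
  apply kval_injective
  refine (kval_yon _).trans ?_
  rw [h.evZ_kIncl, lsmul_apply, zp_znil, unitL, epsTot, Lt.lift_of]
  by_cases hv : v = w
  · subst hv
    rw [h.ε_one, smul_eq_mul, mul_one]
  · rw [kval_of_ne _ hv, zero_smul]

lemma yon_dY (φ : Lt A.homAk.1 v w) : A.yon v w (A.homAk.dY v w φ) = 0 := by
  apply kval_injective
  refine (kval_yon _).trans ?_
  rw [evZ_dY h.isShort, comp_apply, comp_apply, zeps_znil, zBTot_znil, eps_unitL, map_neg,
    h.D_unitL]
  simp

omit h in
lemma evA_nil (x : Lt A.E.aug v v) : A.evA v v x (nil _ v) = 0 := by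
  induction x using Lt.ind with
  | ha x y hx hy => rw [map_add, ladd_apply, hx, hy, add_zero]
  | ho n x =>
    rw [evA_of, evE_of, ← unit_self']
    exact x.2

lemma yon_aY (φ : Lt A.homAk.1 v u) (x : Lt A.E.aug u w) :
    A.yon v w (A.homAk.aY v u w φ x) = 0 := by
  apply kval_injective
  refine (kval_yon _).trans ?_
  rw [evZ_aY, mulZ, znil, convZ_zt, map_zero]
  rw [conv_nil]
  by_cases hu : u = w
  · subst hu
    rw [Pi.single_eq_same]
    rw [comp_apply, eps_nil, evA_nil, zero_mul]
  · rw [Pi.single_eq_of_ne (Ne.symm hu)]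
    simp

/-- The contraction of `RHom_A(A, k)` onto `k`. -/
def sOp (v w : Γ) : Lt A.homAk.1 v w →ₗ[K] Lt A.homAk.1 v w :=
  A.zOp (-1) v w (- (h.zs w v).comp (A.zeps w v))

lemma evZ_sOp (φ : Lt A.homAk.1 v w) (z : A.ZTot w v) :
    A.evZ v w (h.sOp v w φ) z = - A.evZ v w φ (h.zs w v (A.zeps w v z)) := by
  have := evZ_zOp (k := -1) (T := - (h.zs w v).comp (A.zeps w v)) (fun n z hz => by
    rw [lneg_apply, comp_apply, zeps_hom hz, map_smul]
    exact neg_mem (Submodule.smul_mem _ _ (h.zs_mem hz))) φ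
  refine (lcongr_fun this z).trans ?_
  rw [comp_apply, lneg_apply, map_neg, comp_apply]

lemma dY_sOp (φ : Lt A.homAk.1 v w) :
    A.homAk.dY v w (h.sOp v w φ) + h.sOp v w (A.homAk.dY v w φ) =
      φ - A.kIncl v w (A.yon v w φ) := by
  apply A.evZ_injective v w
  refine lext fun z => ?_
  have hs := h.isShort
  rw [map_add, map_sub, ladd_apply, lsub_apply, evZ_dY hs, h.evZ_kIncl, kval_yon, h.evZ_sOp,
    evZ_dY hs]
  simp only [comp_apply, lsmul_apply]
  rw [h.evZ_sOp, zeps_zBTot hs h.isDGOps, zeps_zeps, h.zs_zeps, map_neg, map_neg, map_neg, neg_neg,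
    zeps_zeps, map_neg, map_neg, neg_neg, add_comm, ← map_add, h.zBTot_zs, map_sub, map_smul, smul_eq_mul,
    smul_eq_mul, mul_comm]

lemma yon_sOp (φ : Lt A.homAk.1 v w) : A.yon v w (h.sOp v w φ) = 0 := by
  apply kval_injective
  refine (kval_yon _).trans ?_
  rw [h.evZ_sOp, zeps_znil, eps_unitL, map_neg, map_neg, h.zs_znil, h.augProj_unitL]
  simp

end IsAugDGAlg

end AugOps

namespace AugOps

variable {A : AugOps K Γ}

lemma E_mAug_three (hA : A.NoHigher)
    (p : Wd Γ v w) (n : ℤ) (hp : 3 ≤ p.length) : A.E.mAug p n = 0 :=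
  A.E.mAug_three (fun p n hp => E_m_three hA p n hp) p n hp

lemma eps_bE (hs : A.IsShort) (H : IsDGOps A.1 A.D A.P) (s : Words A.E.aug v w) :
    eps _ v w (A.E.bT v w s) = - A.E.bT v w (eps _ v w s) :=
  eps_barT _ (fun p n hp => E_mAug_three hs.m_three p n hp)
    (isDGOps_aug (E_isDGOps hs.m_three (isDGOps_aug H))) s

lemma homAk_yBTot_mem (hs : A.IsShort) (H : IsDGOps A.1 A.D A.P) {n : ℤ}
    {z : A.homAk.YTot v w} (hz : z ∈ A.homAk.yHom n v w) :
    A.homAk.yBTot v w z ∈ A.homAk.yHom (n + 1) v w :=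
  RMod.yBTot_mem (homAk_isDG hs H) (fun p n hp => E_mAug_three hs.m_three p n hp) rfl hz

lemma homAk_yBTot_yBTot (hs : A.IsShort) (H : IsDGOps A.1 A.D A.P)
    (y : A.homAk.YTot v w) : A.homAk.yBTot v w (A.homAk.yBTot v w y) = 0 :=
  RMod.yBTot_yBTot (homAk_isDG hs H) (fun p n hp => E_mAug_three hs.m_three p n hp)
    (isDGOps_aug (E_isDGOps hs.m_three (isDGOps_aug H))) y

variable (A)

/-- The map `RHom_A(A, k) ⊗ BE → k ⊗ BE` induced by the Yoneda map. -/
abbrev yonY (v w : Γ) : A.homAk.YTot v w →ₗ[K] (kMod A.E).YTot v w :=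
  RMod.ymap (M := A.homAk) (N := kMod A.E) (fun u => A.yon v u) w

/-- The map `k ⊗ BE → RHom_A(A, k) ⊗ BE` induced by `kIncl`. -/
abbrev kInclY (v w : Γ) : (kMod A.E).YTot v w →ₗ[K] A.homAk.YTot v w :=
  RMod.ymap (M := kMod A.E) (N := A.homAk) (fun u => A.kIncl v u) w

variable {A}

lemma yonedaPull_eq (n : ℤ) (v w : Γ) : A.yonedaPull n v w = Module.Dual.transpose (R := K)
    ((((kMod A.E).yProj (-n) w v).comp (A.yonY w v)).comp (A.homAk.yIncl (-n) w v)) := by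
  have : DirectSum.toModule K (YIdx Γ v) ((kMod A.E).YTot w v) (fun s =>
      ((kMod A.E).yOf w s.2.1 s.2.2).comp
        (LinearMap.rTensor (Tens A.E.aug s.2.2) (A.yoneda s.2.1 w s.1))) = A.yonY w v := by
    refine lext fun y => ?_
    induction y using RMod.yind_of with
    | ha x y hx hy => rw [map_add, map_add, hx, hy]
    | ho u i m p t =>
      rw [RMod.toModule_yt, RMod.ymap_yt]
      dsimp only
      rw [comp_apply, rTensor_tmul, ← RMod.yt_of]
      refine congrArg (fun x => (kMod A.E).yt w u v x _) ?_
      exact (Lt.map_of A.yoneda i w u m).symm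
  rw [yonedaPull, this]
  rfl

namespace IsAugDGAlg

variable (h : A.IsAugDGAlg)

include h

lemma yonY_yBTot (y : A.homAk.YTot v w) :
    A.yonY v w (A.homAk.yBTot v w y) = (kMod A.E).yBTot v w (A.yonY v w y) := by
  have : (A.yonY v w).comp (A.homAk.yBTot v w) = ((kMod A.E).yBTot v w).comp (A.yonY v w) := by
    refine RMod.yt_ext fun u m s => ?_
    rw [comp_apply, comp_apply, RMod.ymap_yt, kMod_yBTot, RMod.yBTot_yt homAk_μ_two, map_add,
      map_add, RMod.ymap_yt, RMod.ymap_yt, h.yon_dY]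
    have hc : A.yonY v w (A.homAk.ycirc v u w m s) = 0 := by
      induction s using ind' with
      | ha v s t hs ht => rw [map_add, map_add, hs, ht, add_zero]
      | hs v c s hs => rw [map_smul, map_smul, hs, smul_zero]
      | hn => simp
      | hp v u x s _ =>
        rw [circ_pre, compr₂_apply, compl₂_apply, RMod.ymap_yt, h.yon_aY, map_zero, lzero_apply]
    rw [hc, map_zero, lzero_apply, add_zero, add_zero]
  exact lcongr_fun this y

lemma yonY_mem {n : ℤ} {y : A.homAk.YTot v w} (hy : y ∈ A.homAk.yHom n v w) :
    A.yonY v w y ∈ (kMod A.E).yHom n v w := by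
  refine RMod.yHom_induction (A.yonY v w) _ (fun u i m p t hp => ?_) hy
  rw [RMod.ymap_yt]
  have : A.yon v u (Lt.of _ i v u m) =
      Lt.of (kMod A.E).toGBimod i v u (A.yoneda i v u m) := Lt.map_of A.yoneda i v u m
  rw [this]
  exact RMod.yt_mem hp _ (of_mem_hom (-1) p t)

lemma yonY_kInclY (y : (kMod A.E).YTot v w) : A.yonY v w (A.kInclY v w y) = y := by
  have : (A.yonY v w).comp (A.kInclY v w) = LinearMap.id := RMod.yt_ext fun u m s => by
    rw [comp_apply, RMod.ymap_yt, RMod.ymap_yt, h.yon_kIncl, id_apply]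
  exact lcongr_fun this y

/-- The homotopy on `RHom_A(A, k) ⊗ BE` induced by the contraction of `RHom_A(A, k)`. -/
def sY (v w : Γ) : A.homAk.YTot v w →ₗ[K] A.homAk.YTot v w :=
  RMod.yelim (fun u => (A.homAk.yt v u w).compl₁₂ (h.sOp v u) (eps _ u w))

lemma sY_yt (m : Lt A.homAk.1 v u) (s : Words A.E.aug u w) : h.sY v w (A.homAk.yt v u w m s) =
      A.homAk.yt v u w (h.sOp v u m) (eps _ u w s) := by
  rw [sY, RMod.yelim_yt]
  rfl

lemma yonY_sY (y : A.homAk.YTot v w) : A.yonY v w (h.sY v w y) = 0 := by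
  have : (A.yonY v w).comp (h.sY v w) = 0 := RMod.yt_ext fun u m s => by
    rw [comp_apply, sY_yt, RMod.ymap_yt, h.yon_sOp, map_zero, lzero_apply, lzero_apply]
  exact lcongr_fun this y

lemma yBTot_sY (m : Lt A.homAk.1 v u) (s : Words A.E.aug u w) :
    A.homAk.yBTot v w (h.sY v w (A.homAk.yt v u w m s)) +
      h.sY v w (A.homAk.yBTot v w (A.homAk.yt v u w m s)) =
    A.homAk.yt v u w m s - A.kInclY v w (A.yonY v w (A.homAk.yt v u w m s)) +
      (A.homAk.ycirc v u w (h.sOp v u m) (eps _ u w s) + h.sY v w (A.homAk.ycirc v u w m s)) := by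
  have e := congrArg (fun x => A.homAk.yt v u w x s) (h.dY_sOp m)
  dsimp only at e
  rw [map_add, map_sub, ladd_apply, lsub_apply] at e
  rw [RMod.ymap_yt, RMod.ymap_yt, ← e, RMod.yBTot_yt homAk_μ_two, sY_yt, RMod.yBTot_yt homAk_μ_two,
    eps_eps, map_add, map_add, sY_yt, sY_yt, eps_eps, eps_bE h.isShort h.isDGOps, map_neg]
  abel

lemma yBTot_sY_mem {k : ℕ} {y : A.homAk.YTot v w} (hy : y ∈ A.homAk.lenLt (k + 1) v w) :
    y - A.homAk.yBTot v w (h.sY v w y) - h.sY v w (A.homAk.yBTot v w y) -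
      A.kInclY v w (A.yonY v w y) ∈ A.homAk.lenLt k v w := by
  have := RMod.lenLt_of_pre (M := A.homAk) (k := k) (LinearMap.id + (-1 : K) •
    ((A.homAk.yBTot v w).comp (h.sY v w) + (h.sY v w).comp (A.homAk.yBTot v w) +
      (A.kInclY v w).comp (A.yonY v w))) (fun m => ?_) (fun u z m n x p t hp => ?_) hy
  · simp only [ladd_apply, lsmul_apply, comp_apply, id_apply, neg_smul, one_smul] at this
    convert this using 1
    abel
  · simp only [ladd_apply, lsmul_apply, comp_apply, id_apply, neg_smul, one_smul]
    rw [h.yBTot_sY, eps_nil, circ_nil, circ_nil, map_zero]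
    abel
  · simp only [ladd_apply, lsmul_apply, comp_apply, id_apply, neg_smul, one_smul]
    rw [h.yBTot_sY, eps_pre, circ_pre, circ_pre, compr₂_apply, compr₂_apply, compl₂_apply,
      compl₂_apply, eps_eps, sY_yt, eps_eps]
    have h1 := RMod.yt_mem_lenLt (h.sOp v z (A.homAk.aY v u z m (Lt.of _ n u z x))) p t hp
    have h2 := RMod.yt_mem_lenLt (A.homAk.aY v u z (h.sOp v u m)
      (Lt.eps _ u z (Lt.of _ n u z x))) p t hp
    convert neg_mem (add_mem h2 h1) using 1
    abel

lemma yonY_acyclic (x : A.homAk.YTot v w) (hx : A.yonY v w x = 0)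
    (hdx : A.homAk.yBTot v w x = 0) : ∃ y, A.yonY v w y = 0 ∧ A.homAk.yBTot v w y = x := by
  have := exists_primitive (A.homAk.yBTot v w) (homAk_yBTot_yBTot h.isShort h.isDGOps)
    (LinearMap.ker (A.yonY v w)) (fun x hx => by
      rw [mem_ker] at hx ⊢
      rw [h.yonY_yBTot, hx, map_zero]) (fun k => A.homAk.lenLt k v w)
    (fun x _ hx => RMod.lenLt_zero hx) (fun k x hx hxk hdx => ⟨h.sY v w x, h.yonY_sY x, by
      have := h.yBTot_sY_mem hxk
      rw [hdx, map_zero, LinearMap.mem_ker.1 hx, map_zero, sub_zero, sub_zero] at this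
      exact this⟩) (fun x _ => RMod.exists_mem_lenLt x) x hx hdx
  obtain ⟨y, hy, hyx⟩ := this
  exact ⟨y, hy, hyx⟩

lemma yoneda_quasiIso : IsQuasiIso (kMod A.E).dRHomK A.homAk.dRHomK A.yonedaPull := by
  have := isQuasiIso_dual_of_piece (fun v w => A.homAk.YSummand v w) (fun v w => ydeg w)
    (N := (kMod A.E).Y) (fun v w => A.homAk.yBTot v w)
    (fun n v w x hx => homAk_yBTot_mem h.isShort h.isDGOps hx)
    (fun v w x => homAk_yBTot_yBTot h.isShort h.isDGOps x)
    (fun i j v w => ((kMod A.E).yProj j v w).comp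
      (((kMod A.E).yBTot v w).comp ((kMod A.E).yIncl i v w)))
    (fun n v w => ((kMod A.E).yProj n v w).comp (A.yonY v w)) (fun m n v w x hx hm => ?_)
    (fun i j v w x hij hx => ?_) (fun n v w y => ?_) (fun v w x hx hdx => ?_)
  · have e : A.yonedaPull = fun n v w => Module.Dual.transpose (R := K)
        ((((kMod A.E).yProj (-n) w v).comp (A.yonY w v)).comp (A.homAk.yIncl (-n) w v)) := by
      funext n v w
      exact yonedaPull_eq n v w
    rw [e]
    exact this
  · exact RMod.yProj_ne (h.yonY_mem hx) hm
  · simp only [comp_apply]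
    rw [h.yonY_yBTot, RMod.yIncl_yProj (h.yonY_mem hx)]
  · refine ⟨A.kInclY v w ((kMod A.E).yIncl n v w y), ?_⟩
    rw [comp_apply, h.yonY_kInclY, RMod.yProj_yIncl]
  · obtain ⟨y, hy, hyx⟩ := h.yonY_acyclic x
      (Piece.eq_zero_of_proj (K := K) ((kMod A.E).YSummand v w) (ydeg w) fun n => hx n) hdx
    exact ⟨y, fun n => by rw [comp_apply, hy, map_zero], hyx⟩

end IsAugDGAlg

end AugOps

end Words

section Contract

variable {K : Type u} [Field K] {V W X Y Q : Type*} [AddCommGroup V] [Module K V]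
  [AddCommGroup W] [Module K W] [AddCommGroup X] [Module K X] [AddCommGroup Y] [Module K Y]
  [AddCommGroup Q] [Module K Q] [Module.Finite K V] [Module.Finite K W]

lemma rankOne_induction {P : (V →ₗ[K] X) → Prop} (h0 : P 0) (ha : ∀ L L', P L → P L' → P (L + L'))
    (hr : ∀ (ψ : Dual K V) (x : X), P (ψ.smulRight x)) (L : V →ₗ[K] X) : P L := by
  obtain ⟨t, rfl⟩ := (dualTensorHomEquiv K V X).surjective L
  induction t using TensorProduct.induction_on with
  | zero => rw [map_zero]; exact h0
  | add s t hs ht => rw [map_add]; exact ha _ _ hs ht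
  | tmul ψ x =>
    have : dualTensorHomEquiv K V X (ψ ⊗ₜ x) = ψ.smulRight x := lext fun v => by simp
    rw [this]
    exact hr ψ x

/-- The sum `∑ F(b_k^*, L(b_k))` over a basis `b_k` of `V`. -/
def finContract (F : Dual K V →ₗ[K] X →ₗ[K] Q) : (V →ₗ[K] X) →ₗ[K] Q :=
  (TensorProduct.lift F).comp (dualTensorHomEquiv K V X).symm.toLinearMap

@[simp] lemma finContract_smulRight (F : Dual K V →ₗ[K] X →ₗ[K] Q) (ψ : Dual K V)
    (x : X) : finContract F (ψ.smulRight x) = F ψ x := by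
  have : dualTensorHomEquiv K V X (ψ ⊗ₜ x) = ψ.smulRight x := lext fun v => by simp
  rw [finContract, comp_apply, ← this]
  simp

lemma finContract_add (F G : Dual K V →ₗ[K] X →ₗ[K] Q) (L : V →ₗ[K] X) :
    finContract (F + G) L = finContract F L + finContract G L := by
  induction L using rankOne_induction with
  | h0 => simp
  | ha L L' h h' => simp only [map_add, h, h']; abel
  | hr ψ x => simp

lemma finContract_smul (c : K) (F : Dual K V →ₗ[K] X →ₗ[K] Q) (L : V →ₗ[K] X) :
    finContract (c • F) L = c • finContract F L := by
  induction L using rankOne_induction with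
  | h0 => simp
  | ha L L' h h' => simp only [map_add, h, h', smul_add]
  | hr ψ x => simp

lemma map_finContract {R : Type*} [AddCommGroup R] [Module K R] (g : Q →ₗ[K] R)
    (F : Dual K V →ₗ[K] X →ₗ[K] Q) (L : V →ₗ[K] X) :
    g (finContract F L) = finContract (F.compr₂ g) L := by
  induction L using rankOne_induction with
  | h0 => simp
  | ha L L' h h' => simp only [map_add, h, h']
  | hr ψ x => simp

lemma finContract_comp (F : Dual K V →ₗ[K] X →ₗ[K] Q) (T : V →ₗ[K] W) (L : W →ₗ[K] X) :
    finContract F (L.comp T) = finContract (F.comp (Module.Dual.transpose (R := K) T)) L := by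
  induction L using rankOne_induction with
  | h0 => simp
  | ha L L' h h' => simp only [add_comp, map_add, h, h']
  | hr ψ x =>
    have : (ψ.smulRight x).comp T = (Module.Dual.transpose (R := K) T ψ).smulRight x := rfl
    rw [this, finContract_smulRight, finContract_smulRight, comp_apply]

lemma finContract_compl (F : Dual K V →ₗ[K] Y →ₗ[K] Q) (g : X →ₗ[K] Y) (L : V →ₗ[K] X) :
    finContract (F.compl₂ g) L = finContract F (g.comp L) := by
  induction L using rankOne_induction with
  | h0 => simp
  | ha L L' h h' => simp only [comp_add, map_add, h, h']
  | hr ψ x =>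
    have : g.comp (ψ.smulRight x) = ψ.smulRight (g x) := lext fun v => by simp
    rw [this, finContract_smulRight, finContract_smulRight, compl₂_apply]

lemma finContract_eval (F : Dual K V →ₗ[K] X →ₗ[K] Q) (v : V) (G : X →ₗ[K] Q)
    (hF : ∀ ψ x, F ψ x = ψ v • G x) (L : V →ₗ[K] X) : finContract F L = G (L v) := by
  induction L using rankOne_induction with
  | h0 => simp
  | ha L L' h h' => simp only [ladd_apply, map_add, h, h']
  | hr ψ x => simp [hF]

lemma finContract_congr {F G : Dual K V →ₗ[K] X →ₗ[K] Q} (h : ∀ ψ x, F ψ x = G ψ x)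
    (L : V →ₗ[K] X) : finContract F L = finContract G L := by
  rw [LinearMap.ext₂ h]

lemma finContract_mem (F : Dual K V →ₗ[K] X →ₗ[K] Q) (S : Submodule K Q)
    (h : ∀ ψ x, F ψ x ∈ S) (L : V →ₗ[K] X) : finContract F L ∈ S := by
  induction L using rankOne_induction with
  | h0 => rw [map_zero]; exact zero_mem _
  | ha L L' h h' => rw [map_add]; exact add_mem h h'
  | hr ψ x => rw [finContract_smulRight]; exact h ψ x

end Contract

section Words

variable {K : Type u} [Field K] {Γ : Type u} {v w u z y : Γ}

namespace AugOps

variable (A : AugOps K Γ)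

/-! ### Functionals as elements of `E(A)` -/

/-- The degree `n` part of a functional on the bar construction, made to vanish at the unit. -/
def mkA (n : ℤ) (v w : Γ) : Dual K (Words A.aug w v) →ₗ[K] Lt A.E.aug v w :=
  (Lt.of A.E.aug n v w).comp (LinearMap.codRestrict (LinearMap.ker (A.E.ε n v w))
    ((Module.Dual.transpose (R := K) (wIncl A.aug (-1) (-n) w v)).comp (LinearMap.id + (-1 : K) •
      (LinearMap.applyₗ (unit A.aug w v)).smulRight (counit A.aug w v))) (fun g => by
      rw [mem_ker]
      change (g + (-1 : K) • (g (unit A.aug w v) • counit A.aug w v))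
        (wIncl A.aug (-1) (-n) w v (wProj A.aug (-1) (-n) w v (unit A.aug w v))) = 0
      by_cases hv : w = v
      · subst hv
        by_cases hn : -n = 0
        · rw [wIncl_wProj (by rw [unit_self', hn]; exact nil_mem_hom _ _)]
          simp
        · rw [wProj_unit _ _ _ _ _ (fun h => hn h.1), map_zero, map_zero]
      · rw [unit_ne _ hv, map_zero, map_zero]
        exact map_zero _))

variable {A}

lemma evA_mkA {n : ℤ} {g : Dual K (Words A.aug w v)}
    (hg : ∀ m s, s ∈ hom A.aug (-1) m w v → m ≠ -n → g s = 0) (s : Words A.aug w v) :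
    A.evA v w (A.mkA n v w g) s = g s - g (unit A.aug w v) * counit A.aug w v s := by
  have h0 : ∀ m s, s ∈ hom A.aug (-1) m w v → m ≠ -n →
      g (unit A.aug w v) * counit A.aug w v s = 0 := by
    intro m s hs hm
    by_cases hv : w = v
    · subst hv
      by_cases hm0 : m = 0
      · subst hm0
        rw [hg 0 _ (by rw [unit_self']; exact nil_mem_hom _ _) hm, zero_mul]
      · rw [counit_hom hs (fun h => hm0 h.1), mul_zero]
    · rw [unit_ne _ hv, map_zero, zero_mul]
  have h1 : A.evA v w (A.mkA n v w g) = g + (-1 : K) • (g (unit A.aug w v) • counit A.aug w v) := by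
    refine hom_ext fun p t => ?_
    rw [mkA, comp_apply, evA_of, evE_of]
    change (g + (-1 : K) • (g (unit A.aug w v) • counit A.aug w v))
      (wIncl A.aug (-1) (-n) w v (wProj A.aug (-1) (-n) w v (of A.aug p t))) = _
    by_cases hp : p.deg (-1) = -n
    · rw [wIncl_wProj (of_mem_hom' p hp t)]
    · rw [wProj_ne (of_mem_hom (-1) p t) hp, map_zero, map_zero, ladd_apply, lsmul_apply,
        lsmul_apply, hg _ _ (of_mem_hom (-1) p t) hp, smul_eq_mul, smul_eq_mul,
        h0 _ _ (of_mem_hom (-1) p t) hp]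
      simp
  rw [h1]
  simp only [ladd_apply, lsmul_apply, smul_eq_mul]
  ring

variable (A)

/-- `Θ φ a` is the functional `c ↦ φ(± c ⊗ a)`, made to vanish at the unit. -/
def theta (j : ℤ) (v u z : Γ) : Lt A.Z.dual v u →ₗ[K] A.X j z v →ₗ[K] Lt A.E.aug z u :=
  Lt.lift (fun i => ((LinearMap.mk₂ K (fun (f : Dual K (A.ZTot u v)) (a : A.X j z v) =>
    (f.comp ((A.zt u z v).flip (Lt.of _ j z v a))).comp (eps _ u z))
      (fun f f' a => by rw [add_comp, add_comp]) (fun c f a => by rw [smul_comp, smul_comp])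
      (fun f a a' => by rw [map_add, map_add, comp_add, add_comp])
      (fun c f a => by rw [map_smul, map_smul, LinearMap.comp_smul, smul_comp])).compr₂
        (A.mkA (i + j) z u)).comp ((A.evZ v u).comp (Lt.of _ i v u)))

variable {A}

lemma evA_theta (j : ℤ) (φ : Lt A.Z.dual v u) (a : A.X j z v) (c : Words A.aug u z) :
    A.evA z u (A.theta j v u z φ a) c =
      A.evZ v u φ (A.zt u z v (eps A.aug u z c) (Lt.of A.1 j z v a)) -
      A.evZ v u φ (A.zt u z v (unit A.aug u z) (Lt.of A.1 j z v a)) * counit A.aug u z c := by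
  have he : eps A.aug u z (unit A.aug u z) = unit A.aug u z := by
    by_cases hu : u = z
    · subst hu
      rw [unit_self', eps_nil]
    · rw [unit_ne _ hu, map_zero]
  induction φ using Lt.ind with
  | ha x y hx hy => simp only [map_add, ladd_apply, hx, hy]; ring
  | ho i φ =>
    rw [theta, Lt.lift_of]
    refine (evA_mkA (n := i + j) (fun m s hs hm => ?_) c).trans ?_
    · change A.evZ v u (Lt.of A.Z.dual i v u φ) (A.zt u z v (eps A.aug u z s)
        (Lt.of A.1 j z v a)) = 0
      rw [eps_hom (sgn_neg_one K) hs, map_smul, lsmul_apply]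
      exact evZ_of_eq_zero φ (Submodule.smul_mem _ _ (zt_mem (m := m + j) rfl hs a)) (by omega)
    · change A.evZ v u (Lt.of A.Z.dual i v u φ) (A.zt u z v (eps A.aug u z c)
        (Lt.of A.1 j z v a)) - A.evZ v u (Lt.of A.Z.dual i v u φ) (A.zt u z v
          (eps A.aug u z (unit A.aug u z)) (Lt.of A.1 j z v a)) * _ = _
      rw [he]

variable (A)

/-- A functional on `A^j`, extended by zero to `BA ⊗ A`. -/
def extZ (j : ℤ) (v z : Γ) (ψ : Dual K (A.X j z v)) : Dual K (A.ZTot z v) :=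
  zelim (Pi.single (M := fun y => Words A.aug z y →ₗ[K] Lt A.1 y v →ₗ[K] K) z
    ((LinearMap.lsmul K K).compl₁₂ (counit _ z z) (ψ.comp (Lt.comp A.1 j z v))))

variable {A}

lemma extZ_zt (j : ℤ) (ψ : Dual K (A.X j z v)) (c : Words A.aug z z)
    (a : Lt A.1 z v) : A.extZ j v z ψ (A.zt z z v c a) =
      counit _ z z c * ψ (Lt.comp A.1 j z v a) := by
  rw [extZ, zelim_zt, Pi.single_eq_same]
  rfl

lemma extZ_ne (j : ℤ) (hy : y ≠ z) (ψ : Dual K (A.X j z v))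
    (c : Words A.aug z y) (a : Lt A.1 y v) : A.extZ j v z ψ (A.zt z y v c a) = 0 := by
  rw [extZ, zelim_zt, Pi.single_eq_of_ne hy]
  rfl

lemma extZ_hom (j : ℤ) (ψ : Dual K (A.X j z v)) {m : ℤ} {x : A.ZTot z v}
    (hx : x ∈ A.zHom m z v) (hm : m ≠ j) : A.extZ j v z ψ x = 0 := by
  refine zHom_eq_zero (A.extZ j v z ψ) (fun y p i t a hp => ?_) hx
  by_cases hy : y = z
  · subst hy
    rw [extZ_zt]
    by_cases hi : i = j
    · subst hi
      rw [counit_hom (of_mem_hom (-1) p t) (by omega), zero_mul]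
    · rw [Lt.comp_of_ne A.1 hi, map_zero, mul_zero]
  · exact extZ_ne j hy ψ _ _

variable (A)

/-- A functional on `A^j`, extended by zero to an element of `RHom_A(A, k)`. -/
def alpha (j : ℤ) (v z : Γ) : Dual K (A.X j z v) →ₗ[K] Lt A.Z.dual v z :=
  (A.mkZ (-j) v z).comp
    { toFun := A.extZ j v z
      map_add' := fun ψ ψ' => zt_ext fun y c a => by
        rw [ladd_apply]
        by_cases hy : y = z
        · subst hy
          rw [extZ_zt, extZ_zt, extZ_zt, ladd_apply, mul_add]
        · rw [extZ_ne j hy, extZ_ne j hy, extZ_ne j hy, add_zero]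
      map_smul' := fun r ψ => zt_ext fun y c a => by
        rw [lsmul_apply]
        by_cases hy : y = z
        · subst hy
          rw [extZ_zt, extZ_zt, lsmul_apply, RingHom.id_apply, smul_eq_mul, smul_eq_mul,
            mul_left_comm]
        · rw [extZ_ne j hy, extZ_ne j hy, smul_zero] }

variable {A}

lemma evZ_alpha (j : ℤ) (ψ : Dual K (A.X j z v)) :
    A.evZ v z (A.alpha j v z ψ) = A.extZ j v z ψ :=
  evZ_mkZ (n := -j) (f := A.extZ j v z ψ) fun m x hx hm => extZ_hom j ψ hx (by omega)

end AugOps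

end Words

section Words

variable {K : Type u} [Field K] {Γ : Type u} {v w u z y : Γ}

namespace AugOps

variable {A : AugOps K Γ}

/-- The functional `c ↦ φ(± c ⊗ a)`. -/
def slice (φ : Lt A.Z.dual v u) (a : Lt A.1 z v) : Dual K (Words A.aug u z) :=
  ((A.evZ v u φ).comp ((A.zt u z v).flip a)).comp (eps _ u z)

lemma evA_theta_eq (j : ℤ) (φ : Lt A.Z.dual v u) (a : A.X j z v) :
    A.evA z u (A.theta j v u z φ a) = slice φ (Lt.of A.1 j z v a) +
      (- slice φ (Lt.of A.1 j z v a) (unit A.aug u z)) • counit A.aug u z := by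
  have he : eps A.aug u z (unit A.aug u z) = unit A.aug u z := by
    by_cases hu : u = z
    · subst hu
      rw [unit_self', eps_nil]
    · rw [unit_ne _ hu, map_zero]
  refine lext fun c => ?_
  rw [evA_theta, ladd_apply, lsmul_apply, slice, comp_apply, comp_apply, comp_apply, comp_apply, he,
    smul_eq_mul, neg_mul, ← sub_eq_add_neg]
  rfl

lemma mulDual_evA_unit (x : Lt A.E.aug v w) (g : Dual K (Words A.aug v z)) :
    mulDual (A.evA v w x) g (unit _ w z) = 0 := by
  by_cases hw : w = z
  · subst hw
    rw [unit_self', mulDual, conv_nil]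
    by_cases hv : v = w
    · subst hv
      rw [Pi.single_eq_same, IsAugDGAlg.evA_nil, zero_mul]
    · rw [Pi.single_eq_of_ne (Ne.symm hv), lzero_apply, zero_mul]
  · rw [unit_ne _ hw, map_zero]

lemma slice_aY (φ : Lt A.Z.dual v u) (y : Lt A.E.aug u w) (a : Lt A.1 z v) :
    slice (A.homAk.aY v u w φ y) a = mulDual (A.evA u w y) (slice φ a) := by
  have h2 : ((A.evA u w y).comp (eps _ w u)).comp (eps _ w u) = A.evA u w y := lext fun z => by simp
  refine lext fun c => ?_
  have := mulZ_zt ((A.evA u w y).comp (eps _ w u)) (A.evZ v u φ) (eps _ w z c) a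
  rw [← comp_apply (mulDual _ _), mulDual_eps, h2] at this
  rw [slice, comp_apply, comp_apply, flip_apply, evZ_aY]
  exact this

lemma evA_theta_aY (hA : A.NoHigher) (j : ℤ) (φ : Lt A.Z.dual v u) (y : Lt A.E.aug u w) (a : A.X j z v) :
    A.evA z w (A.E.PAug z u w (A.theta j v u z φ a) (Lt.eps _ u w y) +
      A.theta j v w z (A.homAk.aY v u w φ y) a) = slice φ (Lt.of _ j z v a) (unit _ u z) •
      mulDual (A.evA u w y) (counit _ u z) := by
  have h2 : ((- (A.evA u w y).comp (eps _ w u))).comp (eps _ w u) =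
      (-1 : K) • A.evA u w y := lext fun z => by simp
  rw [map_add, evA_P hA, evA_eps, h2, evA_theta_eq, evA_theta_eq, slice_aY, mulDual_evA_unit,
    mulDual_smul_left, mulDual_add_right, mulDual_smul_right]
  refine lext fun c => ?_
  simp only [ladd_apply, lsmul_apply, lzero_apply, smul_eq_mul]
  ring

lemma theta_aY_self (hA : A.NoHigher) (j : ℤ) (φ : Lt A.Z.dual v u) (y : Lt A.E.aug u w) (a : A.X j u v) :
    A.E.PAug u u w (A.theta j v u u φ a) (Lt.eps _ u w y) +
      A.theta j v w u (A.homAk.aY v u w φ y) a =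
    A.evZ v u φ (A.znil u v (Lt.of _ j u v a)) • y := by
  apply A.evA_injective
  rw [evA_theta_aY hA, mulDual_counit, map_smul, slice, unit_self', comp_apply, eps_nil]
  rfl

lemma theta_aY_ne (hA : A.NoHigher) (j : ℤ) (hz : u ≠ z) (φ : Lt A.Z.dual v u)
    (y : Lt A.E.aug u w) (a : A.X j z v) : A.E.PAug z u w (A.theta j v u z φ a) (Lt.eps _ u w y) +
      A.theta j v w z (A.homAk.aY v u w φ y) a = 0 := by
  apply A.evA_injective
  rw [evA_theta_aY hA, unit_ne _ hz, map_zero, zero_smul, map_zero]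

lemma D_of (j : ℤ) (a : A.X j v w) : A.D v w (Lt.of _ j v w a) =
    Lt.of _ (j + 1) v w (A.d j (j + 1) v w a) := by
  rw [opD_of, AugOps.d, comp_apply]
  have h1 : ∀ m, m = j + 1 → Lt.of _ m v w (A.m (.one v j w) m
      (Tens.letter A.1 v j w a)) = Lt.of _ (j + 1) v w (A.m (.one v j w) (j + 1)
        (Tens.letter A.1 v j w a)) := by
    rintro m rfl
    rfl
  exact h1 _ (by simp only [Wd.deg]; ring)

variable (A)

/-- The part of `BA ⊗ A` with entries in `A` of degree at most `m`. -/
def zLow (m : ℤ) (v w : Γ) : Submodule K (A.ZTot v w) :=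
  Submodule.span K {x | ∃ (y : Γ) (c : Words A.aug v y) (i : ℤ) (a : A.X i y w), i ≤ m ∧
    x = A.zt v y w c (Lt.of _ i y w a)}

variable {A}

lemma zLow_induction {Q : Type*} [AddCommGroup Q] [Module K Q] {m : ℤ}
    (f : A.ZTot v w →ₗ[K] Q) (S : Submodule K Q)
    (h : ∀ y (c : Words A.aug v y) i (a : A.X i y w), i ≤ m →
      f (A.zt v y w c (Lt.of _ i y w a)) ∈ S) {x : A.ZTot v w} (hx : x ∈ A.zLow m v w) :
    f x ∈ S := by
  have : A.zLow m v w ≤ S.comap f := by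
    refine Submodule.span_le.2 ?_
    rintro _ ⟨y, c, i, a, hi, rfl⟩
    exact h y c i a hi
  exact this hx

lemma zLow_eq_zero {Q : Type*} [AddCommGroup Q] [Module K Q] {m : ℤ} (f : A.ZTot v w →ₗ[K] Q)
    (h : ∀ y (c : Words A.aug v y) i (a : A.X i y w), i ≤ m →
      f (A.zt v y w c (Lt.of _ i y w a)) = 0) {x : A.ZTot v w} (hx : x ∈ A.zLow m v w) :
    f x = 0 := by
  have := zLow_induction f ⊥ (fun y c i a hi => by rw [h y c i a hi]; exact zero_mem _) hx
  simpa using this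

lemma zpre_mem_zLow {m : ℤ} (x : Lt A.aug v u) {z : A.ZTot u w}
    (hz : z ∈ A.zLow m u w) : A.zpre v u w x z ∈ A.zLow m v w := by
  refine zLow_induction (A.zpre v u w x) _ (fun y c i a hi => ?_) hz
  rw [zpre_zt]
  exact Submodule.subset_span ⟨y, _, i, a, hi, rfl⟩

lemma mEnd_mem_zLow (haug : ∀ n v w, -1 < n → Subsingleton (A.aug.X n v w))
    (x : Lt A.aug v u) (c : Words A.aug u y) (i : ℤ) (a : A.X i y w) :
    A.znil v w (A.mEnd v y w (pre _ v u y x c) (Lt.of _ i y w a)) ∈ A.zLow (i - 1) v w := by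
  induction c using DirectSum.induction_on with
  | zero => simp
  | add c c' hc hc' =>
    rw [map_add, map_add, ladd_apply, map_add]
    exact add_mem hc hc'
  | of p t =>
    change A.znil v w (A.mEnd v y w (pre _ v u y x (of _ p t)) _) ∈ _
    induction x using Lt.ind with
    | ha x x' hx hx' =>
      rw [map_add, ladd_apply, map_add, ladd_apply, map_add]
      exact add_mem hx hx'
    | ho n x =>
      rw [pre_of_of, mEnd_of]
      rcases Tens.subsingleton_or haug (-1) (.cons v n p) with h | h
      · rw [Subsingleton.elim (Tens.cons A.aug v n p x t) 0]
        simp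
      · refine Submodule.subset_span ⟨v, _, _, _, ?_, rfl⟩
        simp only [Wd.length] at h
        push_cast at h
        have : (0 : ℤ) ≤ p.length := Int.natCast_nonneg _
        linarith

lemma zBTot_zLow (h : A.IsShort) (haug : ∀ n v w, -1 < n → Subsingleton (A.aug.X n v w)) (c : Words A.aug v u) (i : ℤ) (a : A.X i u w) :
    A.zBTot v w (A.zt v u w c (Lt.of _ i u w a)) -
      A.zt v u w (A.bT v u c) (Lt.eps _ u w (Lt.of _ i u w a)) -
      A.zt v u w c (A.D u w (Lt.of _ i u w a)) ∈ A.zLow (i - 1) v w := by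
  induction c using ind' with
  | ha v s t hs ht =>
    simp only [map_add, ladd_apply]
    convert add_mem hs ht using 1
    abel
  | hs v c s hs =>
    simp only [map_smul, lsmul_apply]
    have := Submodule.smul_mem _ c hs
    rwa [smul_sub, smul_sub] at this
  | hn =>
    have := zBTot_znil (A := A) (Lt.of _ i u w a)
    rw [znil] at this
    rw [this]
    simp
  | hp v x y s ih =>
    rw [← zpre_zt, zBTot_zpre, zcirc_zt h, zeps_zt, barT_pre _ (fun p n hp => A.mAug_three h.m_three p n hp)]
    have h1 := mEnd_mem_zLow haug y s i a
    have h2 := zpre_mem_zLow y ih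
    rw [map_sub, map_sub, zpre_zt, zpre_zt] at h2
    rw [map_add, map_add, ladd_apply, ladd_apply, zpre_zt]
    convert add_mem h2 h1 using 1
    abel

/-- The functionals that vanish on `BA ⊗ A^i` for `i ≤ -k`. -/
def killLow (A : AugOps K Γ) (k : ℤ) (v u : Γ) : Submodule K (Lt A.Z.dual v u) where
  carrier := {φ | ∀ x, x ∈ A.zLow (-k) u v → A.evZ v u φ x = 0}
  add_mem' hφ hψ x hx := by rw [map_add, ladd_apply, hφ x hx, hψ x hx, add_zero]
  zero_mem' x _ := by rw [map_zero, lzero_apply]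
  smul_mem' c φ hφ x hx := by rw [map_smul, lsmul_apply, hφ x hx, smul_zero]

lemma zt_mem_zLow {m : ℤ} (c : Words A.aug v u) (i : ℤ) (a : A.X i u w)
    (hi : i ≤ m) : A.zt v u w c (Lt.of _ i u w a) ∈ A.zLow m v w :=
  Submodule.subset_span ⟨u, c, i, a, hi, rfl⟩

lemma mem_killLow {k : ℤ} {φ : Lt A.Z.dual v u}
    (hφ : ∀ y (c : Words A.aug u y) i (a : A.X i y v), i ≤ -k →
      A.evZ v u φ (A.zt u y v c (Lt.of _ i y v a)) = 0) : φ ∈ A.killLow k v u :=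
  fun _ hx => zLow_eq_zero (A.evZ v u φ) hφ hx

lemma alpha_mem_killLow {j k : ℤ} (hj : -k < j) (ψ : Dual K (A.X j z v)) :
    A.alpha j v z ψ ∈ A.killLow k v z := by
  refine mem_killLow fun y c i a hi => ?_
  rw [evZ_alpha]
  by_cases hy : y = z
  · subst hy
    rw [extZ_zt, Lt.comp_of_ne A.1 (by omega), map_zero, mul_zero]
  · exact extZ_ne j hy ψ _ _

variable (A)

/-- The differential of `A` with the sign of its action on `RHom_A(A, k)`. -/
def dSgn (j : ℤ) (v w : Γ) : A.X j v w →ₗ[K] A.X (j + 1) v w := sgn K (j + 1) • A.d j (j + 1) v w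

variable {A}

lemma D_eps_of (j : ℤ) (a : A.X j v w) : A.D v w (Lt.eps _ v w (Lt.of _ j v w a)) =
      Lt.of _ (j + 1) v w (A.dSgn j v w a) := by
  rw [Lt.eps_of, map_smul, D_of, dSgn, lsmul_apply, map_smul]

lemma theta_eq_zero {j k : ℤ} (hj : j ≤ -k) {φ : Lt A.Z.dual v u}
    (hφ : φ ∈ A.killLow k v u) : A.theta j v u z φ = 0 := by
  refine lext fun a => A.evA_injective z u (lext fun c => ?_)
  rw [evA_theta, hφ _ (zt_mem_zLow _ j a hj), hφ _ (zt_mem_zLow _ j a hj)]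
  simp

lemma counit_barCirc (x : Lt A.aug v u) (s : Words A.aug u w) :
    counit _ v w (barCirc A.mAug v u w x s) = 0 := by
  induction s using ind' with
  | ha v s t hs ht => rw [map_add, map_add, hs, ht, add_zero]
  | hs v c s hs => rw [map_smul, map_smul, hs, smul_zero]
  | hn => simp
  | hp v u x' s _ => simp

lemma counit_bT (hA : A.NoHigher) (s : Words A.aug v w) : counit _ v w (A.bT v w s) = 0 := by
  induction s using ind' with
  | ha v s t hs ht => rw [map_add, map_add, hs, ht, add_zero]
  | hs v c s hs => rw [map_smul, map_smul, hs, smul_zero]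
  | hn => simp
  | hp v u x s ih =>
    rw [barT_pre _ (fun p n hp => A.mAug_three hA p n hp), map_add, map_add, counit_pre, counit_pre,
      counit_barCirc, add_zero, add_zero]

lemma bT_unit (v w : Γ) : A.bT v w (unit _ v w) = 0 := by
  by_cases hv : v = w
  · subst hv
    rw [unit_self', barT_nil]
  · rw [unit_ne _ hv, map_zero]

lemma eps_unit (v w : Γ) : eps A.aug v w (unit A.aug v w) = unit A.aug v w := by
  by_cases hv : v = w
  · subst hv
    rw [unit_self', eps_nil]
  · rw [unit_ne _ hv, map_zero]

lemma zLow_mono {m n : ℤ} (hmn : m ≤ n) (v w : Γ) : A.zLow m v w ≤ A.zLow n v w :=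
  Submodule.span_mono fun _ ⟨y, c, i, a, hi, e⟩ => ⟨y, c, i, a, hi.trans hmn, e⟩

lemma slice_apply (φ : Lt A.Z.dual v u) (a : Lt A.1 z v) (c : Words A.aug u z) :
    slice φ a c = A.evZ v u φ (A.zt u z v (eps _ u z c) a) := rfl

lemma D_theta (h : A.IsShort) (H : IsDGOps A.1 A.D A.P)
    (haug : ∀ n v w, -1 < n → Subsingleton (A.aug.X n v w)) {j k : ℤ}
    (hj : j ≤ -k) {φ : Lt A.Z.dual v u} (hφ : φ ∈ A.killLow (k + 1) v u) (a : A.X j z v) :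
    A.E.DAug z u (A.theta j v u z φ a) + A.theta j v u z (A.homAk.dY v u φ) a =
      - Lt.eps A.E.aug z u (A.theta (j + 1) v u z φ (A.dSgn j z v a)) := by
  apply A.evA_injective
  have hA : A.NoHigher := h.m_three
  have h1 : ∀ c : Words A.aug u z, slice (A.homAk.dY v u φ) (Lt.of A.1 j z v a) c =
      A.evZ v u φ (A.zt u z v (A.bT u z c) (Lt.of A.1 j z v a)) +
      A.evZ v u φ (A.zt u z v c (Lt.of A.1 (j + 1) z v (A.dSgn j z v a))) := by
    intro c
    have h2 := hφ _ (zLow_mono (by omega) u v (zBTot_zLow h haug c j (sgn K (j + 1) • a)))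
    rw [map_smul, ← Lt.eps_of, Lt.eps_eps, D_eps_of, map_sub, map_sub, sub_eq_zero,
      sub_eq_iff_eq_add] at h2
    rw [slice_apply, evZ_dY h, comp_apply, comp_apply, zeps_zt, eps_eps, h2, add_comm]
  refine lext fun c => ?_
  rw [map_add, ladd_apply, evA_D hA, evA_theta_eq, evA_theta_eq, map_neg, evA_eps, neg_neg,
    evA_theta_eq]
  simp only [ladd_apply, lsmul_apply, comp_apply, smul_eq_mul]
  rw [counit_bT hA, h1, h1, bT_unit, slice_apply, slice_apply, slice_apply, eps_eps, eps_unit,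
    eps_barT _ (fun p n hp => A.mAug_three hA p n hp) (isDGOps_aug H), eps_eps, counit_eps, map_neg,
    map_zero, slice_apply _ _ (unit A.aug u z), eps_unit]
  simp only [map_neg, lneg_apply, map_zero, lzero_apply]
  ring

lemma dY_alpha (h : A.IsShort)
    (haug : ∀ n v w, -1 < n → Subsingleton (A.aug.X n v w)) {j k : ℤ} (hj : -k ≤ j + 1)
    (ψ : Dual K (A.X (j + 1) z v)) :
    A.homAk.dY v z (A.alpha (j + 1) v z ψ) - A.alpha j v z (ψ.comp (A.dSgn j z v)) ∈
      A.killLow k v z := by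
  have hA : A.NoHigher := h.m_three
  refine mem_killLow fun y c i a hi => ?_
  rw [map_sub, lsub_apply, evZ_dY h, evZ_alpha, evZ_alpha, comp_apply, comp_apply, zeps_zt,
    sub_eq_zero]
  have h1 : ∀ x, x ∈ A.zLow (i - 1) z v → A.extZ (j + 1) v z ψ x = 0 := fun x hx =>
    zLow_eq_zero _ (fun y c i' a hi' => by
      by_cases hy : y = z
      · subst hy
        rw [extZ_zt, Lt.comp_of_ne A.1 (by omega), map_zero, mul_zero]
      · exact extZ_ne _ hy _ _ _) hx
  have h2 := h1 _ (zBTot_zLow h haug (eps _ z y c) i (sgn K (i + 1) • a))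
  rw [map_smul, ← Lt.eps_of, Lt.eps_eps, D_eps_of, map_sub, map_sub, sub_eq_zero,
    sub_eq_iff_eq_add] at h2
  rw [h2]
  by_cases hy : y = z
  · subst hy
    rw [extZ_zt, extZ_zt, extZ_zt, counit_bT hA, zero_mul, add_zero, counit_eps, comp_apply]
    by_cases hij : i = j
    · subst hij
      rw [Lt.comp_of, Lt.comp_of]
    · rw [Lt.comp_of_ne A.1 hij, Lt.comp_of_ne A.1 (by omega), map_zero, map_zero, map_zero]
  · rw [extZ_ne _ hy, extZ_ne _ hy, extZ_ne _ hy, add_zero]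

lemma evZ_aY_alpha (j : ℤ) (ψ : Dual K (A.X j z v)) (x : Lt A.E.aug z u)
    (c : Words A.aug u z) (a : Lt A.1 z v) :
    A.evZ v u (A.homAk.aY v z u (A.alpha j v z ψ) x) (A.zt u z v c a) =
      ψ (Lt.comp A.1 j z v a) * A.evA z u x (eps _ u z c) := by
  have : (A.extZ j v z ψ).comp ((A.zt z z v).flip a) =
      ψ (Lt.comp A.1 j z v a) • counit _ z z := lext fun c => by
    rw [comp_apply, flip_apply, extZ_zt, lsmul_apply, smul_eq_mul, mul_comm]
  rw [evZ_aY, evZ_alpha, mulZ_zt, this, mulDual_smul_right, mulDual_counit]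
  rfl

lemma evZ_aY_alpha_ne (j : ℤ) (hy : y ≠ z) (ψ : Dual K (A.X j z v))
    (x : Lt A.E.aug z u) (c : Words A.aug u y) (a : Lt A.1 y v) :
    A.evZ v u (A.homAk.aY v z u (A.alpha j v z ψ) x) (A.zt u y v c a) = 0 := by
  have : (A.extZ j v z ψ).comp ((A.zt z y v).flip a) = (0 : K) • 0 := lext fun c => by
    rw [comp_apply, flip_apply, extZ_ne j hy, zero_smul, lzero_apply]
  rw [evZ_aY, evZ_alpha, mulZ_zt, this, mulDual_smul_right, zero_smul, lzero_apply]

end AugOps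

end Words

section Contract

variable {K : Type u} [Field K] {V X Q : Type*} [AddCommGroup V] [Module K V]
  [AddCommGroup X] [Module K X] [AddCommGroup Q] [Module K Q] [Module.Finite K V]

lemma finContract_add_of {F G H : Dual K V →ₗ[K] X →ₗ[K] Q}
    (h : ∀ ψ x, F ψ x = G ψ x + H ψ x) (L : V →ₗ[K] X) :
    finContract F L = finContract G L + finContract H L := by
  rw [← finContract_add]
  exact finContract_congr h L

lemma finContract_smul_of {F G : Dual K V →ₗ[K] X →ₗ[K] Q} (c : K)
    (h : ∀ ψ x, F ψ x = c • G ψ x) (L : V →ₗ[K] X) : finContract F L = c • finContract G L := by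
  rw [← finContract_smul]
  exact finContract_congr h L

lemma finContract_eq_zero {F : Dual K V →ₗ[K] X →ₗ[K] Q} (h : ∀ ψ x, F ψ x = 0)
    (L : V →ₗ[K] X) : finContract F L = 0 := by
  have := finContract_mem F ⊥ (fun ψ x => by rw [h]; exact zero_mem _) L
  simpa using this

end Contract

section Words

variable {K : Type u} [Field K] {Γ : Type u} {v w u z y : Γ}

namespace AugOps

variable (A : AugOps K Γ)

/-- `ψ ⊗ x ↦ α(ψ) ⊗ P(x)`. -/
abbrev ytBil {V : Type u} [AddCommGroup V] [Module K V]
    (α : V →ₗ[K] Lt A.homAk.1 v z) (P : Lt A.E.aug z u →ₗ[K] Words A.E.aug z w) :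
    V →ₗ[K] Lt A.E.aug z u →ₗ[K] A.homAk.YTot v w := ((A.homAk.yt v z w).comp α).compl₂ P

/-- `ψ ⊗ x ↦ ψ ⊗ [x|s]`. -/
abbrev preBil (j : ℤ) (s : Words A.E.aug u w) :
    Dual K (A.X j z v) →ₗ[K] Lt A.E.aug z u →ₗ[K] A.homAk.YTot v w :=
  A.ytBil (A.alpha j v z) ((pre _ z u w).flip s)

variable [∀ n v w, Module.Finite K (A.X n v w)]

/-- The homotopy `φ ⊗ s ↦ ∑ b_k^* ⊗ [φ(- ⊗ b_k)|s]` on `RHom_A(A, k) ⊗ BE`, where `b_k` is a basis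
of `e_z A^j e_v`. -/
def tY (j : ℤ) (z v w : Γ) : A.homAk.YTot v w →ₗ[K] A.homAk.YTot v w :=
  RMod.yelim (fun u => LinearMap.mk₂ K
    (fun (φ : Lt A.Z.dual v u) s => finContract (A.preBil j (eps _ u w s)) (A.theta j v u z φ))
    (fun φ ψ s => by rw [map_add, map_add]) (fun c φ s => by rw [map_smul, map_smul])
    (fun φ s t => finContract_add_of (fun ψ x => by simp) _)
    (fun c φ s => finContract_smul_of c (fun ψ x => by simp) _))

variable {A}

lemma tY_yt (j : ℤ) (φ : Lt A.homAk.1 v u) (s : Words A.E.aug u w) :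
    A.tY j z v w (A.homAk.yt v u w φ s) =
      finContract (A.preBil j (eps _ u w s)) (A.theta j v u z φ) := by
  rw [tY, RMod.yelim_yt]
  rfl

/-- The terms of `D t + t D` in which the product of `E` is used. -/
def tMul (j : ℤ) (z : Γ) (φ : Lt A.homAk.1 v u) (s : Words A.E.aug u w) : A.homAk.YTot v w :=
  finContract (A.ytBil (A.alpha j v z) ((barCirc A.E.mAug z u w).flip (eps _ u w s)))
    (A.theta j v u z φ) + A.tY j z v w (A.homAk.ycirc v u w φ s)

namespace IsAugDGAlg

variable (h : A.IsAugDGAlg)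

include h

omit [∀ n v w, Module.Finite K (A.X n v w)] in
lemma yBTot_yt_pre (φ : Lt A.homAk.1 v z) (x : Lt A.E.aug z u)
    (s : Words A.E.aug u w) : A.homAk.yBTot v w (A.homAk.yt v z w φ (pre _ z u w x s)) =
      A.homAk.yt v z w φ (pre _ z u w x (A.E.bT u w s)) +
      A.homAk.yt v z w φ (pre _ z u w (A.E.DAug z u x) (eps _ u w s)) +
      A.homAk.yt v z w φ (barCirc A.E.mAug z u w x s) + A.homAk.yt v z w (A.homAk.dY v z φ)
        (pre _ z u w (Lt.eps _ z u x) (eps _ u w s)) +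
      A.homAk.yt v u w (A.homAk.aY v z u φ x) (eps _ u w s) := by
  have hE : ∀ {v w} (p : Wd Γ v w) (n : ℤ), 3 ≤ p.length → A.E.mAug p n = 0 :=
    fun p n hp => E_mAug_three h.isShort.m_three p n hp
  rw [RMod.yBTot_yt homAk_μ_two, barT_pre _ (fun p n hp => hE p n hp), eps_pre, circ_pre]
  have e := map_add (A.homAk.yt v z w φ)
  rw [e, e]
  rfl

lemma yBTot_preBil (j : ℤ) (L : A.X j z v →ₗ[K] Lt A.E.aug z u) (s : Words A.E.aug u w) :
    A.homAk.yBTot v w (finContract (A.preBil j (eps _ u w s)) L) =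
      finContract (A.preBil j (A.E.bT u w (eps _ u w s))) L +
      finContract (A.preBil j s) ((A.E.DAug z u).comp L) + finContract (A.ytBil (A.alpha j v z)
        ((barCirc A.E.mAug z u w).flip (eps _ u w s))) L +
      finContract (A.ytBil ((A.homAk.dY v z).comp (A.alpha j v z))
        (((pre _ z u w).flip s).comp (Lt.eps _ z u))) L +
      finContract (((A.homAk.aY v z u).comp (A.alpha j v z)).compr₂ ((A.homAk.yt v u w).flip s))
        L := by
  rw [map_finContract, ← finContract_compl, ← finContract_add, ← finContract_add, ← finContract_add,
      ← finContract_add]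
  refine finContract_congr (fun ψ x => ?_) _
  have e := h.yBTot_yt_pre (A.alpha j v z ψ) x (eps _ u w s)
  rw [eps_eps] at e
  exact e

lemma yBTot_tY (j : ℤ) (φ : Lt A.homAk.1 v u) (s : Words A.E.aug u w) :
    A.homAk.yBTot v w (A.tY j z v w (A.homAk.yt v u w φ s)) +
      A.tY j z v w (A.homAk.yBTot v w (A.homAk.yt v u w φ s)) =
    finContract (A.preBil j s) ((A.E.DAug z u).comp (A.theta j v u z φ) +
      A.theta j v u z (A.homAk.dY v u φ)) +
    finContract (A.ytBil ((A.homAk.dY v z).comp (A.alpha j v z))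
      (((pre _ z u w).flip s).comp (Lt.eps _ z u))) (A.theta j v u z φ) + tMul j z φ s +
    finContract (((A.homAk.aY v z u).comp (A.alpha j v z)).compr₂ ((A.homAk.yt v u w).flip s))
      (A.theta j v u z φ) := by
  have h2 : finContract (A.preBil j (z := z) (v := v) (-(A.E.bT u w (eps _ u w s))))
      (A.theta j v u z φ) = - finContract (A.preBil j (A.E.bT u w (eps _ u w s)))
        (A.theta j v u z φ) :=
    (finContract_smul_of (-1) (fun ψ x => by simp) _).trans (neg_one_smul K _)
  have e := map_add (A.tY j z v w)
  rw [tY_yt, h.yBTot_preBil, RMod.yBTot_yt homAk_μ_two, e, e, tY_yt, tY_yt, eps_eps,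
    eps_bE h.isShort h.isDGOps, tMul, h2, map_add]
  abel

end IsAugDGAlg

/-- The part of `φ` seen by words of length zero and elements of degree `j`. -/
def rho (j : ℤ) (v u : Γ) : Lt A.Z.dual v u →ₗ[K] Lt A.Z.dual v u :=
  (A.alpha j v u).comp ((LinearMap.lcomp K K ((A.znil u v).comp (Lt.of _ j u v))).comp (A.evZ v u))

end AugOps

end Words

section Words

variable {K : Type u} [Field K] {Γ : Type u} {v w u z y : Γ}

namespace AugOps

variable (A : AugOps K Γ)

/-- The map `φ ⊗ s ↦ (a ↦ φ([ ] ⊗ a))` if `s` has length zero, and `0` otherwise. -/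
def actT (n : ℤ) (v w : Γ) : A.homAk.YTot w v →ₗ[K] Dual K (A.X n v w) :=
  DirectSum.toModule K (YIdx Γ v) _ (fun s => A.actAux w n s.2.1 s.2.2)

variable {A}

lemma actT_nil (n : ℤ) (φ : Lt A.homAk.1 w v) : A.actT n v w (A.homAk.yt w v v φ (nil _ v)) =
      (A.evZ w v φ).comp ((A.znil v w).comp (Lt.of _ n v w)) := by
  induction φ using Lt.ind with
  | ha x y hx hy => simp only [map_add, ladd_apply, add_comp, hx, hy]
  | ho i φ =>
    rw [nil, actT, RMod.toModule_yt]
    refine lext fun a => ?_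
    have h1 : A.znil v w (Lt.of _ n v w a) =
        A.zOf w (.nil v) n (Tens.nilEquiv A.aug v 1 ⊗ₜ[K] a) := zt_of (.nil v) n _ _
    rw [comp_apply, comp_apply, h1, evZ_of]
    dsimp only [actAux]
    rw [TensorProduct.lift.tmul, compl₁₂_apply, flip_apply]
    simp
    rfl

lemma actT_pre (n : ℤ) (φ : Lt A.homAk.1 w u) (x : Lt A.E.aug u z) (s : Words A.E.aug z v) :
    A.actT n v w (A.homAk.yt w u v φ (pre _ u z v x s)) = 0 := by
  have h1 : (A.actT n v w).comp ((A.homAk.yt w u v φ).comp (pre _ u z v x)) = 0 := by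
    refine hom_ext fun p t => ?_
    simp only [comp_apply, lzero_apply]
    induction x using Lt.ind with
    | ha x y hx hy => simp only [map_add, ladd_apply, hx, hy, add_zero]
    | ho j x =>
      rw [pre_of_of]
      induction φ using Lt.ind with
      | ha x y hx hy => simp only [map_add, ladd_apply, hx, hy, add_zero]
      | ho i φ =>
        rw [actT, RMod.toModule_yt]
        rfl
  exact lcongr_fun h1 s

variable (A)

/-- The part of `RHom_A(A, k) ⊗ BE` whose functionals vanish on `BA ⊗ A^i` for `i ≤ -k`. -/
def filLow (k : ℕ) (v w : Γ) : Submodule K (A.homAk.YTot v w) :=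
  Submodule.span K {y | ∃ (u : Γ) (φ : Lt A.homAk.1 v u) (s : Words A.E.aug u w),
    φ ∈ A.killLow k v u ∧ y = A.homAk.yt v u w φ s}

variable {A}

lemma yt_mem_filLow {k : ℕ} {φ : Lt A.homAk.1 v u}
    (hφ : φ ∈ A.killLow k v u) (s : Words A.E.aug u w) : A.homAk.yt v u w φ s ∈ A.filLow k v w :=
  Submodule.subset_span ⟨u, φ, s, hφ, rfl⟩

lemma filLow_induction {Q : Type*} [AddCommGroup Q] [Module K Q] {k : ℕ}
    (f : A.homAk.YTot v w →ₗ[K] Q) (S : Submodule K Q)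
    (h : ∀ u (φ : Lt A.homAk.1 v u) (s : Words A.E.aug u w), φ ∈ A.killLow k v u →
      f (A.homAk.yt v u w φ s) ∈ S) {y : A.homAk.YTot v w} (hy : y ∈ A.filLow k v w) : f y ∈ S := by
  have : A.filLow k v w ≤ S.comap f := by
    refine Submodule.span_le.2 ?_
    rintro _ ⟨u, φ, s, hφ, rfl⟩
    exact h u φ s hφ
  exact this hy

lemma killLow_mono {k l : ℤ} (hkl : k ≤ l) (v u : Γ) : A.killLow k v u ≤ A.killLow l v u :=
  fun _ hφ _ hx => hφ _ (zLow_mono (by omega) _ _ hx)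

lemma filLow_mono {k l : ℕ} (hkl : k ≤ l) (v w : Γ) : A.filLow k v w ≤ A.filLow l v w :=
  Submodule.span_mono fun _ ⟨u, φ, s, hφ, e⟩ =>
    ⟨u, φ, s, killLow_mono (by exact_mod_cast hkl) v u hφ, e⟩

lemma exists_mem_killLow (haug : ∀ n v w, -1 < n → Subsingleton (A.aug.X n v w)) (i : ℤ)
    (φ : A.Z.dual.X i v u) : Lt.of _ i v u φ ∈ A.killLow (i.toNat + 1 : ℕ) v u := by
  refine mem_killLow fun y c j a hj => ?_
  have : (A.evZ v u (Lt.of _ i v u φ)).comp ((A.zt u y v).flip (Lt.of _ j y v a)) =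
      0 := hom_ext fun p t => by
    rw [comp_apply, flip_apply, lzero_apply]
    rcases Tens.subsingleton_or haug (-1) p with h | h
    · rw [Subsingleton.elim t 0]
      simp
    · refine evZ_of_eq_zero φ (zt_mem (m := p.deg (-1) + j) rfl (of_mem_hom (-1) p t) a) ?_
      have h1 : (0 : ℤ) ≤ p.length := Int.natCast_nonneg _
      have h2 := Int.self_le_toNat i
      push_cast at hj
      intro e
      have : p.deg (-1) ≤ 0 := by linarith
      omega
  exact lcongr_fun this c

lemma exists_mem_filLow (haug : ∀ n v w, -1 < n → Subsingleton (A.aug.X n v w))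
    (y : A.homAk.YTot v w) : ∃ k, y ∈ A.filLow k v w := by
  induction y using RMod.yind_of with
  | ha x y hx hy =>
    obtain ⟨k, hk⟩ := hx
    obtain ⟨l, hl⟩ := hy
    exact ⟨max k l, add_mem (filLow_mono (le_max_left _ _) v w hk)
      (filLow_mono (le_max_right _ _) v w hl)⟩
  | ho u i m p t => exact ⟨_, yt_mem_filLow (exists_mem_killLow haug i m) _⟩

lemma filLow_zero (hpos : ∀ n v w, 0 < n → Subsingleton (A.X n v w))
    {y : A.homAk.YTot v w} (hy : y ∈ A.filLow 0 v w) : y = 0 := by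
  have := filLow_induction LinearMap.id ⊥ (fun u φ s hφ => by
    have : φ = 0 := by
      apply A.evZ_injective v u
      rw [map_zero]
      refine lext fun z => ?_
      induction z using zind_of with
      | ha x y hx hy => rw [map_add, map_add, hx, hy]
      | ho y p j t a =>
        by_cases hj : 0 < j
        · have := hpos j y v hj
          rw [Subsingleton.elim a 0]
          simp
        · exact hφ _ (zt_mem_zLow _ j a (by simpa using hj))
    rw [this, map_zero, lzero_apply, map_zero]
    exact zero_mem _) hy
  simpa using this

section

variable [∀ n v w, Module.Finite K (A.X n v w)]

/-! ### The terms with the product -/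

lemma actT_tY (n j : ℤ) (y : A.homAk.YTot v w) : A.actT n w v (A.tY j z v w y) = 0 := by
  have : (A.actT n w v).comp (A.tY j z v w) = 0 := RMod.yt_ext fun u φ s => by
    rw [comp_apply, tY_yt, map_finContract]
    exact finContract_eq_zero (fun ψ x => (actT_pre n (A.alpha j v z ψ) x _ :)) _
  exact lcongr_fun this y

omit [∀ n v w, Module.Finite K (A.X n v w)] in
lemma rho_apply (j : ℤ) (φ : Lt A.Z.dual v u) : rho j v u φ =
    A.alpha j v u ((A.evZ v u φ).comp ((A.znil u v).comp (Lt.of _ j u v))) := rfl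

lemma tMul_pre (j : ℤ) (φ : Lt A.homAk.1 v u) (x : Lt A.E.aug u y)
    (s : Words A.E.aug y w) : tMul j z φ (pre _ u y w x s) =
      finContract (A.preBil j s) (((A.E.PAug z u y).flip (Lt.eps _ u y x)).comp
        (A.theta j v u z φ) + A.theta j v y z (A.homAk.aY v u y φ x)) := by
  rw [tMul, map_add, circ_pre, compr₂_apply, compl₂_apply, tY_yt, eps_eps, ← finContract_compl]
  congr 1
  refine finContract_congr (fun ψ X => ?_) _
  refine congrArg (A.homAk.yt v z w (A.alpha j v z ψ)) ?_
  rw [flip_apply, eps_pre, circ_pre]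
  simp

lemma tMul_nil (j : ℤ) (φ : Lt A.homAk.1 v w) : tMul j z φ (nil _ w) = 0 := by
  rw [tMul, circ_nil, map_zero, add_zero]
  refine finContract_eq_zero (fun ψ X => ?_) _
  refine (congrArg (A.homAk.yt v z w (A.alpha j v z ψ)) ?_).trans (map_zero _)
  rw [flip_apply, eps_nil, circ_nil]

lemma tMul_pre_self (hA : A.NoHigher) (j : ℤ) (φ : Lt A.homAk.1 v u) (x : Lt A.E.aug u y) (s : Words A.E.aug y w) :
    tMul j u φ (pre _ u y w x s) = A.homAk.yt v u w (rho j v u φ) (pre _ u y w x s) := by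
  have : ((A.E.PAug u u y).flip (Lt.eps _ u y x)).comp (A.theta j v u u φ) +
      A.theta j v y u (A.homAk.aY v u y φ x) =
      ((A.evZ v u φ).comp ((A.znil u v).comp (Lt.of _ j u v))).smulRight x :=
    lext fun a => theta_aY_self hA j φ x a
  rw [tMul_pre, this, finContract_smulRight]
  rfl

lemma tMul_pre_ne (hA : A.NoHigher) (j : ℤ) (hz : u ≠ z) (φ : Lt A.homAk.1 v u) (x : Lt A.E.aug u y)
    (s : Words A.E.aug y w) : tMul j z φ (pre _ u y w x s) = 0 := by
  have : ((A.E.PAug z u y).flip (Lt.eps _ u y x)).comp (A.theta j v u z φ) +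
      A.theta j v y z (A.homAk.aY v u y φ x) = 0 := lext fun a => theta_aY_ne hA j hz φ x a
  rw [tMul_pre, this, map_zero]

variable (A) in
/-- The map `φ ⊗ s ↦ ρ_j(φ) ⊗ s` if `s` has length zero, and `0` otherwise. -/
def gY (j : ℤ) (v w : Γ) : A.homAk.YTot v w →ₗ[K] A.homAk.YTot v w :=
  ((A.homAk.yt v w w).flip (nil _ w)).comp ((A.alpha j v w).comp (A.actT j w v))

lemma sum_tMul [Fintype Γ] (hA : A.NoHigher)
    (j : ℤ) (φ : Lt A.homAk.1 v u) (s : Words A.E.aug u w) :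
    ∑ z, tMul j z φ s + A.gY j v w (A.homAk.yt v u w φ s) = A.homAk.yt v u w (rho j v u φ) s := by
  have ha : ∀ z s t, tMul j z φ (s + t : Words A.E.aug u w) = tMul j z φ s + tMul j z φ t := by
    intro z s t
    have := finContract_add_of (F := A.ytBil (A.alpha j v z)
      ((barCirc A.E.mAug z u w).flip (eps _ u w (s + t))))
      (G := A.ytBil (A.alpha j v z) ((barCirc A.E.mAug z u w).flip (eps _ u w s)))
      (H := A.ytBil (A.alpha j v z) ((barCirc A.E.mAug z u w).flip (eps _ u w t)))
      (fun ψ x => by simp) (A.theta j v u z φ)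
    rw [tMul, this, map_add, map_add, tMul, tMul]
    abel
  have hs : ∀ z (c : K) s, tMul j z φ (c • s : Words A.E.aug u w) = c • tMul j z φ s := by
    intro z c s
    have := finContract_smul_of (F := A.ytBil (A.alpha j v z)
      ((barCirc A.E.mAug z u w).flip (eps _ u w (c • s))))
      (G := A.ytBil (A.alpha j v z) ((barCirc A.E.mAug z u w).flip (eps _ u w s))) c
      (fun ψ x => by simp) (A.theta j v u z φ)
    rw [tMul, this, map_smul, map_smul, tMul, smul_add]
  induction s using ind' with
  | ha v s t hs' ht =>
    rw [Finset.sum_congr rfl (fun z _ => ha z s t), Finset.sum_add_distrib, map_add, map_add,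
      map_add, ← hs' φ ha hs, ← ht φ ha hs]
    abel
  | hs v c s hs' =>
    rw [Finset.sum_congr rfl (fun z _ => hs z c s), ← Finset.smul_sum, map_smul, map_smul, map_smul,
      ← hs' φ ha hs, smul_add]
  | hn =>
    rw [Finset.sum_eq_zero (fun z _ => tMul_nil j φ), zero_add, gY, comp_apply, comp_apply,
      actT_nil]
    rfl
  | hp u y x s _ =>
    rw [Finset.sum_eq_single u (fun z _ hz => tMul_pre_ne hA j (Ne.symm hz) φ x s)
      (fun hu => absurd (Finset.mem_univ u) hu), tMul_pre_self hA, gY, comp_apply, comp_apply,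
      actT_pre, map_zero, map_zero, add_zero]

/-! ### Recovering a functional -/

lemma sum_evZ_aY_alpha [Fintype Γ] (j : ℤ) (φ : Lt A.homAk.1 v u)
    (c : Words A.aug u y) (a : Lt A.1 y v) :
    ∑ z, A.evZ v u (finContract ((A.homAk.aY v z u).comp (A.alpha j v z)) (A.theta j v u z φ))
      (A.zt u y v c a) + A.evZ v u (rho j v u φ) (A.zt u y v c a) =
    A.evZ v u φ (A.zt u y v c (Lt.of _ j y v (Lt.comp A.1 j y v a))) := by
  have h1 : ∀ z, z ≠ y → A.evZ v u (finContract ((A.homAk.aY v z u).comp (A.alpha j v z))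
      (A.theta j v u z φ)) (A.zt u y v c a) = 0 := by
    intro z hz
    have := map_finContract ((LinearMap.applyₗ (A.zt u y v c a)).comp (A.evZ v u))
      ((A.homAk.aY v z u).comp (A.alpha j v z)) (A.theta j v u z φ)
    refine this.trans (finContract_eq_zero (fun ψ x => ?_) _)
    exact evZ_aY_alpha_ne j (Ne.symm hz) ψ x c a
  have h2 : A.evZ v u (finContract ((A.homAk.aY v y u).comp (A.alpha j v y))
      (A.theta j v u y φ)) (A.zt u y v c a) =
      A.evA y u (A.theta j v u y φ (Lt.comp A.1 j y v a)) (eps _ u y c) := by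
    have := map_finContract ((LinearMap.applyₗ (A.zt u y v c a)).comp (A.evZ v u))
      ((A.homAk.aY v y u).comp (A.alpha j v y)) (A.theta j v u y φ)
    refine this.trans ?_
    exact finContract_eval _ (Lt.comp A.1 j y v a)
      ((LinearMap.applyₗ (eps _ u y c)).comp (A.evA y u)) (fun ψ x => evZ_aY_alpha j ψ x c a) _
  rw [Finset.sum_eq_single y (fun z _ hz => h1 z hz) (fun hy => absurd (Finset.mem_univ y) hy), h2,
    evA_theta, eps_eps, counit_eps, rho_apply, evZ_alpha]
  by_cases hy : y = u
  · subst hy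
    rw [extZ_zt, unit_self']
    simp only [comp_apply, znil]
    ring
  · rw [extZ_ne j hy, counit_ne (Ne.symm hy)]
    simp

end

end AugOps

namespace AugOps

variable {A : AugOps K Γ} [∀ n v w, Module.Finite K (A.X n v w)]

/-- The terms of `D t + t D` in which the differential of `A` is used. -/
def tTel (j : ℤ) (z : Γ) (φ : Lt A.homAk.1 v u) (s : Words A.E.aug u w) : A.homAk.YTot v w :=
  finContract (A.preBil j s)
    ((-1 : K) • ((Lt.eps _ z u).comp (A.theta (j + 1) v u z φ)).comp (A.dSgn j z v))

namespace IsAugDGAlg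

variable (h : A.IsAugDGAlg)

include h

lemma preBil_tTel (haug : ∀ n v w, -1 < n → Subsingleton (A.aug.X n v w)) {k : ℕ} (j : ℤ) (z : Γ) {φ : Lt A.homAk.1 v u} (hφ : φ ∈ A.killLow (k + 1) v u)
    (s : Words A.E.aug u w) : finContract (A.preBil j s) ((A.E.DAug z u).comp (A.theta j v u z φ) +
      A.theta j v u z (A.homAk.dY v u φ)) - tTel j z φ s ∈ A.filLow k v w := by
  by_cases hj : j ≤ -k
  · have : (A.E.DAug z u).comp (A.theta j v u z φ) + A.theta j v u z (A.homAk.dY v u φ) =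
        (-1 : K) • ((Lt.eps _ z u).comp (A.theta (j + 1) v u z φ)).comp (A.dSgn j z v) :=
      lext fun a => (D_theta h.isShort h.isDGOps haug hj hφ a).trans (neg_one_smul K _).symm
    rw [this, tTel, sub_self]
    exact zero_mem _
  · have hm : ∀ L, finContract (A.preBil (v := v) (z := z) j s) L ∈ A.filLow k v w := fun L =>
      finContract_mem _ _ (fun ψ x => yt_mem_filLow (alpha_mem_killLow (by omega) ψ) _) L
    exact sub_mem (hm _) (hm _)

lemma dY_alpha_tTel (haug : ∀ n v w, -1 < n → Subsingleton (A.aug.X n v w)) {k : ℕ} (j m : ℤ)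
    (hm : m = j + 1) (z : Γ) {φ : Lt A.homAk.1 v u}
    (hφ : φ ∈ A.killLow (k + 1) v u) (s : Words A.E.aug u w) :
    finContract (A.ytBil ((A.homAk.dY v z).comp (A.alpha m v z))
      (((pre _ z u w).flip s).comp (Lt.eps _ z u))) (A.theta m v u z φ) +
      tTel j z φ s ∈ A.filLow k v w := by
  subst hm
  by_cases hj : -k ≤ j + 1
  · rw [tTel, map_smul, finContract_comp, ← finContract_compl, ← finContract_smul,
      ← finContract_add]
    refine finContract_mem _ _ (fun ψ x => ?_) _
    have h1 := yt_mem_filLow (dY_alpha h.isShort haug hj ψ) (pre _ z u w (Lt.eps _ z u x) s)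
    have h2 := map_sub (A.homAk.yt v z w) (A.homAk.dY v z (A.alpha (j + 1) v z ψ))
      (A.alpha j v z (ψ.comp (A.dSgn j z v)))
    rw [h2, lsub_apply, sub_eq_add_neg] at h1
    refine cast (congrArg (· ∈ A.filLow k v w) ?_) h1
    exact congrArg _ (neg_one_smul K _).symm
  · have h0 : A.theta (j + 1) v u z φ = 0 := theta_eq_zero (k := k + 1) (by omega) hφ
    rw [tTel, h0, map_zero, comp_zero, zero_comp, smul_zero, map_zero, add_zero]
    exact zero_mem _

lemma yBTot_sum_tY (hpos : ∀ n v w, 0 < n → Subsingleton (A.X n v w))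
    (haug : ∀ n v w, -1 < n → Subsingleton (A.aug.X n v w)) {k : ℕ} (z : Γ) {φ : Lt A.homAk.1 v u} (hφ : φ ∈ A.killLow (k + 1) v u)
    (s : Words A.E.aug u w) :
    ∑ i ∈ Finset.range (k + 2), (A.homAk.yBTot v w (A.tY (-i) z v w (A.homAk.yt v u w φ s)) +
      A.tY (-i) z v w (A.homAk.yBTot v w (A.homAk.yt v u w φ s))) -
    (∑ i ∈ Finset.range (k + 2), tMul (-i) z φ s + A.homAk.yt v u w
      (∑ i ∈ Finset.range (k + 2), finContract ((A.homAk.aY v z u).comp (A.alpha (-i) v z))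
        (A.theta (-i) v u z φ)) s) ∈ A.filLow k v w := by
  have h0 : tTel (-(0 : ℕ)) z φ s = 0 := by
    have : ((Lt.eps _ z u).comp (A.theta (-(0 : ℕ) + 1) v u z φ)).comp
        (A.dSgn (-(0 : ℕ)) z v) = 0 := lext fun a => by
      have := hpos (-(0 : ℕ) + 1) z v (by norm_num)
      rw [comp_apply, Subsingleton.elim (A.dSgn (-(0 : ℕ)) z v a) 0, map_zero, lzero_apply]
    rw [tTel, this, smul_zero, map_zero]
  have hN : tTel (-(k + 2 : ℕ)) z φ s = 0 := by
    have h0 : A.theta (-(k + 2 : ℕ) + 1) v u z φ = 0 :=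
      theta_eq_zero (k := k + 1) (by push_cast; omega) hφ
    rw [tTel, h0, comp_zero, zero_comp, smul_zero, map_zero]
  have ht := Finset.sum_range_sub' (fun i : ℕ => tTel (-i) z φ s) (k + 2)
  rw [h0, hN, sub_zero] at ht
  have h5 : ∀ i : ℕ, A.homAk.yt v u w (finContract ((A.homAk.aY v z u).comp (A.alpha (-i) v z))
        (A.theta (-i) v u z φ)) s = finContract (((A.homAk.aY v z u).comp
        (A.alpha (-i) v z)).compr₂ ((A.homAk.yt v u w).flip s)) (A.theta (-i) v u z φ) := fun i =>
    map_finContract ((A.homAk.yt v u w).flip s) _ _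
  have e := map_sum (A.homAk.yt v u w) (fun i : ℕ => finContract ((A.homAk.aY v z u).comp
    (A.alpha (-i) v z)) (A.theta (-i) v u z φ)) (Finset.range (k + 2))
  rw [e, lsum_apply, ← sub_zero (_ - _), ← ht, ← Finset.sum_add_distrib, ← Finset.sum_sub_distrib,
    ← Finset.sum_sub_distrib]
  refine sum_mem fun i _ => ?_
  rw [h5, h.yBTot_tY]
  convert add_mem (h.preBil_tTel haug (-i) z hφ s)
    (h.dY_alpha_tTel haug (-(i + 1 : ℕ)) (-i) (by push_cast; ring) z hφ s) using 1
  abel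

end IsAugDGAlg

omit [∀ n v w, Module.Finite K (A.X n v w)] in
lemma sum_evZ_comp (hpos : ∀ n v w, 0 < n → Subsingleton (A.X n v w)) {N : ℕ}
    {φ : Lt A.homAk.1 v u} (hφ : φ ∈ A.killLow N v u) (c : Words A.aug u y)
    (a : Lt A.1 y v) :
    ∑ i ∈ Finset.range N, A.evZ v u φ (A.zt u y v c (Lt.of _ (-i) y v
      (Lt.comp A.1 (-i) y v a))) = A.evZ v u φ (A.zt u y v c a) := by
  induction a using Lt.ind with
  | ha a b ha hb => simp only [map_add, Finset.sum_add_distrib, ha, hb]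
  | ho n a =>
    by_cases hn : 0 < n
    · have := hpos n y v hn
      rw [Subsingleton.elim a 0]
      simp
    · obtain ⟨m, rfl⟩ : ∃ m : ℕ, n = -m := ⟨(-n).toNat, by omega⟩
      by_cases hm : m < N
      · rw [Finset.sum_eq_single m, Lt.comp_of]
        · intro i _ hi
          rw [Lt.comp_of_ne A.1 (by omega), map_zero, map_zero, map_zero]
        · intro h
          exact absurd (Finset.mem_range.2 hm) h
      · rw [Finset.sum_eq_zero, hφ _ (zt_mem_zLow c (-m) a (by omega))]
        intro i hi
        rw [Finset.mem_range] at hi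
        rw [Lt.comp_of_ne A.1 (by omega), map_zero, map_zero, map_zero]

lemma sum_rho_add [Fintype Γ] (hpos : ∀ n v w, 0 < n → Subsingleton (A.X n v w)) {N : ℕ} {φ : Lt A.homAk.1 v u} (hφ : φ ∈ A.killLow N v u) :
    ∑ z, ∑ i ∈ Finset.range N, finContract ((A.homAk.aY v z u).comp (A.alpha (-i) v z))
      (A.theta (-i) v u z φ) + ∑ i ∈ Finset.range N, rho (-i) v u φ = φ := by
  apply A.evZ_injective v u
  refine lext fun x => ?_
  induction x using zind_of with
  | ha x y hx hy => exact (map_add _ _ _).trans ((congrArg₂ _ hx hy).trans (map_add _ _ _).symm)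
  | ho y p i t a =>
    rw [← sum_evZ_comp hpos hφ, map_add, map_sum, map_sum, ladd_apply, lsum_apply, lsum_apply]
    simp only [map_sum, lsum_apply]
    rw [Finset.sum_comm, ← Finset.sum_add_distrib]
    exact Finset.sum_congr rfl fun i _ => sum_evZ_aY_alpha (-i) φ _ _

variable (A)

/-- The homotopy on `RHom_A(A, k) ⊗ BE`, with the degrees of `A` above `-N`. -/
def tSum [Fintype Γ] (N : ℕ) (v w : Γ) : A.homAk.YTot v w →ₗ[K] A.homAk.YTot v w :=
  ∑ z, ∑ i ∈ Finset.range N, A.tY (-i) z v w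

variable {A}

lemma IsAugDGAlg.yBTot_tSum [Fintype Γ] (h : A.IsAugDGAlg)
    (hpos : ∀ n v w, 0 < n → Subsingleton (A.X n v w))
    (haug : ∀ n v w, -1 < n → Subsingleton (A.aug.X n v w)) {k : ℕ}
    {y : A.homAk.YTot v w} (hy : y ∈ A.filLow (k + 1) v w) :
    A.homAk.yBTot v w (A.tSum (k + 2) v w y) + A.tSum (k + 2) v w (A.homAk.yBTot v w y) +
      ∑ i ∈ Finset.range (k + 2), A.gY (-i) v w y + (-1 : K) • y ∈ A.filLow k v w := by
  refine filLow_induction ((A.homAk.yBTot v w).comp (A.tSum (k + 2) v w) +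
    (A.tSum (k + 2) v w).comp (A.homAk.yBTot v w) +
    ∑ i ∈ Finset.range (k + 2), A.gY (-i) v w + (-1 : K) • LinearMap.id) (A.filLow k v w)
    (fun u φ s hφ => ?_) hy |> fun hh => by
      simpa only [ladd_apply, lsmul_apply, lsum_apply, comp_apply, id_apply] using hh
  have hφ' : φ ∈ A.killLow (k + 1) v u := by exact_mod_cast hφ
  have hφ2 : φ ∈ A.killLow (k + 2 : ℕ) v u := killLow_mono (by push_cast; omega) v u hφ
  have h1 := sum_mem (t := Finset.univ) fun z (_ : z ∈ Finset.univ) =>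
    h.yBTot_sum_tY hpos haug z hφ' s
  refine cast (congrArg (· ∈ A.filLow k v w) ?_) h1
  have h2 := sum_rho_add hpos hφ2
  have h3 : ∑ i ∈ Finset.range (k + 2), (∑ z, tMul (-i) z φ s +
      A.gY (-i) v w (A.homAk.yt v u w φ s)) = ∑ i ∈ Finset.range (k + 2),
      A.homAk.yt v u w (rho (-i) v u φ) s :=
    Finset.sum_congr rfl fun i _ => sum_tMul h.isShort.m_three (-i) φ s
  have e1 := map_sum (A.homAk.yt v u w) (fun i : ℕ => rho (-i) v u φ) (Finset.range (k + 2))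
  have e2 := map_sum (A.homAk.yt v u w) (fun z => ∑ i ∈ Finset.range (k + 2), finContract
    ((A.homAk.aY v z u).comp (A.alpha (-i) v z)) (A.theta (-i) v u z φ)) Finset.univ
  have h4 := congrArg (fun φ => A.homAk.yt v u w φ s) h2
  have e3 := map_add (A.homAk.yt v u w) (∑ z, ∑ i ∈ Finset.range (k + 2), finContract
    ((A.homAk.aY v z u).comp (A.alpha (-i) v z)) (A.theta (-i) v u z φ))
    (∑ i ∈ Finset.range (k + 2), rho (-i) v u φ)
  dsimp only at h4
  rw [e3, e1, e2, ladd_apply, lsum_apply, lsum_apply, ← h3, Finset.sum_add_distrib] at h4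
  rw [Finset.sum_sub_distrib, Finset.sum_add_distrib, Finset.sum_comm (f := fun z i => tMul _ _ _ _)]
  simp only [ladd_apply, lsmul_apply, id_apply, comp_apply, tSum, lsum_apply,
    map_sum (A.homAk.yBTot v w)]
  rw [← Finset.sum_add_distrib]
  simp only [← Finset.sum_add_distrib]
  have e4 := (neg_one_smul K (A.homAk.yt v u w φ s)).trans (congrArg Neg.neg h4.symm)
  rw [e4]
  simp only [Finset.sum_add_distrib]
  abel

end AugOps

/-- The identification of pieces of equal degrees. -/
def GBimod.castEquiv (M : GBimod K Γ) {m n : ℤ} (h : m = n) (v w : Γ) :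
    M.X m v w ≃ₗ[K] M.X n v w := by
  subst h
  exact LinearEquiv.refl K _

namespace AugOps

variable {A : AugOps K Γ}

lemma actT_barCirc (n : ℤ) (φ : Lt A.homAk.1 w u) (x : Lt A.E.aug u z) (s : Words A.E.aug z v) :
    A.actT n v w (A.homAk.yt w u v φ (barCirc A.E.mAug u z v x s)) = 0 := by
  induction s using ind' with
  | ha _ s t hs ht =>
    have e := map_add (A.homAk.yt w u v φ)
    rw [map_add, e, map_add, hs, ht, add_zero]
  | hs _ c s hs =>
    have e := map_smul (A.homAk.yt w u v φ)
    rw [map_smul, e, map_smul, hs, smul_zero]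
  | hn =>
    rw [circ_nil, map_zero, map_zero]
  | hp v u x' s _ =>
    rw [circ_pre]
    exact actT_pre n φ _ _

lemma actT_aY (n : ℤ) (φ : Lt A.homAk.1 w u) (x : Lt A.E.aug u z)
    (s : Words A.E.aug z v) : A.actT n v w (A.homAk.yt w z v (A.homAk.aY w u z φ x) s) = 0 := by
  induction s using ind' with
  | ha _ s t hs ht => rw [map_add, map_add, hs, ht, add_zero]
  | hs _ c s hs => rw [map_smul, map_smul, hs, smul_zero]
  | hn =>
    rw [actT_nil]
    refine lext fun a => ?_
    have := lcongr_fun (slice_aY φ x (Lt.of _ n v w a)) (unit _ v v)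
    rw [mulDual_evA_unit, slice_apply, eps_unit, unit_self'] at this
    exact this
  | hp v u x' s _ => exact actT_pre n _ _ _

namespace IsAugDGAlg

variable (h : A.IsAugDGAlg)

include h

lemma actT_yBTot (n : ℤ) (y : A.homAk.YTot w v) : A.actT n v w (A.homAk.yBTot w v y) =
      Module.Dual.transpose (R := K) (A.dSgn n v w) (A.actT (n + 1) v w y) := by
  have h1 : ∀ u φ (s : Words A.E.aug u v), A.actT n v w (A.homAk.yBTot w v (A.homAk.yt w u v φ s)) =
      Module.Dual.transpose (R := K) (A.dSgn n v w) (A.actT (n + 1) v w (A.homAk.yt w u v φ s)) := by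
    intro u φ s
    induction s using ind' with
    | ha v s t hs ht => simp only [map_add, hs φ, ht φ]
    | hs v c s hs => simp only [map_smul, hs φ]
    | hn =>
      rw [RMod.yBTot_yt (fun v i p n hp => homAk_μ_two v i p n hp), eps_nil, circ_nil, barT_nil, map_zero, zero_add, add_zero,
        actT_nil, actT_nil, evZ_dY h.isShort]
      refine lext fun a => ?_
      simp only [comp_apply]
      rw [zeps_znil, zBTot_znil, D_eps_of]
      rfl
    | hp v u x s _ =>
      rw [h.yBTot_yt_pre, map_add, map_add, map_add, map_add, actT_pre, actT_pre, actT_barCirc,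
        actT_pre, actT_aY, actT_pre, map_zero]
      simp
  exact lcongr_fun (RMod.yt_ext (f := (A.actT n v w).comp (A.homAk.yBTot w v))
    (g := (Module.Dual.transpose (R := K) (A.dSgn n v w)).comp (A.actT (n + 1) v w)) h1) y

end IsAugDGAlg

lemma actT_hom (n m : ℤ) {y : A.homAk.YTot w v} (hy : y ∈ A.homAk.yHom m w v)
    (hm : m ≠ -n) : A.actT n v w y = 0 := by
  refine (Submodule.mem_bot K).1 (RMod.yHom_induction (A.actT n v w) ⊥ (fun u i φ p t hp => ?_) hy)
  rw [Submodule.mem_bot]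
  cases p with
  | nil v =>
    rw [of_nil, map_smul, map_smul, actT_nil]
    refine smul_eq_zero_of_right _ (lext fun a => ?_)
    refine evZ_of_eq_zero (m := n) φ ?_ ?_
    · exact zt_mem (zero_add n) (of_mem_hom (-1) (.nil v) _) a
    · simp only [Wd.deg] at hp
      omega
  | cons u j p =>
    rw [actT, RMod.toModule_yt]
    rfl

section

variable [∀ n v w, Module.Finite K (A.X n v w)]

lemma actT_alpha (n : ℤ) (F : Dual K (A.X n v w)) :
    A.actT n v w (A.homAk.yt w v v (A.alpha n w v F) (nil _ v)) = F := by
  rw [actT_nil, evZ_alpha]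
  refine lext fun a => ?_
  have := extZ_zt n F (nil _ v) (Lt.of _ n v w a)
  rw [Lt.comp_of, counit_nil, one_mul] at this
  exact this

lemma gY_eq_zero (j : ℤ) {y : A.homAk.YTot v w} (hy : A.actT j w v y = 0) : A.gY j v w y = 0 := by
  rw [gY, comp_apply, comp_apply, hy, map_zero, map_zero]

lemma actT_tSum [Fintype Γ] (n : ℤ) (N : ℕ) (y : A.homAk.YTot v w) :
    A.actT n w v (A.tSum N v w y) = 0 := by
  rw [tSum, lsum_apply, map_sum]
  refine Finset.sum_eq_zero fun z _ => ?_
  rw [lsum_apply, map_sum]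
  exact Finset.sum_eq_zero fun i _ => actT_tY n _ _

namespace IsAugDGAlg

variable (h : A.IsAugDGAlg)

include h

lemma actT_acyclic [Fintype Γ] (hpos : ∀ n v w, 0 < n → Subsingleton (A.X n v w))
    (haug : ∀ n v w, -1 < n → Subsingleton (A.aug.X n v w)) (x : A.homAk.YTot v w)
    (hx : ∀ n, A.actT n w v x = 0) (hdx : A.homAk.yBTot v w x = 0) :
    ∃ y, (∀ n, A.actT n w v y = 0) ∧ A.homAk.yBTot v w y = x := by
  have hS : ∀ y, y ∈ ⨅ n, LinearMap.ker (A.actT n w v) ↔ ∀ n, A.actT n w v y = 0 := fun y => by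
    simp only [Submodule.mem_iInf, mem_ker]
  obtain ⟨y, hy, hyx⟩ := exists_primitive (A.homAk.yBTot v w)
    (homAk_yBTot_yBTot h.isShort h.isDGOps) (⨅ n, LinearMap.ker (A.actT n w v)) (fun x hx => by
      rw [hS] at hx ⊢
      intro n
      rw [h.actT_yBTot, hx, map_zero]) (fun k => A.filLow k v w) (fun x _ hx => filLow_zero hpos hx)
    (fun k x hx hxk hdx => ⟨A.tSum (k + 2) v w x, (hS _).2 fun n => actT_tSum n _ x, by
      have := h.yBTot_tSum hpos haug hxk
      rw [hS] at hx
      rw [hdx, map_zero, Finset.sum_eq_zero (fun i _ => gY_eq_zero _ (hx _)), add_zero,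
        add_zero] at this
      have e := (neg_one_smul K x)
      rw [e] at this
      have := neg_mem this
      rwa [neg_add_rev, neg_neg, ← sub_eq_add_neg] at this⟩)
    (fun x _ => exists_mem_filLow haug x) x ((hS x).2 hx) hdx
  exact ⟨y, (hS y).1 hy, hyx⟩

lemma act_quasiIso [Finite Γ] (hpos : ∀ n v w, 0 < n → Subsingleton (A.X n v w))
    (haug : ∀ n v w, -1 < n → Subsingleton (A.aug.X n v w)) :
    IsQuasiIso A.d A.homAk.dRHomK A.act := by
  have := Fintype.ofFinite Γ
  have h1 := isQuasiIso_dual_of_piece (fun v w => A.homAk.YSummand v w) (fun v w => ydeg w)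
    (N := A.1.dual) (fun v w => A.homAk.yBTot v w)
    (fun n v w x hx => homAk_yBTot_mem h.isShort h.isDGOps hx)
    (fun v w x => homAk_yBTot_yBTot h.isShort h.isDGOps x)
    (fun i j v w => sgn K (j + 1) • Module.Dual.transpose (R := K) (A.d (-j) (-i) w v))
    (fun n v w => A.actT (-n) w v) (fun m n v w x hx hm => actT_hom (-n) m hx (by omega))
    (fun i j v w x hij hx => ?_) (fun n v w y => ⟨_, actT_alpha (-n) y⟩) (fun v w x hx hdx => ?_)
  · have h2 := h1.comp_equiv (dM' := A.d) (fun n v w => (A.1.castEquiv (neg_neg n).symm v w).trans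
      (Module.evalEquiv K (A.X (-(-n)) v w))) (fun i j v w x hij => ?_)
    · have e : A.act = fun n v w => (Module.Dual.transpose (R := K) ((A.actT (-(-n)) v w).comp
          (A.homAk.yIncl (-n) w v))).comp ((A.1.castEquiv (neg_neg n).symm v w).trans
          (Module.evalEquiv K (A.X (-(-n)) v w))).toLinearMap := by
        funext n v w
        refine lext fun x => lext fun y => ?_
        have : ∀ m (hm : n = m), A.actT n v w (A.homAk.yIncl (-n) w v y) x =
            A.actT m v w (A.homAk.yIncl (-n) w v y) (A.1.castEquiv hm v w x) := by
          rintro m rfl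
          rfl
        exact this _ _
      rw [e]
      exact h2
    · refine lext fun F => ?_
      have : ∀ i' j' (hi : i = i') (hj : j = j') (F : Dual K (A.X j' v w)),
          F (A.1.castEquiv hj v w (A.d i j v w x)) =
          sgn K j * (sgn K (-i + 1) * F (A.d i' j' v w (A.1.castEquiv hi v w x))) := by
        rintro _ _ rfl rfl F
        rw [← mul_assoc, ← sgn_add, show j + (-i + 1) = 1 + 1 by omega, sgn_add, sgn_mul_self, one_mul]
        rfl
      exact this _ _ _ _ F
  · obtain rfl : i = j - 1 := by omega
    have : ∀ m (hm : m = -j + 1), A.actT (-j) w v (A.homAk.yBTot v w x) = sgn K (j + 1) •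
        Module.Dual.transpose (R := K) (A.d (-j) m w v) (A.actT m w v x) := by
      rintro _ rfl
      rw [h.actT_yBTot, dSgn, map_smul, show sgn K (j + 1) = sgn K (-j + 1) by
        rw [sgn_add, sgn_add, sgn_neg]]
      rfl
    exact this _ (by ring)
  · obtain ⟨y, hy, hyx⟩ := h.actT_acyclic hpos haug x (fun n => by
      obtain ⟨m, rfl⟩ : ∃ m, n = -m := ⟨-n, (neg_neg n).symm⟩
      exact hx m) hdx
    exact ⟨y, fun n => hy _, hyx⟩

end IsAugDGAlg

end

end AugOps

namespace Words

variable {M : GBimod K Γ}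

lemma hom_fg [Finite Γ] (hM : ∀ n v w, -2 < n → Subsingleton (M.X n v w))
    (hfin : ∀ n v w, Module.Finite K (M.X n v w)) (k : ℕ) (n : ℤ) (hk : -n < k) (v w : Γ) :
    (hom M 1 n v w).FG := by
  induction k generalizing n v with
  | zero =>
    have : hom M 1 n v w = ⊥ := by
      refine (Submodule.eq_bot_iff _).2 fun x hx => hom_eq_zero LinearMap.id (fun p t hp => ?_) hx
      rcases Tens.subsingleton_or hM 1 p with h | h
      · rw [Subsingleton.elim t 0, map_zero, map_zero]
      · omega
    rw [this]
    exact Submodule.fg_bot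
  | succ k ih =>
    have hfg : (Submodule.span K {unit M v w} ⊔ ⨆ u, ⨆ i ∈ Finset.Icc (n - 1) (-2),
        Submodule.map₂ ((pre M v u w).comp (Lt.of M i v u)) ⊤ (hom M 1 (n - i - 1) u w)).FG := by
      refine (Submodule.fg_span_singleton _).sup (Submodule.fg_iSup _ fun u =>
        Submodule.fg_biSup _ _ fun i hi => ?_)
      rw [Finset.mem_Icc] at hi
      have := hfin i v u
      refine Submodule.FG.map₂ _ Module.Finite.fg_top (ih _ (by push_cast at hk; omega) u)
    have hle : hom M 1 n v w ≤ Submodule.span K {unit M v w} ⊔ ⨆ u, ⨆ i ∈ Finset.Icc (n - 1) (-2),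
        Submodule.map₂ ((pre M v u w).comp (Lt.of M i v u)) ⊤ (hom M 1 (n - i - 1) u w) := by
      intro x hx
      refine hom_induction LinearMap.id _ (fun p t hp => ?_) hx
      rw [id_apply]
      cases p with
      | nil v =>
        rw [of_nil, ← unit_self']
        exact Submodule.smul_mem _ _ (Submodule.mem_sup_left (Submodule.mem_span_singleton_self _))
      | cons v i p =>
        rename_i u
        by_cases hi : -2 < i
        · have : ∀ t : Tens M (.cons v i p), t = 0 := fun t => by
            have := hM i v u hi
            induction t using Tens.ind with
            | ha s t hs ht => rw [hs, ht, add_zero]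
            | hc x t => rw [Subsingleton.elim x 0, map_zero, lzero_apply]
          rw [this t, map_zero]
          exact zero_mem _
        · rcases Tens.subsingleton_or hM 1 p with h | h
          · induction t using Tens.ind with
            | ha s t hs ht => rw [map_add]; exact add_mem hs ht
            | hc x t =>
              rw [Subsingleton.elim t 0, map_zero, map_zero]
              exact zero_mem _
          · simp only [Wd.deg] at hp
            have hi' : i ∈ Finset.Icc (n - 1) (-2) := Finset.mem_Icc.2 ⟨by omega, by omega⟩
            refine Submodule.mem_sup_right (Submodule.mem_iSup_of_mem u
              (Submodule.mem_iSup_of_mem i (Submodule.mem_iSup_of_mem hi' ?_)))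
            induction t using Tens.ind with
            | ha s t hs ht => rw [map_add]; exact add_mem hs ht
            | hc x t =>
              rw [← pre_of_of]
              refine Submodule.apply_mem_map₂ _ (m := x) (n := of M p t) trivial ?_
              have h1 := of_mem_hom 1 p t
              rwa [show n - i - 1 = p.deg 1 by omega]
    exact Submodule.FG.of_le hfg hle

lemma finite_wordsGr [Finite Γ] (hM : ∀ n v w, -2 < n → Subsingleton (M.X n v w))
    (hfin : ∀ n v w, Module.Finite K (M.X n v w)) (n : ℤ) (v w : Γ) :
    Module.Finite K ((wordsGr M 1).X n v w) := by
  have := Module.Finite.iff_fg.2 (hom_fg hM hfin ((-n).toNat + 1) n (by push_cast; have := Int.self_le_toNat (-n); omega) v w)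
  refine Module.Finite.of_injective ((wIncl M 1 n v w).codRestrict (hom M 1 n v w) (wIncl_mem n))
    fun x y hxy => ?_
  have := congrArg (fun z => wProj M 1 n v w z.1) hxy
  exact (wProj_wIncl n x).symm.trans (this.trans (wProj_wIncl n y))

end Words

namespace AInfCoalg

variable (C : AInfCoalg K Γ) (hconn : C.toGBimod.IsConnected C.η)
  (hsc : ∀ v w, Subsingleton (C.X (-1) v w))

include hconn hsc

lemma cobar_aug_subsingleton (n : ℤ) (v w : Γ) (hn : -1 < n) :
    Subsingleton (C.cobar.aug.X n v w) := by
  have hc := C.cobar_isConnected hconn hsc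
  rcases (show n = 0 ∨ 0 < n by omega) with rfl | h
  · have h0 : ∀ x : C.cobar.aug.X 0 v w, x = 0 := by
      rintro ⟨x, hx⟩
      obtain ⟨r, rfl⟩ := hc.zero v w x
      refine Subtype.ext ?_
      by_cases hv : v = w
      · subst hv
        rw [mem_ker, map_smul, C.cobar_isAugDGAlg.ε_one] at hx
        have hr : r = 0 := by simpa using hx
        change r • _ = _
        rw [hr, zero_smul]
        rfl
      · change r • _ = _
        rw [hc.one_eq v w hv, smul_zero]
        rfl
    exact ⟨fun x y => by rw [h0 x, h0 y]⟩
  · have := hc.pos n v w h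
    exact ⟨fun x y => Subtype.ext (Subsingleton.elim _ _)⟩

lemma cobar_isKoszulDual [Finite Γ] (hfin : C.toGBimod.IsLocallyFinite) :
    C.cobar.IsKoszulDual where
  act := by
    have : ∀ n v w, Module.Finite K (C.cobar.X n v w) :=
      finite_wordsGr (C.coaug_subsingleton hconn hsc) (fun n v w => by
        have := hfin n v w
        exact Module.Finite.of_surjective _ (C.coaugProj_surjective n v w))
    exact C.cobar_isAugDGAlg.act_quasiIso (C.cobar_isConnected hconn hsc).pos
      (C.cobar_aug_subsingleton hconn hsc)
  yoneda := C.cobar_isAugDGAlg.yoneda_quasiIso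

end AInfCoalg

namespace Words

variable {M : GBimod K Γ}

lemma lenProj_of (r : ℕ) (p : Wd Γ v w) (t : Tens M p) :
    lenProj M r v w (of M p t) = if p.length = r then of M p t else 0 := by
  rw [lenProj, lift_of]
  split_ifs <;> rfl

lemma exists_sum_lenProj (z : Words M v w) :
    ∃ N₀, ∀ N, N₀ ≤ N → ∑ i ∈ Finset.range N, lenProj M i v w z = z := by
  induction z using DirectSum.induction_on with
  | zero => exact ⟨0, fun N _ => by simp⟩
  | add x y hx hy =>
    obtain ⟨a, ha⟩ := hx
    obtain ⟨b, hb⟩ := hy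
    refine ⟨max a b, fun N hN => ?_⟩
    simp only [map_add, Finset.sum_add_distrib]
    rw [ha N (le_trans (le_max_left _ _) hN), hb N (le_trans (le_max_right _ _) hN)]
  | of p t =>
    refine ⟨p.length + 1, fun N hN => ?_⟩
    change ∑ i ∈ Finset.range N, lenProj M i v w (of M p t) = of M p t
    rw [Finset.sum_eq_single p.length, lenProj_of, if_pos rfl]
    · intro i _ hi
      rw [lenProj_of, if_neg hi.symm]
    · intro h
      exact absurd (Finset.mem_range.2 (by omega)) h

/-- The letter `x` as a word. -/
abbrev lw (x : Lt M v w) : Words M v w := pre M v w w x (nil M w)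

end Words

namespace AInfCoalg

variable (C : AInfCoalg K Γ)

/-- The projection `c ↦ c - ε(c) η`. -/
def redu (n : ℤ) (v w : Γ) : C.X n v w →ₗ[K] C.X n v w :=
  LinearMap.id - (C.ε n v w).smulRight (C.η n v w)

lemma redu_apply (n : ℤ) (v w : Γ) (x : C.X n v w) :
    C.redu n v w x = x - C.ε n v w x • C.η n v w := rfl

lemma ε_redu (n : ℤ) (v w : Γ) (x : C.X n v w) : C.ε n v w (C.redu n v w x) = 0 := by
  by_cases h : n = 0 ∧ v = w
  · obtain ⟨rfl, rfl⟩ := h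
    rw [redu_apply, map_sub, map_smul, C.ε_η]
    simp
  · rw [C.ε_zero n v w h, lzero_apply]

lemma redu_η (n : ℤ) (v w : Γ) : C.redu n v w (C.η n v w) = 0 := by
  by_cases h : n = 0 ∧ v = w
  · obtain ⟨rfl, rfl⟩ := h
    rw [redu_apply, C.ε_η, one_smul, sub_self]
  · rw [C.η_zero n v w h, map_zero]

/-- The section `C̄ → C` whose image is the kernel of the counit. -/
def sect (n : ℤ) (v w : Γ) : C.coaug.X n v w →ₗ[K] C.X n v w := Submodule.liftQ _ (C.redu n v w) (by
    rw [Submodule.span_le]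
    rintro x hx
    rw [Set.mem_singleton_iff] at hx
    subst hx
    exact C.redu_η n v w)

lemma sect_proj (n : ℤ) (v w : Γ) (x : C.X n v w) :
    C.sect n v w (C.coaugProj n v w x) = C.redu n v w x := rfl

/-- The element `η(e_v)` as a letter. -/
abbrev etaL (v : Γ) : Lt C.toGBimod v v := Lt.of _ 0 v v (C.η 0 v v)

/-- `redu` on all letters of a word. -/
abbrev reduW (v w : Γ) : Words C.toGBimod v w →ₗ[K] Words C.toGBimod v w := map C.redu v w

/-- `sect` on all letters of a word. -/
abbrev kap (v w : Γ) : Words C.coaug v w →ₗ[K] Words C.toGBimod v w := map C.sect v w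

lemma Words.map_map {M N R : GBimod K Γ} (f : ∀ n v w, M.X n v w →ₗ[K] N.X n v w)
    (g : ∀ n v w, N.X n v w →ₗ[K] R.X n v w) (k : ∀ n v w, M.X n v w →ₗ[K] R.X n v w)
    (h : ∀ n v w x, g n v w (f n v w x) = k n v w x) (s : Words M v w) :
    map g v w (map f v w s) = map k v w s := by
  refine ext_ind (fun v => (map g v w).comp (map f v w))
    (fun v => map k v w) (by simp) (fun v u x s ih => ?_) s
  have h1 : Lt.map g v u (Lt.map f v u x) = Lt.map k v u x := by
    induction x using Lt.ind with
    | ha x y hx hy => simp only [map_add, hx, hy]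
    | ho n x => rw [Lt.map_of, Lt.map_of, Lt.map_of, h]
  simp only [comp_apply] at ih ⊢
  rw [map_pre, map_pre, map_pre, h1, ih]

/-- The counit applied to the letter in position `j`. -/
abbrev ctr (j : ℕ) (v w : Γ) : Words C.toGBimod v w →ₗ[K] Words C.toGBimod v w :=
  lift (Koszul.contract C.toGBimod C.ε j)

lemma ctr_nil (j : ℕ) (v : Γ) : C.ctr j v v (nil _ v) = 0 := by
  rw [nil, lift_of]
  cases j <;> simp [Koszul.contract]

lemma ctr_zero_pre (n : ℤ) (x : C.X n v u) (s : Words C.toGBimod u w) :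
    C.ctr 0 v w (pre _ v u w (Lt.of _ n v u x) s) =
      C.ε n v u x • concat _ v u w (unit _ v u) s := by
  induction s using DirectSum.induction_on with
  | zero => simp
  | add s t hs ht => simp only [map_add, hs, ht, smul_add]
  | of p t =>
    change C.ctr 0 v w (pre _ v u w _ (of _ p t)) = _ • concat _ v u w _ (of _ p t)
    rw [pre_of_of, lift_of, Koszul.contract, Tens.lift_cons]
    rfl

lemma ctr_succ_pre (j : ℕ) (x : Lt C.toGBimod v u) (s : Words C.toGBimod u w) :
    C.ctr (j + 1) v w (pre _ v u w x s) = pre _ v u w x (C.ctr j u w s) := by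
  induction x using Lt.ind with
  | ha x y hx hy => simp only [map_add, ladd_apply, hx, hy]
  | ho n x =>
    induction s using DirectSum.induction_on with
    | zero => simp
    | add s t hs ht => simp only [map_add, hs, ht]
    | of p t =>
      change C.ctr (j + 1) v w (pre _ v u w _ (of _ p t)) = pre _ v u w _ (C.ctr j u w (of _ p t))
      rw [pre_of_of, lift_of, lift_of, Koszul.contract, Tens.lift_cons, pre_of]
      rfl

/-- Insertion of `-η` in position `j`, followed by `redu` on the letters to its right. -/
def ins : ℕ → ∀ v w : Γ, Words C.toGBimod v w →ₗ[K] Words C.toGBimod v w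
  | 0, v, w => (-1 : K) • (pre _ v v w (C.etaL v)).comp (C.reduW v w)
  | j + 1, v, w => elim (fun u => (pre _ v u w).compl₂ (ins j u w))

lemma reduW_of (p : Wd Γ v w) (t : Tens C.toGBimod p) (N : ℕ) (hN : p.length ≤ N) :
    C.reduW v w (of _ p t) =
      of _ p t + ∑ j ∈ Finset.range N, C.ins j v w (C.ctr j v w (of _ p t)) := by
  induction p generalizing N with
  | nil v =>
    rw [of_nil, Finset.sum_eq_zero, map_smul, map_nil, add_zero]
    intro j _
    rw [map_smul, ctr_nil, smul_zero, map_zero]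
  | cons v n p ih =>
    rename_i u w
    simp only [Wd.length] at hN
    obtain ⟨N, rfl⟩ : ∃ m, N = m + 1 := ⟨N - 1, by omega⟩
    induction t using Tens.ind with
    | ha s t hs ht =>
      simp only [map_add, Finset.sum_add_distrib] at hs ht ⊢
      rw [hs, ht]
      abel
    | hc x t =>
      have h1 : ∀ j, C.ins (j + 1) v w (C.ctr (j + 1) v w (pre _ v u w
          (Lt.of _ n v u x) (of _ p t))) = pre _ v u w (Lt.of _ n v u x)
            (C.ins j u w (C.ctr j u w (of _ p t))) := fun j => by
        rw [ctr_succ_pre, ins, elim_pre]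
        rfl
      have h2 : C.ins 0 v w (C.ctr 0 v w (pre _ v u w (Lt.of _ n v u x) (of _ p t))) =
          - C.ε n v u x • pre _ v u w (Lt.of _ n v u (C.η n v u)) (C.reduW u w (of _ p t)) := by
        rw [ctr_zero_pre]
        by_cases h : n = 0 ∧ v = u
        · obtain ⟨rfl, rfl⟩ := h
          rw [unit_self', nil_concat, map_smul, ins, lsmul_apply, comp_apply, smul_comm, neg_smul,
            neg_smul, one_smul]
        · rw [C.ε_zero n v u h]
          simp
      rw [← pre_of_of, Finset.sum_range_succ', h2, map_pre, Lt.map_of, redu_apply, map_sub, map_sub,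
        lsub_apply, map_smul, map_smul, lsmul_apply, ih t N (by omega),
        Finset.sum_congr rfl fun j _ => h1 j]
      simp only [map_add, map_sum, smul_add, neg_smul]
      abel

lemma ctr_lenProj (j r : ℕ) (hr : r ≤ j) (z : Words C.toGBimod v w) :
    C.ctr j v w (lenProj _ r v w z) = 0 := by
  have h1 : ∀ {v w : Γ} (p : Wd Γ v w) (j : ℕ) (t : Tens C.toGBimod p), p.length ≤ j →
      C.ctr j v w (of _ p t) = 0 := by
    intro v w p
    induction p with
    | nil v => intro j t _; rw [of_nil, map_smul, ctr_nil, smul_zero]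
    | cons v n p ih =>
      intro j t hj
      simp only [Wd.length] at hj
      obtain ⟨j, rfl⟩ : ∃ m, j = m + 1 := ⟨j - 1, by omega⟩
      induction t using Tens.ind with
      | ha s t hs ht => rw [map_add, map_add, hs, ht, add_zero]
      | hc x t => rw [← pre_of_of, ctr_succ_pre, ih j t (by omega), map_zero]
  induction z using DirectSum.induction_on with
  | zero => simp
  | add s t hs ht => rw [map_add, map_add, hs, ht, add_zero]
  | of p t =>
    change C.ctr j v w (lenProj _ r v w (of _ p t)) = 0
    rw [lenProj_of]
    split_ifs with h
    · exact h1 p j t (by omega)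
    · rw [map_zero]

lemma reduW_Δ (n : ℤ) (v w : Γ) (x : C.X n v w) : C.reduW v w (C.Δ n v w x) = C.Δ n v w x +
      C.ins 0 v w (sgn K n • lw (Lt.of _ n v w x)) + C.ins 1 v w (lw (Lt.of _ n v w x)) := by
  have h0 : ∀ z : Words C.toGBimod v w, ∃ N₀, ∀ N, N₀ ≤ N → C.reduW v w z = z +
      ∑ j ∈ Finset.range N, C.ins j v w (C.ctr j v w z) := by
    intro z
    induction z using DirectSum.induction_on with
    | zero => exact ⟨0, fun N _ => by simp⟩
    | add x y hx hy =>
      obtain ⟨a, ha⟩ := hx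
      obtain ⟨b, hb⟩ := hy
      refine ⟨max a b, fun N hN => ?_⟩
      simp only [map_add, Finset.sum_add_distrib]
      rw [ha N (le_trans (le_max_left _ _) hN), hb N (le_trans (le_max_right _ _) hN)]
      abel
    | of p t => exact ⟨p.length, fun N hN => C.reduW_of p t N hN⟩
  obtain ⟨N₀, hN⟩ := h0 (C.Δ n v w x)
  obtain ⟨N₁, hN1⟩ := exists_sum_lenProj (C.Δ n v w x)
  have h2 : ∀ j, C.ctr j v w (C.Δ n v w x) = C.ctr j v w (lenProj _ 2 v w (C.Δ n v w x)) := by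
    intro j
    conv_lhs => rw [← hN1 (N₁ + 3) (by omega)]
    rw [map_sum, Finset.sum_eq_single 2 (fun i _ hi => C.ε_other n v w x i j hi)
      (fun h => absurd (Finset.mem_range.2 (by omega)) h)]
  have hl : of _ (.one v n w) (Tens.letter C.toGBimod v n w x) = lw (Lt.of _ n v w x) := by
    rw [lw, nil, pre_of_of]
    rfl
  rw [hN (N₀ + 2) (by omega), Finset.sum_range_succ', Finset.sum_range_succ', Finset.sum_eq_zero,
    h2, h2]
  · have e0 := C.ε_left n v w x
    have e1 := C.ε_right n v w x
    rw [hl] at e0 e1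
    rw [e0]
    change _ + (0 + C.ins 1 v w (lift (Koszul.contract C.toGBimod C.ε 1) _) + _) = _
    rw [e1]
    abel
  · intro j _
    rw [h2, ctr_lenProj _ _ _ (by omega), map_zero]

lemma Δ_redu (n : ℤ) (v w : Γ) (x : C.X n v w) :
    C.Δ n v w (C.redu n v w x) = C.reduW v w (C.Δ n v w x) +
      pre _ v w w (Lt.of _ n v w (C.redu n v w x)) (lw (C.etaL w)) +
      sgn K n • pre _ v v w (C.etaL v) (lw (Lt.of _ n v w (C.redu n v w x))) := by
  have h1 : C.ε n v w x • C.Δ n v w (C.η n v w) =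
      C.ε n v w x • pre _ v w w (Lt.of _ n v w (C.η n v w)) (lw (C.etaL w)) := by
    by_cases h : n = 0 ∧ v = w
    · obtain ⟨rfl, rfl⟩ := h
      rw [C.Δ_η, lw, nil, pre_of_of, pre_of_of]
      rfl
    · rw [C.ε_zero n v w h]
      simp
  rw [reduW_Δ, redu_apply, map_sub, map_smul, h1, map_smul, ins, ins, elim_pre, ins, lsmul_apply,
    comp_apply, compl₂_apply, lsmul_apply, comp_apply, map_nil, map_pre, Lt.map_of, map_nil,
    redu_apply]
  simp only [lw, map_smul, map_sub, map_neg, lsub_apply, lsmul_apply, smul_sub, neg_smul, one_smul,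
    smul_neg]
  abel

lemma cobarδ_sect (x : Lt C.coaug v w) :
    cobarδ C.Δ v w (Lt.map C.sect v w x) = C.kap v w (cobarδ C.coaugΔ v w x) +
      pre _ v w w (Lt.map C.sect v w x) (lw (C.etaL w)) -
      pre _ v v w (C.etaL v) (lw (Lt.map C.sect v w (Lt.eps _ v w x))) := by
  induction x using Lt.ind with
  | ha x y hx hy =>
    simp only [lw, map_add, ladd_apply] at hx hy ⊢
    rw [hx, hy]
    abel
  | ho n x =>
    obtain ⟨x, rfl⟩ := C.coaugProj_surjective n v w x
    rw [Lt.eps_of, map_smul, Lt.map_of, Lt.lift_of, Lt.lift_of, sect_proj, Δ_redu, coaugΔ_proj,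
      Words.map_map C.coaugProj C.sect C.redu (fun n v w x => C.sect_proj n v w x), sgn_add]
    simp [lw]

lemma cobarT_kap (s : Words C.coaug v w) : cobarT C.Δ v w (C.kap v w s) = C.kap v w (C.DΩ v w s) +
      concat _ v w w (C.kap v w s) (lw (C.etaL w)) +
      (-1 : K) • pre _ v v w (C.etaL v) (C.kap v w (eps _ v w s)) := by
  refine ext_ind (fun v => (cobarT C.Δ v w).comp (C.kap v w)) (fun v =>
    (C.kap v w).comp (C.DΩ v w) + ((concat _ v w w).flip (lw (C.etaL w))).comp
      (C.kap v w) + (-1 : K) • ((pre _ v v w (C.etaL v)).comp (C.kap v w)).comp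
        (eps _ v w)) ?_ (fun v u x s ih => ?_) s
  · simp
  · simp only [comp_apply, ladd_apply, lsmul_apply, flip_apply] at ih ⊢
    rw [map_pre, cobarT_pre, ih, cobarδ_sect, cobarT_pre, ← map_eps]
    simp only [lw, map_add, map_sub, map_smul, ladd_apply, lsub_apply, map_pre, map_concat, eps_pre,
      pre_concat, nil_concat, neg_smul, one_smul, map_neg]
    abel

end AInfCoalg

namespace Words

variable {M : GBimod K Γ}

lemma concat_ext_ind {Q : Γ → Type*} [∀ w, AddCommMonoid (Q w)] [∀ w, Module K (Q w)]
    (f g : ∀ w, Words M v w →ₗ[K] Q w) (hn : f v (nil M v) = g v (nil M v))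
    (hp : ∀ z w (y : Words M v z) (c : Lt M z w), f z y = g z y →
      f w (concat M v z w y (lw c)) = g w (concat M v z w y (lw c))) (s : Words M v w) : f w s = g w s := by
  have key : ∀ {z : Γ} (s : Words M z w) (y : Words M v z), f z y = g z y →
      f w (concat M v z w y s) = g w (concat M v z w y s) := by
    intro z s
    induction s using ind' with
    | ha _ s t hs ht => intro y hy; rw [map_add, map_add, map_add, hs y hy, ht y hy]
    | hs _ c s hs => intro y hy; rw [map_smul, map_smul, map_smul, hs y hy]
    | hn => intro y hy; rwa [concat_nil]
    | hp z u x s ih =>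
      intro y hy
      have e : concat M v z w y (pre M z u w x s) = concat M v u w (concat M v z u y (lw x)) s := by
        rw [concat_assoc, pre_concat, nil_concat]
      rw [e]
      exact ih _ (hp z u y x hy)
  have := key s (nil M v) hn
  rwa [nil_concat] at this

lemma letterProj_concat_lw (s : Words M v z) (c : Lt M z w) :
    letterProj M v w (concat M v z w s (lw c)) =
      if h : v = z then counit M v z s • (h ▸ c) else 0 := by
  induction s using ind' with
  | ha _ s t hs ht =>
    simp only [map_add, ladd_apply, hs, ht, add_smul]
    split_ifs <;> simp
  | hs _ a s hs =>
    simp only [map_smul, lsmul_apply, hs]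
    split_ifs <;> simp [mul_smul]
  | hn => simp [lw]
  | hp v u x s ih =>
    have h1 : letterProj M v w (concat M v z w (pre M v u z x s) (lw c)) = 0 := by
      rw [pre_concat]
      clear ih
      induction s using ind' with
      | ha _ s t hs ht => simp only [map_add, ladd_apply, hs, ht, add_zero]
      | hs _ a s hs => simp only [map_smul, lsmul_apply, hs, smul_zero]
      | hn => rw [nil_concat, letterProj_two]
      | hp v u x s ih => rw [pre_concat, letterProj_two]
    rw [h1, counit_pre]
    simp

lemma conv_concat_lw (f : ∀ u, Dual K (Words M v u))
    (g : ∀ u, Dual K (Words M u w)) (y : Words M v z) (c : Lt M z w) :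
    conv f g (concat M v z w y (lw c)) = f w (concat M v z w y (lw c)) * g w (nil M w) +
      conv f (fun u => (g u).comp ((concat M u z w).flip (lw c))) y := by
  induction y using ind' with
  | ha _ s t hs ht => simp only [map_add, ladd_apply, hs, ht]; ring
  | hs _ a s hs => simp only [map_smul, lsmul_apply, hs, smul_eq_mul]; ring
  | hn => 
    rw [nil_concat, conv_pre, conv_nil, conv_nil]
    simp only [comp_apply, flip_apply, nil_concat]
    ring
  | hp v u x s ih =>
    rw [pre_concat, conv_pre, ih, conv_pre]
    simp only [comp_apply, flip_apply, pre_concat]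
    ring

lemma mulDual_evLetter_concat (f : Dual K (Words M w u)) (a : Lt M.dual v u)
    (y : Words M w u) (c : Lt M u v) :
    mulDual f (evLetter v u a) (concat M w u v y (lw c)) = f y * Lt.ev M v u a c := by
  have h1 : (Pi.single u (evLetter v u a) : ∀ z, Dual K (Words M z v)) v (nil M v) = 0 := by
    by_cases h : v = u
    · subst h; simp
    · rw [Pi.single_eq_of_ne h]; rfl
  have h2 : (fun z => ((Pi.single u (evLetter v u a) : ∀ z, Dual K (Words M z v)) z).comp
      ((concat M z u v).flip (lw c))) = Pi.single u (Lt.ev M v u a c • counit M u u) := by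
    funext z
    by_cases h : z = u
    · subst h
      rw [Pi.single_eq_same, Pi.single_eq_same]
      refine lext fun s => ?_
      simp only [comp_apply, flip_apply, evLetter, letterProj_concat_lw]
      simp [mul_comm]
    · rw [Pi.single_eq_of_ne h, Pi.single_eq_of_ne h]
      rfl
  rw [mulDual, conv_concat_lw, h1, h2, mul_zero, zero_add]
  change mulDual f _ y = _
  rw [mulDual_smul_right, mulDual_counit, lsmul_apply, smul_eq_mul, mul_comm]

lemma mulDual_evLetter_concat_ne (h : z ≠ u) (f : Dual K (Words M w u))
    (a : Lt M.dual v u) (y : Words M w z) (c : Lt M z v) :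
    mulDual f (evLetter v u a) (concat M w z v y (lw c)) = 0 := by
  have h1 : (Pi.single u (evLetter v u a) : ∀ z, Dual K (Words M z v)) v (nil M v) = 0 := by
    by_cases h : v = u
    · subst h; simp
    · rw [Pi.single_eq_of_ne h]; rfl
  have h2 : (fun y => ((Pi.single u (evLetter v u a) : ∀ z, Dual K (Words M z v)) y).comp
      ((concat M y z v).flip (lw c))) = fun _ => 0 := by
    funext y
    by_cases hy : y = u
    · subst hy
      rw [Pi.single_eq_same]
      refine lext fun s => ?_
      simp only [comp_apply, flip_apply, evLetter, letterProj_concat_lw]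
      rw [dif_neg (Ne.symm h)]
      simp
    · rw [Pi.single_eq_of_ne hy]
      rfl
  rw [mulDual, conv_concat_lw, h1, h2, mul_zero, zero_add, conv_zero_right]

lemma mulDual_letterProj_nil (φ : Dual K (Lt M v w))
    (b : Dual K (Words M w v)) : mulDual (φ.comp (letterProj M v w)) b (nil M v) = 0 := by
  rw [mulDual, conv_nil]
  by_cases h : v = w
  · subst h; simp
  · rw [Pi.single_eq_of_ne h]; simp

lemma mulDual_letterProj_pre (φ : Dual K (Lt M v u))
    (b : Dual K (Words M u w)) (x : Lt M v u) (s : Words M u w) :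
    mulDual (φ.comp (letterProj M v u)) b (pre M v u w x s) = φ x * b s := by
  have h0 : ∀ t : Words M u u, letterProj M v u (pre M v u u x t) = counit M u u t • x := by
    intro t
    refine lcongr_fun (f := (letterProj M v u).comp (pre M v u u x))
      (g := (counit M u u).smulRight x) (ext_cases _ _ (fun _ => by simp) fun z n y s => by simp) t
  have h1 : (fun y => ((Pi.single u (φ.comp (letterProj M v u)) : ∀ z, Dual K (Words M v z))
      y).comp (pre M v u y x)) = Pi.single u (φ x • counit M u u) := by
    funext y
    by_cases h : y = u
    · subst h
      rw [Pi.single_eq_same, Pi.single_eq_same]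
      refine lext fun t => ?_
      simp [h0, mul_comm]
    · rw [Pi.single_eq_of_ne h, Pi.single_eq_of_ne h]
      rfl
  have h2 : (Pi.single u (φ.comp (letterProj M v u)) : ∀ z, Dual K (Words M v z))
      v (nil M v) = 0 := by
    by_cases h : v = u
    · subst h; simp
    · rw [Pi.single_eq_of_ne h]; rfl
  rw [mulDual, conv_pre, h1, h2, zero_mul, zero_add]
  change mulDual _ b s = _
  rw [mulDual_smul_left, counit_mulDual]
  rfl

lemma mulDual_letterProj_pre_ne (h : z ≠ u) (φ : Dual K (Lt M v u))
    (b : Dual K (Words M u w)) (x : Lt M v z) (s : Words M z w) :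
    mulDual (φ.comp (letterProj M v u)) b (pre M v z w x s) = 0 := by
  have h0 : (letterProj M v u).comp (pre M v z u x) = 0 :=
    ext_cases _ _ (fun h' => absurd h' h) fun z n y s => by simp
  have h1 : (fun y => ((Pi.single u (φ.comp (letterProj M v u)) : ∀ z, Dual K (Words M v z))
      y).comp (pre M v z y x)) = fun _ => 0 := by
    funext y
    by_cases h : y = u
    · subst h
      rw [Pi.single_eq_same, comp_assoc, h0, comp_zero]
    · rw [Pi.single_eq_of_ne h]
      rfl
  have h2 : (Pi.single u (φ.comp (letterProj M v u)) : ∀ z, Dual K (Words M v z))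
      v (nil M v) = 0 := by
    by_cases h : v = u
    · subst h; simp
    · rw [Pi.single_eq_of_ne h]; rfl
  rw [mulDual, conv_pre, h1, h2, zero_mul, zero_add, conv_zero_left]

lemma pairT_apply_nil (t : Words M.dual v v) : pairT M v v t (nil M v) = counit _ v v t := by
  refine lcongr_fun (f := (pairT M v v).flip (nil M v)) (g := counit _ v v)
    (ext_cases _ _ (fun _ => ?_) fun z n y s => ?_) t
  · simp
  · rw [flip_apply, pairT_pre, counit_pre, mulDual, conv_nil]
    by_cases h : v = z
    · subst h; simp
    · rw [Pi.single_eq_of_ne h]; simp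

lemma flip_pairT_concat_lw (y : Words M w z) (c : Lt M z v) :
    (pairT M v w).flip (concat M w z v y (lw c)) =
      mulDual (((Lt.ev M v z).flip c).comp (letterProj _ v z)) ((pairT M z w).flip y) := by
  refine ext_cases _ _ (fun h => ?_) fun u n a s => ?_
  · subst h
    rw [flip_apply, pairT_nil, counit_concat, counit_pre, mul_zero, mulDual_letterProj_nil]
  · rw [flip_apply, pairT_pre]
    by_cases h : u = z
    · subst h
      rw [mulDual_evLetter_concat, mulDual_letterProj_pre, mul_comm]
      rfl
    · rw [mulDual_evLetter_concat_ne (Ne.symm h), mulDual_letterProj_pre_ne h]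

lemma flip_pairT_concat (y₁ : Words M w z) (y₂ : Words M z v) :
    (pairT M v w).flip (concat M w z v y₁ y₂) =
      mulDual ((pairT M v z).flip y₂) ((pairT M z w).flip y₁) := by
  refine concat_ext_ind (fun v => (pairT M v w).flip.comp (concat M w z v y₁))
    (fun v => (mulDualₗ v z w).flip ((pairT M z w).flip y₁) ∘ₗ (pairT M v z).flip) ?_
    (fun u v y c ih => ?_) y₂
  · simp only [comp_apply, concat_nil, flip_apply, mulDualₗ_apply]
    have : (pairT M z z).flip (nil M z) = counit _ z z := lext fun t => pairT_apply_nil t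
    rw [this, counit_mulDual]
  · simp only [comp_apply, flip_apply, mulDualₗ_apply] at ih ⊢
    rw [← concat_assoc, flip_pairT_concat_lw, flip_pairT_concat_lw, ih, mulDual_assoc]

lemma pairT_eps (t : Words M.dual v w) :
    pairT M v w (eps _ v w t) = (pairT M v w t).comp (eps M w v) := by
  refine ext_ind (fun v => (pairT M v w).comp (eps _ v w)) (fun v =>
    (LinearMap.lcomp K K (eps M w v)).comp (pairT M v w)) ?_ (fun v u a s ih => ?_) t
  · simp only [comp_apply, eps_nil, pairT_nil]
    exact lext fun s => (counit_eps s).symm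
  · simp only [comp_apply] at ih ⊢
    rw [eps_pre, pairT_pre, pairT_pre, ih]
    refine Eq.trans ?_ (mulDual_eps _ _).symm
    congr 1
    refine lext fun s => ?_
    rw [comp_apply, evLetter, evLetter, comp_apply, comp_apply]
    have h1 : letterProj M u v (eps M u v s) = Lt.eps M u v (letterProj M u v s) :=
      lcongr_fun (f := (letterProj M u v).comp (eps M u v))
        (g := (Lt.eps M u v).comp (letterProj M u v)) (ext_cases _ _
          (fun h => by subst h; simp) fun z n y s => by
            refine lcongr_fun (f := (letterProj M u v).comp ((eps M u v).comp
              (pre M u z v (Lt.of M n u z y)))) (g := (Lt.eps M u v).comp ((letterProj M u v).comp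
                (pre M u z v (Lt.of M n u z y)))) (ext_cases _ _ (fun h => ?_) fun z n y s => ?_) s
            · subst h; simp
            · simp) s
    rw [h1]
    generalize letterProj M u v s = x
    induction x using Lt.ind with
    | ha x y hx hy => rw [map_add, map_add, map_add, hx, hy]
    | ho m x =>
      induction a using Lt.ind with
      | ha a b ha hb => rw [map_add, map_add, map_add, ladd_apply, ladd_apply, ha, hb]
      | ho n a =>
        rw [Lt.eps_of, Lt.eps_of, map_smul, map_smul, lsmul_apply, Lt.ev_of]
        by_cases h : m = -n
        · subst h
          rw [sgn_add, sgn_add, sgn_neg]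
        · rw [Lt.comp_of_ne M h]
          simp

end Words

lemma Words.concat_ext_cases {M : GBimod K Γ} {Q : Type*} [AddCommMonoid Q] [Module K Q]
    (f g : Words M v w →ₗ[K] Q) (hn : ∀ h : v = w, f (h ▸ nil M v) = g (h ▸ nil M v))
    (hp : ∀ z (y : Words M v z) (c : Lt M z w),
      f (concat M v z w y (lw c)) = g (concat M v z w y (lw c))) : f = g := by
  refine lext fun s => ?_
  induction s using ind' with
  | ha _ s t hs ht => rw [map_add, map_add, hs f g hn hp, ht f g hn hp]
  | hs _ c s hs => rw [map_smul, map_smul, hs f g hn hp]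
  | hn => exact hn rfl
  | hp v u x s ih =>
    refine ih (f.comp (pre M v u w x)) (g.comp (pre M v u w x)) (fun h => ?_) (fun z y c => ?_)
    · subst h
      have := hp v (nil M v) x
      rwa [nil_concat] at this
    · have := hp z (pre M v u z x y) c
      rwa [pre_concat] at this

namespace AugOps

variable (A : AugOps K Γ)

lemma barT_pre_cut (h0 : ∀ v, A.mTot v v (nil _ v) = 0) (x : Lt A.1 v u) (s : Words A.1 u w) :
    barT A.1 A.m v w (pre _ v u w x s) = pre _ v u w x (barT A.1 A.m u w s) +
      cut (fun z => (pre _ v z w).compl₁₂ (A.mTot v z) (eps _ z w)) (pre _ v u w x s) := by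
  have h1 : ∀ (z : Γ) (p : Wd Γ v z) (q : Wd Γ z w), barHead A.1 A.m p q =
      TensorProduct.lift (((pre _ v z w).compl₁₂ (A.mTot v z)
        (eps _ z w)).compl₁₂ (of _ p) (of _ q)) := by
    intro z p q
    refine TensorProduct.ext' fun a b => ?_
    cases p with
    | nil v =>
      have : A.mTot v v (of _ (.nil v) a) = 0 := by rw [of_nil, map_smul, h0, smul_zero]
      simp [barHead, Wd.length, this]
    | cons v n p =>
      rw [barHead_tmul]
      simp [mTot_of]
  induction x using Lt.ind with
  | ha x y hx hy =>
    simp only [map_add, ladd_apply, hx, hy]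
    abel
  | ho n x =>
    induction s using DirectSum.induction_on with
    | zero => simp
    | add s t hs ht =>
      simp only [map_add, hs, ht]
      abel
    | of p t =>
      change barT A.1 A.m v w (pre _ v u w _ (of _ p t)) =
        pre _ v u w _ (barT A.1 A.m u w (of _ p t)) + cut _ (pre _ v u w _ (of _ p t))
      rw [pre_of_of, barT_of, barB, ladd_apply, Tens.lift_cons, cut_of, barT_of, pre_of, comp_apply]
      refine congrArg (_ + ·) (lcongr_fun (f := Cuts.lift _) (g := Cuts.lift _) ?_ _)
      exact congrArg (fun G => Cuts.lift G) (funext fun z => funext fun p => funext fun q => h1 z p q)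

end AugOps

namespace AInfCoalg

variable (C : AInfCoalg K Γ)

lemma counit_ΔT (x : Lt C.toGBimod v w) : counit _ v w (cobarδ C.Δ v w x) = 0 := by
  induction x using Lt.ind with
  | ha x y hx hy => rw [map_add, map_add, hx, hy, add_zero]
  | ho n x =>
    rw [Lt.lift_of]
    have h : ∀ z : Words C.toGBimod v w, counit _ v w (lenProj _ 0 v w z) = counit _ v w z := by
      intro z
      refine lcongr_fun (f := (counit _ v w).comp (lenProj _ 0 v w))
        (g := counit _ v w) (hom_ext fun p t => ?_) z
      rw [comp_apply, lenProj_of]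
      cases p with
      | nil => rw [if_pos (by rfl)]
      | cons v n p => rw [if_neg (by simp [Wd.length]), counit_of_cons, map_zero]
    rw [← h, C.Δ_nil, map_zero]

lemma dual_mTot_nil (v : Γ) : C.dual.mTot v v (nil _ v) = 0 := by
  refine Lt.ev_injective v v (lext fun x => ?_)
  refine (CoOps.ev_dual_mTot C.Δ_mem_hom _ x).trans ?_
  rw [pairT_nil, counit_ΔT, neg_zero, map_zero, lzero_apply]

lemma pairT_barT (t : Words C.dual.1 v w) (y : Words C.toGBimod w v) :
    pairT _ v w (barT C.dual.1 C.dual.m v w t) y =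
      - pairT _ v w t (cobarT C.Δ w v (eps _ w v y)) := by
  suffices h : pairT _ v w (barT C.dual.1 C.dual.m v w t) =
      - (pairT _ v w t).comp ((cobarT C.Δ w v).comp (eps _ w v)) from lcongr_fun h y
  refine ext_ind (fun v => (pairT _ v w).comp (barT C.dual.1 C.dual.m v w))
    (fun v => - (LinearMap.lcomp K K ((cobarT C.Δ w v).comp (eps _ w v))).comp
      (pairT _ v w)) ?_ (fun v u a s ih => ?_) t
  · refine lext fun y => ?_
    have h : counit _ w w (cobarT C.Δ w w (eps _ w w y)) = 0 := by
      generalize eps _ w w y = z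
      refine lcongr_fun (f := (counit _ w w).comp (cobarT C.Δ w w)) (g := 0)
        (ext_cases _ _ (fun _ => by simp) fun u n x s => ?_) z
      simp only [comp_apply, cobarT_pre, map_add, counit_concat, counit_ΔT]
      simp
    simp [h]
  · replace ih : pairT _ u w (barT C.dual.1 C.dual.m u w s) =
      - (pairT _ u w s).comp ((cobarT C.Δ w u).comp (eps _ w u)) := ih
    change pairT _ v w (barT C.dual.1 C.dual.m v w
        (pre _ v u w a s)) = - (pairT _ v w (pre _ v u w a s)).comp
          ((cobarT C.Δ w v).comp (eps _ w v))
    refine concat_ext_cases _ _ (fun h => ?_) (fun z y c => ?_)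
    · subst h
      have h2 : counit _ w w (barT C.dual.1 C.dual.m w w (pre _ w u w a s)) = 0 := by
        rw [AugOps.barT_pre_cut _ C.dual_mTot_nil, map_add, counit_pre, map_cut, zero_add]
        refine (cut_congr (fun z s t => ?_) _).trans (cut_zero _)
        exact counit_pre _ _
      rw [pairT_apply_nil, h2]
      simp
    · have h1 : ∀ f : Words C.dual.1 v w, pairT _ v w f (concat _ w z v y (lw c)) =
            (pairT _ v w).flip (concat _ w z v y (lw c)) f := fun _ => rfl
      have e1 : ∀ (t : Words C.dual.1 u w) (y' : Words C.toGBimod w z),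
          pairT _ v w (pre _ v u w a t) (concat _ w z v y' (lw c)) =
            if h : u = z then pairT _ u w t (h ▸ y') * Lt.ev C.toGBimod v u a (h ▸ c) else 0 := by
        intro t y'
        rw [pairT_pre]
        split_ifs with h
        · subst h
          rw [mulDual_evLetter_concat]
        · rw [mulDual_evLetter_concat_ne (Ne.symm h)]
      have e2 : pairT _ v w (cut (fun z => (pre _ v z w).compl₁₂
          (C.dual.mTot v z) (eps _ z w)) (pre _ v u w a s))
          (concat _ w z v y (lw c)) = - pairT _ v w (pre _ v u w a s) (concat _ w z v (eps _ w z y)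
              (cobarδ C.Δ z v (Lt.eps _ z v c))) := by
        rw [h1, map_cut]
        have e3 := lcongr_fun (flip_pairT_concat (eps _ w z y)
          (cobarδ C.Δ z v (Lt.eps _ z v c))) (pre _ v u w a s)
        rw [flip_apply] at e3
        rw [e3, mulDual, conv, ← neg_one_smul K, ← cut_smul]
        refine cut_congr (fun x s₁ s₂ => ?_) _
        simp only [compr₂_apply, compl₁₂_apply, flip_apply, lsmul_apply, LinearMap.lsmul_apply]
        rw [pairT_pre]
        by_cases h : x = z
        · subst h
          rw [mulDual_evLetter_concat, Pi.single_eq_same, Pi.single_eq_same, pairT_eps]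
          have e4 := CoOps.ev_dual_mTot C.Δ_mem_hom s₁ c
          rw [e4]
          simp [mul_comm]
        · rw [mulDual_evLetter_concat_ne (Ne.symm h), Pi.single_eq_of_ne h]
          simp
      rw [AugOps.barT_pre_cut _ C.dual_mTot_nil, map_add, ladd_apply, e2, e1]
      simp only [lneg_apply, comp_apply, eps_concat, eps_pre, eps_nil, cobarT_concat, map_add,
        cobarT_pre, cobarT_nil, map_zero, zero_add, concat_nil, Lt.eps_eps, nil_concat]
      rw [e1, ih]
      split_ifs with h
      · subst h
        simp
      · simp

end AInfCoalg

namespace AInfCoalg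

variable (C : AInfCoalg K Γ)

/-- Elements of the augmentation ideal of the cobar construction as words. -/
def ww (v w : Γ) : Lt C.cobar.aug v w →ₗ[K] Words C.coaug v w :=
  (C.Ω v w).toLinearMap.comp (C.cobar.augIncl v w)

lemma ww_eps (y : Lt C.cobar.aug v w) :
    C.ww v w (Lt.eps _ v w y) = (-1 : K) • eps _ v w (C.ww v w y) := by
  rw [neg_one_smul, ww, comp_apply]
  refine (congrArg (C.Ω v w) (Lt.map_eps _ y)).trans (C.Ω_eps _)

lemma ww_D (y : Lt C.cobar.aug v w) : C.ww v w (C.cobar.DAug v w y) = C.DΩ v w (C.ww v w y) := by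
  rw [ww, comp_apply, AugOps.augIncl_D]
  exact C.Ω_D _

lemma ww_P (x : Lt C.cobar.aug v u) (y : Lt C.cobar.aug u w) : C.ww v w (C.cobar.PAug v u w x y) =
      concat _ v u w (C.ww v u x) (eps _ u w (C.ww u w y)) := by
  rw [ww, comp_apply, AugOps.augIncl_P]
  exact C.Ω_P _ _

lemma ww_of (n : ℤ) (y : C.cobar.aug.X n v w) :
    C.ww v w (Lt.of _ n v w y) = wIncl C.coaug 1 n v w y.1 := by
  refine (congrArg (C.Ω v w) (Lt.map_of _ n v w y)).trans (wordsEquiv_of n _)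

lemma counit_ww (y : Lt C.cobar.aug v w) : counit _ v w (C.ww v w y) = 0 := by
  induction y using Lt.ind with
  | ha x y hx hy => rw [map_add, map_add, hx, hy, add_zero]
  | ho n y => rw [ww_of]; exact y.2

/-- The map from the bar construction of the cobar construction to words in `C`. -/
def tw (v w : Γ) : Words C.cobar.aug v w →ₗ[K] Words C.toGBimod v w :=
  (counit _ v w).smulRight (lw (Lt.of _ 0 v w (C.η 0 v w))) +
    (C.kap v w).comp ((C.ww v w).comp (letterProj _ v w))

lemma tw_nil (v : Γ) : C.tw v v (nil _ v) = lw (C.etaL v) := by simp [tw]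

lemma tw_one (y : Lt C.cobar.aug v w) : C.tw v w (lw y) = C.kap v w (C.ww v w y) := by simp [tw]

lemma tw_two (x : Lt C.cobar.aug v u) (y : Lt C.cobar.aug u z) (s : Words C.cobar.aug z w) :
    C.tw v w (pre _ v u w x (pre _ u z w y s)) = 0 := by
  simp [tw]

lemma eps_tw (z : Words C.cobar.aug v w) :
    eps _ v w (C.tw v w z) = (-1 : K) • C.tw v w (eps _ v w z) := by
  refine lcongr_fun (f := (eps _ v w).comp (C.tw v w))
    (g := (-1 : K) • (C.tw v w).comp (eps _ v w)) (ext_cases _ _ (fun h => ?_) fun u n x s => ?_) z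
  · subst h
    simp [tw_nil]
  · refine lcongr_fun (f := ((eps _ v w).comp (C.tw v w)).comp (pre _ v u w
      (Lt.of _ n v u x))) (g := ((-1 : K) • (C.tw v w).comp (eps _ v w)).comp
        (pre _ v u w (Lt.of _ n v u x))) (ext_cases _ _ (fun h => ?_) fun z m y s => ?_) s
    · subst h
      have e1 := C.tw_one (Lt.of _ n v u x)
      have e2 := C.tw_one (Lt.eps _ v u (Lt.of _ n v u x))
      simp only [comp_apply, lsmul_apply, eps_pre, eps_nil, lw] at e1 e2 ⊢
      rw [e1, e2, ww_eps, map_smul, map_eps, smul_smul]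
      simp
    · simp only [comp_apply, lsmul_apply, eps_pre]
      rw [tw_two, tw_two]
      simp

lemma tw_mem_hom {n k : ℤ} (hk : n + 1 = k) {z : Words C.cobar.aug v w}
    (hz : z ∈ hom C.cobar.aug (-1) n v w) : C.tw v w z ∈ hom C.toGBimod 1 k v w := by
  subst hk
  refine hom_induction (C.tw v w) _ (fun p t hp => ?_) hz
  match p, t with
  | .nil v, t =>
    rw [of_nil, map_smul, tw_nil]
    obtain rfl : n = 0 := hp.symm
    exact Submodule.smul_mem _ _ (pre_mem_hom 0 _ _ (nil_mem_hom 1 v) (by simp))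
  | .cons v i (.nil w), t =>
    simp only [Wd.deg] at hp
    induction t using Tens.ind with
    | ha s t hs ht => rw [map_add, map_add]; exact Submodule.add_mem _ hs ht
    | hc x t =>
      rw [← pre_of_of, of_nil, map_smul, map_smul]
      refine Submodule.smul_mem _ _ ?_
      have e := C.tw_one (Lt.of _ i v w x)
      rw [lw] at e
      rw [e, ww_of]
      obtain rfl : i = n + 1 := by omega
      exact map_mem_hom _ (wIncl_mem _ _)
  | .cons v i (.cons u j p), t =>
    have : C.tw v w (of _ _ t) = 0 := by
      induction t using Tens.ind with
      | ha s t hs ht => rw [map_add, map_add, hs, ht, add_zero]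
      | hc x t =>
        induction t using Tens.ind with
        | ha s t hs ht => rw [map_add, map_add, map_add, hs, ht, add_zero]
        | hc y t => rw [← pre_of_of, ← pre_of_of, tw_two]
    rw [this]
    exact Submodule.zero_mem _

lemma cobarδ_η (v : Γ) : cobarδ C.Δ v v (C.etaL v) = pre _ v v v (C.etaL v) (lw (C.etaL v)) := by
  rw [Lt.lift_of, C.Δ_η, lw, nil, pre_of_of, pre_of_of]
  rfl

lemma cobarT_tw (z : Words C.cobar.aug v w) :
    cobarT C.Δ v w (C.tw v w z) = C.tw v w (C.cobar.bT v w z) +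
      cut (fun u => (concat _ v u w).compl₁₂ (C.tw v u) ((C.tw u w).comp (eps _ u w))) z := by
  have h3 : ∀ {v w : Γ} (p : Wd Γ v w) (n : ℤ), 3 ≤ p.length → C.cobar.mAug p n = 0 :=
    fun p n hp => C.cobar.mAug_three C.cobar_isShort.m_three p n hp
  refine lcongr_fun (f := (cobarT C.Δ v w).comp (C.tw v w))
    (g := (C.tw v w).comp (C.cobar.bT v w) + cut _) (ext_cases _ _ (fun h => ?_)
      fun u n x s => ?_) z
  · subst h
    simp [tw_nil, AugOps.bT]
    have e := C.cobarδ_η v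
    rw [Lt.lift_of] at e
    exact e
  · generalize Lt.of _ n v u x = x
    refine lcongr_fun (f := ((cobarT C.Δ v w).comp (C.tw v w)).comp (pre _ v u w x))
      (g := ((C.tw v w).comp (C.cobar.bT v w) + cut _).comp (pre _ v u w x))
        (ext_cases _ _ (fun h => ?_) fun z m y s => ?_) s
    · subst h
      have e1 := C.tw_one x
      have e2 := C.tw_one (C.cobar.DAug v u x)
      have e3 := C.tw_one (Lt.eps _ v u x)
      rw [lw] at e1 e2 e3
      simp only [comp_apply, ladd_apply, cut_pre, cut_nil, compl₁₂_apply, eps_nil, eps_pre]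
      rw [AugOps.bT, barT_pre C.cobar.mAug h3, barT_nil, barCirc, circ_nil, map_zero, zero_add,
        add_zero, eps_nil, tw_nil, tw_nil, e1, e2, e3, cobarT_kap, ww_D, ww_eps, map_smul,
        pre_concat, nil_concat, map_smul]
      abel
    · generalize Lt.of _ m u z y = y
      have e0 : ∀ (a : Γ) (t : Words C.cobar.aug z a),
          C.tw v a (pre _ v u a x (pre _ u z a y t)) = 0 := fun a t => C.tw_two x y t
      have e1 := C.tw_one x
      rw [lw] at e1
      simp only [comp_apply, ladd_apply]
      rw [cut_pre, cut_pre]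
      simp only [comp_apply, compl₁₂_apply]
      have e5 : cut (fun a => ((concat _ v a w).compl₁₂ (C.tw v a)
          ((C.tw a w).comp (eps _ a w))).comp (pre _ v u a x) ∘ₗ (pre _ u z a y)) s = 0 := by
        refine (cut_congr (fun a s t => ?_) _).trans (cut_zero _)
        simp only [comp_apply, compl₁₂_apply]
        rw [e0]
        simp
      rw [e5, tw_two, map_zero]
      simp only [eps_pre]
      rw [tw_two, map_zero, e1, zero_add, add_zero, AugOps.bT, barT_pre C.cobar.mAug h3,
        barT_pre C.cobar.mAug h3, barCirc, circ_pre]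
      simp only [map_add, ladd_apply, eps_pre, compr₂_apply, compl₂_apply]
      rw [tw_two, tw_two, tw_two, zero_add, zero_add, add_zero]
      have e2 := C.tw_one (opM C.cobar.aug C.cobar.mAug v u z x y)
      have e3 := C.tw_one (Lt.eps _ u z y)
      rw [lw] at e2 e3
      refine lcongr_fun (f := (0 : Words C.cobar.aug z w →ₗ[K] Words C.toGBimod v w))
        (g := (((C.tw v w).comp (pre _ v u w x)).comp
          (barCirc C.cobar.mAug u z w y)) + (((C.tw v w).comp (pre _ v z w
            (opM C.cobar.aug C.cobar.mAug v u z x y))).comp (eps _ z w)) +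
              (concat _ v u w (C.kap v u (C.ww v u x))).comp
                ((C.tw u w).comp ((pre _ u z w (Lt.eps _ u z y)).comp (eps _ z w))))
        (ext_cases _ _ (fun h => ?_) fun a m b s => ?_) s
      · subst h
        simp only [ladd_apply, comp_apply, eps_nil]
        rw [e2, e3, barCirc, circ_nil, ww_eps]
        have e6 := C.ww_P x y
        rw [AugOps.PAug] at e6
        rw [e6, map_concat]
        simp
      · simp only [ladd_apply, comp_apply, eps_pre]
        rw [barCirc, circ_pre]
        simp only [compr₂_apply, compl₂_apply]
        rw [tw_two, tw_two, tw_two]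
        simp

end AInfCoalg

namespace Words

variable {M N : GBimod K Γ}

lemma counit_map (f : ∀ n v w, M.X n v w →ₗ[K] N.X n v w) (s : Words M v w) :
    counit N v w (map f v w s) = counit M v w s := by
  refine lcongr_fun (f := (counit N v w).comp (map f v w)) (g := counit M v w)
    (ext_cases _ _ (fun h => ?_) fun u n x s => ?_) s
  · subst h; simp
  · simp

lemma letterProj_map (f : ∀ n v w, M.X n v w →ₗ[K] N.X n v w) (s : Words M v w) :
    letterProj N v w (map f v w s) = Lt.map f v w (letterProj M v w s) := by
  refine lcongr_fun (f := (letterProj N v w).comp (map f v w))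
    (g := (Lt.map f v w).comp (letterProj M v w)) (ext_cases _ _ (fun h => ?_) fun u n x s => ?_) s
  · subst h; simp
  · refine lcongr_fun (f := ((letterProj N v w).comp (map f v w)).comp
      (pre M v u w (Lt.of M n v u x))) (g := ((Lt.map f v w).comp (letterProj M v w)).comp
        (pre M v u w (Lt.of M n v u x))) (ext_cases _ _ (fun h => ?_) fun u n x s => ?_) s
    · subst h; simp
    · simp

lemma conv_map (f : ∀ n v w, M.X n v w →ₗ[K] N.X n v w)
    (a : ∀ u, Dual K (Words N v u)) (b : ∀ u, Dual K (Words N u w))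
    (s : Words M v w) : conv a b (map f v w s) =
      conv (fun u => (a u).comp (map f v u)) (fun u => (b u).comp (map f u w)) s := by
  induction s using ind' with
  | ha _ s t hs ht => rw [map_add, map_add, map_add, hs, ht]
  | hs _ c s hs => rw [map_smul, map_smul, map_smul, hs]
  | hn => simp
  | hp v u x s ih =>
    rw [map_pre, conv_pre, conv_pre, ih]
    simp only [comp_apply, map_nil, map_pre]
    congr 1
    refine conv_congr (fun u s t => ?_) _
    simp

lemma mulDual_map (f : ∀ n v w, M.X n v w →ₗ[K] N.X n v w)
    (a : Dual K (Words N v u)) (b : Dual K (Words N u w)) :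
    (mulDual a b).comp (map f v w) = mulDual (a.comp (map f v u)) (b.comp (map f u w)) := by
  refine lext fun s => ?_
  rw [comp_apply, mulDual, conv_map, mulDual]
  refine conv_congr (fun z s t => ?_) _
  by_cases h : z = u
  · subst h; simp
  · rw [Pi.single_eq_of_ne h, Pi.single_eq_of_ne h, Pi.single_eq_of_ne h, Pi.single_eq_of_ne h]
    rfl

lemma pairT_concat (s : Words M.dual v u) (t : Words M.dual u w) :
    pairT M v w (concat _ v u w s t) = mulDual (pairT M u w t) (pairT M v u s) := by
  refine ext_ind (fun v => (pairT M v w).comp ((concat _ v u w).flip t))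
    (fun v => (mulDualₗ w u v (pairT M u w t)).comp (pairT M v u)) ?_ (fun v x a s ih => ?_) s
  · simp
  · simp only [comp_apply, flip_apply, mulDualₗ_apply, pre_concat, pairT_pre] at ih ⊢
    rw [ih, mulDual_assoc]

lemma pairT_lw (p : Wd Γ v w) (hp : 2 ≤ p.length) (t : Tens M.dual p) (x : Lt M w v) :
    pairT M v w (of _ p t) (lw x) = 0 := by
  rw [pairT_of]
  induction x using Lt.ind with
  | ha x y hx hy => simp only [lw, map_add, ladd_apply] at hx hy ⊢; rw [hx, hy, add_zero]
  | ho n x =>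
    rw [lw, nil, pre_of_of]
    refine extendDual_of_ne (fun h => ?_) _ _
    have e := congrArg Wd.length h
    rw [Wd.rev, Wd.revAux_length] at e
    simp only [Wd.length] at e
    omega

lemma cut_right_nil {Q : Type u} [AddCommGroup Q] [Module K Q]
    (F : ∀ u, Words M v u →ₗ[K] Words M u w →ₗ[K] Q)
    (hF : ∀ u x z (a : Lt M u z) s, F u x (pre M u z w a s) = 0) (s : Words M v w) :
    cut F s = F w s (nil M w) := by
  induction s using ind' with
  | ha _ s t hs ht => rw [map_add, map_add, hs F hF, ht F hF, ladd_apply]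
  | hs _ c s hs => rw [map_smul, map_smul, hs F hF, lsmul_apply]
  | hn => rw [cut_nil]
  | hp v u x s ih =>
    rw [cut_pre, hF, zero_add, ih _ fun z y => hF z _]
    rfl

lemma cut_mulDual_comm {v w v₀ : Γ} (h : ∀ x, Words M x w →ₗ[K] Dual K (Words N w x))
    (k : ∀ x, Words M v x →ₗ[K] Dual K (Words N x v₀)) (t : Words M v w) (z : Words N w v₀) :
    cut (fun x => ((mulDualₗ w x v₀).compl₁₂ (h x) (k x)).flip.compr₂ (LinearMap.applyₗ z)) t =
      cut (fun y => (((mulDualₗ v y w).compl₁₂ (k y).flip (h y).flip).compr₂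
        (LinearMap.applyₗ t)).flip) z := by
  induction t using ind' with
  | ha _ s t hs ht =>
    rw [map_add, hs, ht, ← cut_add]
    refine cut_congr (fun y s t => ?_) _
    simp
  | hs _ c s hs =>
    rw [map_smul, hs, ← cut_smul]
    refine cut_congr (fun y s t => ?_) _
    simp
  | hn =>
    rw [cut_nil]
    change mulDual (h w (nil M w)) (k w (nil M w)) z = _
    rw [mulDual, conv]
    refine cut_congr (fun y s t => ?_) _
    change _ = mulDual ((k y).flip t) ((h y).flip s) (nil M w)
    rw [mulDual, conv_nil]
    by_cases hy : y = w
    · subst hy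
      simp [mul_comm]
    · simp [hy, Ne.symm hy]
  | hp v u a s ih =>
    rw [cut_pre]
    have e := ih (fun x => (k x).comp (pre M v u x a))
    have e1 : cut (fun x => (((mulDualₗ w x v₀).compl₁₂ (h x) (k x)).flip.compr₂
        (LinearMap.applyₗ z)).comp (pre M v u x a)) s = cut (fun x =>
          ((mulDualₗ w x v₀).compl₁₂ (h x) ((k x).comp (pre M v u x a))).flip.compr₂
            (LinearMap.applyₗ z)) s := cut_congr (fun x s t => rfl) _
    rw [e1, e]
    change mulDual (h v (pre M v u w a s)) (k v (nil M v)) z + _ = _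
    rw [mulDual, conv, ← cut_add]
    refine cut_congr (fun y z₁ z₂ => ?_) _
    change _ + mulDual (((k y).comp (pre M v u y a)).flip z₂) ((h y).flip z₁) s =
      mulDual ((k y).flip z₂) ((h y).flip z₁) (pre M v u w a s)
    have e2 : (fun x => ((Pi.single y ((k y).flip z₂) : ∀ x, Dual K (Words M v x)) x).comp
        (pre M v u x a)) = Pi.single y (((k y).comp (pre M v u y a)).flip z₂) := by
      funext x
      by_cases hx : x = y
      · subst hx
        rw [Pi.single_eq_same, Pi.single_eq_same]
        rfl
      · rw [Pi.single_eq_of_ne hx, Pi.single_eq_of_ne hx]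
        rfl
    conv_rhs => rw [mulDual, conv_pre, e2]
    rw [mulDual]
    congr 1
    by_cases hy : y = v
    · subst hy
      simp [mul_comm]
    · simp [hy, Ne.symm hy]

end Words

lemma AugOps.E_isShort (A : AugOps K Γ) (hA : A.NoHigher) : A.E.IsShort where
  deg {v w} p n hp := by
    refine lext fun t => lext fun c => ?_
    refine (CoOps.dual_m_apply A.bar p n t c).trans ?_
    rw [pairT_hom p t (by omega) (A.bar_Δ_mem_hom (-n) w v c), mul_zero]
    rfl
  m_zero {v w} p n hp := by
    match p, hp with
    | .nil v, _ =>
      refine lext fun t => lext fun c => ?_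
      refine (CoOps.dual_m_apply A.bar _ n t c).trans ?_
      rw [of_nil, map_smul, lsmul_apply, pairT_nil, ladd_apply, A.barΔ1_eq (-n) hA, A.barΔ2_eq,
        map_add, counit_pre, map_cut, cut_congr (G := fun _ => 0), cut_zero]
      · simp
      · intro u s t
        exact counit_pre _ _
  m_three := A.E_m_three hA

namespace AInfCoalg

variable (C : AInfCoalg K Γ)

/-- The `A_∞`-map `C^# → E(ΩC)`: words in the dual are paired with the values of `tw`. -/
def dualToE (p : Wd Γ v w) (n : ℤ) : Tens C.dual.1 p →ₗ[K] C.cobar.E.X n v w :=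
  (LinearMap.lcomp K K ((C.tw w v).comp (wIncl C.cobar.aug (-1) (-n) w v))).comp
    ((pairT _ v w).comp (of _ p))

lemma dualToE_apply (p : Wd Γ v w) (n : ℤ) (t : Tens C.dual.1 p)
    (x : (wordsGr C.cobar.aug (-1)).X (-n) w v) : C.dualToE p n t x =
      pairT _ v w (of _ p t) (C.tw w v (wIncl C.cobar.aug (-1) (-n) w v x)) := rfl

lemma dualToE_deg (p : Wd Γ v w) (n : ℤ) (hp : p.deg (-1) + 1 ≠ n) : C.dualToE p n = 0 := by
  refine lext fun t => lext fun x => ?_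
  rw [dualToE_apply, pairT_hom p t (n := -n + 1) (by omega) (C.tw_mem_hom rfl (wIncl_mem _ x))]
  rfl

/-- The sum of the components of the map to `E(ΩC)`. -/
def dualToETot (v w : Γ) : Words C.dual.1 v w →ₗ[K] Lt C.cobar.E.1 v w :=
  lift (fun p => (Lt.of _ (p.deg (-1) + 1) v w).comp (C.dualToE p (p.deg (-1) + 1)))

lemma evE_dualToETot (t : Words C.dual.1 v w) :
    C.cobar.evE v w (C.dualToETot v w t) = (pairT _ v w t).comp (C.tw w v) := by
  refine lcongr_fun (f := (C.cobar.evE v w).comp (C.dualToETot v w))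
    (g := (LinearMap.lcomp K K (C.tw w v)).comp (pairT _ v w))
    (hom_ext fun p t => hom_ext fun q s => ?_) t
  rw [comp_apply, dualToETot, lift_of, comp_apply, AugOps.evE_of, dualToE_apply, wIncl_wProj_of]
  change _ = pairT _ v w (of _ p t) (C.tw w v (of _ q s))
  split_ifs with h
  · rfl
  · rw [map_zero, map_zero, pairT_hom p t (n := q.deg (-1) + 1) (by omega)
      (C.tw_mem_hom rfl (of_mem_hom (-1) q s))]

lemma counit_tw (z : Words C.cobar.aug v w) : counit _ v w (C.tw v w z) = 0 := by
  rw [tw, ladd_apply, map_add, comp_apply, comp_apply, counit_map, counit_ww]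
  simp [lw]

lemma dualToETot_nil (v : Γ) : C.dualToETot v v (nil _ v) = 0 := by
  refine C.cobar.evE_injective v v ?_
  rw [evE_dualToETot, pairT_nil, map_zero]
  exact lext fun z => C.counit_tw z

lemma comp_dualToETot (n : ℤ) (s : Words C.dual.1 v w) :
    Lt.comp C.cobar.E.1 n v w (C.dualToETot v w s) = lift (fun q => C.dualToE q n) s := by
  refine lcongr_fun (f := (Lt.comp C.cobar.E.1 n v w).comp (C.dualToETot v w))
    (hom_ext fun p t => ?_) s
  rw [comp_apply, dualToETot, lift_of, lift_of, comp_apply]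
  by_cases h : p.deg (-1) + 1 = n
  · subst h
    rw [Lt.comp_of]
  · rw [Lt.comp_of_ne _ h, C.dualToE_deg p n h]
    rfl

/-- The map of bar constructions. -/
def dualToEHat (r : ℕ) (v w : Γ) : Words C.dual.1 v w →ₗ[K] Words C.cobar.E.1 v w :=
  lift (hat (M := C.dual.1) (N := C.cobar.E.1) C.dualToE r)

lemma dualToEHat_zero (t : Words C.dual.1 v w) :
    C.dualToEHat 0 v w t = counit _ v w t • unit _ v w := by
  refine lcongr_fun (f := C.dualToEHat 0 v w) (g := (counit _ v w).smulRight
    (unit _ v w)) (hom_ext fun p t => ?_) t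
  rw [dualToEHat, lift_of, smulRight_apply]
  cases p with
  | nil v => rw [hat, Tens.nilLift_apply, counit_of_nil]
  | cons v n p => rw [counit_of_cons, hat, zero_smul, lzero_apply]

lemma dualToEHat_succ (r : ℕ) (t : Words C.dual.1 v w) :
    C.dualToEHat (r + 1) v w t = cut (fun u => (pre _ v u w).compl₁₂
      (C.dualToETot v u) (C.dualToEHat r u w)) t := by
  refine lcongr_fun (f := C.dualToEHat (r + 1) v w) (g := cut _) (hom_ext fun p t => ?_) t
  rw [dualToEHat, lift_of, hat, cut_of, comp_apply]
  refine lcongr_fun (f := Cuts.lift _) (g := Cuts.lift _) (Cuts.hom_ext _ fun u q s x y => ?_) _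
  rw [Cuts.lift_of', Cuts.lift_of']
  simp only [TensorProduct.lift.tmul, compl₁₂_apply]
  cases q with
  | nil v =>
    rw [if_pos (by rfl), of_nil, map_smul, dualToETot_nil]
    simp
  | cons v n q =>
    rw [if_neg (by simp [Wd.length])]
    simp only [TensorProduct.lift.tmul, compl₁₂_apply]
    rw [dualToETot, lift_of, comp_apply, pre_of, dualToEHat, lift_of]

lemma mTot_dualToEHat_one (t : Words C.dual.1 v w) :
    C.cobar.E.mTot v w (C.dualToEHat 1 v w t) = C.cobar.E.D v w (C.dualToETot v w t) := by
  rw [dualToEHat_succ, cut_right_nil]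
  · rw [compl₁₂_apply, dualToEHat_zero, counit_nil, one_smul, unit_self', AugOps.mTot_one]
  · intro u x z a s
    rw [compl₁₂_apply, dualToEHat_zero, counit_pre, zero_smul, map_zero]

lemma dualToEHat_one (t : Words C.dual.1 v w) :
    C.dualToEHat 1 v w t = lw (C.dualToETot v w t) := by
  rw [dualToEHat_succ, cut_right_nil]
  · rw [compl₁₂_apply, dualToEHat_zero, counit_nil, one_smul, unit_self']
  · intro u x z a s
    rw [compl₁₂_apply, dualToEHat_zero, counit_pre, zero_smul, map_zero]

lemma mTot_dualToEHat_two (t : Words C.dual.1 v w) :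
    C.cobar.E.mTot v w (C.dualToEHat 2 v w t) = cut (fun u => (C.cobar.E.P v u w).compl₁₂
      (C.dualToETot v u) (C.dualToETot u w)) t := by
  rw [dualToEHat_succ, map_cut]
  refine cut_congr (fun u s t => ?_) _
  rw [compr₂_apply, compl₁₂_apply, dualToEHat_one, lw, AugOps.mTot_two]
  rfl

lemma mTot_dualToEHat_three (r : ℕ) (t : Words C.dual.1 v w) :
    C.cobar.E.mTot v w (C.dualToEHat (r + 3) v w t) = 0 := by
  rw [dualToEHat_succ, map_cut]
  refine (cut_congr (fun u s t => ?_) _).trans (cut_zero _)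
  rw [compr₂_apply, compl₁₂_apply, dualToEHat_succ]
  refine ((map_cut ((C.cobar.E.mTot v w).comp (pre _ v u w (C.dualToETot v u s))) _ _).trans
    (cut_congr (fun z s t => ?_) _)).trans (cut_zero _)
  rw [compr₂_apply, compl₁₂_apply, dualToEHat_succ]
  refine ((map_cut ((C.cobar.E.mTot v w).comp ((pre _ v u w _).comp
    (pre _ u z w (C.dualToETot u z s)))) _ _).trans
    (cut_congr (fun z s t => ?_) _)).trans (cut_zero _)
  exact (C.cobar.E_isShort C.cobar_isShort.m_three).mTot_three _ _ _ _

lemma dualToETot_barT (t : Words C.dual.1 v w) : C.dualToETot v w (barT C.dual.1 C.dual.m v w t) =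
      C.cobar.E.D v w (C.dualToETot v w t) + cut (fun u => (C.cobar.E.P v u w).compl₁₂
        (C.dualToETot v u) (C.dualToETot u w)) t := by
  refine C.cobar.evE_injective v w ?_
  rw [map_add, AugOps.evE_D C.cobar_isShort.m_three, evE_dualToETot, evE_dualToETot]
  refine lext fun z => ?_
  have h1 := cut_mulDual_comm (v₀ := v)
    (fun x => (LinearMap.lcomp K K ((C.tw w x).comp (eps _ w x))).comp (pairT _ x w))
    (fun x => (LinearMap.lcomp K K (C.tw x v)).comp (pairT _ v x)) t z
  have h2 : C.cobar.evE v w (cut (fun u => (C.cobar.E.P v u w).compl₁₂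
      (C.dualToETot v u) (C.dualToETot u w)) t) z = cut (fun x =>
        ((mulDualₗ w x v).compl₁₂ ((LinearMap.lcomp K K ((C.tw w x).comp (eps _ w x))).comp
          (pairT _ x w)) ((LinearMap.lcomp K K (C.tw x v)).comp
            (pairT _ v x))).flip.compr₂ (LinearMap.applyₗ z)) t := by
    refine (map_cut ((LinearMap.applyₗ z).comp (C.cobar.evE v w)) _ t).trans
      (cut_congr (fun x s t => ?_) _)
    have e := AugOps.evE_P C.cobar_isShort.m_three (C.dualToETot v x s) (C.dualToETot x w t)
    rw [evE_dualToETot, evE_dualToETot] at e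
    exact lcongr_fun e z
  have h3 : pairT _ v w t (cut (fun u => (concat _ w u v).compl₁₂
      (C.tw w u) ((C.tw u v).comp (eps _ u v))) (eps _ w v z)) = cut (fun y =>
        (((mulDualₗ v y w).compl₁₂ ((LinearMap.lcomp K K (C.tw y v)).comp
          (pairT _ v y)).flip ((LinearMap.lcomp K K ((C.tw w y).comp
            (eps _ w y))).comp (pairT _ y w)).flip).compr₂ (LinearMap.applyₗ t)).flip) z := by
    rw [cut_eps, map_cut]
    refine cut_congr (fun y z₁ z₂ => ?_) _
    have e := lcongr_fun (flip_pairT_concat (C.tw w y (eps _ w y z₁)) (C.tw y v z₂)) t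
    simp only [compr₂_apply, compl₁₂_apply, comp_apply, eps_eps]
    exact e
  have h4 : ∀ a b : K, -((-1 : K) • (a + b)) = a + b := fun a b => by simp
  rw [comp_apply, pairT_barT, eps_tw, map_smul, map_smul, cobarT_tw, map_add, h3, h4, ladd_apply,
    h2, h1]
  rfl

lemma dualToE_rel (p : Wd Γ v w) (t : Tens C.dual.1 p) (hp : p.length ≠ 0) :
    ∑ r ∈ Finset.range (p.length + 1), lift (fun q => C.cobar.E.m q (p.deg (-1) + 2))
        (hat (M := C.dual.1) (N := C.cobar.E.1) C.dualToE r p t) =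
      lift (fun q => C.dualToE q (p.deg (-1) + 2)) (barB C.dual.1 C.dual.m p t) := by
  have hE := C.cobar.E_isShort C.cobar_isShort.m_three
  have h1 : ∀ r, lift (fun q => C.cobar.E.m q (p.deg (-1) + 2))
      (hat (M := C.dual.1) (N := C.cobar.E.1) C.dualToE r p t) =
      Lt.comp _ (p.deg (-1) + 2) v w (C.cobar.E.mTot v w (C.dualToEHat r v w (of _ p t))) := by
    intro r
    rw [hE.comp_mTot, dualToEHat, lift_of]
  rw [Finset.sum_congr rfl fun r _ => h1 r, ← barT_of, ← comp_dualToETot, dualToETot_barT, map_add,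
    ← mTot_dualToEHat_one, ← mTot_dualToEHat_two]
  have h0 : C.dualToEHat 0 v w (of _ p t) = 0 := by
    rw [dualToEHat_zero]
    cases p with
    | nil => exact absurd rfl hp
    | cons v n p => rw [counit_of_cons, zero_smul]
  rcases p with v | ⟨v, n, p⟩
  · exact absurd rfl hp
  rcases p with w | ⟨u, m, p⟩
  ·
    have h2 : C.dualToEHat 2 v w (of _ (.cons v n (.nil w)) t) = 0 := by
      induction t using Tens.ind with
      | ha s t hs ht =>
        rw [map_add, map_add, hs (fun r => by rw [hE.comp_mTot, dualToEHat, lift_of])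
          (by rw [dualToEHat_zero, counit_of_cons, zero_smul]), ht (fun r => by rw [hE.comp_mTot,
          dualToEHat, lift_of]) (by rw [dualToEHat_zero, counit_of_cons, zero_smul]), add_zero]
      | hc x t =>
        rw [← pre_of_of, of_nil, map_smul, map_smul, dualToEHat_succ, cut_pre, cut_nil,
          compl₁₂_apply, comp_apply, compl₁₂_apply, dualToETot_nil, C.dualToEHat_one (nil _ w),
          dualToETot_nil]
        simp [lw]
    rw [h2, map_zero, map_zero, add_zero]
    change ∑ r ∈ Finset.range 2, _ = _
    rw [Finset.sum_range_succ, Finset.sum_range_one, h0, map_zero, map_zero, zero_add]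
  · change ∑ r ∈ Finset.range (p.length + 3), _ = _
    rw [Finset.sum_range_succ', Finset.sum_range_succ', Finset.sum_range_succ', Finset.sum_eq_zero,
      h0]
    · rw [map_zero, map_zero, add_zero, zero_add]
      exact add_comm _ _
    · intro r _
      rw [mTot_dualToEHat_three, map_zero]

lemma ε_sect (n : ℤ) (x : C.coaug.X n v w) : C.ε n v w (C.sect n v w x) = 0 := by
  obtain ⟨x, rfl⟩ := C.coaugProj_surjective n v w x
  rw [sect_proj, ε_redu]

/-- The unit of `C^#` as a letter. -/
abbrev epsL (v : Γ) : Lt C.dual.1 v v := Lt.of _ 0 v v (C.dual.one 0 v v)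

lemma evLetter_epsL_kap (v : Γ) : (evLetter v v (C.epsL v)).comp (C.kap v v) = 0 := by
  refine lext fun s => ?_
  rw [comp_apply, evLetter, comp_apply, letterProj_map]
  refine (Lt.ev_of 0 (C.dual.one 0 v v) _).trans ?_
  rw [Lt.comp_map]
  exact C.ε_sect _ _

lemma dualToE_eq_zero (p : Wd Γ v w) (hp : 2 ≤ p.length) (n : ℤ) (t : Tens C.dual.1 p)
    (h : (pairT _ v w (of _ p t)).comp (C.kap w v) = 0) : C.dualToE p n t = 0 := by
  refine lext fun x => ?_
  rw [dualToE_apply, tw, ladd_apply, map_add, smulRight_apply, map_smul, pairT_lw p hp, smul_zero,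
    zero_add]
  exact lcongr_fun h _

lemma dualToE_unit_zero (p : Wd Γ v u) (q : Wd Γ u w) (n : ℤ)
    (s : Tens C.dual.1 p) (t : Tens C.dual.1 q) (h : 0 < p.length + q.length) :
    C.dualToE (p.append (.cons u 0 q)) n (Tens.concat _ p (.cons u 0 q) s
      (Tens.cons _ u 0 q (C.dual.one 0 u u) t)) = 0 := by
  have hl : ∀ {v u w : Γ} (p : Wd Γ v u) (q : Wd Γ u w),
      (p.append q).length = p.length + q.length := by
    intro v u w p q
    induction p with
    | nil => simp [Wd.append, Wd.length]
    | cons v n p ih => simp only [Wd.append, Wd.length, ih]; omega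
  refine C.dualToE_eq_zero _ (by rw [hl, Wd.length]; omega) n _ ?_
  rw [← concat_of, ← pre_of_of, pairT_concat, pairT_pre, mulDual_map, mulDual_map]
  have e := C.evLetter_epsL_kap u
  rw [epsL] at e
  rw [e]
  simp only [← mulDualₗ_apply, map_zero, lzero_apply]

lemma dualToE_unit (v : Γ) : C.dualToE (.one v 0 v) 0
    (Tens.letter _ v 0 v (C.dual.one 0 v v)) = C.cobar.E.one 0 v v := by
  refine lext fun x => ?_
  have h1 : of _ (.one v 0 v) (Tens.letter _ v 0 v (C.dual.one 0 v v)) = lw (C.epsL v) := by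
    rw [lw, nil, pre_of_of]
    rfl
  rw [dualToE_apply, h1, pairT_pre, pairT_nil, counit_mulDual, tw, ladd_apply, map_add]
  have e := lcongr_fun (C.evLetter_epsL_kap v)
  simp only [comp_apply, lzero_apply] at e
  rw [comp_apply, comp_apply, e, add_zero, smulRight_apply, map_smul, evLetter, comp_apply,
    letterProj_one]
  have e2 : Lt.ev C.toGBimod v v (C.epsL v) (C.etaL v) = 1 := by
    refine (Lt.ev_of 0 (C.dual.one 0 v v) _).trans ?_
    exact (congrArg _ (Lt.comp_of _ 0 v v _)).trans (C.ε_η v)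
  rw [e2, smul_eq_mul, mul_one]
  rfl

lemma ε_dualToE (n : ℤ) (v w : Γ) (x : C.dual.X n v w) :
    C.cobar.E.ε n v w (C.dualToE (.one v n w) n (Tens.letter _ v n w x)) = C.dual.ε n v w x := by
  change C.dualToE (.one v n w) n (Tens.letter _ v n w x)
    (wProj C.cobar.aug (-1) (-n) w v (unit _ w v)) = x (C.η (-n) w v)
  by_cases h : -n = 0 ∧ w = v
  · obtain ⟨h, rfl⟩ := h
    obtain rfl : n = 0 := by omega
    have h1 : of _ (.one w 0 w) (Tens.letter _ w 0 w x) = lw (Lt.of _ 0 w w x) := by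
      rw [lw, nil, pre_of_of]
      rfl
    rw [dualToE_apply, h1, pairT_pre, pairT_nil, counit_mulDual, unit_self',
      wIncl_wProj (n := -0) (h ▸ nil_mem_hom (-1) w), tw_nil, evLetter, comp_apply, letterProj_one]
    refine (Lt.ev_of 0 x _).trans ?_
    exact congrArg _ (Lt.comp_of _ 0 w w _)
  · rw [wProj_unit _ _ _ _ _ h, C.η_zero _ _ _ h, map_zero, map_zero]

lemma ε_dualToE_zero (p : Wd Γ v w) (n : ℤ) (t : Tens C.dual.1 p)
    (hp : 2 ≤ p.length) : C.cobar.E.ε n v w (C.dualToE p n t) = 0 := by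
  change C.dualToE p n t (wProj C.cobar.aug (-1) (-n) w v (unit _ w v)) = 0
  by_cases h : -n = 0 ∧ w = v
  · obtain ⟨h, rfl⟩ := h
    obtain rfl : n = 0 := by omega
    rw [dualToE_apply, unit_self', wIncl_wProj (n := -0) (h ▸ nil_mem_hom (-1) w), tw_nil,
      pairT_lw p hp]
  · rw [wProj_unit _ _ _ _ _ h, map_zero]

end AInfCoalg

namespace AInfCoalg

variable (C : AInfCoalg K Γ)

lemma ww_injective (v w : Γ) : Function.Injective (C.ww v w) :=
  (C.Ω v w).injective.comp (C.cobar.augIncl_injective v w)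

/-- The projection of a word to the augmentation ideal of the cobar construction. -/
def wordL (v w : Γ) : Words C.coaug v w →ₗ[K] Lt C.cobar.aug v w :=
  (C.cobar_isAugDGAlg.augProj v w).comp (C.Ω v w).symm.toLinearMap

lemma epsTot_eq (a : Lt C.cobar.1 v w) : C.cobar.epsTot v w a = counit _ v w (C.Ω v w a) := by
  refine lcongr_fun (f := C.cobar.epsTot v w)
    (g := (counit _ v w).comp (C.Ω v w).toLinearMap) (Lt.hom_ext fun n x => ?_) a
  exact (Lt.lift_of _ n x).trans (congrArg (counit _ v w) (wordsEquiv_of n x)).symm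

lemma Ω_unitL (v w : Γ) : C.Ω v w (C.cobar.unitL v w) = unit _ v w := by
  refine (wordsEquiv_of 0 _).trans (wIncl_wProj ?_)
  by_cases h : v = w
  · subst h
    rw [unit_self']
    exact nil_mem_hom 1 v
  · rw [unit_ne _ h]
    exact zero_mem _

lemma ww_wordL (s : Words C.coaug v w) :
    C.ww v w (C.wordL v w s) = s + (- counit _ v w s) • unit _ v w := by
  obtain ⟨a, rfl⟩ := (C.Ω v w).surjective s
  have e : C.wordL v w (C.Ω v w a) = C.cobar_isAugDGAlg.augProj v w a :=
    congrArg (C.cobar_isAugDGAlg.augProj v w) ((C.Ω v w).symm_apply_apply a)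
  rw [e, ww, comp_apply, C.cobar_isAugDGAlg.augIncl_augProj]
  refine (map_add (C.Ω v w) _ _).trans (congrArg _ ((map_smul (C.Ω v w) _ _).trans ?_))
  rw [C.epsTot_eq, Ω_unitL]

lemma ww_wordL_of_counit {s : Words C.coaug v w} (hs : counit _ v w s = 0) :
    C.ww v w (C.wordL v w s) = s := by
  rw [ww_wordL, hs, neg_zero, zero_smul, add_zero]

lemma wordL_ww (y : Lt C.cobar.aug v w) : C.wordL v w (C.ww v w y) = y :=
  C.ww_injective v w (C.ww_wordL_of_counit (C.counit_ww y))

lemma wordL_unit (v w : Γ) : C.wordL v w (unit _ v w) = 0 := by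
  refine C.ww_injective v w ?_
  rw [ww_wordL, map_zero]
  by_cases h : v = w
  · subst h
    simp
  · simp [unit_ne _ h]

lemma counit_DΩ (s : Words C.coaug v w) : counit _ v w (C.DΩ v w s) = 0 := by
  refine lcongr_fun (f := (counit _ v w).comp (C.DΩ v w)) (g := 0) (hom_ext fun p t => ?_) s
  rw [comp_apply]
  refine (congrArg _ (lift_of _ _ p t)).trans ?_
  exact counit_cobarD C.coaug C.coaugΔ C.counit_coaugΔ p t

lemma DAug_wordL (s : Words C.coaug v w) :
    C.cobar.DAug v w (C.wordL v w s) = C.wordL v w (C.DΩ v w s) := by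
  refine C.ww_injective v w ?_
  rw [ww_D, ww_wordL, ww_wordL, counit_DΩ, map_add, map_smul]
  by_cases h : v = w
  · subst h
    simp
  · simp [unit_ne _ h]

lemma eps_wordL (s : Words C.coaug v w) :
    Lt.eps _ v w (C.wordL v w s) = (-1 : K) • C.wordL v w (eps _ v w s) := by
  refine C.ww_injective v w ?_
  rw [ww_eps, map_smul, ww_wordL, ww_wordL, counit_eps, map_add, map_smul]
  by_cases h : v = w
  · subst h
    simp
  · simp [unit_ne _ h]

lemma PAug_wordL (s : Words C.coaug v u) (y : Lt C.cobar.aug u w) :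
    C.cobar.PAug v u w (C.wordL v u s) y =
      C.wordL v w (concat _ v u w (s + (- counit _ v u s) • unit _ v u)
        (eps _ u w (C.ww u w y))) := by
  refine C.ww_injective v w ?_
  rw [ww_P, ww_wordL, ww_wordL_of_counit]
  rw [counit_concat, counit_eps, counit_ww, mul_zero]

/-- The part of the contracting homotopy that splits off the first letter of a word. -/
def splitFirst (v u w : Γ) :
    Words C.coaug v u →ₗ[K] Words C.cobar.aug u w →ₗ[K] Words C.cobar.aug v w :=
  elim (fun z => LinearMap.mk₂ K (fun c x =>
    (pre _ v z w (C.wordL v z (lw c))).comp ((pre _ z u w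
      (C.wordL z u (eps _ z u x))).comp (eps _ u w)))
    (fun c c' x => by ext; simp [lw]) (fun r c x => by ext; simp [lw])
    (fun c x x' => by ext; simp) (fun r c x => by ext; simp))

lemma splitFirst_nil : C.splitFirst v v w (nil _ v) = 0 := elim_nil _

lemma splitFirst_pre (c : Lt C.coaug v z) (x : Words C.coaug z u)
    (s : Words C.cobar.aug u w) : C.splitFirst v u w (pre _ v z u c x) s =
      pre _ v z w (C.wordL v z (lw c)) (pre _ z u w (C.wordL z u (eps _ z u x)) (eps _ u w s)) := by
  rw [splitFirst, elim_pre]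
  rfl

/-- The contracting homotopy. -/
def hSplit (v w : Γ) : Words C.cobar.aug v w →ₗ[K] Words C.cobar.aug v w :=
  elim (fun u => (C.splitFirst v u w).comp (C.ww v u))

lemma hSplit_nil (v : Γ) : C.hSplit v v (nil _ v) = 0 := elim_nil _

lemma hSplit_pre (y : Lt C.cobar.aug v u) (s : Words C.cobar.aug u w) :
    C.hSplit v w (pre _ v u w y s) = C.splitFirst v u w (C.ww v u y) s := elim_pre _ _ _

end AInfCoalg

lemma Words.letterProj_pre {M : GBimod K Γ} (y : Lt M v u) (s : Words M u u) :
    letterProj M v u (pre M v u u y s) = counit M u u s • y := by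
  refine lcongr_fun (f := (letterProj M v u).comp (pre M v u u y))
    (g := (counit M u u).smulRight y) (ext_cases _ _ (fun h => ?_) fun z n x s => ?_) s
  · simp only [comp_apply, smulRight_apply]
    rw [counit_nil, one_smul]
    exact letterProj_one y
  · simp only [comp_apply, smulRight_apply]
    rw [letterProj_two, counit_pre, zero_smul]

lemma Words.letterProj_pre_ne {M : GBimod K Γ} (h : u ≠ w) (y : Lt M v u)
    (s : Words M u w) : letterProj M v w (pre M v u w y s) = 0 := by
  refine lcongr_fun (f := (letterProj M v w).comp (pre M v u w y))
    (g := 0) (ext_cases _ _ (fun h' => absurd h' h) fun z n x s => ?_) s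
  simp only [comp_apply, lzero_apply]
  rw [letterProj_two]

namespace AInfCoalg

variable (C : AInfCoalg K Γ)

/-- The part of a word that survives the contracting homotopy. -/
def twoLetter (v w : Γ) : Words C.cobar.aug v w →ₗ[K] Lt C.coaug v w :=
  (letterProj _ v w).comp ((C.ww v w).comp (letterProj _ v w))

lemma ww_wordL_pre (c : Lt C.coaug v z) (x : Words C.coaug z u) :
    C.ww v u (C.wordL v u (pre _ v z u c x)) = pre _ v z u c x :=
  C.ww_wordL_of_counit (counit_pre _ _)

lemma bT_pre (y : Lt C.cobar.aug v u) (s : Words C.cobar.aug u w) :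
    C.cobar.bT v w (pre _ v u w y s) = pre _ v u w y (C.cobar.bT u w s) +
      pre _ v u w (C.cobar.DAug v u y) (eps _ u w s) + barCirc C.cobar.mAug v u w y s :=
  barT_pre C.cobar.mAug (fun p n hp => C.cobar.mAug_three C.cobar_isShort.m_three p n hp) y s

lemma eps_bT (s : Words C.cobar.aug v w) :
    eps _ v w (C.cobar.bT v w s) = - C.cobar.bT v w (eps _ v w s) :=
  eps_barT C.cobar.mAug (fun p n hp => C.cobar.mAug_three C.cobar_isShort.m_three p n hp)
    (AugOps.isDGOps_aug C.cobar_isDGOps) s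

lemma PAug_wordL_wordL (c : Lt C.coaug v z) (x : Words C.coaug z u) :
    C.cobar.PAug v z u (C.wordL v z (lw c)) (C.wordL z u (eps _ z u x)) =
      C.wordL v u (pre _ v z u c x) +
        (-counit _ z u x) • C.wordL v u (pre _ v z u c (unit _ z u)) := by
  have e : eps _ z u (unit C.coaug z u) = unit C.coaug z u := by
    by_cases h : z = u
    · subst h
      simp
    · simp [unit_ne _ h]
  rw [PAug_wordL, ww_wordL, lw, counit_pre, neg_zero, zero_smul, add_zero, map_add,
    map_smul, eps_eps, counit_eps, e, pre_concat, nil_concat, map_add,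
    map_smul, map_add, map_smul]

lemma circ_hSplit (c : Lt C.coaug v z) (x : Words C.coaug z u) (s : Words C.cobar.aug u w) :
    pre _ v z w (C.wordL v z (lw c)) (barCirc C.cobar.mAug z u w
        (C.wordL z u (eps _ z u x)) (eps _ u w s)) +
      C.hSplit v w (barCirc C.cobar.mAug v u w (C.wordL v u (pre _ v z u c x)) s) +
        pre _ v u w ((-counit _ z u x) • C.wordL v u (pre _ v z u c (unit _ z u))) s =
    (-1 : K) • lw (C.wordL v w (lw (C.twoLetter v w
      (pre _ v u w (C.wordL v u (pre _ v z u c x)) s)))) := by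
  have hz : z ≠ u → counit _ z u x = 0 := fun h => by rw [counit_ne h, lzero_apply]
  refine lcongr_fun (f := (pre _ v z w (C.wordL v z (lw c))).comp
      ((barCirc C.cobar.mAug z u w (C.wordL z u (eps _ z u x))).comp (eps _ u w)) +
      (C.hSplit v w).comp (barCirc C.cobar.mAug v u w (C.wordL v u (pre _ v z u c x))) +
        pre _ v u w ((-counit _ z u x) • C.wordL v u (pre _ v z u c (unit _ z u))))
    (g := (-1 : K) • ((pre _ v w w).flip (nil _ w)).comp ((C.wordL v w).comp
      (((pre _ v w w).flip (nil _ w)).comp ((C.twoLetter v w).comp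
      (pre _ v u w (C.wordL v u (pre _ v z u c x)))))))
    (ext_cases _ _ (fun h => ?_) fun z' n y s => ?_) s
  · subst h
    have e := letterProj_one (C.wordL v u (pre _ v z u c x))
    simp only [ladd_apply, comp_apply, lsmul_apply, eps_nil, flip_apply, barCirc, circ_nil,
      map_zero, zero_add, twoLetter]
    rw [e, ww_wordL_pre]
    by_cases h : z = u
    · subst h
      rw [letterProj_pre, unit_self']
      simp
    · rw [letterProj_pre_ne h, hz h]
      simp
  · generalize Lt.of _ n u z' y = y
    simp only [ladd_apply, comp_apply, lsmul_apply, eps_pre, flip_apply, twoLetter]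
    rw [letterProj_two, map_zero, map_zero, map_zero]
    simp only [lzero_apply, map_zero, smul_zero]
    rw [barCirc, barCirc, circ_pre, circ_pre]
    simp only [compr₂_apply, compl₂_apply]
    have e1 := C.ww_P (C.wordL v u (pre _ v z u c x)) y
    have e2 := C.PAug_wordL (eps _ z u x) (Lt.eps _ u z' y)
    rw [AugOps.PAug] at e1 e2
    rw [hSplit_pre, e1, e2, ww_wordL_pre, pre_concat, splitFirst_pre, eps_eps, ww_eps, map_smul,
      eps_eps, eps_concat, eps_eps, counit_eps]
    by_cases h : z = u
    · subst h
      rw [unit_self']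
      simp only [map_add, map_smul, ladd_apply, lsmul_apply, nil_concat, wordL_ww, lw]
      module
    · rw [hz h, neg_zero, zero_smul, zero_smul, add_zero]
      simp only [map_add, map_smul, ladd_apply, lsmul_apply, map_zero, lzero_apply]
      module

lemma bT_hSplit (c : Lt C.coaug v z) (x : Words C.coaug z u) (s : Words C.cobar.aug u w) :
    C.cobar.bT v w (C.hSplit v w (pre _ v u w (C.wordL v u (pre _ v z u c x)) s)) +
      C.hSplit v w (C.cobar.bT v w (pre _ v u w (C.wordL v u (pre _ v z u c x)) s)) =
    pre _ v u w (C.wordL v u (pre _ v z u c x)) s + (-1 : K) • lw (C.wordL v w (lw (C.twoLetter v w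
      (pre _ v u w (C.wordL v u (pre _ v z u c x)) s)))) +
    ((-1 : K) • pre _ v z w (C.wordL v z (cobarδ C.coaugΔ v z c)) (pre _ z u w (C.wordL z u x) s) +
      C.splitFirst v u w (concat _ v z u (cobarδ C.coaugΔ v z c) (eps _ z u x)) (eps _ u w s)) := by
  rw [← circ_hSplit]
  rw [bT_pre C (C.wordL v u _) s, hSplit_pre, ww_wordL_pre, splitFirst_pre, map_add (C.hSplit v w),
    map_add (C.hSplit v w), hSplit_pre, hSplit_pre, ww_wordL_pre, splitFirst_pre, ww_D,
    ww_wordL_pre, cobarT_pre, map_add (C.splitFirst v u w), ladd_apply, splitFirst_pre, eps_eps,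
    bT_pre, bT_pre, eps_bT, eps_DΩ, eps_pre, eps_eps, DAug_wordL, DAug_wordL, eps_wordL, eps_eps,
    barCirc, barCirc, circ_pre]
  simp only [compr₂_apply, compl₂_apply]
  have e := C.PAug_wordL_wordL c x
  rw [AugOps.PAug] at e
  have e2 : C.DΩ v z (lw c) = cobarδ C.coaugΔ v z c := by
    rw [lw, cobarT_pre, cobarT_nil, map_zero, zero_add, eps_nil, concat_nil]
  rw [e, e2, eps_eps]
  simp only [map_add, map_smul, map_neg, ladd_apply, lsmul_apply, lneg_apply]
  module

end AInfCoalg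

lemma Words.letterProj_concat {M : GBimod K Γ} {s : Words M v u} {t : Words M u w}
    (hs : counit _ v u s = 0) (ht : counit _ u w t = 0) :
    letterProj _ v w (concat _ v u w s t) = 0 := by
  have h : letterProj _ v w (concat _ v u w (s + (-counit _ v u s) • unit _ v u) t) = 0 := by
    clear hs
    generalize s = s
    refine lcongr_fun (f := ((letterProj _ v w).comp ((concat _ v u w).flip t)).comp
      (LinearMap.id + (-counit _ v u).smulRight (unit _ v u))) (g := 0)
      (ext_cases _ _ (fun e => ?_) fun z n x s => ?_) s
    · cases e
      simp
    · simp only [comp_apply, ladd_apply, smulRight_apply, lneg_apply, id_apply, flip_apply,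
        lzero_apply]
      rw [counit_pre, neg_zero, zero_smul, add_zero, pre_concat]
      by_cases h : z = w
      · subst h
        rw [letterProj_pre, counit_concat, ht, mul_zero, zero_smul]
      · exact letterProj_pre_ne h _ _
  rwa [hs, neg_zero, zero_smul, add_zero] at h

namespace AInfCoalg

variable (C : AInfCoalg K Γ)

lemma tw_hSplit (z : Words C.cobar.aug v w) : C.tw v w (C.hSplit v w z) = 0 := by
  have h1 : ∀ {v u : Γ} (x : Words C.coaug v u) (s : Words C.cobar.aug u w),
      C.tw v w (C.splitFirst v u w x s) = 0 := fun {v u} x s => by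
    refine lcongr_fun (f := (C.tw v w).comp ((C.splitFirst v u w).flip s)) (g := 0)
      (ext_cases _ _ (fun h => ?_) fun u' n c x => ?_) x
    · subst h
      simp only [comp_apply, flip_apply]
      rw [splitFirst_nil]
      simp
    · simp only [comp_apply, flip_apply]
      rw [splitFirst_pre, tw_two, lzero_apply]
  refine lcongr_fun (f := (C.tw v w).comp (C.hSplit v w)) (g := 0)
    (ext_cases _ _ (fun h => ?_) fun u' n c x => ?_) z
  · subst h
    simp only [comp_apply]
    rw [hSplit_nil, map_zero, lzero_apply]
  · simp only [comp_apply]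
    rw [hSplit_pre, h1, lzero_apply]

lemma letterProj_tw (z : Words C.cobar.aug v w) : letterProj _ v w (C.tw v w z) =
      counit _ v w z • Lt.of C.toGBimod 0 v w (C.η 0 v w) +
        Lt.map C.sect v w (C.twoLetter v w z) := by
  rw [tw, ladd_apply, smulRight_apply, map_add, map_smul]
  refine congrArg₂ (· + ·) (congrArg _ (letterProj_one _)) ?_
  exact letterProj_map _ _

lemma of_letterProj_tw {z : Words C.cobar.aug v w} (hz : letterProj _ v w (C.tw v w z) = 0) :
    C.twoLetter v w z = 0 ∧ counit _ v w z • unit C.cobar.aug v w = 0 := by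
  rw [letterProj_tw] at hz
  have h1 : C.twoLetter v w z = 0 := by
    have := congrArg (Lt.map C.coaugProj v w) hz
    rw [map_add, map_smul, Lt.map_of, coaugProj_η, map_zero, map_zero, smul_zero, zero_add] at this
    rw [← this]
    generalize C.twoLetter v w z = y
    induction y using Lt.ind with
    | ha x y hx hy => rw [map_add, map_add, ← hx, ← hy]
    | ho n y =>
      obtain ⟨y, rfl⟩ := C.coaugProj_surjective n v w y
      rw [Lt.map_of, Lt.map_of, sect_proj, redu_apply, map_sub, map_smul, coaugProj_η, smul_zero,
        sub_zero]
  refine ⟨h1, ?_⟩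
  rw [h1, map_zero, add_zero] at hz
  by_cases h : v = w
  · subst h
    have := congrArg (Lt.lift (fun n => C.ε n v v)) hz
    rw [map_smul, Lt.lift_of, C.ε_η, map_zero, smul_eq_mul, mul_one] at this
    rw [this, zero_smul]
  · rw [unit_ne _ h, smul_zero]

/-- The words whose first letter begins with an element of degree at least `-1 - k`. -/
def firstGe (k : ℕ) (v w : Γ) : Submodule K (Words C.cobar.aug v w) :=
  Submodule.span K ({unit _ v w} ∪ {z | ∃ (i : ℤ) (a u : Γ) (c : C.coaug.X i v a)
    (x : Words C.coaug a u) (s : Words C.cobar.aug u w), -1 - (k : ℤ) ≤ i ∧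
      z = pre _ v u w (C.wordL v u (pre _ v a u (Lt.of _ i v a c) x)) s})

variable {C}

lemma unit_mem_firstGe (k : ℕ) (v w : Γ) : unit _ v w ∈ C.firstGe k v w :=
  Submodule.subset_span (Or.inl rfl)

lemma pre_mem_firstGe {k : ℕ} {i : ℤ} {v a u w : Γ} (c : C.coaug.X i v a)
    (x : Words C.coaug a u) (s : Words C.cobar.aug u w) (hi : -1 - (k : ℤ) ≤ i) :
    pre _ v u w (C.wordL v u (pre _ v a u (Lt.of _ i v a c) x)) s ∈ C.firstGe k v w :=
  Submodule.subset_span (Or.inr ⟨i, a, u, c, x, s, hi, rfl⟩)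

lemma firstGe_mono {k l : ℕ} (h : k ≤ l) (v w : Γ) : C.firstGe k v w ≤ C.firstGe l v w := by
  refine Submodule.span_mono (Set.union_subset_union_right _ ?_)
  rintro z ⟨i, a, u, c, x, s, hi, rfl⟩
  exact ⟨i, a, u, c, x, s, by omega, rfl⟩

lemma exists_mem_firstGe (z : Words C.cobar.aug v w) : ∃ k, z ∈ C.firstGe k v w := by
  have h1 : ∀ {v u : Γ} (x : Words C.coaug v u) (s : Words C.cobar.aug u w),
      ∃ k, pre _ v u w (C.wordL v u x) s ∈ C.firstGe k v w := fun {v u} x s => by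
    induction x using ind with
    | ha _ x y hx hy =>
      obtain ⟨k, hk⟩ := hx
      obtain ⟨l, hl⟩ := hy
      refine ⟨max k l, ?_⟩
      rw [map_add, map_add, ladd_apply]
      exact Submodule.add_mem _ (firstGe_mono (le_max_left _ _) _ _ hk)
        (firstGe_mono (le_max_right _ _) _ _ hl)
    | hs _ r x hx =>
      obtain ⟨k, hk⟩ := hx
      refine ⟨k, ?_⟩
      rw [map_smul, map_smul, lsmul_apply]
      exact Submodule.smul_mem _ _ hk
    | hn =>
      refine ⟨0, ?_⟩
      rw [← unit_self', wordL_unit]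
      simp
    | hp v z n c x ih => exact ⟨(-1 - n).toNat, pre_mem_firstGe c x s (by omega)⟩
  induction z using ind with
  | ha _ x y hx hy =>
    obtain ⟨k, hk⟩ := hx
    obtain ⟨l, hl⟩ := hy
    exact ⟨max k l, Submodule.add_mem _ (firstGe_mono (le_max_left _ _) _ _ hk)
        (firstGe_mono (le_max_right _ _) _ _ hl)⟩
  | hs _ r x hx =>
    obtain ⟨k, hk⟩ := hx
    exact ⟨k, Submodule.smul_mem _ _ hk⟩
  | hn => exact ⟨0, by rw [← unit_self']; exact unit_mem_firstGe 0 _ _⟩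
  | hp v u n y s ih =>
    obtain ⟨k, hk⟩ := h1 (C.ww v u (Lt.of _ n v u y)) s
    rw [wordL_ww] at hk
    exact ⟨k, hk⟩

lemma bT_bT (z : Words C.cobar.aug v w) : C.cobar.bT v w (C.cobar.bT v w z) = 0 :=
  barT_barT C.cobar.mAug (fun p n hp => C.cobar.mAug_three C.cobar_isShort.m_three p n hp)
    (AugOps.isDGOps_aug C.cobar_isDGOps) z

lemma letterProj_cobarT (s : Words C.toGBimod v w) : letterProj _ v w (cobarT C.Δ v w s) =
      letterProj _ v w (cobarδ C.Δ v w (letterProj _ v w s)) := by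
  have h0 : ∀ {v w : Γ} (s : Words C.toGBimod v w), counit _ v w (cobarT C.Δ v w s) = 0 :=
    fun {v w} s => by
      refine lcongr_fun (f := (counit _ v w).comp (cobarT C.Δ v w)) (g := 0)
        (ext_cases _ _ (fun h => ?_) fun u n x s => ?_) s
      · subst h
        simp
      · simp only [comp_apply, cobarT_pre, map_add, counit_concat, counit_ΔT]
        simp
  refine lcongr_fun (f := (letterProj _ v w).comp (cobarT C.Δ v w))
    (g := (letterProj _ v w).comp ((cobarδ C.Δ v w).comp (letterProj _ v w)))
    (ext_cases _ _ (fun h => ?_) fun u n x s => ?_) s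
  · subst h
    simp
  · generalize Lt.of _ n v u x = x
    simp only [comp_apply]
    rw [cobarT_pre, map_add]
    have e1 : letterProj _ v w (pre _ v u w x (cobarT C.Δ u w s)) = 0 := by
      by_cases h : u = w
      · subst h
        rw [letterProj_pre, h0, zero_smul]
      · exact letterProj_pre_ne h _ _
    rw [e1, zero_add]
    refine lcongr_fun (f := (letterProj _ v w).comp ((concat _ v u w
      (cobarδ C.Δ v u x)).comp (eps _ u w)))
      (g := (letterProj _ v w).comp ((cobarδ C.Δ v w).comp ((letterProj _ v w).comp
        (pre _ v u w x)))) (ext_cases _ _ (fun h => ?_) fun z m y s => ?_) s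
    · subst h
      simp only [comp_apply, eps_nil, concat_nil]
      rw [letterProj_pre, counit_nil, one_smul]
    · simp only [comp_apply, letterProj_two, map_zero]
      exact letterProj_concat (C.counit_ΔT x) (by rw [counit_eps, counit_pre])

lemma letterProj_tw_bT (z : Words C.cobar.aug v w) :
    letterProj _ v w (C.tw v w (C.cobar.bT v w z)) =
      letterProj _ v w (cobarδ C.Δ v w (letterProj _ v w (C.tw v w z))) := by
  rw [← letterProj_cobarT, cobarT_tw, map_add, map_cut,
    (cut_congr (fun u s t => ?_) z).trans (cut_zero z), add_zero]
  exact letterProj_concat (C.counit_tw s) (C.counit_tw _)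

variable (hconn : C.toGBimod.IsConnected C.η) (hsc : ∀ v w, Subsingleton (C.X (-1) v w))

include hconn hsc

lemma eq_of_mem_firstGe_zero {z : Words C.cobar.aug v w} (hz : z ∈ C.firstGe 0 v w) :
    z = counit _ v w z • unit _ v w := by
  refine Submodule.span_induction (p := fun z _ => z = counit _ v w z • unit _ v w)
    ?_ (by simp) (fun x y _ _ hx hy => by rw [map_add, add_smul, ← hx, ← hy])
    (fun r x _ hx => by rw [map_smul, smul_assoc, ← hx]) hz
  rintro z (rfl | ⟨i, a, u, c, x, s, hi, rfl⟩)
  · by_cases h : v = w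
    · subst h
      simp
    · simp [unit_ne _ h]
  · have := C.coaug_subsingleton hconn hsc i v a (by push_cast at hi; omega)
    rw [Subsingleton.elim c 0]
    simp

lemma coaugΔ_mem_of_pre {Q : Type*} [AddCommGroup Q] [Module K Q] {v a : Γ}
    (f : Words C.coaug v a →ₗ[K] Q) (S : Submodule K Q) {i : ℤ} (c : C.coaug.X i v a)
    (h : ∀ (n : ℤ) (u : Γ) (c' : C.coaug.X n v u) (x : Words C.coaug u a), i + 1 ≤ n →
      f (pre _ v u a (Lt.of _ n v u c') x) ∈ S) : f (C.coaugΔ i v a c) ∈ S := by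
  have e : f (C.coaugΔ i v a c) = (f ∘ₗ (LinearMap.id - (counit _ v a).smulRight
      (unit _ v a))) (C.coaugΔ i v a c) := by
    rw [comp_apply, lsub_apply, smulRight_apply, counit_coaugΔ, zero_smul, sub_zero, id_apply]
  rw [e]
  refine hom_induction _ S (fun p t hp => ?_) (C.coaugΔ_mem_hom i v a c)
  cases p with
  | nil v =>
    rw [of_nil, map_smul]
    simp
  | cons v n p =>
    induction t using Tens.ind with
    | ha s t hs ht => rw [map_add, map_add]; exact Submodule.add_mem _ hs ht
    | hc c' t =>
      rw [← pre_of_of]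
      simp only [comp_apply, lsub_apply, smulRight_apply, id_apply]
      rw [counit_pre, zero_smul, sub_zero]
      rcases C.coaug_tens hconn hsc p with hs | hs
      · rw [Subsingleton.elim t 0]
        simp
      · refine h n _ c' _ ?_
        simp only [Wd.deg] at hp
        omega

lemma bT_hSplit_mem {k : ℕ} {z : Words C.cobar.aug v w}
    (hz : z ∈ C.firstGe (k + 1) v w) (hg : C.twoLetter v w z = 0) (hD : C.cobar.bT v w z = 0) :
    z - C.cobar.bT v w (C.hSplit v w z) ∈ C.firstGe k v w := by
  have h : z - C.cobar.bT v w (C.hSplit v w z) - C.hSplit v w (C.cobar.bT v w z) -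
      lw (C.wordL v w (lw (C.twoLetter v w z))) ∈ C.firstGe k v w := by
    clear hg hD
    refine Submodule.span_induction (p := fun z _ => z - C.cobar.bT v w (C.hSplit v w z) -
      C.hSplit v w (C.cobar.bT v w z) - lw (C.wordL v w (lw (C.twoLetter v w z))) ∈
        C.firstGe k v w) ?_ (by simp [lw]) (fun x y _ _ hx hy => ?_) (fun r x _ hx => ?_) hz
    · rintro z (rfl | ⟨i, a, u, c, x, s, hi, rfl⟩)
      · by_cases h : v = w
        · subst h
          rw [unit_self', hSplit_nil, twoLetter, comp_apply, comp_apply, letterProj_nil, AugOps.bT,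
            barT_nil]
          simp only [map_zero, lw, lzero_apply, sub_zero]
          rw [← unit_self']
          exact unit_mem_firstGe k v v
        · simp [unit_ne _ h, lw]
      · have e := C.bT_hSplit (Lt.of _ i v a c) x s
        rw [sub_sub _ _ (C.hSplit v w _), e]
        have e1 : cobarδ C.coaugΔ v a (Lt.of _ i v a c) = C.coaugΔ i v a c := Lt.lift_of _ i c
        rw [e1]
        have h1 := coaugΔ_mem_of_pre hconn hsc (((pre _ v a w).flip
          (pre _ a u w (C.wordL a u x) s)).comp (C.wordL v a)) (C.firstGe k v w) c
          (fun n u c' x _ => pre_mem_firstGe c' x _ (by push_cast at hi; omega))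
        have h2 := coaugΔ_mem_of_pre hconn hsc (((C.splitFirst v u w).flip (eps _ u w s)).comp
          ((concat _ v a u).flip (eps _ a u x))) (C.firstGe k v w) c (fun n u c' x _ => by
            simp only [comp_apply, flip_apply]
            rw [pre_concat, splitFirst_pre]
            exact pre_mem_firstGe c' _ _ (by push_cast at hi; omega))
        simp only [comp_apply, flip_apply] at h1 h2
        refine (congrArg (· ∈ C.firstGe k v w) ?_).mp (sub_mem h1 h2)
        module
    · refine (congrArg (· ∈ C.firstGe k v w) ?_).mp (add_mem hx hy)
      simp only [map_add, lw, ladd_apply]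
      abel
    · refine (congrArg (· ∈ C.firstGe k v w) ?_).mp (Submodule.smul_mem _ r hx)
      simp only [map_smul, lw, lsmul_apply, smul_sub]
  rw [hg, hD] at h
  simpa [lw] using h

lemma tw_acyclic (x : Words C.cobar.aug v w)
    (hx : letterProj _ v w (C.tw v w x) = 0) (hdx : C.cobar.bT v w x = 0) :
    ∃ y, letterProj _ v w (C.tw v w y) = 0 ∧ C.cobar.bT v w y = x := by
  obtain ⟨y, hy, hyx⟩ := exists_primitive (C.cobar.bT v w) bT_bT
    (LinearMap.ker ((letterProj _ v w).comp (C.tw v w))) (fun x hx => by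
      rw [mem_ker, comp_apply] at hx ⊢
      rw [letterProj_tw_bT, hx, map_zero, map_zero]) (fun k => C.firstGe k v w)
    (fun x hx hx0 => by rw [eq_of_mem_firstGe_zero hconn hsc hx0, (C.of_letterProj_tw hx).2])
    (fun k x hx hxk hdx => ⟨C.hSplit v w x, by
      rw [mem_ker, comp_apply, tw_hSplit, map_zero],
      bT_hSplit_mem hconn hsc hxk (C.of_letterProj_tw hx).1 hdx⟩)
    (fun x _ => exists_mem_firstGe x) x hx hdx
  exact ⟨y, hy, hyx⟩

end AInfCoalg

lemma Words.pairT_one {M : GBimod K Γ} (a : Lt M.dual v w) :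
    pairT M v w (lw a) = evLetter v w a := by
  rw [lw, pairT_pre, pairT_nil, counit_mulDual]

/-- The part of an operation on a single letter with values in single letters. -/
def CoOps.δ (Q : CoOps K Γ) (i j : ℤ) (v w : Γ) : Q.X i v w →ₗ[K] Q.X j v w :=
  (Lt.comp Q.1 j v w).comp ((letterProj Q.1 v w).comp (Q.Δ i v w))

lemma CoOps.dual_d (Q : CoOps K Γ) : Q.dual.d = dualD Q.δ := by
  funext i j v w
  refine lext fun f => lext fun x => ?_
  rw [dualD_apply]
  refine (CoOps.dual_m_apply Q (.one v i w) j _ x).trans ?_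
  have e := pairT_one (Lt.of Q.dual.1 i v w f)
  rw [lw, nil, pre_of_of] at e
  refine (congrArg (fun g => sgn K j * g (Q.Δ (-j) w v x)) e).trans ?_
  exact congrArg (sgn K j * ·) (Lt.ev_of i f _)

namespace AugOps

variable (A : AugOps K Γ)

lemma bar_δ (hA : A.NoHigher) (i j : ℤ) (v w : Γ) :
    A.bar.δ i j v w = (wProj A.aug (-1) j v w).comp ((A.bT v w).comp (wIncl A.aug (-1) i v w)) := by
  refine lext fun c => ?_
  have e1 : letterProj _ v w (A.barΔ1 i v w c) =
      (wordsEquiv A.aug (-1) v w).symm (A.bT v w (wIncl A.aug (-1) i v w c)) := by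
    rw [barΔ1_eq A i hA]
    exact letterProj_one _
  have e2 : letterProj _ v w (A.barΔ2 i v w c) = 0 := by
    rw [barΔ2_eq]
    refine (map_cut _ _ _).trans ?_
    refine (cut_congr (fun u s t => ?_) _).trans (cut_zero _)
    exact letterProj_two _ _ _
  have e3 : ∀ s, Lt.comp A.bar.1 j v w ((wordsEquiv A.aug (-1) v w).symm s) =
      wProj A.aug (-1) j v w s := fun s => by
    obtain ⟨s, rfl⟩ := (wordsEquiv A.aug (-1) v w).surjective s
    rw [LinearEquiv.symm_apply_apply]
    induction s using Lt.ind with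
    | ha x y hx hy => rw [map_add, map_add, map_add, hx, hy]
    | ho n x =>
      rw [wordsEquiv_of]
      by_cases h : n = j
      · subst h
        rw [wProj_wIncl]
        exact Lt.comp_of _ _ _ _ _
      · rw [wProj_ne (wIncl_mem n x) h]
        exact Lt.comp_of_ne _ h _ _ _
  refine (congrArg (Lt.comp A.bar.1 j v w) ((map_add (letterProj _ v w)
    _ _).trans (congrArg₂ (· + ·) e1 e2))).trans ?_
  rw [add_zero]
  exact e3 _

end AugOps

namespace AInfCoalg

variable (C : AInfCoalg K Γ)

/-- The components of the map from the bar construction of the cobar construction to `C`. -/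
def twComp (n : ℤ) (v w : Γ) : Words C.cobar.aug v w →ₗ[K] C.X n v w :=
  (Lt.comp C.toGBimod n v w).comp ((letterProj _ v w).comp (C.tw v w))

lemma dualToE_one (n : ℤ) (v w : Γ) :
    (C.dualToE (.one v n w) n).comp (Tens.letter C.dual.1 v n w) =
      Module.Dual.transpose (R := K) ((C.twComp (-n) w v).comp (wIncl C.cobar.aug (-1) (-n) w v)) := by
  refine lext fun f => lext fun x => ?_
  refine (C.dualToE_apply _ _ _ x).trans ?_
  have e := pairT_one (Lt.of _ n v w f)
  rw [lw, nil, pre_of_of] at e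
  refine (congrArg (fun g => g (C.tw w v (wIncl C.cobar.aug (-1) (-n) w v x))) e).trans ?_
  exact Lt.ev_of n f _

lemma twComp_surjective (n : ℤ) (v w : Γ) : Function.Surjective (C.twComp n v w) := by
  intro c
  have h0 : ∀ z, C.twComp n v w z = counit _ v w z •
      Lt.comp C.toGBimod n v w (Lt.of _ 0 v w (C.η 0 v w)) +
        C.sect n v w (Lt.comp C.coaug n v w (C.twoLetter v w z)) := fun z => by
    rw [twComp, comp_apply, comp_apply, letterProj_tw, map_add, map_smul, Lt.comp_map]
  have h1 : C.twComp n v w (lw (C.wordL v w (lw (Lt.of _ n v w (C.coaugProj n v w c))))) =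
      C.redu n v w c := by
    rw [h0, twoLetter, comp_apply, comp_apply]
    have e1 := letterProj_one (C.wordL v w (lw (Lt.of _ n v w (C.coaugProj n v w c))))
    rw [e1, lw, lw, ww_wordL_pre, counit_pre, zero_smul, zero_add]
    have e2 := letterProj_one (Lt.of _ n v w (C.coaugProj n v w c))
    rw [e2, Lt.comp_of, sect_proj]
  by_cases h : n = 0 ∧ v = w
  · obtain ⟨rfl, rfl⟩ := h
    refine ⟨lw (C.wordL v v (lw (Lt.of _ 0 v v (C.coaugProj 0 v v c)))) + C.ε 0 v v c • nil _ v, ?_⟩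
    rw [map_add, map_smul, h1, h0, counit_nil, one_smul, Lt.comp_of, twoLetter, comp_apply,
      comp_apply, letterProj_nil, map_zero, map_zero, map_zero, map_zero, add_zero, redu_apply,
      sub_add_cancel]
  · exact ⟨_, h1.trans (by rw [redu_apply, C.ε_zero n v w h, lzero_apply, zero_smul, sub_zero])⟩

lemma letterProj_hom {M : GBimod K Γ} {m n : ℤ} (h : m ≠ n) {s : Words M v w}
    (hs : s ∈ hom M 1 (m + 1) v w) : Lt.comp M n v w (letterProj M v w s) = 0 := by
  refine hom_eq_zero ((Lt.comp M n v w).comp (letterProj M v w)) (fun p t hp => ?_) hs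
  rw [comp_apply]
  match p, t with
  | .nil v, t => rw [of_nil, map_smul, letterProj_nil, smul_zero, map_zero]
  | .cons v i (.nil w), t =>
    rw [letterProj, lift_of]
    refine Lt.comp_of_ne _ (fun e => h ?_) _ _ _
    simp only [Wd.deg] at hp
    omega
  | .cons v i (.cons u j p), t =>
    rw [letterProj, lift_of, lzero_apply, map_zero]

variable {C}
variable (hconn : C.toGBimod.IsConnected C.η) (hsc : ∀ v w, Subsingleton (C.X (-1) v w))

include hconn hsc

lemma dualToE_quasiIso : IsQuasiIso C.dual.d C.cobar.E.d (fun n v w =>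
    (C.dualToE (.one v n w) n).comp (Tens.letter C.dual.1 v n w)) := by
  have := isQuasiIso_dual_of_piece (fun (v w : Γ) (p : Wd Γ v w) => Tens C.cobar.aug p)
    (fun v w p => p.deg (-1)) (N := C.toGBimod) (fun v w => C.cobar.bT v w)
    (fun n v w x hx => barT_mem_hom (fun p n hp => C.cobar.mAug_three C.cobar_isShort.m_three p n hp) rfl hx)
    (fun v w x => C.bT_bT x) C.toCoOps.δ C.twComp
    (fun m n v w x hx hm => letterProj_hom hm (C.tw_mem_hom rfl hx))
    (fun i j v w x hij hx => ?_) C.twComp_surjective (fun v w x hx hdx => ?_)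
  · rw [CoOps.dual_d, show C.cobar.E.d = _ from CoOps.dual_d C.cobar.bar,
      show C.cobar.bar.δ = _ from funext fun i => funext fun j => funext fun v => funext fun w =>
        C.cobar.bar_δ C.cobar_isShort.m_three i j v w,
      show (fun n v w => (C.dualToE (.one v n w) n).comp (Tens.letter C.dual.1 v n w))
        = _ from funext fun n => funext fun v => funext fun w => C.dualToE_one n v w]
    exact this
  · have e := congrArg (Lt.comp C.toGBimod j v w) (C.letterProj_tw_bT x)
    refine e.trans ?_
    have h : letterProj _ v w (C.tw v w x) = Lt.of _ i v w (C.twComp i v w x) := by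
      refine Lt.ext_comp fun n => ?_
      by_cases hn : i = n
      · subst hn
        exact (Lt.comp_of _ _ _ _ _).symm
      · rw [Lt.comp_of_ne _ hn, letterProj_hom hn (C.tw_mem_hom rfl hx)]
    rw [h, Lt.lift_of]
    rfl
  · obtain ⟨y, hy, hyx⟩ := tw_acyclic hconn hsc x (Lt.ext_comp fun n => (hx n).trans (map_zero _).symm) hdx
    exact ⟨y, fun n => by rw [twComp, comp_apply, comp_apply, hy, map_zero], hyx⟩

lemma dualToE_isAInfQuasiIso : IsAInfQuasiIso C.dual C.cobar.E C.dualToE where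
  deg := C.dualToE_deg
  rel := C.dualToE_rel
  unit := C.dualToE_unit
  unit_zero := C.dualToE_unit_zero
  ε := C.ε_dualToE
  ε_zero := C.ε_dualToE_zero
  quasiIso := dualToE_quasiIso hconn hsc

end AInfCoalg

end Words

end

end Koszul

theorem mainTheorem9 {K Γ : Type u} [Field K] [Finite Γ] (C : Koszul.AInfCoalg K Γ)
    (hconn : C.toGBimod.IsConnected C.η)
    (hsc : ∀ v w, Subsingleton (C.X (-1) v w))
    (hfin : C.toGBimod.IsLocallyFinite) :
    -- `A = ΩC` is an augmented connected DG-algebra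
    (C.cobar.IsAugDGAlg ∧ C.cobar.toGBimod.IsConnected C.cobar.one) ∧
    -- `C^#` and `E(A)` are quasi-isomorphic augmented `A_∞`-algebras
    (∃ F : ∀ {v w : Γ} (p : Koszul.Wd Γ v w) (n : ℤ),
        Koszul.Tens C.toCoOps.dual.toGBimod p →ₗ[K] C.cobar.E.X n v w,
      Koszul.IsAInfQuasiIso C.toCoOps.dual C.cobar.E F) ∧
    -- `A → RHom_{E(A)}(k, k)` is a quasi-isomorphism
    C.cobar.IsKoszulDual := by
  exact ⟨⟨C.cobar_isAugDGAlg, C.cobar_isConnected hconn hsc⟩,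
    ⟨C.dualToE, Koszul.AInfCoalg.dualToE_isAInfQuasiIso hconn hsc⟩,
    C.cobar_isKoszulDual hconn hsc hfin⟩
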